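/- Let $n\ge 3$ and let $(M^n,g)$ be a smooth Riemannian manifold with boundary (metric smooth up to $\partial M$). Let $V\in C^\infty(M)$ (smooth up to $\partial M$) be positive in the interior of $M$; thus $(M,g,V)$ is a static triple. Assume that $(M,g,V)$ is asymptotically flat: there are a compact set $K\subset M$ and a diffeomorphism from $\{x\in\mathbb R^n:|x|>1\}$ onto $M\setminus K$ such that in the coordinates $x$ $$g_{ij}=\delta_{ij}+o_2\big(|x|^{\frac{2-n}{2}}\big),\qquad V=1-m|x|^{2-n}+o_1\big(|x|^{2-n}\big),$$ where $m$ is the ADM mass of $(M,g)$, i.e. $m=\lim_{r\to\infty}\frac{1}{2(n-1)w_{n-1}}\int_{|x|=r}\sum_{i,j}(\partial_j g_{ij}-\partial_i g_{jj})\frac{x^i}{r}\,d\sigma$ with $w_{n-1}$ the area of the unit sphere in $\mathbb R^n$. Assume that the tensor $$P=V\,\mathrm{Ric}-\nabla^2V+(\Delta V)\,g$$ is non-negative definite on $M$. Let $\Sigma\subset\partial M$ be a compact connected component of $\partial M$ which is * minimal: its mean curvature vanishes identically; * stable: it is a local minimum of area along each of its smooth variations within $M$, that is, for every smooth family $X_t:\Sigma\to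 M$, $t\in[0,\varepsilon)$, with $X_0$ the inclusion, $|X_t(\Sigma)|\ge|\Sigma|$ (area counted with multiplicity) for all sufficiently small $t>0$; * outermost: no closed embedded minimal hypersurface $S$ in the interior of $M$ encloses $\Sigma$, where "$S$ encloses $\Sigma$" means that $S$ is the topological boundary in $M$ of a relatively compact open set $\Omega\subset M$ with $\Sigma\subset\Omega$. No condition is imposed on the other components of $\partial M$. Then $V$ vanishes identically on $\Sigma$. -/

import Mathlib

open scoped Manifold ContDiff Topology ENNReal
open Set Filter MeasureTheory

noncomputable section

namespace StaticTriple

/-- Coordinate space `ℝⁿ` with its Euclidean norm. -/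
abbrev Coord (n : ℕ) : Type := EuclideanSpace ℝ (Fin n)

/-- The `i`-th standard basis vector of `ℝⁿ`. -/
abbrev stdVec {n : ℕ} (i : Fin n) : Coord n := EuclideanSpace.single i 1

section Geometry

variable {n : ℕ} [NeZero n] {M : Type*} [TopologicalSpace M]
  [ChartedSpace (EuclideanHalfSpace n) M] [IsManifold (𝓡∂ n) ∞ M]

variable (n M) in
/-- Smooth Riemannian metrics on the manifold with boundary `M` (smooth up to the boundary). -/
abbrev SmoothMetric : Type _ :=
  Bundle.ContMDiffRiemannianMetric (𝓡∂ n) ∞ (Coord n) (fun p : M => TangentSpace (𝓡∂ n) p)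

/-! ### Curvature in charts

Every quantity below is expressed in the chart `extChartAt (𝓡∂ n) c` at a base point `c : M`, at a
point `y` of the target of this chart. Derivatives are taken within the half space, so that they
are one-sided at boundary points. -/

/-- The partial derivative `∂ᵢ f` of a function on the model half space. -/
def partialD (f : Coord n → ℝ) (i : Fin n) (y : Coord n) : ℝ :=
  fderivWithin ℝ f (range (𝓡∂ n)) y (stdVec i)

/-- The coordinate vector field `∂/∂xⁱ` of the chart at `c`. -/
def coordVec (c : M) (y : Coord n) (i : Fin n) :
    TangentSpace (𝓡∂ n) ((extChartAt (𝓡∂ n) c).symm y) :=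
  mfderivWithin 𝓘(ℝ, Coord n) (𝓡∂ n) (extChartAt (𝓡∂ n) c).symm (range (𝓡∂ n)) y (stdVec i)

/-- The matrix `gᵢⱼ` of the metric in the chart at `c`. -/
def coordMetric (g : SmoothMetric n M) (c : M) (y : Coord n) : Matrix (Fin n) (Fin n) ℝ :=
  Matrix.of fun i j =>
    g.inner ((extChartAt (𝓡∂ n) c).symm y) (coordVec c y i) (coordVec c y j)

/-- The Christoffel symbol `Γᵏᵢⱼ = ½ gᵏˡ (∂ᵢ gⱼₗ + ∂ⱼ gᵢₗ - ∂ₗ gᵢⱼ)`. -/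
def christoffel (g : SmoothMetric n M) (c : M) (k i j : Fin n) (y : Coord n) : ℝ :=
  (1 / 2 : ℝ) * ∑ l, (coordMetric g c y)⁻¹ k l *
    (partialD (fun z => coordMetric g c z j l) i y
      + partialD (fun z => coordMetric g c z i l) j y
      - partialD (fun z => coordMetric g c z i j) l y)

/-- The Ricci tensor
`Rᵢⱼ = ∂ₖ Γᵏᵢⱼ - ∂ⱼ Γᵏᵢₖ + Γᵏₖₗ Γˡᵢⱼ - Γᵏⱼₗ Γˡᵢₖ` (positive on round spheres). -/
def ricci (g : SmoothMetric n M) (c : M) (i j : Fin n) (y : Coord n) : ℝ :=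
  ∑ k, (partialD (christoffel g c k i j) k y - partialD (christoffel g c k i k) j y
    + ∑ l, (christoffel g c k k l y * christoffel g c l i j y
      - christoffel g c k j l y * christoffel g c l i k y))

/-- The partial derivative `∂ᵢ f` of a function on `M`, in the chart at `c`. -/
def coordD (c : M) (f : M → ℝ) (i : Fin n) (y : Coord n) : ℝ :=
  partialD (fun z => f ((extChartAt (𝓡∂ n) c).symm z)) i y

/-- The Hessian `(∇²f)ᵢⱼ = ∂ᵢ ∂ⱼ f - Γᵏᵢⱼ ∂ₖ f`. -/
def hessian (g : SmoothMetric n M) (c : M) (f : M → ℝ) (i j : Fin n) (y : Coord n) : ℝ :=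
  partialD (coordD c f j) i y - ∑ k, christoffel g c k i j y * coordD c f k y

/-- The Laplacian `Δf = gⁱʲ (∇²f)ᵢⱼ`. -/
def laplacian (g : SmoothMetric n M) (c : M) (f : M → ℝ) (y : Coord n) : ℝ :=
  ∑ i, ∑ j, (coordMetric g c y)⁻¹ i j * hessian g c f i j y

/-- The gradient `(∇f)ⁱ = gⁱʲ ∂ⱼ f`. -/
def gradient (g : SmoothMetric n M) (c : M) (f : M → ℝ) (i : Fin n) (y : Coord n) : ℝ :=
  ∑ j, (coordMetric g c y)⁻¹ i j * coordD c f j y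

/-- `|∇f|² = (∇f)ⁱ ∂ᵢ f`. -/
def gradNormSq (g : SmoothMetric n M) (c : M) (f : M → ℝ) (y : Coord n) : ℝ :=
  ∑ i, gradient g c f i y * coordD c f i y

/-- The tensor `P = V Ric - ∇²V + (ΔV) g`. -/
def tensorP (g : SmoothMetric n M) (V : M → ℝ) (c : M) (y : Coord n) :
    Matrix (Fin n) (Fin n) ℝ :=
  Matrix.of fun i j =>
    V ((extChartAt (𝓡∂ n) c).symm y) * ricci g c i j y - hessian g c V i j y
      + laplacian g c V y * coordMetric g c y i j

/-- `P` is non-negative definite on `M`. -/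
def NonnegP (g : SmoothMetric n M) (V : M → ℝ) : Prop :=
  ∀ c : M, ∀ y ∈ (extChartAt (𝓡∂ n) c).target, ∀ v : Fin n → ℝ,
    0 ≤ ∑ i, ∑ j, tensorP g V c y i j * v i * v j

/-! ### Minimal hypersurfaces -/

/-- The mean curvature `H = div (∇u / |∇u|) = (Δu - ∇²u(∇u, ∇u) / |∇u|²) / |∇u|` of the level set
of `u`, with respect to the unit normal `∇u / |∇u|`. -/
def meanCurvature (g : SmoothMetric n M) (u : M → ℝ) (c : M) (y : Coord n) : ℝ :=
  (laplacian g c u y -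
    (∑ i, ∑ j, hessian g c u i j y * gradient g c u i y * gradient g c u j y)
      / gradNormSq g c u y) / √(gradNormSq g c u y)

/-- `S` is a smooth embedded hypersurface with vanishing mean curvature: locally it is the zero set
of a smooth function `u` with `du ≠ 0` along `S`, and the mean curvature of this zero set is `0`.
This makes sense both for hypersurfaces in the interior of `M` and for components of `∂M`. -/
def IsMinimalHypersurface (g : SmoothMetric n M) (S : Set M) : Prop :=
  ∀ p ∈ S, ∃ U : Set M, IsOpen U ∧ p ∈ U ∧ ∃ u : M → ℝ,
    ContMDiffOn (𝓡∂ n) 𝓘(ℝ, ℝ) ∞ u U ∧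
    (∀ q ∈ U, q ∈ S ↔ u q = 0) ∧
    ∀ q ∈ U, q ∈ S → mfderiv (𝓡∂ n) 𝓘(ℝ, ℝ) u q ≠ 0 ∧
      ∀ c : M, q ∈ (extChartAt (𝓡∂ n) c).source →
        meanCurvature g u c (extChartAt (𝓡∂ n) c q) = 0

/-- `S` encloses `T`: `S` is the frontier of a relatively compact open subset of `M` that
contains `T`. -/
def Encloses (S T : Set M) : Prop :=
  ∃ Ω : Set M, IsOpen Ω ∧ IsCompact (closure Ω) ∧ T ⊆ Ω ∧ frontier Ω = S

/-- `T` is outermost: no closed minimal hypersurface in the interior of `M` encloses `T`. -/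
def IsOutermost (g : SmoothMetric n M) (T : Set M) : Prop :=
  ¬ ∃ S : Set M, S.Nonempty ∧ IsCompact S ∧ S ⊆ (𝓡∂ n).interior M ∧
    IsMinimalHypersurface g S ∧ Encloses S T

/-! ### Area and stability -/

/-- The area density `√(det (F^* g)ₐᵦ)` of a map `F : N → M` in the chart of `N` at `c`. -/
def areaDensity {d : ℕ} {N : Type*} [TopologicalSpace N] [ChartedSpace (Coord d) N]
    (g : SmoothMetric n M) (F : N → M) (c : N) (y : Coord d) : ℝ :=
  √(Matrix.of fun a b : Fin d =>
    g.inner ((F ∘ (extChartAt (𝓡 d) c).symm) y)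
      (mfderiv 𝓘(ℝ, Coord d) (𝓡∂ n) (F ∘ (extChartAt (𝓡 d) c).symm) y (stdVec a))
      (mfderiv 𝓘(ℝ, Coord d) (𝓡∂ n) (F ∘ (extChartAt (𝓡 d) c).symm) y (stdVec b))).det

/-- The area of the parametrized hypersurface `F : N → M`, that is the total volume of `N` for
`F^* g`: the supremum, over all finite families of pairwise disjoint measurable pieces of `N` that
lie in chart domains, of the sum of the areas of the pieces. (For compact `N` it is attained by any
partition of `N` into such pieces.) -/
def area (d : ℕ) {N : Type*} [TopologicalSpace N] [ChartedSpace (Coord d) N]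
    (g : SmoothMetric n M) (F : N → M) : ℝ≥0∞ :=
  ⨆ (s : Finset N) (B : N → Set (Coord d))
    (_ : ∀ c ∈ s, MeasurableSet (B c) ∧ B c ⊆ (extChartAt (𝓡 d) c).target)
    (_ : (s : Set N).PairwiseDisjoint fun c => (extChartAt (𝓡 d) c).symm '' B c),
    ∑ c ∈ s, ∫⁻ y in B c, ENNReal.ofReal (areaDensity g F c y)

/-- `X` is a smooth one-parameter variation of `ι : N → M` within `M`, for parameters
`t ∈ [0, ε)`. -/
def IsVariation (d : ℕ) {N : Type*} [TopologicalSpace N] [ChartedSpace (Coord d) N]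
    (ι : N → M) (ε : ℝ) (X : ℝ → N → M) : Prop :=
  ContMDiffOn (𝓘(ℝ, ℝ).prod (𝓡 d)) (𝓡∂ n) ∞ (fun q : ℝ × N => X q.1 q.2) (Ico 0 ε ×ˢ univ) ∧
    X 0 = ι

/-- Stability of a (boundary) hypersurface `ι : N → M`: along each smooth one-parameter variation
of it within `M`, its area is a local minimum of the area. -/
def IsStable (d : ℕ) {N : Type*} [TopologicalSpace N] [ChartedSpace (Coord d) N]
    (g : SmoothMetric n M) (ι : N → M) : Prop :=
  ∀ (ε : ℝ) (X : ℝ → N → M), 0 < ε → IsVariation (n := n) d ι ε X →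
    ∀ᶠ t in 𝓝[>] (0 : ℝ), area d g ι ≤ area d g (X t)

/-- `T` is a connected component of the boundary `∂M`. -/
def IsBoundaryComponent (T : Set M) : Prop :=
  ∃ p ∈ (𝓡∂ n).boundary M, T = connectedComponentIn ((𝓡∂ n).boundary M) p

/-! ### Asymptotically flat static triples -/

/-- `(M, g, V)` is a static triple: the lapse `V` is smooth on `M` (up to the boundary) and
positive in the interior of `M`. -/
structure IsLapse (V : M → ℝ) : Prop where
  smooth : ContMDiff (𝓡∂ n) 𝓘(ℝ, ℝ) ∞ V
  pos : ∀ p ∈ (𝓡∂ n).interior M, 0 < V p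

/-- `f = o_k(|x|^a)` at infinity in `ℝⁿ`: the derivatives of `f` of each order `l ≤ k` are
`o(|x|^(a - l))`. -/
def IsLittleODeriv (k : ℕ) (a : ℝ) (f : Coord n → ℝ) : Prop :=
  ∀ l : ℕ, l ≤ k →
    (fun x => iteratedFDeriv ℝ l f x) =o[Bornology.cobounded (Coord n)]
      fun x => ‖x‖ ^ (a - (l : ℝ))

/-- The matrix `gᵢⱼ(x)` of the metric in the coordinates at infinity given by `Φ`. -/
def endMetric (g : SmoothMetric n M) (Φ : Coord n → M) (x : Coord n) :
    Matrix (Fin n) (Fin n) ℝ :=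
  Matrix.of fun i j =>
    g.inner (Φ x) (mfderiv 𝓘(ℝ, Coord n) (𝓡∂ n) Φ x (stdVec i))
      (mfderiv 𝓘(ℝ, Coord n) (𝓡∂ n) Φ x (stdVec j))

/-- The area `w_{n-1}` of the unit sphere in `ℝⁿ`. -/
def sphereArea (n : ℕ) : ℝ :=
  ((volume : Measure (Coord n)).toSphere).real univ

/-- The flux `(2 (n-1) w_{n-1})⁻¹ ∫_{|x| = r} ∑ᵢⱼ (∂ⱼ hᵢⱼ - ∂ᵢ hⱼⱼ) xⁱ / r dσ`, written as an
integral over the unit sphere. -/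
def admFlux (h : Coord n → Matrix (Fin n) (Fin n) ℝ) (r : ℝ) : ℝ :=
  (2 * ((n : ℝ) - 1) * sphereArea n)⁻¹ * (r ^ (n - 1) *
    ∫ θ : Metric.sphere (0 : Coord n) 1,
      ∑ i, ∑ j, (fderiv ℝ (fun x => h x i j) (r • (θ : Coord n)) (stdVec j)
        - fderiv ℝ (fun x => h x j j) (r • (θ : Coord n)) (stdVec i)) * (θ : Coord n) i
      ∂(volume : Measure (Coord n)).toSphere)

/-- `(M, g, V)` is asymptotically flat with ADM mass `m`: outside of a compact set `K` there are
coordinates `x ∈ ℝⁿ`, `|x| > 1`, in which `gᵢⱼ = δᵢⱼ + o₂(|x|^((2-n)/2))` and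
`V = 1 - m |x|^(2-n) + o₁(|x|^(2-n))`, where `m` is the ADM mass of `(M, g)`. -/
def IsAsymptoticallyFlat (g : SmoothMetric n M) (V : M → ℝ) (m : ℝ) : Prop :=
  ∃ (K : Set M) (Φ : OpenPartialHomeomorph (Coord n) M),
    IsCompact K ∧ Φ.source = {x | 1 < ‖x‖} ∧ Φ.target = Kᶜ ∧
    ContMDiffOn 𝓘(ℝ, Coord n) (𝓡∂ n) ∞ Φ Φ.source ∧
    ContMDiffOn (𝓡∂ n) 𝓘(ℝ, Coord n) ∞ Φ.symm Φ.target ∧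
    (∀ i j, IsLittleODeriv 2 ((2 - (n : ℝ)) / 2)
      fun x => endMetric g Φ x i j - (1 : Matrix (Fin n) (Fin n) ℝ) i j) ∧
    IsLittleODeriv 1 (2 - (n : ℝ)) (fun x => V (Φ x) - (1 - m * ‖x‖ ^ (2 - (n : ℝ)))) ∧
    Tendsto (admFlux (endMetric g Φ)) atTop (𝓝 m)

end Geometry

end StaticTriple

end

noncomputable section

set_option linter.unusedSectionVars false
set_option linter.unusedVariables false
set_option maxSynthPendingDepth 3

namespace StaticTriple

open Manifold (IsSmoothEmbedding)

/-! Let `Σ` be the boundary component and `ν` its unit normal pointing into `M`. The engine of the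
proof is the normal flow of `Σ` with speed `W = V + η`, where `η ≥ 0` is a constant and `W > 0` on
`Σ`. Its arrival time `u` is the distance to `Σ` for the metric `W⁻² g`; thus `W |∇u| = 1`, and the
velocity is `W² ∇u = W ν`. Let `H` be the mean curvature of the level sets of `u` and `E = H / W`
(`eikonalMean`). The Riccati equation, in which the square of the second fundamental form is
discarded, gives `W ∂ₜE ≤ -(P(ν,ν) + η Ric(ν,ν))` (`IsEikonal.bochner`, `IsEikonal.source_eq`). The
area density grows at the relative rate `W² E` (`IsCollar.hasDerivAt_areaDensity_sq`). Since `Σ` is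
minimal, `E` starts from zero, so the sign of `P(ν,ν) + η Ric(ν,ν)` on `Σ` decides how the area
changes at order `t²`.

This is used three times. With small `η > 0`: if `P(ν,ν) > 0` at a point of `Σ` where `V > 0`, then
the area loses a definite multiple of `t²` near that point and gains at most `O(η) t²` elsewhere,
against stability. Hence `P(ν,ν) = 0` wherever `V > 0` on `Σ` (`normalForm_tensorP_eq_zero`).

On the minimal hypersurface `Σ` one has `P(ν,ν) = Δ_Σ V + Ric(ν,ν) V`. So the restriction of `V` is
non-negative and solves a linear elliptic equation wherever it is positive; by the strong maximum
principle (`eventually_eq_zero_of_elliptic`) and connectedness, `V` vanishes on all of `Σ` or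
nowhere on it (`lapse_eq_zero_or_pos`).

If `V > 0` on `Σ`, the flow is run with `η = 0`. Now `E ≤ 0`, the area density does not increase,
and stability forces it to be constant for a short time. Then `E = 0`, so the slices of the flow are
minimal hypersurfaces in the interior that enclose `Σ`, against the outermost property
(`exists_lapse_nonpos`).

The flow is constructed by hand. The cometric `W² g⁻¹` is extended smoothly across the boundary by
Seeley's series of reflections, the eikonal equation is solved by the Hamiltonian flow of the
extension (`exists_fermi_chart`), and the local collars are glued by uniqueness (`exists_collar`).
-/

/-! ### Smooth extension across a hyperplane -/

/-- The factors of the Lagrange basis polynomials at `-1` for the nodes `2 ^ k`. -/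
def seeleyFactor (k j : ℕ) : ℝ := if j = k then 1 else (1 + 2 ^ j) / (2 ^ j - 2 ^ k)

/-- The numerator is at most `2 · 2^j` and the denominator at least `2^(k-1)`. The decay in `k - j`,
multiplied over all `j < k`, makes the coefficients decay faster than every power of `2^k`. -/
lemma abs_seeleyFactor_le_of_lt {k j : ℕ} (h : j < k) :
    |seeleyFactor k j| ≤ 4 / 2 ^ (k - j) := by
  obtain ⟨i, rfl⟩ := Nat.exists_eq_add_of_lt h
  have h1 : (1 : ℝ) ≤ 2 ^ j := one_le_pow₀ (by norm_num)
  have h2 : (1 : ℝ) ≤ 2 ^ i := one_le_pow₀ (by norm_num)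
  have e : j + i + 1 - j = i + 1 := by omega
  rw [seeleyFactor, if_neg (by omega), e, abs_div, abs_of_pos (by positivity : (0 : ℝ) < 1 + 2 ^ j)]
  have h3 : |(2 : ℝ) ^ j - 2 ^ (j + i + 1)| = 2 ^ j * (2 * 2 ^ i - 1) := by
    rw [abs_of_nonpos]
    · ring
    · have : (2 : ℝ) ^ j ≤ 2 ^ (j + i + 1) := pow_le_pow_right₀ (by norm_num) (by omega)
      linarith
  rw [h3, div_le_div_iff₀ (by nlinarith) (by positivity), pow_succ]
  nlinarith [mul_nonneg (sub_nonneg.2 h1) (sub_nonneg.2 h2)]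

/-- The difference equals `(1 + 2^k) / (2^j - 2^k)`, which is summable in `j`; so the infinite
product of the factors converges. -/
lemma abs_seeleyFactor_sub_one_le (k j : ℕ) (h : k < j) :
    |seeleyFactor k j - 1| ≤ 4 * 2 ^ k * (1 / 2) ^ j := by
  obtain ⟨i, rfl⟩ := Nat.exists_eq_add_of_lt h
  have h1 : (1 : ℝ) ≤ 2 ^ k := one_le_pow₀ (by norm_num)
  have h2 : (1 : ℝ) ≤ 2 ^ i := one_le_pow₀ (by norm_num)
  have h3 : (2 : ℝ) ^ (k + i + 1) - 2 ^ k = 2 ^ k * (2 * 2 ^ i - 1) := by ring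
  have h4 : (0 : ℝ) < 2 * 2 ^ i - 1 := by linarith
  have h5 : (0 : ℝ) < 2 ^ k := by positivity
  rw [seeleyFactor, if_neg (by omega), h3, div_sub_one (by positivity),
    abs_of_nonneg (div_nonneg (by ring_nf; nlinarith) (by positivity)), div_pow, one_pow,
    mul_one_div, div_le_div_iff₀ (by positivity) (by positivity)]
  have h6 : (2 : ℝ) ^ (k + i + 1) = 2 * (2 ^ k * 2 ^ i) := by ring
  rw [h6]
  generalize (2 : ℝ) ^ k = a at h1 h5 ⊢
  generalize (2 : ℝ) ^ i = b at h2 h4 ⊢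
  have h7 : (1 + 2 * (a * b) - a * (2 * b - 1)) = 1 + a := by ring
  rw [h7]
  have h8 : (1 + a) * (2 * (a * b)) ≤ (2 * a) * (2 * (a * b)) :=
    mul_le_mul_of_nonneg_right (by linarith) (by positivity)
  have h9 : 0 ≤ a * (a * (b - 1)) := mul_nonneg h5.le (mul_nonneg h5.le (by linarith))
  nlinarith

lemma summable_seeleyFactor_sub_one (k : ℕ) :
    Summable fun j => ‖seeleyFactor k j - 1‖ := by
  have hs : Summable fun j : ℕ => 4 * (2 : ℝ) ^ k * (1 / 2) ^ j :=
    (summable_geometric_of_lt_one (by norm_num) (by norm_num)).mul_left _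
  have hs' : Summable fun i : ℕ => 4 * (2 : ℝ) ^ k * (1 / 2) ^ (i + (k + 1)) :=
    (summable_nat_add_iff (f := fun j : ℕ => 4 * (2 : ℝ) ^ k * (1 / 2) ^ j) (k + 1)).2 hs
  have h : Summable fun i : ℕ => ‖seeleyFactor k (i + (k + 1)) - 1‖ := by
    refine Summable.of_nonneg_of_le (fun _ => norm_nonneg _) (fun i => ?_) hs'
    rw [Real.norm_eq_abs]
    exact abs_seeleyFactor_sub_one_le k (i + (k + 1)) (by omega)
  exact (summable_nat_add_iff (f := fun j => ‖seeleyFactor k j - 1‖) (k + 1)).1 h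

/-- A rapidly decaying sequence bounding the coefficients of the extension operator. -/
def seeleyBound (k : ℕ) : ℝ := ∏ i ∈ Finset.range k, (4 / 2 ^ (i + 1) : ℝ)

lemma seeleyBound_pos (k : ℕ) : 0 < seeleyBound k := Finset.prod_pos fun _ _ => by positivity

/-- `seeleyBound k` is `4^k · 2^(-k(k+1)/2)`, which beats every geometric sequence. -/
lemma summable_seeleyBound (r : ℝ) (hr : 0 < r) : Summable fun k => seeleyBound k * r ^ k := by
  refine summable_of_ratio_test_tendsto_lt_one (l := 0) one_pos
    (.of_forall fun k => (mul_pos (seeleyBound_pos k) (pow_pos hr k)).ne') ?_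
  have : ∀ k, ‖seeleyBound (k + 1) * r ^ (k + 1)‖ / ‖seeleyBound k * r ^ k‖
      = 2 * r * (1 / 2) ^ k := by
    intro k
    have h1 := seeleyBound_pos k
    rw [Real.norm_of_nonneg (mul_pos (seeleyBound_pos _) (pow_pos hr _)).le,
      Real.norm_of_nonneg (mul_pos h1 (pow_pos hr _)).le, seeleyBound, Finset.prod_range_succ,
      ← seeleyBound]
    have := pow_pos hr k
    rw [one_div, inv_pow, pow_succ, pow_succ]
    field_simp
    ring
  simp_rw [this]
  simpa using (tendsto_pow_atTop_nhds_zero_of_lt_one (r := (1 / 2 : ℝ)) (by norm_num)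
    (by norm_num)).const_mul (2 * r)

lemma prod_range_abs_seeleyFactor_le (k N : ℕ) (h : N ≤ k) :
    ∏ j ∈ Finset.range N, |seeleyFactor k j| ≤ ∏ j ∈ Finset.range N, (4 / 2 ^ (k - j) : ℝ) :=
  Finset.prod_le_prod (fun _ _ => abs_nonneg _) fun j hj =>
    abs_seeleyFactor_le_of_lt ((Finset.mem_range.1 hj).trans_le h)

/-- Split the product at `k`: the factors below `k` give `seeleyBound k`, and those above are
bounded by the exponential of a geometric sum. The bound does not depend on `N`, as dominated
convergence will require. -/
lemma abs_prod_seeleyFactor_le (k N : ℕ) (h : k < N) :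
    |∏ j ∈ Finset.range N, seeleyFactor k j| ≤ Real.exp 8 * seeleyBound k := by
  rw [Finset.abs_prod, ← Finset.prod_range_mul_prod_Ico _ (Nat.succ_le_of_lt h),
    Finset.prod_range_succ, mul_comm]
  have h1 : ∏ j ∈ Finset.range k, |seeleyFactor k j| ≤ seeleyBound k := by
    refine (prod_range_abs_seeleyFactor_le k k le_rfl).trans_eq ?_
    rw [seeleyBound, ← Finset.prod_range_reflect]
    refine Finset.prod_congr rfl fun j hj => ?_
    have := Finset.mem_range.1 hj
    congr 2; omega
  have h2 : ∏ j ∈ Finset.Ico k.succ N, |seeleyFactor k j| ≤ Real.exp 8 := by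
    calc _ ≤ ∏ j ∈ Finset.Ico k.succ N, Real.exp (4 * 2 ^ k * (1 / 2) ^ j) := by
          refine Finset.prod_le_prod (fun _ _ => abs_nonneg _) fun j hj => ?_
          have hk := abs_seeleyFactor_sub_one_le k j (Finset.mem_Ico.1 hj).1
          have : |seeleyFactor k j| ≤ 1 + |seeleyFactor k j - 1| := by
            simpa using abs_add_le 1 (seeleyFactor k j - 1)
          have := Real.add_one_le_exp (4 * (2 : ℝ) ^ k * (1 / 2) ^ j)
          linarith
      _ = Real.exp (∑ j ∈ Finset.Ico k.succ N, 4 * 2 ^ k * (1 / 2) ^ j) := (Real.exp_sum _ _).symm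
      _ ≤ Real.exp 8 := by
          refine Real.exp_le_exp.2 ?_
          rw [← Finset.mul_sum, Finset.sum_Ico_eq_sum_range]
          have : ∑ i ∈ Finset.range (N - k.succ), (1 / 2 : ℝ) ^ (k.succ + i)
              = (1 / 2) ^ k.succ * ∑ i ∈ Finset.range (N - k.succ), (1 / 2) ^ i := by
            rw [Finset.mul_sum]; exact Finset.sum_congr rfl fun i _ => pow_add _ _ _
          rw [this]
          have h3 : ∑ i ∈ Finset.range (N - k.succ), (1 / 2 : ℝ) ^ i ≤ 2 := by
            have := (summable_geometric_of_lt_one (r := (1 / 2 : ℝ)) (by norm_num)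
              (by norm_num)).sum_le_tsum (Finset.range (N - k.succ)) fun i _ => by positivity
            rwa [tsum_geometric_two] at this
          have h4 : (2 : ℝ) ^ k * (1 / 2) ^ k = 1 := by rw [← mul_pow]; norm_num
          rw [pow_succ]
          nlinarith
  have h3 : |seeleyFactor k k| = 1 := by simp [seeleyFactor]
  rw [h3, mul_one]
  exact mul_le_mul h2 h1 (Finset.prod_nonneg fun _ _ => abs_nonneg _) (Real.exp_pos _).le

/-- The products are the Lagrange basis polynomials for the nodes `1, 2, …, 2^(N-1)`, evaluated at
`-1`. Interpolation reproduces `X^i` exactly for `i < N`. -/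
lemma sum_prod_seeleyFactor_mul_pow (N i : ℕ) (h : i < N) :
    ∑ k ∈ Finset.range N, (∏ j ∈ Finset.range N, seeleyFactor k j) * (2 ^ k : ℝ) ^ i = (-1) ^ i := by
  have hinj : Set.InjOn (fun k : ℕ => (2 : ℝ) ^ k) (Finset.range N : Set ℕ) :=
    (pow_right_injective₀ (by norm_num) (by norm_num)).injOn
  have h1 := Lagrange.eq_interpolate (F := ℝ) (s := Finset.range N) hinj
    (f := Polynomial.X ^ i) (by
      rw [Polynomial.degree_X_pow, Finset.card_range]; exact_mod_cast h)
  have h2 := congrArg (Polynomial.eval (-1 : ℝ)) h1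
  rw [Lagrange.interpolate_apply, Polynomial.eval_finsetSum] at h2
  simp only [Polynomial.eval_pow, Polynomial.eval_X, Polynomial.eval_mul, Polynomial.eval_C] at h2
  rw [h2]
  refine Finset.sum_congr rfl fun k hk => ?_
  rw [mul_comm]
  congr 1
  rw [Lagrange.basis, Polynomial.eval_prod, ← Finset.mul_prod_erase _ _ hk]
  rw [show seeleyFactor k k = 1 by simp [seeleyFactor], one_mul]
  refine Finset.prod_congr rfl fun j hj => ?_
  have hjk := Finset.ne_of_mem_erase hj
  have hne : (2 : ℝ) ^ j - 2 ^ k ≠ 0 := sub_ne_zero.2 fun he =>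
    hjk (pow_right_injective₀ (by norm_num) (by norm_num) he)
  have hne' : (2 : ℝ) ^ k - 2 ^ j ≠ 0 := by rw [← neg_sub]; exact neg_ne_zero.2 hne
  rw [seeleyFactor, if_neg hjk, Lagrange.basisDivisor]
  simp only [Polynomial.eval_mul, Polynomial.eval_C, Polynomial.eval_sub, Polynomial.eval_X]
  field_simp
  ring

/-- Coefficient sequences for which reflection preserves all derivatives at the hyperplane. -/
def IsReflectionSequence (b : ℕ → ℝ) : Prop :=
  ∀ j : ℕ, Summable (fun k => |b k| * (2 ^ k : ℝ) ^ j) ∧ ∑' k, b k * (-(2 ^ k : ℝ)) ^ j = 1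

lemma exists_isReflectionSequence : ∃ b : ℕ → ℝ, IsReflectionSequence b := by
  have hm : ∀ k, ∃ b : ℝ, Tendsto (fun N => ∏ j ∈ Finset.range N, seeleyFactor k j) atTop (𝓝 b) := by
    intro k
    have := multipliable_one_add_of_summable (summable_seeleyFactor_sub_one k)
    simp only [add_sub_cancel] at this
    exact ⟨_, this.hasProd.tendsto_prod_nat⟩
  choose b hb using hm
  have hbound : ∀ k, |b k| ≤ Real.exp 8 * seeleyBound k := fun k =>
    le_of_tendsto (hb k).abs ((eventually_gt_atTop k).mono fun N hN => abs_prod_seeleyFactor_le k N hN)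
  have hsum : ∀ j : ℕ, Summable fun k => Real.exp 8 * seeleyBound k * (2 ^ k : ℝ) ^ j := by
    intro j
    have := (summable_seeleyBound (2 ^ j) (by positivity)).mul_left (Real.exp 8)
    refine this.congr fun k => ?_
    rw [← pow_mul, ← pow_mul, mul_comm j k, mul_assoc]
  refine ⟨b, fun j => ⟨?_, ?_⟩⟩
  · exact Summable.of_nonneg_of_le (fun _ => by positivity)
      (fun k => mul_le_mul_of_nonneg_right (hbound k) (by positivity)) (hsum j)
  -- Pass to the limit `N → ∞` in the finite interpolation identity, with the sums extended by zero
  -- and dominated by `exp 8 * seeleyBound k`.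
  · have key : Tendsto (fun N : ℕ => ∑' k, if k < N then
        (∏ i ∈ Finset.range N, seeleyFactor k i) * (2 ^ k : ℝ) ^ j else 0) atTop
        (𝓝 (∑' k, b k * (2 ^ k : ℝ) ^ j)) := by
      refine tendsto_tsum_of_dominated_convergence (hsum j) (fun k => ?_) (.of_forall fun N k => ?_)
      · refine ((hb k).mul_const _).congr' ?_
        filter_upwards [eventually_gt_atTop k] with N hN
        rw [if_pos hN]
      · split_ifs with h
        · rw [norm_mul, Real.norm_eq_abs, Real.norm_of_nonneg (by positivity : (0 : ℝ) ≤ (2 ^ k) ^ j)]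
          exact mul_le_mul_of_nonneg_right (abs_prod_seeleyFactor_le k N h) (by positivity)
        · have := seeleyBound_pos k
          rw [norm_zero]; positivity
    have h2 : ∀ᶠ N : ℕ in atTop, (∑' k, if k < N then
        (∏ i ∈ Finset.range N, seeleyFactor k i) * (2 ^ k : ℝ) ^ j else 0) = (-1) ^ j := by
      filter_upwards [eventually_gt_atTop j] with N hN
      rw [← sum_prod_seeleyFactor_mul_pow N j hN, tsum_eq_sum (s := Finset.range N)]
      · exact Finset.sum_congr rfl fun k hk => if_pos (Finset.mem_range.1 hk)
      · intro k hk
        exact if_neg fun h => hk (Finset.mem_range.2 h)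
    have h3 : ∑' k, b k * (2 ^ k : ℝ) ^ j = (-1) ^ j :=
      tendsto_nhds_unique key (tendsto_const_nhds.congr' (h2.mono fun _ h => h.symm))
    have h4 : ∀ k, b k * (-(2 ^ k : ℝ)) ^ j = (-1) ^ j * (b k * (2 ^ k : ℝ) ^ j) := by
      intro k; rw [neg_pow]; ring
    simp_rw [h4]
    rw [tsum_mul_left, h3, ← mul_pow]; norm_num

/-- The normal derivative of a reflected function carries the factor `-2^k`. The moment conditions
shift by one degree, so the class of coefficient sequences is closed under differentiation. -/
lemma IsReflectionSequence.mul_neg_two_pow {b : ℕ → ℝ} (hb : IsReflectionSequence b) :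
    IsReflectionSequence fun k => -(2 ^ k : ℝ) * b k := by
  intro j
  obtain ⟨h1, h2⟩ := hb (j + 1)
  refine ⟨h1.congr fun k => ?_, ?_⟩
  · rw [abs_mul, abs_neg, abs_of_pos (by positivity : (0 : ℝ) < 2 ^ k)]; ring
  · rw [← h2]
    exact tsum_congr fun k => by ring

/-! ### Seeley extension by a series of scaled reflections -/

section Reflection

variable {E F : Type} [NormedAddCommGroup E] [NormedSpace ℝ E] [FiniteDimensional ℝ E]
  [NormedAddCommGroup F] [NormedSpace ℝ F]

/-- The map `x ↦ x - (1 + 2ᵏ) ℓ(x) e`, which multiplies `ℓ` by `-2ᵏ` if `ℓ e = 1`. -/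
def scaledReflection (l : E →L[ℝ] ℝ) (e : E) (k : ℕ) : E →L[ℝ] E :=
  (ContinuousLinearMap.id ℝ E - l.smulRight e) + (-(2 ^ k : ℝ)) • l.smulRight e

lemma map_scaledReflection {l : E →L[ℝ] ℝ} {e : E} (he : l e = 1) (k : ℕ) (x : E) :
    l (scaledReflection l e k x) = -(2 ^ k * l x) := by
  simp [scaledReflection, he]

lemma scaledReflection_of_map_eq_zero {l : E →L[ℝ] ℝ} (e : E) (k : ℕ) {x : E} (hx : l x = 0) :
    scaledReflection l e k x = x := by
  simp [scaledReflection, hx]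

/-- The extension of a function on the half space `0 ≤ ℓ` by a series of reflections. -/
def reflectionExtension (l : E →L[ℝ] ℝ) (e : E) (b : ℕ → ℝ) (f : E → F) (x : E) : F :=
  open Classical in
  if 0 ≤ l x then f x else ∑' k, b k • f (scaledReflection l e k x)

variable {l : E →L[ℝ] ℝ} {e : E}

lemma closure_halfSpace_pos (he : l e = 1) : {x | 0 ≤ l x} ⊆ closure {x | 0 < l x} := by
  intro x hx
  have : Tendsto (fun t : ℝ => x + t • e) (𝓝[>] 0) (𝓝 x) := by
    have h : Continuous fun t : ℝ => x + t • e := by fun_prop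
    simpa using (h.tendsto 0).mono_left nhdsWithin_le_nhds
  refine mem_closure_of_tendsto this ?_
  filter_upwards [self_mem_nhdsWithin] with t ht
  simp only [mem_ofPred_eq, map_add, map_smul, he, smul_eq_mul, mul_one] at *
  exact add_pos_of_nonneg_of_pos hx ht

lemma closure_halfSpace_neg (he : l e = 1) : {x | l x ≤ 0} ⊆ closure {x | l x < 0} := by
  intro x hx
  have h := closure_halfSpace_pos (l := -l) (e := -e) (by simpa using he)
    (show x ∈ {x | 0 ≤ (-l) x} by simpa using hx)
  simpa using h

lemma uniqueDiffOn_halfSpace (he : l e = 1) : UniqueDiffOn ℝ {x | 0 ≤ l x} := by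
  refine uniqueDiffOn_convex ?_ ⟨e, ?_⟩
  · simpa using convex_halfSpace_ge l.toLinearMap.isLinear 0
  · refine mem_interior.2 ⟨{x | 0 < l x}, fun x hx => show 0 ≤ l x from le_of_lt hx,
      isOpen_lt continuous_const l.continuous, ?_⟩
    simp [he]

lemma exists_bound_of_continuousOn {f : E → F} (hf : ContinuousOn f {x | 0 ≤ l x})
    (hR : ∃ R : ℝ, ∀ x, 0 ≤ l x → R < ‖x‖ → f x = 0) :
    ∃ C, 0 ≤ C ∧ ∀ x, 0 ≤ l x → ‖f x‖ ≤ C := by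
  obtain ⟨R, hR⟩ := hR
  have hc : IsCompact ({x | 0 ≤ l x} ∩ Metric.closedBall 0 R) :=
    (isCompact_closedBall _ _).inter_left (isClosed_le continuous_const l.continuous)
  obtain ⟨C, hC⟩ := hc.exists_bound_of_continuousOn (hf.mono inter_subset_left)
  refine ⟨max C 0, le_max_right _ _, fun x hx => ?_⟩
  by_cases h : R < ‖x‖
  · simp [hR x hx h]
  · exact (hC x ⟨hx, by simpa using h⟩).trans (le_max_left _ _)

/-- On the hyperplane all reflections fix the point and the coefficients sum to `1`, so the two
formulas agree there. Continuity can then be glued from two closed half spaces. -/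
lemma reflectionExtension_of_nonpos (he : l e = 1) {b : ℕ → ℝ} (hb : IsReflectionSequence b)
    (f : E → F) {x : E} (hx : l x ≤ 0) :
    reflectionExtension l e b f x = ∑' k, b k • f (scaledReflection l e k x) := by
  rw [reflectionExtension]
  split_ifs with h
  · have h0 : l x = 0 := le_antisymm hx h
    simp_rw [scaledReflection_of_map_eq_zero e _ h0]
    have h1 : Summable b := by
      have := (hb 0).1
      simp only [pow_zero, mul_one] at this
      exact this.of_abs
    rw [h1.tsum_smul_const]
    have := (hb 0).2
    simp only [pow_zero, mul_one] at this
    rw [this, one_smul]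
  · rfl

lemma map_scaledReflection_nonneg (he : l e = 1) (k : ℕ) {x : E} (hx : l x ≤ 0) :
    0 ≤ l (scaledReflection l e k x) := by
  rw [map_scaledReflection he]
  have : (0 : ℝ) < 2 ^ k := by positivity
  nlinarith

variable [CompleteSpace F]

lemma continuous_reflectionExtension (he : l e = 1) {b : ℕ → ℝ} (hb : IsReflectionSequence b)
    {f : E → F} (hf : ContinuousOn f {x | 0 ≤ l x})
    (hR : ∃ R : ℝ, ∀ x, 0 ≤ l x → R < ‖x‖ → f x = 0) :
    Continuous (reflectionExtension l e b f) := by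
  obtain ⟨C, -, hC⟩ := exists_bound_of_continuousOn hf hR
  have h1 : ContinuousOn (reflectionExtension l e b f) {x | 0 ≤ l x} :=
    hf.congr fun x hx => if_pos hx
  have h2 : ContinuousOn (reflectionExtension l e b f) {x | l x ≤ 0} := by
    refine ContinuousOn.congr ?_ fun x hx => reflectionExtension_of_nonpos he hb f hx
    have hs : Summable fun k => |b k| * C := by
      have := (hb 0).1
      simp only [pow_zero, mul_one] at this
      exact this.mul_right C
    refine continuousOn_tsum (fun k => ?_) hs fun k x hx => ?_
    · exact ContinuousOn.const_smul (hf.comp (scaledReflection l e k).continuous.continuousOn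
        fun x hx => map_scaledReflection_nonneg he k hx) _
    · rw [norm_smul]
      exact mul_le_mul_of_nonneg_left (hC _ (map_scaledReflection_nonneg he k hx)) (norm_nonneg _)
  have h3 := h1.union_of_isClosed h2 (isClosed_le continuous_const l.continuous)
    (isClosed_le l.continuous continuous_const)
  rw [show {x | 0 ≤ l x} ∪ {x | l x ≤ 0} = univ from
    eq_univ_of_forall fun x => le_total 0 (l x)] at h3
  exact continuousOn_univ.1 h3

/-- The derivative of the extension of `f` consists of extensions of the derivative of `f`. -/
lemma hasFDerivAt_reflectionExtension (he : l e = 1) {b : ℕ → ℝ} (hb : IsReflectionSequence b)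
    {f : E → F} (hf : ContDiffOn ℝ ∞ f {x | 0 ≤ l x})
    (hR : ∃ R : ℝ, ∀ x, 0 ≤ l x → R < ‖x‖ → f x = 0)
    {f₁ f₂ : E → E →L[ℝ] F}
    (hf₁ : f₁ = fun x => (fderivWithin ℝ f {x | 0 ≤ l x} x).comp
      (ContinuousLinearMap.id ℝ E - l.smulRight e))
    (hf₂ : f₂ = fun x => (fderivWithin ℝ f {x | 0 ≤ l x} x).comp (l.smulRight e))
    (hc₁ : ContinuousOn f₁ {x | 0 ≤ l x}) (hc₂ : ContinuousOn f₂ {x | 0 ≤ l x})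
    (hR₁ : ∃ R : ℝ, ∀ x, 0 ≤ l x → R < ‖x‖ → f₁ x = 0)
    (hR₂ : ∃ R : ℝ, ∀ x, 0 ≤ l x → R < ‖x‖ → f₂ x = 0) (x : E) :
    HasFDerivAt (reflectionExtension l e b f) (reflectionExtension l e b f₁ x +
      reflectionExtension l e (fun k => -(2 ^ k : ℝ) * b k) f₂ x) x := by
  have hb' := hb.mul_neg_two_pow
  obtain ⟨C, hC0, hC⟩ := exists_bound_of_continuousOn hf.continuousOn hR
  obtain ⟨C₁, hC₁0, hC₁⟩ := exists_bound_of_continuousOn hc₁ hR₁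
  obtain ⟨C₂, hC₂0, hC₂⟩ := exists_bound_of_continuousOn hc₂ hR₂
  have hL := (continuous_reflectionExtension he hb hc₁ hR₁).add
    (continuous_reflectionExtension he hb' hc₂ hR₂)
  have hcont := continuous_reflectionExtension he hb hf.continuousOn hR
  have hopos : IsOpen {x | 0 < l x} := isOpen_lt continuous_const l.continuous
  have honeg : IsOpen {x | l x < 0} := isOpen_lt l.continuous continuous_const
  have hsum12 : ∀ y, f₁ y + f₂ y = fderivWithin ℝ f {x | 0 ≤ l x} y := by
    intro y; rw [hf₁, hf₂]; ext v; simp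
  have hpos : ∀ y, 0 < l y → HasFDerivAt (reflectionExtension l e b f)
      (reflectionExtension l e b f₁ y +
        reflectionExtension l e (fun k => -(2 ^ k : ℝ) * b k) f₂ y) y := by
    intro y hy
    have hmem : {x | 0 ≤ l x} ∈ 𝓝 y := mem_of_superset (hopos.mem_nhds hy) fun z hz => show 0 ≤ l z from le_of_lt hz
    have h1 : HasFDerivAt f (fderivWithin ℝ f {x | 0 ≤ l x} y) y :=
      ((hf.differentiableOn (by simp) y hy.le).hasFDerivWithinAt).hasFDerivAt hmem
    have h2 : reflectionExtension l e b f₁ y +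
        reflectionExtension l e (fun k => -(2 ^ k : ℝ) * b k) f₂ y
        = fderivWithin ℝ f {x | 0 ≤ l x} y := by
      rw [reflectionExtension, if_pos hy.le, reflectionExtension, if_pos hy.le, hsum12]
    rw [h2]
    refine h1.congr_of_eventuallyEq ?_
    filter_upwards [hmem] with z hz using if_pos hz
  have hs0 : Summable fun k => |b k| := by simpa using (hb 0).1
  have hs1 : Summable fun k => |b k| * 2 ^ k := by simpa using (hb 1).1
  have hneg : ∀ y, l y < 0 → HasFDerivAt (reflectionExtension l e b f)
      (reflectionExtension l e b f₁ y +
        reflectionExtension l e (fun k => -(2 ^ k : ℝ) * b k) f₂ y) y := by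
    intro y hy
    have hin : ∀ k z, l z < 0 → 0 < l (scaledReflection l e k z) := by
      intro k z hz
      rw [map_scaledReflection he]
      have : (0 : ℝ) < 2 ^ k := by positivity
      nlinarith
    have hk : ∀ k z, l z < 0 → HasFDerivAt (fun z => b k • f (scaledReflection l e k z))
        (b k • f₁ (scaledReflection l e k z)
          + (-(2 ^ k : ℝ) * b k) • f₂ (scaledReflection l e k z)) z := by
      intro k z hz
      have hmem : {x | 0 ≤ l x} ∈ 𝓝 (scaledReflection l e k z) :=
        mem_of_superset (hopos.mem_nhds (hin k z hz)) fun z hz => show 0 ≤ l z from le_of_lt hz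
      have h1 := ((hf.differentiableOn (by simp) _ (hin k z hz).le).hasFDerivWithinAt).hasFDerivAt
        hmem
      have h2 := (h1.comp z (scaledReflection l e k).hasFDerivAt).const_smul (b k)
      -- The derivative of the reflection is the projection along `e` plus `-2^k` times the normal
      -- part; the two parts produce `f₁` and `f₂`.
      refine h2.congr_fderiv ?_
      rw [hf₁, hf₂]
      ext v
      simp only [scaledReflection, FunLike.coe_smul, ContinuousLinearMap.coe_comp,
        Pi.smul_apply, Function.comp_apply, add_apply, map_add, map_smul,
        smul_add, ← mul_smul]
      rw [mul_comm (b k)]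
    have hbd : ∀ k z, l z < 0 → ‖b k • f₁ (scaledReflection l e k z)
          + (-(2 ^ k : ℝ) * b k) • f₂ (scaledReflection l e k z)‖
          ≤ |b k| * C₁ + |b k| * 2 ^ k * C₂ := by
      intro k z hz
      refine (norm_add_le _ _).trans (add_le_add ?_ ?_)
      · rw [norm_smul]
        exact mul_le_mul_of_nonneg_left (hC₁ _ (hin k z hz).le) (norm_nonneg _)
      · rw [norm_smul, norm_mul, norm_neg, Real.norm_of_nonneg (by positivity : (0 : ℝ) ≤ 2 ^ k),
          mul_comm (2 ^ k : ℝ)]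
        exact mul_le_mul_of_nonneg_left (hC₂ _ (hin k z hz).le) (by positivity)
    have hsumm : Summable fun k => b k • f (scaledReflection l e k y) := by
      refine Summable.of_norm_bounded (hs0.mul_right C) fun k => ?_
      rw [norm_smul]
      exact mul_le_mul_of_nonneg_left (hC _ (hin k y hy).le) (norm_nonneg _)
    have hder := hasFDerivAt_tsum_of_isPreconnected
      ((hs0.mul_right C₁).add (hs1.mul_right C₂)) honeg
      (by simpa using (convex_halfSpace_lt l.toLinearMap.isLinear 0).isPreconnected)
      (fun k z hz => hk k z hz) (fun k z hz => hbd k z hz) hy hsumm hy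
    have hv : reflectionExtension l e b f₁ y +
        reflectionExtension l e (fun k => -(2 ^ k : ℝ) * b k) f₂ y
        = ∑' k, (b k • f₁ (scaledReflection l e k y)
          + (-(2 ^ k : ℝ) * b k) • f₂ (scaledReflection l e k y)) := by
      rw [reflectionExtension_of_nonpos he hb _ hy.le, reflectionExtension_of_nonpos he hb' _ hy.le]
      refine (Summable.tsum_add ?_ ?_).symm
      · refine Summable.of_norm_bounded (hs0.mul_right C₁) fun k => ?_
        rw [norm_smul]
        exact mul_le_mul_of_nonneg_left (hC₁ _ (hin k y hy).le) (norm_nonneg _)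
      · refine Summable.of_norm_bounded (hs1.mul_right C₂) fun k => ?_
        rw [norm_smul, norm_mul, norm_neg, Real.norm_of_nonneg (by positivity : (0 : ℝ) ≤ 2 ^ k),
          mul_comm (2 ^ k : ℝ)]
        exact mul_le_mul_of_nonneg_left (hC₂ _ (hin k y hy).le) (by positivity)
    rw [hv]
    refine hder.congr_of_eventuallyEq ?_
    filter_upwards [honeg.mem_nhds hy] with z hz
    exact reflectionExtension_of_nonpos he hb f (le_of_lt hz)
  rcases lt_trichotomy (l x) 0 with hx | hx | hx
  · exact hneg x hx
  -- On the hyperplane the candidate derivative is continuous and is the limit of the derivatives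
  -- from either side, so it is a derivative within both closed half spaces, which together cover
  -- `E`.
  · have h1 := hasFDerivWithinAt_closure_of_tendsto_fderiv (f := reflectionExtension l e b f)
      (s := {x | 0 < l x}) (x := x) (fun y hy => (hpos y hy).differentiableAt.differentiableWithinAt)
      (by simpa using convex_halfSpace_gt l.toLinearMap.isLinear 0) hopos
      (fun y _ => hcont.continuousWithinAt)
      (((hL.tendsto x).mono_left nhdsWithin_le_nhds).congr'
        (by filter_upwards [self_mem_nhdsWithin] with y hy using ((hpos y hy).fderiv).symm))
    have h2 := hasFDerivWithinAt_closure_of_tendsto_fderiv (f := reflectionExtension l e b f)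
      (s := {x | l x < 0}) (x := x) (fun y hy => (hneg y hy).differentiableAt.differentiableWithinAt)
      (by simpa using convex_halfSpace_lt l.toLinearMap.isLinear 0) honeg
      (fun y _ => hcont.continuousWithinAt)
      (((hL.tendsto x).mono_left nhdsWithin_le_nhds).congr'
        (by filter_upwards [self_mem_nhdsWithin] with y hy using ((hneg y hy).fderiv).symm))
    have h3 := h1.union h2
    refine hasFDerivWithinAt_univ.1 (h3.mono fun y _ => ?_)
    rcases le_total 0 (l y) with h | h
    · exact Or.inl (closure_halfSpace_pos he h)
    · exact Or.inr (closure_halfSpace_neg he h)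
  · exact hpos x hx

lemma exists_bound_fderivWithin {f : E → F}
    (hR : ∃ R : ℝ, ∀ x, 0 ≤ l x → R < ‖x‖ → f x = 0) :
    ∃ R : ℝ, ∀ x, 0 ≤ l x → R < ‖x‖ → fderivWithin ℝ f {x | 0 ≤ l x} x = 0 := by
  obtain ⟨R, hR⟩ := hR
  refine ⟨R, fun x hx hxR => ?_⟩
  have : f =ᶠ[𝓝[{x | 0 ≤ l x}] x] fun _ => 0 := by
    filter_upwards [self_mem_nhdsWithin, mem_nhdsWithin_of_mem_nhds
      ((isOpen_lt continuous_const continuous_norm).mem_nhds hxR)] with y hy hy'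
    exact hR y hy hy'
  rw [this.fderivWithin_eq (hR x hx hxR)]
  simp

/-- The derivative of an extension is a sum of two extensions of the same kind, with values in `E
→L[ℝ] G` and with coefficients `b k` and `-2^k b k`. The induction therefore runs over all targets
and all reflection sequences at once. -/
theorem contDiff_reflectionExtension (he : l e = 1) (n : ℕ) :
    ∀ {G : Type} [NormedAddCommGroup G] [NormedSpace ℝ G] [CompleteSpace G] {b : ℕ → ℝ},
    IsReflectionSequence b → ∀ {f : E → G}, ContDiffOn ℝ ∞ f {x | 0 ≤ l x} →
    (∃ R : ℝ, ∀ x, 0 ≤ l x → R < ‖x‖ → f x = 0) →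
    ContDiff ℝ n (reflectionExtension l e b f) := by
  induction n with
  | zero =>
    intro G _ _ _ b hb f hf hR
    exact contDiff_zero.2 (continuous_reflectionExtension he hb hf.continuousOn hR)
  | succ n ih =>
    intro G _ _ _ b hb f hf hR
    have hd : ContDiffOn ℝ ∞ (fderivWithin ℝ f {x | 0 ≤ l x}) {x | 0 ≤ l x} :=
      hf.fderivWithin (uniqueDiffOn_halfSpace he) (by simp)
    obtain ⟨R, hR'⟩ := exists_bound_fderivWithin hR
    have h1 : ∀ T : E →L[ℝ] E, ContDiffOn ℝ ∞
        (fun x => (fderivWithin ℝ f {x | 0 ≤ l x} x).comp T) {x | 0 ≤ l x} :=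
      fun T => hd.clm_comp contDiffOn_const
    have h2 : ∀ T : E →L[ℝ] E, ∃ R : ℝ, ∀ x, 0 ≤ l x → R < ‖x‖ →
        (fderivWithin ℝ f {x | 0 ≤ l x} x).comp T = 0 :=
      fun T => ⟨R, fun x hx hxR => by rw [hR' x hx hxR]; simp⟩
    have hder := hasFDerivAt_reflectionExtension he hb hf hR rfl rfl
      (h1 _).continuousOn (h1 _).continuousOn (h2 _) (h2 _)
    push_cast
    refine contDiff_succ_iff_fderiv.2 ⟨fun x => (hder x).differentiableAt, by simp, ?_⟩
    have := (ih hb (h1 (ContinuousLinearMap.id ℝ E - l.smulRight e)) (h2 _)).add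
      (ih hb.mul_neg_two_pow (h1 (l.smulRight e)) (h2 _))
    convert this using 1
    ext1 x
    exact (hder x).fderiv

/-- A smooth compactly supported function on a closed half space extends smoothly. -/
theorem exists_contDiff_extension (he : l e = 1) {f : E → F}
    (hf : ContDiffOn ℝ ∞ f {x | 0 ≤ l x}) (hR : ∃ R : ℝ, ∀ x, 0 ≤ l x → R < ‖x‖ → f x = 0) :
    ∃ g : E → F, ContDiff ℝ ∞ g ∧ ∀ x, 0 ≤ l x → g x = f x := by
  obtain ⟨b, hb⟩ := exists_isReflectionSequence
  exact ⟨reflectionExtension l e b f,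
    contDiff_infty.2 fun n => contDiff_reflectionExtension he n hb hf hR, fun x hx => if_pos hx⟩

end Reflection

/-! ### Smooth dependence of solutions of differential equations on the initial value -/

section LocalInverse

variable {E F : Type*} [NormedAddCommGroup E] [NormedSpace ℝ E] [CompleteSpace E]
  [NormedAddCommGroup F] [NormedSpace ℝ F]

/-- The inverse function theorem for smooth maps, with a smooth inverse on the whole target. -/
theorem exists_smooth_openPartialHomeomorph {f : E → F} {U : Set E} {a : E} (hU : IsOpen U)
    (ha : a ∈ U) (hf : ContDiffOn ℝ ∞ f U) (f' : E ≃L[ℝ] F)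
    (hf' : HasFDerivAt f (f' : E →L[ℝ] F) a) :
    ∃ e : OpenPartialHomeomorph E F, a ∈ e.source ∧ e.source ⊆ U ∧ (∀ x, e x = f x) ∧
      ContDiffOn ℝ ∞ e.symm e.target := by
  have hfa : ContDiffAt ℝ ∞ f a := hf.contDiffAt (hU.mem_nhds ha)
  let e₀ := hfa.toOpenPartialHomeomorph f hf' (by simp)
  let R : Set (E →L[ℝ] F) := range ((↑) : (E ≃L[ℝ] F) → E →L[ℝ] F)
  -- Invertibility of the derivative is an open condition. After restriction to it the inverse is
  -- smooth at every point of the target and not only at `f a`.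
  have hRo : IsOpen (U ∩ fderiv ℝ f ⁻¹' R) :=
    (hf.continuousOn_fderiv_of_isOpen hU (by simp)).isOpen_inter_preimage hU
      ContinuousLinearEquiv.isOpen
  refine ⟨e₀.restrOpen _ hRo, ⟨hfa.mem_toOpenPartialHomeomorph_source hf' (by simp), ha, ?_⟩,
    fun x hx => hx.2.1, fun x => rfl, ?_⟩
  · exact ⟨f', hf'.fderiv.symm⟩
  · intro y hy
    have hx := (e₀.restrOpen _ hRo).map_target hy
    obtain ⟨hx1, hxU, A, hA⟩ := hx
    have hfx : ContDiffAt ℝ ∞ f ((e₀.restrOpen _ hRo).symm y) := hf.contDiffAt (hU.mem_nhds hxU)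
    have hd : HasFDerivAt f (A : E →L[ℝ] F) ((e₀.restrOpen _ hRo).symm y) := by
      rw [hA]; exact (hfx.differentiableAt (by simp)).hasFDerivAt
    exact ((e₀.restrOpen _ hRo).contDiffAt_symm hy hd hfx).contDiffWithinAt

end LocalInverse

/-! ### Smoothness of composition operators on `C(K, E)` -/

section Composition

variable {K : Type} [TopologicalSpace K] [CompactSpace K]
  {E : Type} [NormedAddCommGroup E] [NormedSpace ℝ E]

/-- Pointwise application of a family of linear maps, as a continuous bilinear map. -/
def pointwiseApply (K : Type*) [TopologicalSpace K] [CompactSpace K] (E F : Type*)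
    [NormedAddCommGroup E] [NormedSpace ℝ E] [NormedAddCommGroup F] [NormedSpace ℝ F] :
    C(K, E →L[ℝ] F) →L[ℝ] C(K, E) →L[ℝ] C(K, F) :=
  LinearMap.mkContinuous₂
    (LinearMap.mk₂ ℝ (fun (A : C(K, E →L[ℝ] F)) (h : C(K, E)) =>
        (⟨fun k => A k (h k), A.continuous.clm_apply h.continuous⟩ : C(K, F)))
      (fun A B h => by ext k; simp) (fun c A h => by ext k; simp)
      (fun A h h' => by ext k; simp) (fun c A h => by ext k; simp)) 1
    (fun A h => by
      rw [one_mul]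
      refine (ContinuousMap.norm_le _ (by positivity)).2 fun k => ?_
      exact ((A k).le_opNorm (h k)).trans (mul_le_mul (A.norm_coe_le_norm k) (h.norm_coe_le_norm k)
        (norm_nonneg _) (norm_nonneg A)))

/-- The mean value inequality on a ball of radius `δ`, together with uniform continuity of `f'`,
bounds the remainder uniformly in the points of `K`. -/
lemma hasFDerivAt_continuousMap_comp {F : Type*} [NormedAddCommGroup F] [NormedSpace ℝ F]
    (f : C(E, F)) (f' : C(E, E →L[ℝ] F)) (hf : ∀ x, HasFDerivAt f (f' x) x)
    (hf' : UniformContinuous f') (γ : C(K, E)) :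
    HasFDerivAt (fun γ : C(K, E) => f.comp γ) (pointwiseApply K E F (f'.comp γ)) γ := by
  rw [hasFDerivAt_iff_isLittleO, Asymptotics.isLittleO_iff]
  intro ε hε
  obtain ⟨δ, hδ, h⟩ := Metric.uniformContinuous_iff.1 hf' ε hε
  filter_upwards [Metric.ball_mem_nhds γ hδ] with β hβ
  refine (ContinuousMap.norm_le _ (by positivity)).2 fun k => ?_
  have h1 : dist (β k) (γ k) < δ := (ContinuousMap.dist_apply_le_dist k).trans_lt hβ
  have h2 := (convex_ball (γ k) δ).norm_image_sub_le_of_norm_hasFDerivWithin_le'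
    (f := f) (f' := f') (φ := f' (γ k)) (C := ε) (fun x _ => (hf x).hasFDerivWithinAt)
    (fun x hx => by
      have := h (Metric.mem_ball.1 hx)
      rw [dist_eq_norm] at this
      exact this.le) (Metric.mem_ball_self hδ) (Metric.mem_ball.2 h1)
  refine h2.trans (mul_le_mul_of_nonneg_left ?_ hε.le)
  exact (β - γ).norm_coe_le_norm k

/-- Composition with a compactly supported smooth function is smooth on `C(K, E)`. -/
theorem contDiff_continuousMap_comp (n : ℕ) : ∀ {F : Type} [NormedAddCommGroup F]
    [NormedSpace ℝ F] (f : C(E, F)), ContDiff ℝ ∞ f → HasCompactSupport f →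
    ContDiff ℝ n (fun γ : C(K, E) => f.comp γ) := by
  induction n with
  | zero =>
    intro F _ _ f _ _
    exact contDiff_zero.2 (ContinuousMap.continuous_postcomp f)
  | succ n ih =>
    intro F _ _ f hf hc
    have hd : ContDiff ℝ ∞ (fderiv ℝ f) := hf.fderiv_right (by simp)
    have hcd : HasCompactSupport (fderiv ℝ f) := hc.fderiv ℝ
    let f' : C(E, E →L[ℝ] F) := ⟨fderiv ℝ f, hd.continuous⟩
    have hder := hasFDerivAt_continuousMap_comp (K := K) f f'
      (fun x => (hf.differentiable (by simp) x).hasFDerivAt)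
      (hcd.uniformContinuous_of_continuous hd.continuous)
    push_cast
    refine contDiff_succ_iff_fderiv.2 ⟨fun x => (hder x).differentiableAt, by simp, ?_⟩
    -- The derivative is composition with `fderiv ℝ f`, again smooth with compact support, followed
    -- by a continuous linear map; this is why the target space varies in the induction.
    have h := (pointwiseApply K E F).contDiff.comp (ih f' hd hcd)
    rw [show fderiv ℝ (fun γ : C(K, E) => f.comp γ) = _ from funext fun γ => (hder γ).fderiv]
    exact h

end Composition

/-! ### Local flows from the inverse function theorem in path space -/

section Flow

variable {E : Type} [NormedAddCommGroup E] [NormedSpace ℝ E] [CompleteSpace E]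

/-- The primitive of a continuous function on `[0, 1]`. -/
def unitPrimitive (E : Type*) [NormedAddCommGroup E] [NormedSpace ℝ E] [CompleteSpace E] :
    C(Icc (0 : ℝ) 1, E) →L[ℝ] C(Icc (0 : ℝ) 1, E) :=
  LinearMap.mkContinuous
    { toFun := fun h => ⟨fun τ => ∫ s in (0 : ℝ)..τ, IccExtend zero_le_one h s,
        (intervalIntegral.continuous_primitive
          (fun a b => (h.continuous.Icc_extend').intervalIntegrable a b) 0).comp
          continuous_subtype_val⟩
      map_add' := fun h h' => by
        ext τ
        exact intervalIntegral.integral_add ((h.continuous.Icc_extend').intervalIntegrable _ _)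
          ((h'.continuous.Icc_extend').intervalIntegrable _ _)
      map_smul' := fun c h => by
        ext τ
        exact intervalIntegral.integral_smul c _ } 1
    (fun h => by
      rw [one_mul]
      refine (ContinuousMap.norm_le _ (norm_nonneg _)).2 fun τ => ?_
      refine (intervalIntegral.norm_integral_le_of_norm_le_const (C := ‖h‖)
        fun s _ => h.norm_coe_le_norm _).trans ?_
      have h1 := τ.2.1
      have h2 := τ.2.2
      rw [sub_zero, abs_of_nonneg h1]
      exact mul_le_of_le_one_right (norm_nonneg _) h2)

/-- Constant functions, as a continuous linear map. -/
def constCurve (E : Type*) [NormedAddCommGroup E] [NormedSpace ℝ E] :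
    E →L[ℝ] C(Icc (0 : ℝ) 1, E) :=
  LinearMap.mkContinuous
    { toFun := fun z => ContinuousMap.const _ z
      map_add' := fun _ _ => rfl
      map_smul' := fun _ _ => rfl } 1
    (fun z => by
      rw [one_mul]
      exact (ContinuousMap.norm_le _ (norm_nonneg _)).2 fun τ => le_rfl)

/-- Solutions on `[0, 1]` of `γ' = s f(γ)`, `γ(0) = z` depend smoothly on `(s, z)`. -/
lemma exists_smooth_solution_curves {f : C(E, E)} (hf : ContDiff ℝ ∞ f) (hc : HasCompactSupport f)
    (z₀ : E) : ∃ (O : Set (ℝ × E)) (γ : ℝ × E → C(Icc (0 : ℝ) 1, E)), IsOpen O ∧ (0, z₀) ∈ O ∧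
      ContDiffOn ℝ ∞ γ O ∧ ∀ x ∈ O,
        γ x = constCurve E x.2 + x.1 • unitPrimitive E (f.comp (γ x)) := by
  let C := C(Icc (0 : ℝ) 1, E)
  have hcomp : ContDiff ℝ ∞ fun γ : C => f.comp γ :=
    contDiff_infty.2 fun n => contDiff_continuousMap_comp n f hf hc
  -- A curve solves the integral equation with parameters `(s, z)` exactly when the second component
  -- of `Φ` is zero. At `s = 0` the nonlinear term drops out of the derivative in the curve, so the
  -- linearisation is unipotent with the explicit inverse `B`.
  let Φ : (ℝ × E) × C → (ℝ × E) × C := fun p =>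
    (p.1, p.2 - constCurve E p.1.2 - p.1.1 • unitPrimitive E (f.comp p.2))
  have hΦ : ContDiff ℝ ∞ Φ := by
    refine contDiff_fst.prodMk ((contDiff_snd.sub ?_).sub ?_)
    · exact (constCurve E).contDiff.comp (contDiff_snd.comp contDiff_fst)
    · exact (contDiff_fst.comp contDiff_fst).smul
        ((unitPrimitive E).contDiff.comp (hcomp.comp contDiff_snd))
  let c₀ : C := unitPrimitive E (f.comp (constCurve E z₀))
  let T : (ℝ × E) →L[ℝ] C := (constCurve E).comp (ContinuousLinearMap.snd ℝ ℝ E) +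
    (ContinuousLinearMap.fst ℝ ℝ E).smulRight c₀
  let A : ((ℝ × E) × C) →L[ℝ] (ℝ × E) × C := (ContinuousLinearMap.fst ℝ (ℝ × E) C).prod
    (ContinuousLinearMap.snd ℝ (ℝ × E) C - T.comp (ContinuousLinearMap.fst ℝ (ℝ × E) C))
  let B : ((ℝ × E) × C) →L[ℝ] (ℝ × E) × C := (ContinuousLinearMap.fst ℝ (ℝ × E) C).prod
    (ContinuousLinearMap.snd ℝ (ℝ × E) C + T.comp (ContinuousLinearMap.fst ℝ (ℝ × E) C))
  let Φ' : ((ℝ × E) × C) ≃L[ℝ] (ℝ × E) × C := ContinuousLinearEquiv.equivOfInverse A B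
    (fun p => by ext1 <;> simp [A, B]) (fun p => by ext1 <;> simp [A, B])
  have hder : HasFDerivAt Φ (Φ' : ((ℝ × E) × C) →L[ℝ] (ℝ × E) × C) ((0, z₀), constCurve E z₀) := by
    have h1 : HasFDerivAt (fun p : (ℝ × E) × C => p.1.1)
        ((ContinuousLinearMap.fst ℝ ℝ E).comp (ContinuousLinearMap.fst ℝ (ℝ × E) C))
        ((0, z₀), constCurve E z₀) := ((ContinuousLinearMap.fst ℝ ℝ E).comp
          (ContinuousLinearMap.fst ℝ (ℝ × E) C)).hasFDerivAt
    have h2 : HasFDerivAt (fun p : (ℝ × E) × C => unitPrimitive E (f.comp p.2)) _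
        ((0, z₀), constCurve E z₀) :=
      (((unitPrimitive E).contDiff.comp (hcomp.comp contDiff_snd)).differentiable (by simp)
        _).hasFDerivAt
    have h3 : HasFDerivAt (fun p : (ℝ × E) × C => p.2 - constCurve E p.1.2)
        (ContinuousLinearMap.snd ℝ (ℝ × E) C - (constCurve E).comp
          ((ContinuousLinearMap.snd ℝ ℝ E).comp (ContinuousLinearMap.fst ℝ (ℝ × E) C)))
        ((0, z₀), constCurve E z₀) := ContinuousLinearMap.hasFDerivAt
          (ContinuousLinearMap.snd ℝ (ℝ × E) C - (constCurve E).comp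
          ((ContinuousLinearMap.snd ℝ ℝ E).comp (ContinuousLinearMap.fst ℝ (ℝ × E) C)))
    have h4 := hasFDerivAt_fst (𝕜 := ℝ) (p := (((0 : ℝ), z₀), constCurve E z₀))
    refine (h4.prodMk (h3.sub (h1.smul h2))).congr_fderiv ?_
    refine ContinuousLinearMap.ext fun p => Prod.ext rfl ?_
    simp [Φ', A, T, c₀, sub_sub, ContinuousLinearEquiv.equivOfInverse]
  obtain ⟨e, he0, -, heq, hsymm⟩ := exists_smooth_openPartialHomeomorph isOpen_univ
    (mem_univ ((0, z₀), constCurve E z₀)) hΦ.contDiffOn Φ' hder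
  let j : ℝ × E → (ℝ × E) × C := fun x => (x, 0)
  have hj : ContDiff ℝ ∞ j := contDiff_id.prodMk contDiff_const
  refine ⟨j ⁻¹' e.target, fun x => (e.symm (j x)).2, e.open_target.preimage hj.continuous, ?_,
    ?_, ?_⟩
  · have : Φ ((0, z₀), constCurve E z₀) = j (0, z₀) := by simp [Φ, j]
    rw [mem_preimage, ← this, ← heq]
    exact e.map_source he0
  · exact (contDiff_snd.comp_contDiffOn hsymm).comp hj.contDiffOn fun x hx => hx
  · intro x hx
    have h := e.right_inv hx
    rw [heq] at h
    have h1 : (e.symm (j x)).1 = x := congrArg Prod.fst h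
    have h2 : (e.symm (j x)).2 - constCurve E (e.symm (j x)).1.2
      - (e.symm (j x)).1.1 • unitPrimitive E (f.comp (e.symm (j x)).2) = 0 := congrArg Prod.snd h
    rw [h1, sub_sub] at h2
    exact sub_eq_zero.1 h2

/-- The local flow of a compactly supported smooth vector field is smooth. -/
theorem exists_smooth_flow {f : E → E} (hf : ContDiff ℝ ∞ f) (hc : HasCompactSupport f) (z₀ : E) :
    ∃ (η : ℝ) (φ : ℝ × E → E), 0 < η ∧
      ContDiffOn ℝ ∞ φ (Ioo (-η) η ×ˢ Metric.ball z₀ η) ∧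
      ∀ z ∈ Metric.ball z₀ η, φ (0, z) = z ∧
        ∀ t ∈ Ico 0 η, HasDerivAt (fun s => φ (s, z)) (f (φ (t, z))) t := by
  obtain ⟨O, γ, hO, h0, hγ, hsol⟩ :=
    exists_smooth_solution_curves (f := ⟨f, hf.continuous⟩) hf hc z₀
  obtain ⟨η, hη, hball⟩ := Metric.isOpen_iff.1 hO _ h0
  have hsub : Ioo (-η) η ×ˢ Metric.ball z₀ η ⊆ O := by
    rintro ⟨t, z⟩ ⟨ht, hz⟩
    refine hball ?_
    rw [← ball_prod_same]
    exact ⟨by simpa [abs_lt] using ht, hz⟩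
  let one : Icc (0 : ℝ) 1 := ⟨1, by simp⟩
  obtain ⟨L, hL⟩ := ContDiff.lipschitzWith_of_hasCompactSupport hc hf (by simp)
  -- the solution curves, extended to the real line
  let β : ℝ × E → ℝ → E := fun x τ =>
    x.2 + x.1 • ∫ s in (0 : ℝ)..τ, IccExtend zero_le_one (fun r => f (γ x r)) s
  have hFc : ∀ x, Continuous (IccExtend zero_le_one (fun r => f (γ x r))) := fun x =>
    (hf.continuous.comp (γ x).continuous).Icc_extend'
  have hβγ : ∀ x ∈ O, ∀ τ (hτ : τ ∈ Icc (0 : ℝ) 1), β x τ = γ x ⟨τ, hτ⟩ := by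
    intro x hx τ hτ
    have := congrArg (fun c : C(Icc (0 : ℝ) 1, E) => c ⟨τ, hτ⟩) (hsol x hx)
    exact this.symm
  have hβd : ∀ x ∈ O, ∀ τ ∈ Icc (0 : ℝ) 1, HasDerivAt (β x) (x.1 • f (β x τ)) τ := by
    intro x hx τ hτ
    have h1 := (intervalIntegral.integral_hasDerivAt_right ((hFc x).intervalIntegrable 0 τ)
      ((hFc x).stronglyMeasurableAtFilter _ _) (hFc x).continuousAt)
    have h2 := (h1.const_smul x.1).const_add x.2
    rw [hβγ x hx τ hτ]
    rwa [IccExtend_of_mem _ _ hτ] at h2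
  have hβ0 : ∀ x, β x 0 = x.2 := fun x => by simp [β]
  -- By uniqueness, slowing down the solution with parameter `s` by the factor `c` gives the one
  -- with parameter `c s`. Hence the value at time `1`, as a function of the parameter, traces the
  -- solution itself.
  have hscale : ∀ s z c, (s, z) ∈ O → (c * s, z) ∈ O → c ∈ Icc (0 : ℝ) 1 →
      γ (c * s, z) one = β (s, z) c := by
    intro s z c hs hcs hc'
    have hlin : ∀ τ ∈ Icc (0 : ℝ) 1, c * τ ∈ Icc (0 : ℝ) 1 := fun τ hτ =>
      ⟨mul_nonneg hc'.1 hτ.1, mul_le_one₀ hc'.2 hτ.1 hτ.2⟩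
    have hd2 : ∀ τ ∈ Icc (0 : ℝ) 1,
        HasDerivAt (fun τ => β (s, z) (c * τ)) ((c * s) • f (β (s, z) (c * τ))) τ := by
      intro τ hτ
      have h1 := hβd (s, z) hs _ (hlin τ hτ)
      have h2 : HasDerivAt (fun τ => c * τ) c τ := by simpa using (hasDerivAt_id τ).const_mul c
      have h3 := h1.scomp τ h2
      rwa [smul_smul] at h3
    have hE : EqOn (β (c * s, z)) (fun τ => β (s, z) (c * τ)) (Icc 0 1) :=
      ODE_solution_unique_of_mem_Icc_right (v := fun _ x => (c * s) • f x)
        (K := ‖c * s‖₊ * L) (s := fun _ => univ)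
        (fun t _ => ((lipschitzWith_smul (c * s)).comp hL).lipschitzOnWith)
        (fun τ hτ => (hβd _ hcs τ hτ).continuousAt.continuousWithinAt)
        (fun τ hτ => (hβd _ hcs τ ⟨hτ.1, hτ.2.le⟩).hasDerivWithinAt) (fun _ _ => mem_univ _)
        (fun τ hτ => (hd2 τ hτ).continuousAt.continuousWithinAt)
        (fun τ hτ => (hd2 τ ⟨hτ.1, hτ.2.le⟩).hasDerivWithinAt) (fun _ _ => mem_univ _)
        (by simp [hβ0])
    have h1 := hE (right_mem_Icc.2 zero_le_one)
    rw [hβγ _ hcs 1 (by simp)] at h1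
    change γ (c * s, z) one = β (s, z) (c * 1) at h1
    rwa [mul_one] at h1
  have hsm : ContDiffOn ℝ ∞ (fun x => γ x one) (Ioo (-η) η ×ˢ Metric.ball z₀ η) :=
    (ContinuousMap.evalCLM ℝ (M := E) one).contDiff.comp_contDiffOn (hγ.mono hsub)
  refine ⟨η, fun x => γ x one, hη, hsm, fun z hz => ⟨?_, fun t ht => ?_⟩⟩
  · have hz0 : ((0 : ℝ), z) ∈ O := hsub ⟨⟨by linarith, hη⟩, hz⟩
    change γ (0, z) one = z
    rw [← hβγ _ hz0 1 (by simp)]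
    simp [β]
  · obtain ⟨s, hts, hsη⟩ := exists_between ht.2
    have hs0 : 0 < s := ht.1.trans_lt hts
    have hO' : ∀ r ∈ Icc 0 s, (r, z) ∈ O := fun r hr =>
      hsub ⟨⟨by linarith [hr.1], hr.2.trans_lt hsη⟩, hz⟩
    have hsz := hO' s ⟨hs0.le, le_rfl⟩
    have heq : ∀ r ∈ Icc 0 s, γ (r, z) one = β (s, z) (r / s) := by
      intro r hr
      have hc' : r / s ∈ Icc (0 : ℝ) 1 := ⟨div_nonneg hr.1 hs0.le, (div_le_one hs0).2 hr.2⟩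
      have := hscale s z (r / s) hsz (by rw [div_mul_cancel₀ _ hs0.ne']; exact hO' r hr) hc'
      rwa [div_mul_cancel₀ _ hs0.ne'] at this
    have htI : t ∈ Icc 0 s := ⟨ht.1, hts.le⟩
    have htc : t / s ∈ Icc (0 : ℝ) 1 := ⟨div_nonneg ht.1 hs0.le, (div_le_one hs0).2 hts.le⟩
    have h1 : HasDerivAt (fun r => β (s, z) (r / s)) (f (γ (t, z) one)) t := by
      have h2 := (hβd _ hsz _ htc).scomp t ((hasDerivAt_id t).div_const s)
      rw [heq t htI]
      rw [smul_smul, one_div, inv_mul_cancel₀ hs0.ne', one_smul] at h2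
      exact h2
    have h3 : HasDerivWithinAt (fun r => γ (r, z) one) (f (γ (t, z) one)) (Icc 0 s) t :=
      h1.hasDerivWithinAt.congr heq (heq t htI)
    have h4 : DifferentiableAt ℝ (fun r => γ (r, z) one) t := by
      have h5 : ContDiffAt ℝ ∞ (fun x => γ x one) (t, z) := hsm.contDiffAt
        ((isOpen_Ioo.prod Metric.isOpen_ball).mem_nhds ⟨⟨by linarith [ht.1], ht.2⟩, hz⟩)
      exact (h5.differentiableAt (by simp)).comp t
        (f := fun r : ℝ => (r, z)) (by fun_prop)
    -- At `t = 0` the comparison with `β` only gives a one-sided derivative; smoothness in the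
    -- parameter turns it into a two-sided one.
    have h6 := (uniqueDiffOn_Icc hs0 t htI).eq_deriv _ h3 h4.hasDerivAt.hasDerivWithinAt
    change HasDerivAt (fun r => γ (r, z) one) (f (γ (t, z) one)) t
    rw [h6]
    exact h4.hasDerivAt

end Flow

/-! ### The eikonal equation near a hyperplane -/

lemma two_le_infty : (2 : ℕ∞ω) ≤ (∞ : ℕ∞ω) := ENat.LEInfty.out

section Lines

variable {E F G : Type*} [NormedAddCommGroup E] [NormedSpace ℝ E] [NormedAddCommGroup F]
  [NormedSpace ℝ F] [NormedAddCommGroup G] [NormedSpace ℝ G]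

lemma hasDerivAt_line {f : E → F} {z : E} (hf : DifferentiableAt ℝ f z) (v : E) :
    HasDerivAt (fun s : ℝ => f (z + s • v)) (fderiv ℝ f z v) 0 := by
  have h3 : HasDerivAt (fun s : ℝ => z + s • v) v 0 := by
    simpa using ((hasDerivAt_id (0 : ℝ)).smul_const v).const_add z
  have h4 : HasFDerivAt f (fderiv ℝ f z) ((fun s : ℝ => z + s • v) 0) := by
    simpa using hf.hasFDerivAt
  exact h4.comp_hasDerivAt (0 : ℝ) h3

lemma hasDerivAt_prod_fst {f : ℝ → F × G} {f' : F × G} {t : ℝ} (h : HasDerivAt f f' t) :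
    HasDerivAt (fun s => (f s).1) f'.1 t :=
  (ContinuousLinearMap.fst ℝ F G).hasFDerivAt.comp_hasDerivAt t h

lemma hasDerivAt_prod_snd {f : ℝ → F × G} {f' : F × G} {t : ℝ} (h : HasDerivAt f f' t) :
    HasDerivAt (fun s => (f s).2) f'.2 t :=
  (ContinuousLinearMap.snd ℝ F G).hasFDerivAt.comp_hasDerivAt t h

end Lines

section Eikonal

variable {E : Type} [NormedAddCommGroup E] [NormedSpace ℝ E] [FiniteDimensional ℝ E]

/-- The Hamiltonian vector field of `½ p(A(x) p)`. -/
def hamiltonField (A : E → (E →L[ℝ] ℝ) →L[ℝ] E) (z : E × (E →L[ℝ] ℝ)) : E × (E →L[ℝ] ℝ) :=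
  (A z.1 z.2, (-(1 / 2) : ℝ) • z.2.comp ((fderiv ℝ A z.1).flip z.2))

lemma contDiff_hamiltonField {A : E → (E →L[ℝ] ℝ) →L[ℝ] E} (hA : ContDiff ℝ ∞ A) :
    ContDiff ℝ ∞ (hamiltonField A) := by
  have hA' : ContDiff ℝ ∞ (fderiv ℝ A) := hA.fderiv_right (by simp)
  have h1 : ContDiff ℝ ∞ fun z : E × (E →L[ℝ] ℝ) => (fderiv ℝ A z.1).flip :=
    (ContinuousLinearMap.flipₗᵢ ℝ E (E →L[ℝ] ℝ) E).contDiff.comp (hA'.comp contDiff_fst)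
  exact ((hA.comp contDiff_fst).clm_apply contDiff_snd).prodMk
    ((contDiff_snd.clm_comp (h1.clm_apply contDiff_snd)).const_smul _)

/-- The set of points `z` with `|ℓ z| < r` whose projection along `e` is within `r` of `y`. -/
def slab (l : E →L[ℝ] ℝ) (e y : E) (r : ℝ) : Set E := {z | |l z| < r ∧ ‖z - l z • e - y‖ < r}

variable {l : E →L[ℝ] ℝ} {e : E}

lemma isOpen_slab (y : E) (r : ℝ) : IsOpen (slab l e y r) :=
  (isOpen_lt (f := fun z => |l z|) (by fun_prop) continuous_const).inter
    (isOpen_lt (f := fun z => ‖z - l z • e - y‖) (by fun_prop) continuous_const)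

lemma exists_slab_subset {y : E} (hy : l y = 0) {W : Set E} (hW : W ∈ 𝓝 y) :
    ∃ r, 0 < r ∧ slab l e y r ⊆ W := by
  obtain ⟨ε, hε, hb⟩ := Metric.mem_nhds_iff.1 hW
  have h0 : 0 < ‖e‖ + 2 := by positivity
  refine ⟨ε / (‖e‖ + 2), by positivity, fun z hz => hb ?_⟩
  rw [Metric.mem_ball, dist_eq_norm]
  have h1 : z - y = l z • e + (z - l z • e - y) := by abel
  have h2 : ‖l z • e‖ ≤ ε / (‖e‖ + 2) * ‖e‖ := by
    rw [norm_smul]; exact mul_le_mul_of_nonneg_right hz.1.le (norm_nonneg _)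
  calc ‖z - y‖ ≤ ‖l z • e‖ + ‖z - l z • e - y‖ := by rw [h1]; exact norm_add_le _ _
    _ < ε / (‖e‖ + 2) * ‖e‖ + ε / (‖e‖ + 2) * 2 := by
        have := hz.2
        have : 0 < ε / (‖e‖ + 2) := by positivity
        linarith
    _ = ε := by field_simp

lemma slab_line (he : l e = 1) {y z : E} {r s : ℝ} (hz : z ∈ slab l e y r) (hs : |s| < r) :
    (z - l z • e) + s • e ∈ slab l e y r := by
  have h1 : l ((z - l z • e) + s • e) = s := by simp [he]
  refine ⟨by rwa [h1], ?_⟩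
  rw [h1, add_sub_cancel_right]
  exact hz.2

/-- A smooth map whose derivative along `e` is a Hamiltonian vector field, starting from conormal
data of unit energy on the hyperplane `ℓ = 0`. -/
structure IsHamiltonianFlowout (l : E →L[ℝ] ℝ) (e : E) (A : E → (E →L[ℝ] ℝ) →L[ℝ] E) (y : E)
    (r : ℝ) (F : E → E × (E →L[ℝ] ℝ)) : Prop where
  smooth : ContDiffOn ℝ ∞ F (slab l e y r)
  deriv : ∀ z ∈ slab l e y r, 0 ≤ l z → fderiv ℝ F z e = hamiltonField A (F z)
  fst_eq : ∀ z ∈ slab l e y r, l z = 0 → (F z).1 = z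
  snd_eq : ∀ z ∈ slab l e y r, l z = 0 → ∀ v, l v = 0 → (F z).2 v = 0
  energy : ∀ z ∈ slab l e y r, l z = 0 → (F z).2 (A (F z).1 (F z).2) = 1
  snd_pos : 0 < l (A y (F y).2)

/-- Start at each point `x` of the hyperplane with the covector `ℓ / √(ℓ(A ℓ))`, which is conormal
and of unit energy, and follow the Hamiltonian flow for the time `ℓ z`. The field is multiplied by a
bump function because flows are available for compactly supported fields. -/
lemma exists_hamiltonianFlowout (he : l e = 1) {A : E → (E →L[ℝ] ℝ) →L[ℝ] E}
    (hA : ContDiff ℝ ∞ A) {y : E} (hy : l y = 0) (hpos : 0 < l (A y l)) :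
    ∃ r F, 0 < r ∧ IsHamiltonianFlowout l e A y r F := by
  let P₀ : E → (E →L[ℝ] ℝ) := fun x => (√(l (A x l)))⁻¹ • l
  let z₀ : E × (E →L[ℝ] ℝ) := (y, P₀ y)
  obtain ⟨χ⟩ : Nonempty (ContDiffBump z₀) := ⟨⟨1, 2, by norm_num, by norm_num⟩⟩
  have hf : ContDiff ℝ ∞ fun z => χ z • hamiltonField A z :=
    χ.contDiff.smul (contDiff_hamiltonField hA)
  have hc : HasCompactSupport fun z => χ z • hamiltonField A z := χ.hasCompactSupport.smul_right
  obtain ⟨η, φ, hη, hφ, hflow⟩ := exists_smooth_flow hf hc z₀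
  have hqc : Continuous fun x => l (A x l) :=
    l.continuous.comp (hA.continuous.clm_apply continuous_const)
  have hqs : ContDiff ℝ ∞ fun x => l (A x l) :=
    l.contDiff.comp (hA.clm_apply contDiff_const)
  have hP₀ : ContDiffOn ℝ ∞ P₀ {x | 0 < l (A x l)} := by
    intro x hx
    have hx : 0 < l (A x l) := hx
    exact (((hqs.contDiffAt.sqrt hx.ne').inv (Real.sqrt_pos.2 hx).ne').smul
      contDiffAt_const).contDiffWithinAt
  let π : E → E := fun z => z - l z • e
  have hπ : ContDiff ℝ ∞ π := contDiff_id.sub (l.contDiff.smul contDiff_const)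
  have hπy : π y = y := by simp [π, hy]
  let G : E → ℝ × (E × (E →L[ℝ] ℝ)) := fun z => (l z, (π z, P₀ (π z)))
  have hGy : G y = (0, z₀) := by simp [G, hπy, z₀, hy]
  let D : Set E := {z | 0 < l (A (π z) l)}
  have hD : IsOpen D := isOpen_lt continuous_const (hqc.comp hπ.continuous)
  have hyD : y ∈ D := by change 0 < l (A (π y) l); rwa [hπy]
  have hG : ContDiffOn ℝ ∞ G D := l.contDiff.contDiffOn.prodMk
    (hπ.contDiffOn.prodMk (hP₀.comp hπ.contDiffOn fun z hz => hz))
  have hGc : ContinuousAt G y := hG.continuousOn.continuousAt (hD.mem_nhds hyD)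
  let B : Set (ℝ × (E × (E →L[ℝ] ℝ))) := Ioo (-η) η ×ˢ Metric.ball z₀ η
  have hB : IsOpen B := isOpen_Ioo.prod Metric.isOpen_ball
  have h0B : (0, z₀) ∈ B := ⟨⟨by linarith, hη⟩, Metric.mem_ball_self hη⟩
  have hφ0 : φ (0, z₀) = z₀ := (hflow z₀ (Metric.mem_ball_self hη)).1
  have hφc : ContinuousAt φ (0, z₀) := hφ.continuousOn.continuousAt (hB.mem_nhds h0B)
  have hFc : ContinuousAt (fun z => φ (G z)) y :=
    ContinuousAt.comp (g := φ) (by rw [hGy]; exact hφc) hGc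
  -- The slab is taken so small that the flow stays where the bump function is `1`, so the cut-off
  -- field is the Hamiltonian field.
  have hev : ∀ᶠ z in 𝓝 y, z ∈ D ∧ G z ∈ B ∧ φ (G z) ∈ Metric.ball z₀ χ.rIn := by
    refine (hD.eventually_mem hyD).and ((hGc.eventually_mem ?_).and (hFc.eventually_mem ?_))
    · rw [hGy]; exact hB.mem_nhds h0B
    · rw [hGy, hφ0]; exact Metric.ball_mem_nhds _ χ.rIn_pos
  obtain ⟨r, hr, hsub⟩ := exists_slab_subset (l := l) (e := e) hy hev
  have hsm : ContDiffOn ℝ ∞ (fun z => φ (G z)) (slab l e y r) :=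
    hφ.comp (hG.mono fun z hz => (hsub hz).1) fun z hz => (hsub hz).2.1
  have hF0 : ∀ z ∈ slab l e y r, l z = 0 → φ (G z) = (z, P₀ z) := by
    intro z hz hlz
    have hπz : π z = z := by simp [π, hlz]
    have hb := (hsub hz).2.1.2
    have := (hflow _ hb).1
    change φ (l z, G z |>.2) = _
    rw [hlz, this]
    simp [G, hπz]
  refine ⟨r, fun z => φ (G z), hr, hsm, ?_, ?_, ?_, ?_, ?_⟩
  · intro z hz hlz
    have hGz := (hsub hz).2.1
    have h1 := (hflow _ hGz.2).2 (l z) ⟨hlz, hGz.1.2⟩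
    have hd : DifferentiableAt ℝ (fun z => φ (G z)) z :=
      (hsm.contDiffAt ((isOpen_slab y r).mem_nhds hz)).differentiableAt (by simp)
    have h2 : HasDerivAt (fun s : ℝ => φ (G (z + s • e))) (fderiv ℝ (fun z => φ (G z)) z e) 0 := by
      have h3 : HasDerivAt (fun s : ℝ => z + s • e) e 0 := by
        simpa using ((hasDerivAt_id (0 : ℝ)).smul_const e).const_add z
      have h4 : HasFDerivAt (fun z => φ (G z)) (fderiv ℝ (fun z => φ (G z)) z)
        ((fun s : ℝ => z + s • e) 0) := by simpa using hd.hasFDerivAt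
      exact h4.comp_hasDerivAt (0 : ℝ) h3
    have h5 : (fun s : ℝ => φ (G (z + s • e))) = fun s : ℝ => φ (l z + s, (G z).2) := by
      funext s
      have : π (z + s • e) = π z := by
        simp only [π, map_add, map_smul, he, smul_eq_mul, mul_one, add_smul]; abel
      simp [G, this, he]
    rw [h5] at h2
    have h6 : HasDerivAt (fun s : ℝ => φ (l z + s, (G z).2))
        (χ (φ (G z)) • hamiltonField A (φ (G z))) 0 := by
      have h7 : HasDerivAt (fun s => φ (s, (G z).2)) (χ (φ (G z)) • hamiltonField A (φ (G z)))
        (l z + 0) := by rw [add_zero]; exact h1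
      exact h7.comp_const_add (l z) 0
    rw [h2.unique h6, χ.one_of_mem_closedBall (Metric.ball_subset_closedBall (hsub hz).2.2),
      one_smul]
  · intro z hz hlz
    rw [hF0 z hz hlz]
  · intro z hz hlz v hv
    rw [hF0 z hz hlz]
    simp [P₀, hv]
  · intro z hz hlz
    rw [hF0 z hz hlz]
    have hD := (hsub hz).1
    have hπz : π z = z := by simp [π, hlz]
    have hD : 0 < l (A z l) := by have h : 0 < l (A (π z) l) := hD; rwa [hπz] at h
    simp only [P₀, map_smul, smul_apply, smul_eq_mul]
    rw [← mul_assoc, ← mul_inv, Real.mul_self_sqrt hD.le, inv_mul_cancel₀ hD.ne']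
  · have hyS : y ∈ slab l e y r := ⟨by simpa [hy] using hr, by simpa [hy] using hr⟩
    change 0 < l (A y (φ (G y)).2)
    rw [hF0 y hyS hy]
    simp only [P₀, map_smul, smul_eq_mul]
    exact mul_pos (inv_pos.2 (Real.sqrt_pos.2 hpos)) hpos

namespace IsHamiltonianFlowout

variable {A : E → (E →L[ℝ] ℝ) →L[ℝ] E} {y : E} {r : ℝ} {F : E → E × (E →L[ℝ] ℝ)}

lemma contDiffAt (h : IsHamiltonianFlowout l e A y r F) {z : E} (hz : z ∈ slab l e y r) :
    ContDiffAt ℝ ∞ F z := h.smooth.contDiffAt ((isOpen_slab y r).mem_nhds hz)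

/-- A function on a slab that is constant along `e` in the half space agrees with its value on the
hyperplane. -/
lemma eq_of_fderiv_eq_zero (he : l e = 1) {f : E → ℝ}
    (hf : ∀ z ∈ slab l e y r, 0 ≤ l z → HasDerivAt (fun s : ℝ => f (z + s • e)) 0 0) {z : E}
    (hz : z ∈ slab l e y r) (hlz : 0 ≤ l z) : f z = f (z - l z • e) := by
  have hr : |l z| < r := hz.1
  rw [abs_of_nonneg hlz] at hr
  have hd : ∀ s ∈ Icc 0 (l z), HasDerivAt (fun s : ℝ => f ((z - l z • e) + s • e)) 0 s := by
    intro s hs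
    have hs' : |s| < r := by rw [abs_of_nonneg hs.1]; exact hs.2.trans_lt hr
    have h1 := hf _ (slab_line he hz hs') (by simp [he]; exact hs.1)
    have h2 : HasDerivAt (fun s' : ℝ => f ((z - l z • e) + s • e + (s' - s) • e)) 0 s := by
      have h3 : HasDerivAt (fun s' : ℝ => f ((z - l z • e) + s • e + s' • e)) 0 (s - s) := by
        rwa [sub_self]
      exact h3.comp_sub_const s s
    refine h2.congr_of_eventuallyEq (.of_forall fun s' => ?_)
    change f _ = f _
    congr 1
    rw [sub_smul]; abel
  have := constant_of_has_deriv_right_zero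
    (fun s hs => (hd s hs).continuousAt.continuousWithinAt)
    (fun s hs => (hd s ⟨hs.1, hs.2.le⟩).hasDerivWithinAt) (l z) ⟨hlz, le_rfl⟩
  simpa using this

lemma hasFDerivAt_energy (hA : ContDiff ℝ ∞ A)
    (hsym : ∀ x (p q : E →L[ℝ] ℝ), p (A x q) = q (A x p)) (h : IsHamiltonianFlowout l e A y r F) {z : E}
    (hz : z ∈ slab l e y r) (v : E) :
    HasDerivAt (fun s : ℝ => (F (z + s • v)).2 (A (F (z + s • v)).1 (F (z + s • v)).2))
      (2 * (fderiv ℝ F z v).2 (A (F z).1 (F z).2) +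
        (F z).2 (fderiv ℝ A (F z).1 (fderiv ℝ F z v).1 (F z).2)) 0 := by
  have h1 : HasDerivAt (fun s : ℝ => F (z + s • v)) (fderiv ℝ F z v) 0 :=
    hasDerivAt_line ((h.contDiffAt hz).differentiableAt (by simp)) v
  have hz0 : z + (0 : ℝ) • v = z := by simp
  have hX : HasDerivAt (fun s : ℝ => (F (z + s • v)).1) (fderiv ℝ F z v).1 0 := hasDerivAt_prod_fst h1
  have hP : HasDerivAt (fun s : ℝ => (F (z + s • v)).2) (fderiv ℝ F z v).2 0 := hasDerivAt_prod_snd h1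
  have hAX : HasDerivAt (fun s : ℝ => A (F (z + s • v)).1)
      (fderiv ℝ A (F z).1 (fderiv ℝ F z v).1) 0 := by
    have h5 : HasFDerivAt A (fderiv ℝ A (F z).1) ((fun s : ℝ => (F (z + s • v)).1) 0) := by
      simpa using (hA.differentiable (by simp) (F z).1).hasFDerivAt
    exact h5.comp_hasDerivAt (0 : ℝ) hX
  have h6 := hP.clm_apply (hAX.clm_apply hP)
  refine h6.congr_deriv ?_
  simp only [hz0, map_add]
  rw [hsym (F z).1 (F z).2 (fderiv ℝ F z v).2]
  ring

/-- Conservation of energy: Hamilton's equations make the two terms in the derivative of `p(A(x) p)`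
cancel. -/
lemma energy_eq (he : l e = 1) (hA : ContDiff ℝ ∞ A)
    (hsym : ∀ x (p q : E →L[ℝ] ℝ), p (A x q) = q (A x p)) (h : IsHamiltonianFlowout l e A y r F) {z : E}
    (hz : z ∈ slab l e y r) (hlz : 0 ≤ l z) : (F z).2 (A (F z).1 (F z).2) = 1 := by
  have h1 := eq_of_fderiv_eq_zero he (f := fun z => (F z).2 (A (F z).1 (F z).2))
    (fun z hz hlz => by
      have h2 := h.hasFDerivAt_energy hA hsym hz e
      refine h2.congr_deriv ?_
      rw [h.deriv z hz hlz]
      simp [hamiltonField]) hz hlz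
  rw [h1]
  have hr : (0 : ℝ) < r := (abs_nonneg _).trans_lt hz.1
  have h3 := slab_line he hz (s := 0) (by simpa using hr)
  rw [zero_smul, add_zero] at h3
  exact h.energy _ h3 (by simp [he])

lemma slab_add {z v : E} (hz : z ∈ slab l e y r) :
    ∀ᶠ s : ℝ in 𝓝 0, z + s • v ∈ slab l e y r := by
  have hc : Continuous fun s : ℝ => z + s • v := by fun_prop
  exact hc.continuousAt.eventually_mem ((isOpen_slab y r).mem_nhds (by simpa using hz))

/-- The Gauss lemma: the covector of the flowout annihilates the images of horizontal vectors. -/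
lemma snd_fderiv_eq_zero (he : l e = 1) (hA : ContDiff ℝ ∞ A)
    (hsym : ∀ x (p q : E →L[ℝ] ℝ), p (A x q) = q (A x p)) (h : IsHamiltonianFlowout l e A y r F) {z v : E}
    (hv : l v = 0) (hz : z ∈ slab l e y r) (hlz : 0 ≤ l z) :
    (F z).2 (fderiv ℝ F z v).1 = 0 := by
  -- Write `F = (x, p)`. The derivative of `p(∂ᵥx)` along `e` is `∂ₑp(∂ᵥx) + p(∂ᵥ∂ₑx)`. After
  -- Hamilton's equations are inserted this is half the `v`-derivative of the energy, and the energy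
  -- is constant.
  have h1 := eq_of_fderiv_eq_zero he (f := fun z => (F z).2 (fderiv ℝ F z v).1)
    (fun z hz hlz => by
      have hF : HasDerivAt (fun s : ℝ => F (z + s • e)) (fderiv ℝ F z e) 0 :=
        hasDerivAt_line ((h.contDiffAt hz).differentiableAt (by simp)) e
      have hd2 : DifferentiableAt ℝ (fderiv ℝ F) z :=
        ((h.contDiffAt hz).fderiv_right (m := ∞) (by simp)).differentiableAt (by simp)
      have hline : ∀ w : E, HasDerivAt (fun s : ℝ => fderiv ℝ F (z + s • w))
          (fderiv ℝ (fderiv ℝ F) z w) 0 := fun w => hasDerivAt_line hd2 w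
      have hsymm : fderiv ℝ (fderiv ℝ F) z e v = fderiv ℝ (fderiv ℝ F) z v e :=
        ((h.contDiffAt hz).isSymmSndFDerivAt (by simpa using two_le_infty)) e v
      have hz0 : ∀ w : E, z + (0 : ℝ) • w = z := fun w => by simp
      -- the mixed derivative of the first component
      have hmix : (fderiv ℝ (fderiv ℝ F) z v e).1 = fderiv ℝ A (F z).1 (fderiv ℝ F z v).1 (F z).2
          + A (F z).1 (fderiv ℝ F z v).2 := by
        have h5 : HasDerivAt (fun s : ℝ => (fderiv ℝ F (z + s • v) e).1)
            (fderiv ℝ (fderiv ℝ F) z v e).1 0 := by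
          have := (hline v).clm_apply (hasDerivAt_const (0 : ℝ) e)
          simpa using hasDerivAt_prod_fst this
        have hFv : HasDerivAt (fun s : ℝ => F (z + s • v)) (fderiv ℝ F z v) 0 :=
          hasDerivAt_line ((h.contDiffAt hz).differentiableAt (by simp)) v
        have hAX : HasDerivAt (fun s : ℝ => A (F (z + s • v)).1)
            (fderiv ℝ A (F z).1 (fderiv ℝ F z v).1) 0 := by
          have h5 : HasFDerivAt A (fderiv ℝ A (F z).1) ((fun s : ℝ => (F (z + s • v)).1) 0) := by
            simpa using (hA.differentiable (by simp) (F z).1).hasFDerivAt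
          exact h5.comp_hasDerivAt (0 : ℝ) (hasDerivAt_prod_fst hFv)
        have h6 := hAX.clm_apply (hasDerivAt_prod_snd hFv)
        simp only [hz0] at h6
        refine h5.unique (h6.congr_of_eventuallyEq ?_)
        filter_upwards [slab_add hz (v := v)] with s hs
        rw [h.deriv _ hs (by simpa [hv] using hlz)]
        rfl
      have h7 := (hasDerivAt_prod_snd hF).clm_apply
        (hasDerivAt_prod_fst ((hline e).clm_apply (hasDerivAt_const (0 : ℝ) v)))
      have h8 := h.hasFDerivAt_energy hA hsym hz v
      have h9 : HasDerivAt (fun s : ℝ => (F (z + s • v)).2 (A (F (z + s • v)).1 (F (z + s • v)).2))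
          0 0 := by
        refine (hasDerivAt_const (0 : ℝ) (1 : ℝ)).congr_of_eventuallyEq ?_
        filter_upwards [slab_add hz (v := v)] with s hs
        exact h.energy_eq he hA hsym hs (by simpa [hv] using hlz)
      have h10 := h8.unique h9
      refine h7.congr_deriv ?_
      simp only [hz0, map_zero, add_zero]
      rw [hsymm, hmix, h.deriv z hz hlz, map_add, hsym (F z).1 (F z).2 (fderiv ℝ F z v).2]
      simp only [hamiltonField, smul_apply, ContinuousLinearMap.comp_apply,
        ContinuousLinearMap.flip_apply, smul_eq_mul]
      linarith) hz hlz
  rw [h1]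
  have hr : (0 : ℝ) < r := (abs_nonneg _).trans_lt hz.1
  have h3 := slab_line he hz (s := 0) (by simpa using hr)
  rw [zero_smul, add_zero] at h3
  set z' := z - l z • e
  have hlz' : l z' = 0 := by simp [z', he]
  have h4 : (fderiv ℝ F z' v).1 = v := by
    have hFv : HasDerivAt (fun s : ℝ => F (z' + s • v)) (fderiv ℝ F z' v) 0 :=
      hasDerivAt_line ((h.contDiffAt h3).differentiableAt (by simp)) v
    have h5 : HasDerivAt (fun s : ℝ => z' + s • v) v 0 := by
      simpa using ((hasDerivAt_id (0 : ℝ)).smul_const v).const_add z'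
    refine (hasDerivAt_prod_fst hFv).unique (h5.congr_of_eventuallyEq ?_)
    filter_upwards [slab_add h3 (v := v)] with s hs
    exact h.fst_eq _ hs (by simp [hlz', hv])
  rw [h4]
  exact h.snd_eq _ h3 hlz' v hv

end IsHamiltonianFlowout

/-- Fermi coordinates for the eikonal equation `p(A p) = 1` with respect to the hyperplane `ℓ = 0`:
in the coordinates `Ψ`, the function `ℓ ∘ Ψ⁻¹` solves the equation. -/
theorem exists_fermi_chart (he : l e = 1) {A : E → (E →L[ℝ] ℝ) →L[ℝ] E}
    (hA : ContDiff ℝ ∞ A) (hsym : ∀ x (p q : E →L[ℝ] ℝ), p (A x q) = q (A x p)) {y : E}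
    (hy : l y = 0) (hpos : 0 < l (A y l)) {O : Set E} (hO : IsOpen O) (hyO : y ∈ O) :
    ∃ Ψ : OpenPartialHomeomorph E E, y ∈ Ψ.source ∧ Ψ.target ⊆ O ∧
      ContDiffOn ℝ ∞ Ψ Ψ.source ∧ ContDiffOn ℝ ∞ Ψ.symm Ψ.target ∧
      (∀ z ∈ Ψ.source, l z = 0 → Ψ z = z) ∧ (∀ z ∈ Ψ.source, 0 < l z → 0 < l (Ψ z)) ∧
      (∀ z ∈ Ψ.source, l z < 0 → l (Ψ z) < 0) ∧
      ∀ z ∈ Ψ.source, 0 ≤ l z → ∃ p : E →L[ℝ] ℝ,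
        HasFDerivAt (fun x => l (Ψ.symm x)) p (Ψ z) ∧ fderiv ℝ Ψ z e = A (Ψ z) p ∧
        p (A (Ψ z) p) = 1 := by
  obtain ⟨r, F, hr, h⟩ := exists_hamiltonianFlowout he hA hy hpos
  have hyS : y ∈ slab l e y r := ⟨by simpa [hy] using hr, by simpa [hy] using hr⟩
  let X : E → E := fun z => (F z).1
  have hX : ContDiffOn ℝ ∞ X (slab l e y r) := h.smooth.fst
  have hXd : ∀ z ∈ slab l e y r, HasFDerivAt X
      ((ContinuousLinearMap.fst ℝ E (E →L[ℝ] ℝ)).comp (fderiv ℝ F z)) z := fun z hz =>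
    (ContinuousLinearMap.fst ℝ E (E →L[ℝ] ℝ)).hasFDerivAt.comp z
      ((h.contDiffAt hz).differentiableAt (by simp)).hasFDerivAt
  have hXe : ∀ z ∈ slab l e y r, 0 ≤ l z → fderiv ℝ X z e = A (X z) (F z).2 := by
    intro z hz hlz
    rw [(hXd z hz).fderiv, ContinuousLinearMap.comp_apply, h.deriv z hz hlz]
    rfl
  have hXv : ∀ z ∈ slab l e y r, l z = 0 → ∀ v, l v = 0 → fderiv ℝ X z v = v := by
    intro z hz hlz v hv
    have h1 := hasDerivAt_line (hXd z hz).differentiableAt v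
    have h5 : HasDerivAt (fun s : ℝ => z + s • v) v 0 := by
      simpa using ((hasDerivAt_id (0 : ℝ)).smul_const v).const_add z
    refine h1.unique (h5.congr_of_eventuallyEq ?_)
    filter_upwards [IsHamiltonianFlowout.slab_add hz (v := v)] with s hs
    exact h.fst_eq _ hs (by simp [hlz, hv])
  have hXy : X y = y := h.fst_eq y hyS hy
  have hpe : 0 < l (fderiv ℝ X y e) := by
    rw [hXe y hyS hy.ge, hXy]; exact h.snd_pos
  -- the derivative at `y` is invertible
  have hinj : Function.Injective (fderiv ℝ X y : E →ₗ[ℝ] E) := by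
    refine (injective_iff_map_eq_zero _).2 fun v hv => ?_
    have hv' : fderiv ℝ X y v = 0 := hv
    have h1 : v = (v - l v • e) + l v • e := by abel
    have h2 := hXv y hyS hy (v - l v • e) (by simp [he])
    rw [h1, map_add, h2, map_smul] at hv'
    have h3 := congrArg l hv'
    simp only [map_add, map_sub, map_smul, he, smul_eq_mul, mul_one, sub_self, zero_add,
      map_zero] at h3
    have h4 : l v = 0 := (mul_eq_zero.1 h3).resolve_right hpe.ne'
    rw [h4] at hv'
    simpa using hv'
  let T : E ≃L[ℝ] E := (LinearEquiv.ofInjectiveEndo _ hinj).toContinuousLinearEquiv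
  have hT : HasFDerivAt X (T : E →L[ℝ] E) y := by
    have : (T : E →L[ℝ] E) = fderiv ℝ X y := by ext v; rfl
    rw [this]; exact (hXd y hyS).differentiableAt.hasFDerivAt
  have hfc : ContinuousOn (fun z => l (fderiv ℝ X z e)) (slab l e y r) :=
    l.continuous.comp_continuousOn
      ((hX.continuousOn_fderiv_of_isOpen (isOpen_slab y r) (by simp)).clm_apply continuousOn_const)
  have hev : ∀ᶠ z in 𝓝 y, z ∈ slab l e y r ∧ 0 < l (fderiv ℝ X z e) ∧ X z ∈ O := by
    have hn := (isOpen_slab (l := l) (e := e) y r).mem_nhds hyS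
    refine (Filter.Eventually.and hn) (((hfc.continuousAt hn).eventually_mem
      (isOpen_Ioi.mem_nhds hpe)).and ((hX.continuousOn.continuousAt hn).eventually_mem ?_))
    rw [hXy]; exact hO.mem_nhds hyO
  obtain ⟨r', hr', hsub⟩ := exists_slab_subset (l := l) (e := e) hy hev
  have hyS' : y ∈ slab l e y r' := ⟨by simpa [hy] using hr', by simpa [hy] using hr'⟩
  obtain ⟨Ψ, hyΨ, hΨs, hΨX, hsymm⟩ := exists_smooth_openPartialHomeomorph (isOpen_slab y r') hyS'
    (hX.mono fun z hz => (hsub hz).1) T hT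
  have hΨX' : (Ψ : E → E) = X := funext hΨX
  -- the sign of `ℓ` is preserved
  have hmono : ∀ z ∈ slab l e y r', StrictMonoOn (fun s : ℝ => l (X ((z - l z • e) + s • e)))
      (Ioo (-r') r') := by
    intro z hz
    have hd : ∀ s ∈ Ioo (-r') r', HasDerivAt (fun s : ℝ => l (X ((z - l z • e) + s • e)))
        (l (fderiv ℝ X ((z - l z • e) + s • e) e)) s := by
      intro s hs
      have hs' := slab_line he hz (s := s) (abs_lt.2 hs)
      have h1 := hasDerivAt_line (hXd _ (hsub hs').1).differentiableAt e
      have h2 : HasDerivAt (fun s' : ℝ => X ((z - l z • e) + s • e + (s' - s) • e))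
          (fderiv ℝ X ((z - l z • e) + s • e) e) s := by
        have h3 : HasDerivAt (fun s' : ℝ => X ((z - l z • e) + s • e + s' • e))
          (fderiv ℝ X ((z - l z • e) + s • e) e) (s - s) := by rwa [sub_self]
        exact h3.comp_sub_const s s
      have h4 := l.hasFDerivAt.comp_hasDerivAt s h2
      refine h4.congr_of_eventuallyEq (.of_forall fun s' => ?_)
      change l (X _) = l (X _)
      congr 2
      rw [sub_smul]; abel
    refine strictMonoOn_of_deriv_pos (convex_Ioo _ _)
      (fun s hs => (hd s hs).continuousAt.continuousWithinAt) fun s hs => ?_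
    rw [interior_Ioo] at hs
    rw [(hd s hs).deriv]
    exact (hsub (slab_line he hz (s := s) (abs_lt.2 hs))).2.1
  have hzero : ∀ z ∈ slab l e y r', l (X ((z - l z • e) + (0 : ℝ) • e)) = 0 := by
    intro z hz
    have h1 := slab_line he hz (s := 0) (by simpa using hr')
    have h2 : l ((z - l z • e) + (0 : ℝ) • e) = 0 := by simp [he]
    have h3 : X ((z - l z • e) + (0 : ℝ) • e) = _ := h.fst_eq _ (hsub h1).1 h2
    rw [h3, h2]
  have hback : ∀ z, (z - l z • e) + l z • e = z := fun z => by abel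
  refine ⟨Ψ, hyΨ, fun x hx => ?_, ?_, hsymm, ?_, ?_, ?_, ?_⟩
  · have h1 := Ψ.map_target hx
    rw [← Ψ.right_inv hx, hΨX]
    exact (hsub (hΨs h1)).2.2
  · rw [hΨX']; exact hX.mono fun z hz => (hsub (hΨs hz)).1
  · intro z hz hlz
    rw [hΨX]; exact h.fst_eq z (hsub (hΨs hz)).1 hlz
  · intro z hz hlz
    have h1 := hmono z (hΨs hz) ⟨by linarith, hr'⟩ (abs_lt.1 (hΨs hz).1) hlz
    simp only [hzero z (hΨs hz), hback] at h1
    rwa [hΨX]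
  · intro z hz hlz
    have h1 := hmono z (hΨs hz) (abs_lt.1 (hΨs hz).1) ⟨by linarith, hr'⟩ hlz
    simp only [hzero z (hΨs hz), hback] at h1
    rwa [hΨX]
  · intro z hz hlz
    have hzS := (hsub (hΨs hz)).1
    have hz' : Ψ.symm (Ψ z) = z := Ψ.left_inv hz
    have hE := h.energy_eq he hA hsym hzS hlz
    refine ⟨(F z).2, ?_, ?_, ?_⟩
    · have hd1 : DifferentiableAt ℝ Ψ.symm (Ψ z) :=
        (hsymm.contDiffAt (Ψ.open_target.mem_nhds (Ψ.map_source hz))).differentiableAt (by simp)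
      have hd2 : HasFDerivAt Ψ (fderiv ℝ X z) z := by
        rw [hΨX']; exact (hXd z hzS).differentiableAt.hasFDerivAt
      have hid : (fderiv ℝ X z).comp (fderiv ℝ Ψ.symm (Ψ z)) = ContinuousLinearMap.id ℝ E := by
        have h1 : HasFDerivAt (fun x => Ψ (Ψ.symm x))
            ((fderiv ℝ X z).comp (fderiv ℝ Ψ.symm (Ψ z))) (Ψ z) := by
          have h2 : HasFDerivAt Ψ (fderiv ℝ X z) (Ψ.symm (Ψ z)) := by rwa [hz']
          exact h2.comp (Ψ z) hd1.hasFDerivAt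
        refine h1.unique ((hasFDerivAt_id (Ψ z)).congr_of_eventuallyEq ?_)
        filter_upwards [Ψ.open_target.mem_nhds (Ψ.map_source hz)] with x hx
        exact Ψ.right_inv hx
      -- The Gauss lemma handles horizontal vectors and unit energy handles `e`. So `p` is the
      -- differential of `ℓ ∘ Ψ⁻¹`, and the eikonal equation becomes conservation of energy.
      have hPl : (F z).2.comp (fderiv ℝ X z) = l := by
        ext v
        have h1 : v = (v - l v • e) + l v • e := by abel
        have h2 := h.snd_fderiv_eq_zero he hA hsym (v := v - l v • e) (by simp [he]) hzS hlz
        have h3 : fderiv ℝ X z (v - l v • e) = (fderiv ℝ F z (v - l v • e)).1 := by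
          rw [(hXd z hzS).fderiv]; rfl
        rw [ContinuousLinearMap.comp_apply]
        conv_lhs => rw [h1, map_add, map_add, h3, h2, map_smul, map_smul, hXe z hzS hlz]
        change 0 + l v • (F z).2 (A (F z).1 (F z).2) = l v
        rw [hE]; simp
      have h4 := l.hasFDerivAt.comp (Ψ z) hd1.hasFDerivAt
      rw [← hPl, ContinuousLinearMap.comp_assoc, hid, ContinuousLinearMap.comp_id, hPl] at h4
      exact h4
    · rw [hΨX']; exact hXe z hzS hlz
    · rw [hΨX]; exact hE

end Eikonal

/-! ### Metric coefficients in charts -/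

section Charts

variable {n : ℕ} [NeZero n] {M : Type*} [TopologicalSpace M]
  [ChartedSpace (EuclideanHalfSpace n) M] [IsManifold (𝓡∂ n) ∞ M]

lemma uniqueDiffOn_range : UniqueDiffOn ℝ (range (𝓡∂ n)) := (𝓡∂ n).uniqueDiffOn

lemma target_mem_nhdsWithin (c : M) {y : Coord n} (hy : y ∈ (extChartAt (𝓡∂ n) c).target) :
    (extChartAt (𝓡∂ n) c).target ∈ 𝓝[range (𝓡∂ n)] y :=
  extChartAt_target_mem_nhdsWithin_of_mem hy

lemma target_subset_range (c : M) : (extChartAt (𝓡∂ n) c).target ⊆ range (𝓡∂ n) :=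
  extChartAt_target_subset_range c

lemma contMDiffOn_coordVec (c : M) (i : Fin n) :
    ContMDiffOn 𝓘(ℝ, Coord n) (𝓡∂ n).tangent ∞
      (fun y => (⟨(extChartAt (𝓡∂ n) c).symm y, coordVec c y i⟩ : TangentBundle (𝓡∂ n) M))
      (extChartAt (𝓡∂ n) c).target := by
  have hu : UniqueMDiffOn 𝓘(ℝ, Coord n) (extChartAt (𝓡∂ n) c).target :=
    (uniqueDiffOn_extChartAt_target c).uniqueMDiffOn
  have h1 : ContMDiffOn 𝓘(ℝ, Coord n).tangent (𝓡∂ n).tangent ∞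
      (tangentMapWithin 𝓘(ℝ, Coord n) (𝓡∂ n) (extChartAt (𝓡∂ n) c).symm
        (extChartAt (𝓡∂ n) c).target)
      (Bundle.TotalSpace.proj ⁻¹' (extChartAt (𝓡∂ n) c).target) :=
    (contMDiffOn_extChartAt_symm (n := ∞) c).contMDiffOn_tangentMapWithin (by simp) hu
  have h2 := (contMDiffOn_vectorSpace_iff_contDiffOn (𝕜 := ℝ) (n := ∞) (E := Coord n)
    (V := fun _ => stdVec i) (s := (extChartAt (𝓡∂ n) c).target)).2 contDiffOn_const
  refine (h1.comp h2 fun y hy => hy).congr fun y hy => ?_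
  have h3 := mfderivWithin_subset (target_subset_range c) (hu y hy)
    ((mdifferentiableWithinAt_extChartAt_symm hy))
  simp only [Function.comp_apply, tangentMapWithin, coordVec]
  rw [h3]

lemma contDiffOn_coordMetric (g : SmoothMetric n M) (c : M) (i j : Fin n) :
    ContDiffOn ℝ ∞ (fun y => coordMetric g c y i j) (extChartAt (𝓡∂ n) c).target := by
  refine contMDiffOn_iff_contDiffOn.1 fun y hy => ?_
  have h1 : ContMDiffWithinAt 𝓘(ℝ, Coord n) ((𝓡∂ n).prod 𝓘(ℝ, ℝ)) ∞
      (fun m => Bundle.TotalSpace.mk' ℝ (E := Bundle.Trivial M ℝ) ((extChartAt (𝓡∂ n) c).symm m)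
        (g.inner ((extChartAt (𝓡∂ n) c).symm m) (coordVec c m i) (coordVec c m j)))
      (extChartAt (𝓡∂ n) c).target y := by
    apply ContMDiffWithinAt.clm_bundle_apply₂ (F₁ := Coord n) (F₂ := Coord n)
    · exact ContMDiffAt.comp_contMDiffWithinAt y g.contMDiff.contMDiffAt
        (contMDiffOn_extChartAt_symm (n := ∞) c y hy)
    · exact contMDiffOn_coordVec c i y hy
    · exact contMDiffOn_coordVec c j y hy
  exact ((Bundle.contMDiffWithinAt_totalSpace ..).1 h1).2

lemma coordMetric_symm (g : SmoothMetric n M) (c : M) (y : Coord n) (i j : Fin n) :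
    coordMetric g c y i j = coordMetric g c y j i := g.symm _ _ _

lemma inner_sum_coordVec (g : SmoothMetric n M) (c : M) (y : Coord n) (v w : Coord n) :
    g.inner ((extChartAt (𝓡∂ n) c).symm y)
      (mfderivWithin 𝓘(ℝ, Coord n) (𝓡∂ n) (extChartAt (𝓡∂ n) c).symm (range (𝓡∂ n)) y v)
      (mfderivWithin 𝓘(ℝ, Coord n) (𝓡∂ n) (extChartAt (𝓡∂ n) c).symm (range (𝓡∂ n)) y w)
      = ∑ i, ∑ j, coordMetric g c y i j * v i * w j := by
  have hexp : ∀ v : Coord n, v = ∑ i, v i • stdVec i := fun v => by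
    have := (EuclideanSpace.basisFun (Fin n) ℝ).sum_repr v
    simpa using this.symm
  let L : Coord n →L[ℝ] Coord n :=
    mfderivWithin 𝓘(ℝ, Coord n) (𝓡∂ n) (extChartAt (𝓡∂ n) c).symm (range (𝓡∂ n)) y
  let B : Coord n →L[ℝ] Coord n →L[ℝ] ℝ := g.inner ((extChartAt (𝓡∂ n) c).symm y)
  have hB : ∀ i j, coordMetric g c y i j = B (L (stdVec i)) (L (stdVec j)) := fun i j => rfl
  simp only [hB]
  change B (L v) (L w) = _
  have h1 : ∀ x : Coord n, B x (L w) = ∑ j, w j * B x (L (stdVec j)) := fun x => by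
    conv_lhs => rw [hexp w]
    simp only [map_sum, map_smul, smul_eq_mul]
  have h2 : B (L v) = ∑ i, v i • B (L (stdVec i)) := by
    conv_lhs => rw [hexp v]
    simp only [map_sum, map_smul]
  rw [h2, sum_apply]
  refine Finset.sum_congr rfl fun i _ => ?_
  rw [smul_apply, h1, smul_eq_mul, Finset.mul_sum]
  refine Finset.sum_congr rfl fun j _ => ?_
  ring

lemma coordMetric_posDef (g : SmoothMetric n M) (c : M) {y : Coord n}
    (hy : y ∈ (extChartAt (𝓡∂ n) c).target) : (coordMetric g c y).PosDef := by
  refine Matrix.PosDef.of_dotProduct_mulVec_pos ?_ fun x hx => ?_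
  · ext i j
    simp only [Matrix.conjTranspose_apply, star_trivial]
    exact coordMetric_symm g c y j i
  · have h1 := inner_sum_coordVec g c y (WithLp.toLp 2 x) (WithLp.toLp 2 x)
    have h2 : star x ⬝ᵥ (coordMetric g c y).mulVec x
        = ∑ i, ∑ j, coordMetric g c y i j * x i * x j := by
      simp only [star_trivial, dotProduct, Matrix.mulVec, Finset.mul_sum]
      exact Finset.sum_congr rfl fun i _ => Finset.sum_congr rfl fun j _ => by ring
    rw [h2]
    refine lt_of_lt_of_eq (g.pos _ _ ?_) h1
    intro h0
    have hinj := (isInvertible_mfderivWithin_extChartAt_symm hy).injective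
    have h3 : (WithLp.toLp 2 x : Coord n) = (0 : Coord n) :=
      hinj (a₁ := (WithLp.toLp 2 x : Coord n)) (a₂ := (0 : Coord n)) (by rw [h0]; exact (map_zero _).symm)
    exact hx (by simpa using congrArg (WithLp.ofLp) h3)

lemma isUnit_det_coordMetric (g : SmoothMetric n M) (c : M) {y : Coord n}
    (hy : y ∈ (extChartAt (𝓡∂ n) c).target) : IsUnit (coordMetric g c y).det :=
  isUnit_iff_ne_zero.2 (coordMetric_posDef g c hy).det_pos.ne'

lemma contDiffOn_det {E : Type*} [NormedAddCommGroup E] [NormedSpace ℝ E] {m : ℕ}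
    {A : E → Matrix (Fin m) (Fin m) ℝ} {s : Set E} {k : ℕ∞ω}
    (hA : ∀ i j, ContDiffOn ℝ k (fun x => A x i j) s) : ContDiffOn ℝ k (fun x => (A x).det) s := by
  simp_rw [Matrix.det_apply']
  exact ContDiffOn.sum fun σ _ => contDiffOn_const.mul (contDiffOn_prod fun i _ => hA _ _)

/-- Cramer's rule: the entries of the inverse are quotients of determinants. -/
lemma contDiffOn_inv {E : Type*} [NormedAddCommGroup E] [NormedSpace ℝ E] {m : ℕ}
    {A : E → Matrix (Fin m) (Fin m) ℝ} {s : Set E} {k : ℕ∞ω}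
    (hA : ∀ i j, ContDiffOn ℝ k (fun x => A x i j) s) (h0 : ∀ x ∈ s, (A x).det ≠ 0) (i j : Fin m) :
    ContDiffOn ℝ k (fun x => (A x)⁻¹ i j) s := by
  have : ∀ x, (A x)⁻¹ i j = (A x).det⁻¹ * ((A x).updateRow j (Pi.single i 1)).det := by
    intro x
    rw [Matrix.inv_def, Ring.inverse_eq_inv', Matrix.smul_apply, Matrix.adjugate_apply, smul_eq_mul]
  simp_rw [this]
  refine ((contDiffOn_det hA).inv h0).mul (contDiffOn_det fun a b => ?_)
  by_cases hj : a = j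
  · subst hj
    simp only [Matrix.updateRow_self]
    exact contDiffOn_const
  · simp only [Matrix.updateRow_ne hj]
    exact hA a b

lemma contDiffOn_coordMetric_inv (g : SmoothMetric n M) (c : M) (i j : Fin n) :
    ContDiffOn ℝ ∞ (fun y => (coordMetric g c y)⁻¹ i j) (extChartAt (𝓡∂ n) c).target :=
  contDiffOn_inv (contDiffOn_coordMetric g c)
    (fun y hy => (coordMetric_posDef g c hy).det_pos.ne') i j

lemma coordMetric_inv_symm (g : SmoothMetric n M) (c : M) (y : Coord n) (i j : Fin n) :
    (coordMetric g c y)⁻¹ i j = (coordMetric g c y)⁻¹ j i := by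
  have h : (coordMetric g c y).transpose = coordMetric g c y := by
    ext a b; exact coordMetric_symm g c y b a
  have h2 : ((coordMetric g c y)⁻¹).transpose = (coordMetric g c y)⁻¹ := by
    rw [Matrix.transpose_nonsing_inv, h]
  exact congrFun (congrFun h2 j) i

lemma sum_inv_mul_coordMetric (g : SmoothMetric n M) (c : M) {y : Coord n}
    (hy : y ∈ (extChartAt (𝓡∂ n) c).target) (i k : Fin n) :
    ∑ j, (coordMetric g c y)⁻¹ i j * coordMetric g c y j k = if i = k then 1 else 0 := by
  have := Matrix.nonsing_inv_mul _ (isUnit_det_coordMetric g c hy)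
  rw [← Matrix.mul_apply, this, Matrix.one_apply]

lemma sum_coordMetric_mul_inv (g : SmoothMetric n M) (c : M) {y : Coord n}
    (hy : y ∈ (extChartAt (𝓡∂ n) c).target) (i k : Fin n) :
    ∑ j, coordMetric g c y i j * (coordMetric g c y)⁻¹ j k = if i = k then 1 else 0 := by
  have := Matrix.mul_nonsing_inv _ (isUnit_det_coordMetric g c hy)
  rw [← Matrix.mul_apply, this, Matrix.one_apply]

lemma contDiffOn_comp_extChartAt_symm {f : M → ℝ} {U : Set M} (hU : IsOpen U)
    (hf : ContMDiffOn (𝓡∂ n) 𝓘(ℝ, ℝ) ∞ f U) (c : M) :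
    ContDiffOn ℝ ∞ (fun y => f ((extChartAt (𝓡∂ n) c).symm y))
      ((extChartAt (𝓡∂ n) c).target ∩ (extChartAt (𝓡∂ n) c).symm ⁻¹' U) :=
  contMDiffOn_iff_contDiffOn.1 (hf.comp
    ((contMDiffOn_extChartAt_symm (n := ∞) c).mono inter_subset_left) fun y hy => hy.2)

/-- A part of a chart domain in the half space that is open relative to the half space. -/
structure IsChartRegion (c : M) (T : Set (Coord n)) : Prop where
  subset : T ⊆ (extChartAt (𝓡∂ n) c).target
  mem_nhds : ∀ y ∈ T, T ∈ 𝓝[range (𝓡∂ n)] y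

lemma isChartRegion_target (c : M) : IsChartRegion c (extChartAt (𝓡∂ n) c).target :=
  ⟨subset_rfl, fun _ hy => target_mem_nhdsWithin c hy⟩

lemma isChartRegion_preimage (c : M) {U : Set M} (hU : IsOpen U) :
    IsChartRegion c ((extChartAt (𝓡∂ n) c).target ∩ (extChartAt (𝓡∂ n) c).symm ⁻¹' U) := by
  refine ⟨inter_subset_left, fun y hy => inter_mem (target_mem_nhdsWithin c hy.1) ?_⟩
  have h := (continuousOn_extChartAt_symm (I := 𝓡∂ n) c y hy.1).mono_of_mem_nhdsWithin
    (target_mem_nhdsWithin c hy.1)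
  exact h.preimage_mem_nhdsWithin (hU.mem_nhds hy.2)

end Charts

section Calculus

variable {n : ℕ} [NeZero n] {M : Type*} [TopologicalSpace M]
  [ChartedSpace (EuclideanHalfSpace n) M] [IsManifold (𝓡∂ n) ∞ M]
  {c : M} {T : Set (Coord n)}

/-! ### Partial derivatives on the half space -/

lemma IsChartRegion.subset_range (hT : IsChartRegion c T) : T ⊆ range (𝓡∂ n) :=
  hT.subset.trans (target_subset_range c)

lemma IsChartRegion.contDiffWithinAt (hT : IsChartRegion c T) {F : Type*} [NormedAddCommGroup F]
    [NormedSpace ℝ F] {f : Coord n → F} (hf : ContDiffOn ℝ ∞ f T)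
    {y : Coord n} (hy : y ∈ T) : ContDiffWithinAt ℝ ∞ f (range (𝓡∂ n)) y :=
  (hf y hy).mono_of_mem_nhdsWithin (hT.mem_nhds y hy)

lemma IsChartRegion.differentiableWithinAt (hT : IsChartRegion c T) {F : Type*}
    [NormedAddCommGroup F] [NormedSpace ℝ F] {f : Coord n → F}
    (hf : ContDiffOn ℝ ∞ f T) {y : Coord n} (hy : y ∈ T) :
    DifferentiableWithinAt ℝ f (range (𝓡∂ n)) y :=
  (hT.contDiffWithinAt hf hy).differentiableWithinAt (by simp)

lemma IsChartRegion.contDiffOn_fderivWithin (hT : IsChartRegion c T) {F : Type*}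
    [NormedAddCommGroup F] [NormedSpace ℝ F] {f : Coord n → F}
    (hf : ContDiffOn ℝ ∞ f T) : ContDiffOn ℝ ∞ (fderivWithin ℝ f (range (𝓡∂ n))) T :=
  fun y hy => ((hT.contDiffWithinAt hf hy).fderivWithin_right uniqueDiffOn_range (m := ∞) (by simp)
    (hT.subset_range hy)).mono hT.subset_range

lemma IsChartRegion.contDiffOn_partialD (hT : IsChartRegion c T) {f : Coord n → ℝ}
    (hf : ContDiffOn ℝ ∞ f T) (i : Fin n) : ContDiffOn ℝ ∞ (partialD f i) T :=
  (hT.contDiffOn_fderivWithin hf).clm_apply contDiffOn_const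

lemma partialD_add {f h : Coord n → ℝ} {y : Coord n} (hy : y ∈ range (𝓡∂ n))
    (hf : DifferentiableWithinAt ℝ f (range (𝓡∂ n)) y)
    (hh : DifferentiableWithinAt ℝ h (range (𝓡∂ n)) y) (i : Fin n) :
    partialD (fun z => f z + h z) i y = partialD f i y + partialD h i y := by
  simp only [partialD]
  rw [fderivWithin_fun_add (uniqueDiffOn_range y hy) hf hh, add_apply]

lemma partialD_mul {f h : Coord n → ℝ} {y : Coord n} (hy : y ∈ range (𝓡∂ n))
    (hf : DifferentiableWithinAt ℝ f (range (𝓡∂ n)) y)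
    (hh : DifferentiableWithinAt ℝ h (range (𝓡∂ n)) y) (i : Fin n) :
    partialD (fun z => f z * h z) i y = partialD f i y * h y + f y * partialD h i y := by
  simp only [partialD]
  rw [fderivWithin_fun_mul (uniqueDiffOn_range y hy) hf hh, add_apply, smul_apply, smul_apply,
    smul_eq_mul, smul_eq_mul]
  ring

lemma partialD_sum {κ : Type*} {s : Finset κ} {f : κ → Coord n → ℝ} {y : Coord n}
    (hy : y ∈ range (𝓡∂ n))
    (hf : ∀ k ∈ s, DifferentiableWithinAt ℝ (f k) (range (𝓡∂ n)) y) (i : Fin n) :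
    partialD (fun z => ∑ k ∈ s, f k z) i y = ∑ k ∈ s, partialD (f k) i y := by
  simp only [partialD]
  rw [fderivWithin_fun_sum (uniqueDiffOn_range y hy) hf, sum_apply]

lemma IsChartRegion.partialD_congr (hT : IsChartRegion c T) {f h : Coord n → ℝ}
    (hfh : EqOn f h T) {y : Coord n} (hy : y ∈ T) (i : Fin n) : partialD f i y = partialD h i y := by
  simp only [partialD]
  rw [Filter.EventuallyEq.fderivWithin_eq (Filter.mem_of_superset (hT.mem_nhds y hy) hfh) (hfh hy)]

lemma IsChartRegion.partialD_sum_mul (hT : IsChartRegion c T) {κ : Type*} [Fintype κ]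
    {f h : κ → Coord n → ℝ} (hf : ∀ k, ContDiffOn ℝ ∞ (f k) T) (hh : ∀ k, ContDiffOn ℝ ∞ (h k) T)
    {y : Coord n} (hy : y ∈ T) (i : Fin n) :
    partialD (fun z => ∑ k, f k z * h k z) i y
      = ∑ k, (partialD (f k) i y * h k y + f k y * partialD (h k) i y) := by
  have hyR := hT.subset_range hy
  rw [partialD_sum (f := fun k z => f k z * h k z) hyR fun k _ =>
    (hT.differentiableWithinAt ((hf k).mul (hh k)) hy)]
  exact Finset.sum_congr rfl fun k _ => partialD_mul hyR (hT.differentiableWithinAt (hf k) hy)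
    (hT.differentiableWithinAt (hh k) hy) i

lemma partialD_const (a : ℝ) (i : Fin n) (y : Coord n) : partialD (fun _ => a) i y = 0 := by
  simp [partialD]

lemma mem_closure_interior_range {y : Coord n} (hy : y ∈ range (𝓡∂ n)) :
    y ∈ closure (interior (range (𝓡∂ n))) :=
  (𝓡∂ n).range_subset_closure_interior hy

/-- Second derivatives within the half space are symmetric also at boundary points, since the half
space lies in the closure of its interior. -/
lemma IsChartRegion.partialD_comm (hT : IsChartRegion c T) {f : Coord n → ℝ}
    (hf : ContDiffOn ℝ ∞ f T) {y : Coord n} (hy : y ∈ T) (i j : Fin n) :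
    partialD (partialD f i) j y = partialD (partialD f j) i y := by
  have hyR := hT.subset_range hy
  have hd := hT.differentiableWithinAt (hT.contDiffOn_fderivWithin hf) hy
  have key : ∀ i j : Fin n, partialD (partialD f i) j y
      = fderivWithin ℝ (fderivWithin ℝ f (range (𝓡∂ n))) (range (𝓡∂ n)) y (stdVec j) (stdVec i) := by
    intro i j
    change fderivWithin ℝ (fun z => fderivWithin ℝ f (range (𝓡∂ n)) z (stdVec i)) _ y (stdVec j) = _
    rw [fderivWithin_clm_apply (uniqueDiffOn_range y hyR) hd (by fun_prop)]
    simp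
  rw [key, key]
  exact ((hT.contDiffWithinAt hf hy).isSymmSndFDerivWithinAt
    (by simpa using two_le_infty) uniqueDiffOn_range
    (mem_closure_interior_range hyR) hyR) _ _

/-! ### Christoffel symbols -/

variable (g : SmoothMetric n M)

lemma IsChartRegion.contDiffOn_coordMetric (hT : IsChartRegion c T) (i j : Fin n) :
    ContDiffOn ℝ ∞ (fun z => coordMetric g c z i j) T :=
  (StaticTriple.contDiffOn_coordMetric g c i j).mono hT.subset

lemma IsChartRegion.contDiffOn_coordMetric_inv (hT : IsChartRegion c T) (i j : Fin n) :
    ContDiffOn ℝ ∞ (fun z => (coordMetric g c z)⁻¹ i j) T :=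
  (StaticTriple.contDiffOn_coordMetric_inv g c i j).mono hT.subset

lemma IsChartRegion.contDiffOn_christoffel (hT : IsChartRegion c T) (k i j : Fin n) :
    ContDiffOn ℝ ∞ (christoffel g c k i j) T := by
  refine contDiffOn_const.mul (ContDiffOn.sum fun l _ =>
    (hT.contDiffOn_coordMetric_inv g k l).mul (((hT.contDiffOn_partialD ?_ _).add
      (hT.contDiffOn_partialD ?_ _)).sub (hT.contDiffOn_partialD ?_ _))) <;>
  exact hT.contDiffOn_coordMetric g _ _

lemma christoffel_symm (k i j : Fin n) (y : Coord n) :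
    christoffel g c k i j y = christoffel g c k j i y := by
  have h : (fun z => coordMetric g c z i j) = fun z => coordMetric g c z j i :=
    funext fun z => coordMetric_symm g c z i j
  unfold christoffel
  congr 1
  refine Finset.sum_congr rfl fun l _ => ?_
  rw [h]
  ring

lemma sum_coordMetric_mul_christoffel {y : Coord n} (hy : y ∈ (extChartAt (𝓡∂ n) c).target)
    (i j k : Fin n) :
    ∑ m, coordMetric g c y k m * christoffel g c m i j y
      = (1 / 2 : ℝ) * (partialD (fun z => coordMetric g c z j k) i y
      + partialD (fun z => coordMetric g c z i k) j y
      - partialD (fun z => coordMetric g c z i j) k y) := by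
  set D : Fin n → ℝ := fun l => partialD (fun z => coordMetric g c z j l) i y
      + partialD (fun z => coordMetric g c z i l) j y
      - partialD (fun z => coordMetric g c z i j) l y with hD
  have h1 : ∀ m, coordMetric g c y k m * christoffel g c m i j y
      = ∑ l, (1 / 2 : ℝ) * ((coordMetric g c y k m * (coordMetric g c y)⁻¹ m l) * D l) := by
    intro m
    unfold christoffel
    rw [Finset.mul_sum, Finset.mul_sum]
    exact Finset.sum_congr rfl fun l _ => by simp only [hD]; ring
  simp_rw [h1]
  rw [Finset.sum_comm]
  simp_rw [← Finset.mul_sum, ← Finset.sum_mul, sum_coordMetric_mul_inv g c hy]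
  simp [hD]

/-- The Levi-Civita connection is compatible with the metric. -/
lemma partialD_coordMetric {y : Coord n} (hy : y ∈ (extChartAt (𝓡∂ n) c).target)
    (k i j : Fin n) :
    partialD (fun z => coordMetric g c z i j) k y
      = ∑ m, coordMetric g c y j m * christoffel g c m k i y
        + ∑ m, coordMetric g c y i m * christoffel g c m k j y := by
  rw [sum_coordMetric_mul_christoffel g hy, sum_coordMetric_mul_christoffel g hy]
  have h : (fun z => coordMetric g c z j i) = fun z => coordMetric g c z i j :=
    funext fun z => coordMetric_symm g c z j i
  rw [h]
  ring

/-- Metric compatibility contracted with the inverse metric. The left side is the logarithmic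
derivative of `det g`, which links the evolution of volumes to divergences. -/
lemma sum_inv_mul_partialD_coordMetric {y : Coord n} (hy : y ∈ (extChartAt (𝓡∂ n) c).target)
    (k : Fin n) :
    ∑ i, ∑ j, (coordMetric g c y)⁻¹ i j * partialD (fun z => coordMetric g c z i j) k y
      = 2 * ∑ i, christoffel g c i i k y := by
  have key : ∑ i, ∑ j, (coordMetric g c y)⁻¹ i j *
      ∑ m, coordMetric g c y j m * christoffel g c m k i y = ∑ i, christoffel g c i i k y := by
    refine Finset.sum_congr rfl fun i _ => ?_
    simp_rw [Finset.mul_sum, ← mul_assoc]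
    rw [Finset.sum_comm]
    simp_rw [← Finset.sum_mul, sum_inv_mul_coordMetric g c hy]
    simp [christoffel_symm g _ k i]
  have key2 : ∑ i, ∑ j, (coordMetric g c y)⁻¹ i j *
      ∑ m, coordMetric g c y i m * christoffel g c m k j y = ∑ i, christoffel g c i i k y := by
    rw [← key, Finset.sum_comm]
    refine Finset.sum_congr rfl fun i _ => Finset.sum_congr rfl fun j _ => ?_
    rw [coordMetric_inv_symm g c y j i]
  simp_rw [partialD_coordMetric g hy, mul_add, Finset.sum_add_distrib]
  rw [key, key2]
  ring

/-! ### Gradient, Hessian and Laplacian -/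

variable {f h : M → ℝ}

lemma IsChartRegion.contDiffOn_coordD (hT : IsChartRegion c T)
    (hf : ContDiffOn ℝ ∞ (fun z => f ((extChartAt (𝓡∂ n) c).symm z)) T) (i : Fin n) :
    ContDiffOn ℝ ∞ (coordD c f i) T := hT.contDiffOn_partialD hf i

lemma IsChartRegion.contDiffOn_gradient (hT : IsChartRegion c T)
    (hf : ContDiffOn ℝ ∞ (fun z => f ((extChartAt (𝓡∂ n) c).symm z)) T) (i : Fin n) :
    ContDiffOn ℝ ∞ (gradient g c f i) T :=
  ContDiffOn.sum fun j _ => (hT.contDiffOn_coordMetric_inv g i j).mul (hT.contDiffOn_coordD hf j)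

lemma IsChartRegion.contDiffOn_hessian (hT : IsChartRegion c T)
    (hf : ContDiffOn ℝ ∞ (fun z => f ((extChartAt (𝓡∂ n) c).symm z)) T) (i j : Fin n) :
    ContDiffOn ℝ ∞ (hessian g c f i j) T :=
  (hT.contDiffOn_partialD (hT.contDiffOn_coordD hf j) i).sub (ContDiffOn.sum fun k _ =>
    (hT.contDiffOn_christoffel g k i j).mul (hT.contDiffOn_coordD hf k))

lemma IsChartRegion.contDiffOn_laplacian (hT : IsChartRegion c T)
    (hf : ContDiffOn ℝ ∞ (fun z => f ((extChartAt (𝓡∂ n) c).symm z)) T) :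
    ContDiffOn ℝ ∞ (laplacian g c f) T :=
  ContDiffOn.sum fun i _ => ContDiffOn.sum fun j _ =>
    (hT.contDiffOn_coordMetric_inv g i j).mul (hT.contDiffOn_hessian g hf i j)

lemma IsChartRegion.contDiffOn_gradNormSq (hT : IsChartRegion c T)
    (hf : ContDiffOn ℝ ∞ (fun z => f ((extChartAt (𝓡∂ n) c).symm z)) T) :
    ContDiffOn ℝ ∞ (gradNormSq g c f) T :=
  ContDiffOn.sum fun i _ => (hT.contDiffOn_gradient g hf i).mul (hT.contDiffOn_coordD hf i)

lemma sum_coordMetric_mul_gradient {y : Coord n} (hy : y ∈ (extChartAt (𝓡∂ n) c).target)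
    (i : Fin n) : ∑ j, coordMetric g c y i j * gradient g c f j y = coordD c f i y := by
  unfold gradient
  simp_rw [Finset.mul_sum, ← mul_assoc]
  rw [Finset.sum_comm]
  simp_rw [← Finset.sum_mul, sum_coordMetric_mul_inv g c hy]
  simp

lemma IsChartRegion.hessian_symm (hT : IsChartRegion c T)
    (hf : ContDiffOn ℝ ∞ (fun z => f ((extChartAt (𝓡∂ n) c).symm z)) T)
    {y : Coord n} (hy : y ∈ T) (i j : Fin n) : hessian g c f i j y = hessian g c f j i y := by
  unfold hessian
  rw [show partialD (coordD c f j) i y = partialD (coordD c f i) j y from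
    hT.partialD_comm hf hy j i]
  simp_rw [christoffel_symm g _ i j]

/-- The covariant derivative `∇ᵢ Zᵏ` of the gradient `Z` of `f`. -/
def covGradient (g : SmoothMetric n M) (c : M) (f : M → ℝ) (i k : Fin n) (y : Coord n) : ℝ :=
  partialD (gradient g c f k) i y + ∑ l, christoffel g c k i l y * gradient g c f l y

lemma IsChartRegion.contDiffOn_covGradient (hT : IsChartRegion c T)
    (hf : ContDiffOn ℝ ∞ (fun z => f ((extChartAt (𝓡∂ n) c).symm z)) T) (i k : Fin n) :
    ContDiffOn ℝ ∞ (covGradient g c f i k) T :=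
  (hT.contDiffOn_partialD (hT.contDiffOn_gradient g hf k) i).add (ContDiffOn.sum fun l _ =>
    (hT.contDiffOn_christoffel g k i l).mul (hT.contDiffOn_gradient g hf l))

/-- Differentiate `gₖⱼ Zʲ = ∂ₖ f` and use that the metric is parallel. -/
lemma IsChartRegion.sum_coordMetric_mul_covGradient (hT : IsChartRegion c T)
    (hf : ContDiffOn ℝ ∞ (fun z => f ((extChartAt (𝓡∂ n) c).symm z)) T)
    {y : Coord n} (hy : y ∈ T) (i k : Fin n) :
    ∑ j, coordMetric g c y k j * covGradient g c f i j y = hessian g c f i k y := by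
  have hyR := hT.subset_range hy
  have hyt := hT.subset hy
  have h1 : partialD (coordD c f k) i y
      = ∑ j, (partialD (fun z => coordMetric g c z k j) i y * gradient g c f j y
        + coordMetric g c y k j * partialD (gradient g c f j) i y) := by
    rw [← hT.partialD_congr (f := fun z => ∑ j, coordMetric g c z k j * gradient g c f j z)
      (fun z hz => sum_coordMetric_mul_gradient g (hT.subset hz) k) hy]
    exact hT.partialD_sum_mul (f := fun j z => coordMetric g c z k j)
      (fun j => hT.contDiffOn_coordMetric g k j) (fun j => hT.contDiffOn_gradient g hf j) hy i
  have h2 : ∑ j, (∑ m, coordMetric g c y j m * christoffel g c m i k y) * gradient g c f j y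
      = ∑ m, christoffel g c m i k y * coordD c f m y := by
    simp_rw [← sum_coordMetric_mul_gradient g hyt, Finset.sum_mul, Finset.mul_sum]
    rw [Finset.sum_comm]
    refine Finset.sum_congr rfl fun m _ => Finset.sum_congr rfl fun j _ => ?_
    rw [coordMetric_symm g c y j m]; ring
  have h3 : ∑ j, (∑ m, coordMetric g c y k m * christoffel g c m i j y) * gradient g c f j y
      = ∑ m, coordMetric g c y k m * ∑ l, christoffel g c m i l y * gradient g c f l y := by
    simp_rw [Finset.sum_mul, Finset.mul_sum]
    rw [Finset.sum_comm]
    exact Finset.sum_congr rfl fun m _ => Finset.sum_congr rfl fun j _ => by ring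
  unfold hessian covGradient
  rw [h1]
  simp_rw [partialD_coordMetric g hyt, add_mul, mul_add, Finset.sum_add_distrib, h2, h3]
  ring

lemma IsChartRegion.covGradient_eq (hT : IsChartRegion c T)
    (hf : ContDiffOn ℝ ∞ (fun z => f ((extChartAt (𝓡∂ n) c).symm z)) T)
    {y : Coord n} (hy : y ∈ T) (i k : Fin n) :
    covGradient g c f i k y = ∑ j, (coordMetric g c y)⁻¹ k j * hessian g c f i j y := by
  simp_rw [← hT.sum_coordMetric_mul_covGradient g hf hy, Finset.mul_sum, ← mul_assoc]
  rw [Finset.sum_comm]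
  simp_rw [← Finset.sum_mul, sum_inv_mul_coordMetric g c (hT.subset hy)]
  simp

lemma IsChartRegion.laplacian_eq (hT : IsChartRegion c T)
    (hf : ContDiffOn ℝ ∞ (fun z => f ((extChartAt (𝓡∂ n) c).symm z)) T)
    {y : Coord n} (hy : y ∈ T) : laplacian g c f y = ∑ k, covGradient g c f k k y := by
  simp_rw [hT.covGradient_eq g hf hy]
  unfold laplacian
  refine Finset.sum_congr rfl fun i _ => Finset.sum_congr rfl fun j _ => ?_
  rfl

/-- Derivative of the inner product `⟨∇f, ∇h⟩` of two gradients. -/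
lemma IsChartRegion.partialD_inner_gradient (hT : IsChartRegion c T)
    (hf : ContDiffOn ℝ ∞ (fun z => f ((extChartAt (𝓡∂ n) c).symm z)) T)
    (hh : ContDiffOn ℝ ∞ (fun z => h ((extChartAt (𝓡∂ n) c).symm z)) T)
    {y : Coord n} (hy : y ∈ T) (j : Fin n) :
    partialD (fun z => ∑ i, gradient g c f i z * coordD c h i z) j y
      = ∑ i, hessian g c f j i y * gradient g c h i y
        + ∑ i, hessian g c h j i y * gradient g c f i y := by
  have hyR := hT.subset_range hy
  have hyt := hT.subset hy
  have h1 : ∑ i, hessian g c f j i y * gradient g c h i y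
      = ∑ i, covGradient g c f j i y * coordD c h i y := by
    simp_rw [hT.covGradient_eq g hf hy]
    unfold gradient
    simp_rw [Finset.sum_mul, Finset.mul_sum]
    rw [Finset.sum_comm]
    refine Finset.sum_congr rfl fun i _ => Finset.sum_congr rfl fun k _ => ?_
    rw [coordMetric_inv_symm g c y k i]; ring
  rw [h1, hT.partialD_sum_mul (fun i => hT.contDiffOn_gradient g hf i)
    (fun i => hT.contDiffOn_coordD hh i) hy j]
  unfold covGradient hessian
  have h3 : ∑ i, (∑ l, christoffel g c i j l y * gradient g c f l y) * coordD c h i y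
      = ∑ i, (∑ k, christoffel g c k j i y * coordD c h k y) * gradient g c f i y := by
    simp_rw [Finset.sum_mul]
    rw [Finset.sum_comm]
    exact Finset.sum_congr rfl fun i _ => Finset.sum_congr rfl fun k _ => by ring
  simp_rw [add_mul, sub_mul, Finset.sum_add_distrib, Finset.sum_sub_distrib, h3, mul_comm]
  ring

end Calculus

/-! ### A trace inequality -/

/-- The sum of the squared entries of `(1 - e eᵀ) D (1 - e eᵀ)` is non-negative. For the Hessian of
`u` and the unit normal `e`, this discards the squared second fundamental form of the level set. -/
lemma trace_sq_ge_of_unit {m : ℕ} {D : Fin m → Fin m → ℝ} (hD : ∀ i j, D i j = D j i)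
    {e : Fin m → ℝ} (he : ∑ i, e i * e i = 1) :
    2 * ∑ i, (∑ j, D i j * e j) * (∑ j, D i j * e j) - (∑ i, e i * ∑ j, D i j * e j) ^ 2
      ≤ ∑ i, ∑ j, D i j * D j i := by
  set w : Fin m → ℝ := fun i => ∑ j, D i j * e j with hw
  set a : ℝ := ∑ i, e i * w i with ha
  have h0 : 0 ≤ ∑ i, ∑ j, (D i j - w i * e j - e i * w j + a * e i * e j) ^ 2 :=
    Finset.sum_nonneg fun i _ => Finset.sum_nonneg fun j _ => sq_nonneg _
  have h1 : ∀ i, ∑ j, (D i j - w i * e j - e i * w j + a * e i * e j) ^ 2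
      = ∑ j, D i j * D j i + (2 * a * (e i * w i) - w i * w i - a ^ 2 * (e i * e i))
        + (∑ j, w j * w j) * (e i * e i) - 2 * ∑ j, e i * D i j * w j := by
    intro i
    have e1 : ∀ j, (D i j - w i * e j - e i * w j + a * e i * e j) ^ 2
        = D i j * D j i + w i ^ 2 * (e j * e j) + e i ^ 2 * (w j * w j)
          + a ^ 2 * e i ^ 2 * (e j * e j) - 2 * w i * (D i j * e j) - 2 * (e i * D i j * w j)
          + 2 * a * e i * (D i j * e j) + 2 * w i * e i * (e j * w j)
          - 2 * a * w i * e i * (e j * e j) - 2 * a * e i ^ 2 * (e j * w j) := by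
      intro j
      rw [hD j i]; ring
    simp only [e1, Finset.sum_sub_distrib, Finset.sum_add_distrib]
    simp only [← Finset.mul_sum, he]
    rw [show ∑ j, D i j * e j = w i from rfl, ← ha]
    ring
  have h2 : ∑ i, ∑ j, e i * D i j * w j = ∑ j, w j * w j := by
    rw [Finset.sum_comm]
    refine Finset.sum_congr rfl fun j _ => ?_
    rw [← Finset.sum_mul]
    congr 1
    exact Finset.sum_congr rfl fun i _ => by rw [hD i j]; ring
  simp only [h1, Finset.sum_sub_distrib, Finset.sum_add_distrib] at h0
  simp only [← Finset.mul_sum, he, h2, ← ha] at h0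
  change 2 * ∑ i, w i * w i - a ^ 2 ≤ _
  linarith

/-- For a symmetric matrix `C`, a positive semidefinite `P` and a `P`-unit vector `η`, a lower
bound of `tr (C P C P)` by the terms that involve `b = C P η`. -/
lemma trace_sq_ge {m : ℕ} {C P : Matrix (Fin m) (Fin m) ℝ} (hC : ∀ i j, C i j = C j i)
    (hP : P.PosSemidef) {η b : Fin m → ℝ} (hη : ∑ i, η i * ∑ j, P i j * η j = 1)
    (hb : ∀ i, b i = ∑ j, C i j * ∑ k, P j k * η k) :
    2 * ∑ i, b i * ∑ j, P i j * b j - (∑ i, η i * ∑ j, P i j * b j) ^ 2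
      ≤ ∑ i, ∑ k, (C * P) i k * (C * P) k i := by
  -- Factor `P = Rᵀ R` and conjugate: for `D = R C Rᵀ` and the Euclidean unit vector `R η` the claim
  -- is the previous lemma.
  obtain ⟨R, hR⟩ : ∃ R : Matrix (Fin m) (Fin m) ℝ, P = R.transpose * R := by
    open scoped MatrixOrder in
    obtain ⟨R, hR⟩ := CStarAlgebra.nonneg_iff_eq_star_mul_self.1 hP.nonneg
    exact ⟨R, by rw [hR, Matrix.star_eq_conjTranspose, Matrix.conjTranspose_eq_transpose_of_trivial]⟩
  have hCt : C.transpose = C := by ext i j; exact hC j i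
  have hquad : ∀ v w : Fin m → ℝ, ∑ i, v i * ∑ j, P i j * w j
      = ∑ i, R.mulVec v i * R.mulVec w i := by
    intro v w
    change v ⬝ᵥ P.mulVec w = R.mulVec v ⬝ᵥ R.mulVec w
    rw [hR, ← Matrix.mulVec_mulVec, Matrix.dotProduct_mulVec, Matrix.vecMul_transpose]
  set D : Matrix (Fin m) (Fin m) ℝ := R * C * R.transpose with hD
  have hDs : ∀ i j, D i j = D j i := by
    intro i j
    have : D.transpose = D := by
      rw [hD, Matrix.transpose_mul, Matrix.transpose_mul, hCt, Matrix.transpose_transpose,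
        Matrix.mul_assoc]
    exact congrFun (congrFun this j) i
  have hbv : b = C.mulVec (P.mulVec η) := funext hb
  have hw : R.mulVec b = D.mulVec (R.mulVec η) := by
    rw [hbv, hD, hR]
    simp only [Matrix.mulVec_mulVec, Matrix.mul_assoc]
  have key := trace_sq_ge_of_unit hDs (e := R.mulVec η) (by rw [← hquad]; exact hη)
  have h1 : ∀ i, ∑ j, D i j * R.mulVec η j = R.mulVec b i := fun i => by rw [hw]; rfl
  simp_rw [h1] at key
  rw [hquad, hquad]
  refine key.trans (le_of_eq ?_)
  have ht : ∀ X : Matrix (Fin m) (Fin m) ℝ, ∑ i, ∑ j, X i j * X j i = (X * X).trace := fun X => rfl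
  rw [ht, ht, hD, hR]
  rw [show R * C * R.transpose * (R * C * R.transpose)
    = R * (C * (R.transpose * R) * C * R.transpose) by simp only [Matrix.mul_assoc],
    Matrix.trace_mul_comm]
  simp only [Matrix.mul_assoc]

/-! ### The Bochner identity -/

/-- This is `div(∇_Z Z) = Z(div Z) + tr((∇Z)²) + Ric(Z, Z)` as algebra in formal jets: `z`, `p`,
`pp` stand for `Zⁱ`, `∂ₖZⁱ`, `∂ᵢ∂ⱼZᵏ`, and `G`, `DG` for the Christoffel symbols and their
derivatives. Only the symmetries of `pp`, `G` and `DG` enter. -/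
lemma ricci_identity_aux {m : ℕ} (z : Fin m → ℝ) (p : Fin m → Fin m → ℝ)
    (pp : Fin m → Fin m → Fin m → ℝ) (G : Fin m → Fin m → Fin m → ℝ)
    (DG : Fin m → Fin m → Fin m → Fin m → ℝ) (hpp : ∀ i j k, pp i j k = pp j i k)
    (hG : ∀ k i j, G k i j = G k j i) (hDG : ∀ l k i j, DG l k i j = DG l k j i) :
    ∑ k, (∑ i, (p k i * (p i k + ∑ l, G k i l * z l)
        + z i * (pp k i k + ∑ l, (DG k k i l * z l + G k i l * p k l)))
      + ∑ l, G k k l * ∑ i, z i * (p i l + ∑ j, G l i j * z j))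
    = ∑ i, z i * ∑ k, (pp i k k + ∑ l, (DG i k k l * z l + G k k l * p i l))
      + ∑ i, ∑ k, (p i k + ∑ l, G k i l * z l) * (p k i + ∑ l, G i k l * z l)
      + ∑ i, ∑ j, (∑ k, (DG k k i j - DG j k i k
        + ∑ l, (G k k l * G l i j - G k j l * G l i k))) * z i * z j := by
  set H : Fin m → Fin m → ℝ := fun i k => ∑ l, G k i l * z l with hH
  have hHd : ∀ i k, ∑ l, G k i l * z l = H i k := fun i k => rfl
  simp_rw [hHd]
  -- the terms of the left hand side
  have a1 : ∑ k, ∑ i, z i * ∑ l, G k i l * p k l = ∑ i, ∑ k, H i k * p k i := by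
    rw [Finset.sum_comm (f := fun i k => H i k * p k i)]
    refine Finset.sum_congr rfl fun k _ => ?_
    simp_rw [hH, Finset.mul_sum, Finset.sum_mul]
    rw [Finset.sum_comm]
    refine Finset.sum_congr rfl fun i _ => Finset.sum_congr rfl fun l _ => ?_
    rw [hG k l i]; ring
  have a2 : ∑ k, ∑ i, z i * pp k i k = ∑ i, z i * ∑ k, pp i k k := by
    rw [Finset.sum_comm]
    refine Finset.sum_congr rfl fun i _ => ?_
    rw [Finset.mul_sum]
    exact Finset.sum_congr rfl fun k _ => by rw [hpp]
  have a3 : ∑ k, ∑ l, G k k l * ∑ i, z i * p i l = ∑ i, z i * ∑ k, ∑ l, G k k l * p i l := by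
    simp_rw [Finset.mul_sum]
    rw [Finset.sum_comm (s := Finset.univ (α := Fin m)) (f := fun i k => ∑ l, z i * (G k k l * p i l))]
    refine Finset.sum_congr rfl fun k _ => ?_
    rw [Finset.sum_comm]
    exact Finset.sum_congr rfl fun i _ => Finset.sum_congr rfl fun l _ => by ring
  -- the terms of the Ricci curvature
  have b1 : ∑ i, ∑ j, (∑ k, DG k k i j) * z i * z j = ∑ k, ∑ i, z i * ∑ l, DG k k i l * z l := by
    rw [Finset.sum_comm (f := fun k i => z i * ∑ l, DG k k i l * z l)]
    refine Finset.sum_congr rfl fun i _ => ?_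
    simp_rw [Finset.mul_sum, Finset.sum_mul]
    rw [Finset.sum_comm]
    exact Finset.sum_congr rfl fun k _ => Finset.sum_congr rfl fun l _ => by ring
  have b2 : ∑ i, ∑ j, (∑ k, DG j k i k) * z i * z j = ∑ i, z i * ∑ k, ∑ l, DG i k k l * z l := by
    rw [Finset.sum_comm]
    refine Finset.sum_congr rfl fun j _ => ?_
    simp_rw [Finset.mul_sum, Finset.sum_mul]
    rw [Finset.sum_comm]
    exact Finset.sum_congr rfl fun k _ => Finset.sum_congr rfl fun l _ => by
      rw [hDG j k l k]; ring
  have b3 : ∑ i, ∑ j, (∑ k, ∑ l, G k k l * G l i j) * z i * z j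
      = ∑ k, ∑ l, G k k l * ∑ i, z i * H i l := by
    simp_rw [hH, Finset.mul_sum, Finset.sum_mul]
    rw [show ∑ i, ∑ j, ∑ k, ∑ l, G k k l * G l i j * z i * z j
      = ∑ k, ∑ i, ∑ j, ∑ l, G k k l * G l i j * z i * z j by
        simp_rw [Finset.sum_comm (s := Finset.univ (α := Fin m)) (t := Finset.univ (α := Fin m))
          (f := fun j k => ∑ l, G k k l * G l _ j * z _ * z j)]
        rw [Finset.sum_comm]]
    refine Finset.sum_congr rfl fun k _ => ?_
    rw [show ∑ i, ∑ j, ∑ l, G k k l * G l i j * z i * z j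
      = ∑ l, ∑ i, ∑ j, G k k l * G l i j * z i * z j by
        simp_rw [Finset.sum_comm (s := Finset.univ (α := Fin m)) (t := Finset.univ (α := Fin m))
          (f := fun j l => G k k l * G l _ j * z _ * z j)]
        rw [Finset.sum_comm]]
    exact Finset.sum_congr rfl fun l _ => Finset.sum_congr rfl fun i _ =>
      Finset.sum_congr rfl fun j _ => by ring
  have b4 : ∑ i, ∑ j, (∑ k, ∑ l, G k j l * G l i k) * z i * z j = ∑ i, ∑ k, H i k * H k i := by
    have c1 : ∀ i j, (∑ k, ∑ l, G k j l * G l i k) * z i * z j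
        = ∑ k, ∑ l, (G k l j * z j) * (G l k i * z i) := fun i j => by
      simp_rw [Finset.sum_mul]
      exact Finset.sum_congr rfl fun k _ => Finset.sum_congr rfl fun l _ => by
        rw [hG k l j, hG l k i]; ring
    have c2 : ∀ l k, H l k * H k l = ∑ i, ∑ j, (G k l j * z j) * (G l k i * z i) := fun l k => by
      simp_rw [hH]
      rw [Finset.sum_mul_sum, Finset.sum_comm]
    simp_rw [c1, c2]
    rw [Finset.sum_comm (f := fun l k => ∑ i, ∑ j, (G k l j * z j) * (G l k i * z i))]
    rw [show ∑ i, ∑ j, ∑ k, ∑ l, (G k l j * z j) * (G l k i * z i)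
      = ∑ k, ∑ i, ∑ j, ∑ l, (G k l j * z j) * (G l k i * z i) by
        simp_rw [Finset.sum_comm (s := Finset.univ (α := Fin m)) (t := Finset.univ (α := Fin m))
          (f := fun j k => ∑ l, (G k l j * z j) * (G l k _ * z _))]
        rw [Finset.sum_comm]]
    refine Finset.sum_congr rfl fun k _ => ?_
    simp_rw [Finset.sum_comm (s := Finset.univ (α := Fin m)) (t := Finset.univ (α := Fin m))
          (f := fun j l => (G k l j * z j) * (G l k _ * z _))]
    rw [Finset.sum_comm]
  have hR : ∑ i, ∑ j, (∑ k, (DG k k i j - DG j k i k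
        + ∑ l, (G k k l * G l i j - G k j l * G l i k))) * z i * z j
      = ∑ k, ∑ i, z i * ∑ l, DG k k i l * z l - ∑ i, z i * ∑ k, ∑ l, DG i k k l * z l
        + ∑ k, ∑ l, G k k l * ∑ i, z i * H i l - ∑ i, ∑ k, H i k * H k i := by
    rw [← b1, ← b2, ← b3, ← b4]
    simp only [Finset.sum_add_distrib, Finset.sum_sub_distrib, add_mul, sub_mul]
    ring
  rw [hR]
  have hpH : ∑ k, ∑ i, p k i * H i k = ∑ i, ∑ k, p i k * H k i := rfl
  have hpp' : ∑ k, ∑ i, p k i * p i k = ∑ i, ∑ k, p i k * p k i := rfl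
  simp only [mul_add, add_mul, Finset.sum_add_distrib]
  rw [a1, a2, a3]
  ring

section Bochner

variable {n : ℕ} [NeZero n] {M : Type*} [TopologicalSpace M]
  [ChartedSpace (EuclideanHalfSpace n) M] [IsManifold (𝓡∂ n) ∞ M]
  {c : M} {T : Set (Coord n)} (g : SmoothMetric n M)

/-- The contracted Ricci identity for the gradient of a function. -/
lemma IsChartRegion.ricci_identity (hT : IsChartRegion c T) {u : M → ℝ}
    (hu : ContDiffOn ℝ ∞ (fun z => u ((extChartAt (𝓡∂ n) c).symm z)) T)
    {y : Coord n} (hy : y ∈ T) :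
    ∑ k, (partialD (fun z => ∑ i, gradient g c u i z * covGradient g c u i k z) k y
        + ∑ l, christoffel g c k k l y *
          ∑ i, gradient g c u i y * covGradient g c u i l y)
      = ∑ i, gradient g c u i y * partialD (laplacian g c u) i y
        + ∑ i, ∑ k, covGradient g c u i k y * covGradient g c u k i y
        + ∑ i, ∑ j, ricci g c i j y * gradient g c u i y * gradient g c u j y := by
  have hyR := hT.subset_range hy
  have hZ := fun i => hT.contDiffOn_gradient g hu i
  have hB := fun i k => hT.contDiffOn_covGradient g hu i k
  have hG := fun k i j => hT.contDiffOn_christoffel g k i j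
  have hDB : ∀ m i k, partialD (covGradient g c u i k) m y
      = partialD (partialD (gradient g c u k) i) m y
        + ∑ l, (partialD (christoffel g c k i l) m y * gradient g c u l y
          + christoffel g c k i l y * partialD (gradient g c u l) m y) := by
    intro m i k
    have h1 := hT.contDiffOn_partialD (hZ k) i
    have h2 : ContDiffOn ℝ ∞ (fun z => ∑ l, christoffel g c k i l z * gradient g c u l z) T :=
      ContDiffOn.sum fun l _ => (hG k i l).mul (hZ l)
    rw [← hT.partialD_sum_mul (fun l => hG k i l) hZ hy m]
    exact partialD_add hyR (hT.differentiableWithinAt h1 hy) (hT.differentiableWithinAt h2 hy) m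
  have hDQ : ∀ k, partialD (fun z => ∑ i, gradient g c u i z * covGradient g c u i k z) k y
      = ∑ i, (partialD (gradient g c u i) k y * covGradient g c u i k y
        + gradient g c u i y * partialD (covGradient g c u i k) k y) := fun k =>
    hT.partialD_sum_mul hZ (fun i => hB i k) hy k
  have hDL : ∀ i, partialD (laplacian g c u) i y
      = ∑ k, partialD (covGradient g c u k k) i y := by
    intro i
    rw [hT.partialD_congr (h := fun z => ∑ k, covGradient g c u k k z)
      (fun z hz => hT.laplacian_eq g hu hz) hy]
    exact partialD_sum (f := fun k => covGradient g c u k k) hyR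
      (fun k _ => hT.differentiableWithinAt (hB k k) hy) i
  simp_rw [hDQ, hDL, hDB]
  exact ricci_identity_aux (fun i => gradient g c u i y)
    (fun k i => partialD (gradient g c u i) k y)
    (fun i j k => partialD (partialD (gradient g c u k) j) i y)
    (fun k i j => christoffel g c k i j y)
    (fun l k i j => partialD (christoffel g c k i j) l y)
    (fun i j k => hT.partialD_comm (hZ k) hy j i)
    (fun k i j => christoffel_symm g k i j y)
    (fun l k i j => by rw [show christoffel g c k i j = christoffel g c k j i from
      funext fun z => christoffel_symm g k i j z])

/-- The quotient of the mean curvature of the level sets of `u` by `W`, if `W |∇u| = 1`. -/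
def eikonalMean (g : SmoothMetric n M) (W u : M → ℝ) (c : M) (y : Coord n) : ℝ :=
  laplacian g c u y
    + (∑ i, gradient g c u i y * coordD c W i y) / W ((extChartAt (𝓡∂ n) c).symm y)

/-- `u` solves the eikonal equation `W |∇u| = 1` in the region `T` of the chart at `c`. -/
structure IsEikonal (g : SmoothMetric n M) (W u : M → ℝ) (c : M) (T : Set (Coord n)) : Prop where
  region : IsChartRegion c T
  smooth_u : ContDiffOn ℝ ∞ (fun z => u ((extChartAt (𝓡∂ n) c).symm z)) T
  smooth_W : ContDiffOn ℝ ∞ (fun z => W ((extChartAt (𝓡∂ n) c).symm z)) T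
  pos : ∀ y ∈ T, 0 < W ((extChartAt (𝓡∂ n) c).symm y)
  eq_one : ∀ y ∈ T, W ((extChartAt (𝓡∂ n) c).symm y) ^ 2 * gradNormSq g c u y = 1

variable {g} {W u : M → ℝ}

lemma IsEikonal.contDiffOn_eikonalMean (h : IsEikonal g W u c T) :
    ContDiffOn ℝ ∞ (eikonalMean g W u c) T :=
  (h.region.contDiffOn_laplacian g h.smooth_u).add ((ContDiffOn.sum fun i _ =>
    (h.region.contDiffOn_gradient g h.smooth_u i).mul (h.region.contDiffOn_coordD h.smooth_W i)).div
    h.smooth_W fun y hy => (h.pos y hy).ne')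

/-- Differentiate `W² |∇u|² = 1`: the Hessian in the direction `∇u` is `-dW / W³`. -/
lemma IsEikonal.hessian_gradient (h : IsEikonal g W u c T) {y : Coord n} (hy : y ∈ T)
    (k : Fin n) :
    W ((extChartAt (𝓡∂ n) c).symm y) ^ 3 * ∑ i, hessian g c u k i y * gradient g c u i y
      = - coordD c W k y := by
  have hT := h.region
  have hyR := hT.subset_range hy
  have hN := hT.contDiffOn_gradNormSq g h.smooth_u
  have h1 : partialD (gradNormSq g c u) k y
      = 2 * ∑ i, hessian g c u k i y * gradient g c u i y := by
    have := hT.partialD_inner_gradient g h.smooth_u h.smooth_u hy k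
    rw [two_mul]
    exact this
  have hWd := hT.differentiableWithinAt h.smooth_W hy
  have h2 : partialD (fun z => W ((extChartAt (𝓡∂ n) c).symm z) * (W ((extChartAt (𝓡∂ n) c).symm z)
      * gradNormSq g c u z)) k y = 0 := by
    rw [hT.partialD_congr (h := fun _ => 1) (fun z hz => ?_) hy, partialD_const]
    rw [← h.eq_one z hz]; ring
  rw [partialD_mul hyR hWd (hWd.fun_mul (hT.differentiableWithinAt hN hy)),
    partialD_mul hyR hWd (hT.differentiableWithinAt hN hy), h1] at h2
  have h3 := h.eq_one y hy
  change coordD c W k y * _ + _ * (coordD c W k y * _ + _) = 0 at h2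
  set w := W ((extChartAt (𝓡∂ n) c).symm y)
  linear_combination (w / 2) * h2 - coordD c W k y * h3

/-- The level sets of a solution of the eikonal equation have mean curvature `W` times
`eikonalMean`. -/
lemma IsEikonal.meanCurvature_eq (h : IsEikonal g W u c T) {y : Coord n} (hy : y ∈ T) :
    meanCurvature g u c y = eikonalMean g W u c y * W ((extChartAt (𝓡∂ n) c).symm y) := by
  have hw := h.pos y hy
  have hN : gradNormSq g c u y = (W ((extChartAt (𝓡∂ n) c).symm y))⁻¹ ^ 2 := by
    rw [inv_pow]
    exact eq_inv_of_mul_eq_one_right (h.eq_one y hy)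
  have hH : W ((extChartAt (𝓡∂ n) c).symm y) ^ 3 *
      ∑ i, ∑ j, hessian g c u i j y * gradient g c u i y * gradient g c u j y
      = - ∑ i, gradient g c u i y * coordD c W i y := by
    rw [Finset.mul_sum, ← Finset.sum_neg_distrib]
    refine Finset.sum_congr rfl fun i _ => ?_
    rw [← mul_neg, ← h.hessian_gradient hy i]
    simp only [Finset.mul_sum]
    exact Finset.sum_congr rfl fun j _ => by ring
  unfold meanCurvature eikonalMean
  rw [hN, Real.sqrt_sq (inv_nonneg.2 hw.le)]
  set w := W ((extChartAt (𝓡∂ n) c).symm y)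
  have hw0 : w ≠ 0 := hw.ne'
  field_simp
  linear_combination -hH

/-- The evolution of the mean curvature along the flow of `∇u`. -/
theorem IsEikonal.bochner (h : IsEikonal g W u c T) {y : Coord n} (hy : y ∈ T) :
    W ((extChartAt (𝓡∂ n) c).symm y) ^ 3
        * ∑ i, gradient g c u i y * partialD (eikonalMean g W u c) i y
      ≤ -(laplacian g c W y - W ((extChartAt (𝓡∂ n) c).symm y) ^ 2
          * ∑ i, ∑ j, hessian g c W i j y * gradient g c u i y * gradient g c u j y
        + W ((extChartAt (𝓡∂ n) c).symm y) ^ 3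
          * ∑ i, ∑ j, ricci g c i j y * gradient g c u i y * gradient g c u j y) := by
  have hT := h.region
  have hyR := hT.subset_range hy
  have hyt := hT.subset hy
  have hw := h.pos y hy
  have hWd := hT.differentiableWithinAt h.smooth_W hy
  have hZ := fun i => hT.contDiffOn_gradient g h.smooth_u i
  set W' : Coord n → ℝ := fun z => W ((extChartAt (𝓡∂ n) c).symm z) with hW'
  -- `Q` is `∇_{∇u} ∇u`, which the differentiated eikonal equation identifies with `-∇W / W³`. Its
  -- divergence is computed once from this formula and once from the contracted Ricci identity;
  -- comparing the two gives the derivative of `Δu` along `∇u`.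
  set Q : Fin n → Coord n → ℝ := fun k z => ∑ i, gradient g c u i z * covGradient g c u i k z
    with hQdef
  have hQs : ∀ k, ContDiffOn ℝ ∞ (Q k) T := fun k => ContDiffOn.sum fun i _ =>
    (hZ i).mul (hT.contDiffOn_covGradient g h.smooth_u i k)
  have hQ : ∀ z ∈ T, ∀ k, W' z * (W' z * (W' z * Q k z)) = -1 * gradient g c W k z := by
    intro z hz k
    have e1 : Q k z = ∑ j, (coordMetric g c z)⁻¹ k j
        * ∑ i, hessian g c u j i z * gradient g c u i z := by
      simp only [hQdef, hT.covGradient_eq g h.smooth_u hz, Finset.mul_sum]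
      rw [Finset.sum_comm]
      refine Finset.sum_congr rfl fun j _ => Finset.sum_congr rfl fun i _ => ?_
      rw [hT.hessian_symm g h.smooth_u hz i j]; ring
    have e2 : ∀ j, W' z * (W' z * (W' z * ((coordMetric g c z)⁻¹ k j
        * ∑ i, hessian g c u j i z * gradient g c u i z)))
        = -1 * ((coordMetric g c z)⁻¹ k j * coordD c W j z) := fun j => by
      linear_combination (coordMetric g c z)⁻¹ k j * h.hessian_gradient hz j
    rw [e1, Finset.mul_sum, Finset.mul_sum, Finset.mul_sum, gradient, Finset.mul_sum]
    exact Finset.sum_congr rfl fun j _ => e2 j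
  -- the divergence of `Q`
  set divQ := ∑ k, (partialD (Q k) k y + ∑ l, christoffel g c k k l y * Q l y) with hdivQ
  have hDQ : ∀ k, 3 * W' y ^ 2 * coordD c W k y * Q k y + W' y ^ 3 * partialD (Q k) k y
      = - partialD (gradient g c W k) k y := by
    intro k
    have e1 := hT.partialD_congr (fun z hz => hQ z hz k) hy k
    have d0 := hT.differentiableWithinAt (hQs k) hy
    rw [partialD_mul hyR hWd (hWd.fun_mul (hWd.fun_mul d0)), partialD_mul hyR hWd (hWd.fun_mul d0),
      partialD_mul hyR hWd d0, partialD_mul hyR (by fun_prop)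
        (hT.differentiableWithinAt (hT.contDiffOn_gradient g h.smooth_W k) hy), partialD_const] at e1
    change coordD c W k y * _ + _ * (coordD c W k y * _ + _ * (coordD c W k y * _ + _)) = _ at e1
    linear_combination e1
  have hWQ : W' y ^ 3 * ∑ k, coordD c W k y * Q k y = - gradNormSq g c W y := by
    rw [Finset.mul_sum, gradNormSq, ← Finset.sum_neg_distrib]
    refine Finset.sum_congr rfl fun k _ => ?_
    linear_combination coordD c W k y * hQ y hy k
  have hdiv : W' y ^ 4 * divQ = - W' y * laplacian g c W y + 3 * gradNormSq g c W y := by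
    have e1 : W' y ^ 3 * divQ = - laplacian g c W y
        - 3 * W' y ^ 2 * ∑ k, coordD c W k y * Q k y := by
      rw [hT.laplacian_eq g h.smooth_W hy, hdivQ, Finset.mul_sum, Finset.mul_sum,
        ← Finset.sum_neg_distrib, ← Finset.sum_sub_distrib]
      refine Finset.sum_congr rfl fun k _ => ?_
      have e2 : W' y ^ 3 * ∑ l, christoffel g c k k l y * Q l y
          = - ∑ l, christoffel g c k k l y * gradient g c W l y := by
        rw [Finset.mul_sum, ← Finset.sum_neg_distrib]
        refine Finset.sum_congr rfl fun l _ => ?_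
        linear_combination christoffel g c k k l y * hQ y hy l
      unfold covGradient
      linear_combination hDQ k + e2
    linear_combination W' y * e1 - 3 * hWQ
  -- the derivative of `⟨∇W, ∇u⟩`
  set a : Coord n → ℝ := fun z => ∑ i, gradient g c u i z * coordD c W i z with hadef
  have has : ContDiffOn ℝ ∞ a T := ContDiffOn.sum fun i _ =>
    (hZ i).mul (hT.contDiffOn_coordD h.smooth_W i)
  set HW := ∑ i, ∑ j, hessian g c W i j y * gradient g c u i y * gradient g c u j y with hHW
  have hZa : W' y ^ 3 * ∑ j, gradient g c u j y * partialD a j y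
      = W' y ^ 3 * HW - gradNormSq g c W y := by
    have e1 : ∀ j, gradient g c u j y * partialD a j y
        = gradient g c u j y * ∑ i, hessian g c u j i y * gradient g c W i y
          + ∑ i, hessian g c W j i y * gradient g c u j y * gradient g c u i y := by
      intro j
      rw [hT.partialD_inner_gradient g h.smooth_u h.smooth_W hy j, mul_add]
      congr 1
      rw [Finset.mul_sum]
      exact Finset.sum_congr rfl fun i _ => by ring
    have e2 : W' y ^ 3 * ∑ j, gradient g c u j y * ∑ i, hessian g c u j i y * gradient g c W i y
        = - gradNormSq g c W y := by
      have : ∑ j, gradient g c u j y * ∑ i, hessian g c u j i y * gradient g c W i y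
          = ∑ i, gradient g c W i y * ∑ j, hessian g c u i j y * gradient g c u j y := by
        simp only [Finset.mul_sum]
        rw [Finset.sum_comm]
        refine Finset.sum_congr rfl fun i _ => Finset.sum_congr rfl fun j _ => ?_
        rw [hT.hessian_symm g h.smooth_u hy i j]; ring
      rw [this, gradNormSq, Finset.mul_sum, ← Finset.sum_neg_distrib]
      refine Finset.sum_congr rfl fun i _ => ?_
      linear_combination gradient g c W i y * h.hessian_gradient hy i
    simp_rw [e1, Finset.sum_add_distrib]
    linear_combination e2
  -- the derivative of `eikonalMean`
  have hE := h.contDiffOn_eikonalMean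
  have hL := hT.contDiffOn_laplacian g h.smooth_u
  have hDE : ∀ j, W' y * partialD (eikonalMean g W u c) j y
      = W' y * partialD (laplacian g c u) j y + partialD a j y - a y / W' y * coordD c W j y := by
    intro j
    have e1 : partialD (fun z => W' z * eikonalMean g W u c z) j y
        = partialD (fun z => W' z * laplacian g c u z + a z) j y := by
      refine hT.partialD_congr (fun z hz => ?_) hy j
      have := (h.pos z hz).ne'
      change W' z * (laplacian g c u z + a z / W' z) = _
      rw [mul_add, mul_div_cancel₀ _ this]
    rw [partialD_mul hyR hWd (hT.differentiableWithinAt hE hy),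
      partialD_add hyR (hWd.fun_mul (hT.differentiableWithinAt hL hy)) (hT.differentiableWithinAt has hy),
      partialD_mul hyR hWd (hT.differentiableWithinAt hL hy)] at e1
    change coordD c W j y * (laplacian g c u y + a y / W' y) + _ = coordD c W j y * _ + _ + _ at e1
    linear_combination e1
  have hZE : W' y ^ 2 * ∑ j, gradient g c u j y * partialD (eikonalMean g W u c) j y
      = W' y ^ 2 * ∑ j, gradient g c u j y * partialD (laplacian g c u) j y
        + W' y * ∑ j, gradient g c u j y * partialD a j y - a y ^ 2 := by
    have e1 : W' y * ∑ j, gradient g c u j y * partialD (eikonalMean g W u c) j y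
        = W' y * ∑ j, gradient g c u j y * partialD (laplacian g c u) j y
          + ∑ j, gradient g c u j y * partialD a j y - a y / W' y * a y := by
      rw [show a y / W' y * a y = ∑ j, a y / W' y * (gradient g c u j y * coordD c W j y) by
        rw [← Finset.mul_sum], Finset.mul_sum, Finset.mul_sum, ← Finset.sum_add_distrib,
        ← Finset.sum_sub_distrib]
      refine Finset.sum_congr rfl fun j _ => ?_
      linear_combination gradient g c u j y * hDE j
    have e2 : W' y * (a y / W' y * a y) = a y ^ 2 := by
      have : W' y ≠ 0 := hw.ne'
      field_simp
    linear_combination W' y * e1 - e2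
  -- the trace inequality
  have htr : 2 * gradNormSq g c W y - W' y ^ 2 * a y ^ 2
      ≤ W' y ^ 4 * ∑ i, ∑ k, covGradient g c u i k y * covGradient g c u k i y := by
    have hP : ((coordMetric g c y)⁻¹).PosSemidef := (coordMetric_posDef g c hyt).inv.posSemidef
    have hgr : ∀ (f : M → ℝ) (s : ℝ) (i : Fin n), ∑ j, (coordMetric g c y)⁻¹ i j * (s * coordD c f j y)
        = s * gradient g c f i y := by
      intro f s i
      rw [gradient, Finset.mul_sum]
      exact Finset.sum_congr rfl fun j _ => by ring
    have hw0 : W' y ≠ 0 := hw.ne'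
    have hCP : ∀ i k, (Matrix.of (fun i j => hessian g c u i j y) * (coordMetric g c y)⁻¹) i k
        = covGradient g c u i k y := by
      intro i k
      rw [hT.covGradient_eq g h.smooth_u hy, Matrix.mul_apply]
      refine Finset.sum_congr rfl fun j _ => ?_
      rw [Matrix.of_apply, coordMetric_inv_symm g c y j k, mul_comm]
    -- The unit covector is `W du`, and `b` is the Hessian of `u` in the direction of the unit
    -- normal `W ∇u`, which equals `-dW / W²`.
    have := trace_sq_ge (C := Matrix.of fun i j => hessian g c u i j y) (P := (coordMetric g c y)⁻¹)
      (fun i j => hT.hessian_symm g h.smooth_u hy i j) hP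
      (η := fun i => W' y * coordD c u i y) (b := fun i => -(W' y ^ 2)⁻¹ * coordD c W i y)
      (by
        simp only [hgr]
        rw [← h.eq_one y hy, gradNormSq, Finset.mul_sum]
        exact Finset.sum_congr rfl fun i _ => by simp only [hW']; ring)
      (by
        intro i
        simp only [hgr, Matrix.of_apply]
        have e1 : ∑ j, hessian g c u i j y * (W' y * gradient g c u j y)
            = W' y * ∑ j, hessian g c u i j y * gradient g c u j y := by
          rw [Finset.mul_sum]; exact Finset.sum_congr rfl fun j _ => by ring
        have e2 : W' y ^ 3 * ∑ i_1, hessian g c u i i_1 y * gradient g c u i_1 y = _ :=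
          h.hessian_gradient hy i
        rw [e1]
        field_simp
        linear_combination -e2)
    simp only [hgr, hCP] at this
    have e3 : ∑ i, -(W' y ^ 2)⁻¹ * coordD c W i y * (-(W' y ^ 2)⁻¹ * gradient g c W i y)
        = (W' y ^ 4)⁻¹ * gradNormSq g c W y := by
      rw [gradNormSq, Finset.mul_sum]
      refine Finset.sum_congr rfl fun i _ => ?_
      field_simp
    have e4 : ∑ i, W' y * coordD c u i y * (-(W' y ^ 2)⁻¹ * gradient g c W i y)
        = -(W' y)⁻¹ * a y := by
      have e5 : ∑ i, coordD c u i y * gradient g c W i y = a y := by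
        simp only [hadef, gradient, Finset.mul_sum, Finset.sum_mul]
        rw [Finset.sum_comm]
        refine Finset.sum_congr rfl fun i _ => Finset.sum_congr rfl fun j _ => ?_
        rw [coordMetric_inv_symm g c y i j]; ring
      rw [← e5, Finset.mul_sum]
      refine Finset.sum_congr rfl fun i _ => ?_
      field_simp
    rw [e3, e4] at this
    have h4 := mul_le_mul_of_nonneg_left this (by positivity : 0 ≤ W' y ^ 4)
    refine le_trans (le_of_eq ?_) h4
    field_simp
  have hric := hT.ricci_identity g h.smooth_u hy
  rw [show ∑ k, (partialD (fun z => ∑ i, gradient g c u i z * covGradient g c u i k z) k y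
        + ∑ l, christoffel g c k k l y *
          ∑ i, gradient g c u i y * covGradient g c u i l y) = divQ from rfl] at hric
  set RZ := ∑ i, ∑ j, ricci g c i j y * gradient g c u i y * gradient g c u j y
  set B2 := ∑ i, ∑ k, covGradient g c u i k y * covGradient g c u k i y
  set ZL := ∑ i, gradient g c u i y * partialD (laplacian g c u) i y
  set ZE := ∑ j, gradient g c u j y * partialD (eikonalMean g W u c) j y
  set Za := ∑ j, gradient g c u j y * partialD a j y
  have hw' : 0 < W' y := hw
  change W' y ^ 3 * ZE ≤ -(laplacian g c W y - W' y ^ 2 * HW + W' y ^ 3 * RZ)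
  -- After multiplication by `W` the identities `hZE`, `hZa`, `hdiv` and `hric` eliminate everything
  -- but the trace inequality `htr`.
  refine le_of_mul_le_mul_left ?_ hw'
  nlinarith [hZE, hZa, hdiv, htr, hric, congrArg (fun t => W' y ^ 2 * t) hZE,
    congrArg (fun t => W' y ^ 4 * t) hric]

/-- The divergence of `W² ∇u`. -/
lemma IsEikonal.divergence (h : IsEikonal g W u c T) {y : Coord n} (hy : y ∈ T) :
    ∑ k, (partialD (fun z => W ((extChartAt (𝓡∂ n) c).symm z) ^ 2 * gradient g c u k z) k y
      + ∑ i, christoffel g c i i k y * (W ((extChartAt (𝓡∂ n) c).symm y) ^ 2 * gradient g c u k y))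
      = W ((extChartAt (𝓡∂ n) c).symm y) ^ 2 * eikonalMean g W u c y
        + W ((extChartAt (𝓡∂ n) c).symm y) * ∑ i, gradient g c u i y * coordD c W i y := by
  have hT := h.region
  have hyR := hT.subset_range hy
  have hw := (h.pos y hy).ne'
  have hWd := hT.differentiableWithinAt h.smooth_W hy
  have hZ := fun i => hT.contDiffOn_gradient g h.smooth_u i
  have e1 : ∀ k, partialD (fun z => W ((extChartAt (𝓡∂ n) c).symm z) ^ 2 * gradient g c u k z) k y
      = 2 * W ((extChartAt (𝓡∂ n) c).symm y) * (gradient g c u k y * coordD c W k y)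
        + W ((extChartAt (𝓡∂ n) c).symm y) ^ 2 * partialD (gradient g c u k) k y := by
    intro k
    simp_rw [pow_two]
    rw [partialD_mul hyR (hWd.fun_mul hWd) (hT.differentiableWithinAt (hZ k) hy), partialD_mul hyR hWd hWd]
    change (coordD c W k y * _ + _ * coordD c W k y) * _ + _ = _
    ring
  have e2 : ∑ k, ∑ i, christoffel g c i i k y * (W ((extChartAt (𝓡∂ n) c).symm y) ^ 2
      * gradient g c u k y) = W ((extChartAt (𝓡∂ n) c).symm y) ^ 2 * ∑ i, ∑ k,
        christoffel g c i i k y * gradient g c u k y := by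
    rw [Finset.sum_comm]
    simp_rw [Finset.mul_sum]
    exact Finset.sum_congr rfl fun i _ => Finset.sum_congr rfl fun k _ => by ring
  rw [Finset.sum_add_distrib, e2]
  simp_rw [e1]
  rw [Finset.sum_add_distrib, ← Finset.mul_sum, ← Finset.mul_sum]
  unfold eikonalMean
  rw [hT.laplacian_eq g h.smooth_u hy]
  simp_rw [covGradient, Finset.sum_add_distrib]
  field_simp
  ring

end Bochner

/-! ### The model half space -/

section HalfSpace

variable {d : ℕ}

lemma mem_range_halfSpace {n : ℕ} [NeZero n] {y : Coord n} : y ∈ range (𝓡∂ n) ↔ 0 ≤ y 0 := by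
  rw [range_modelWithCornersEuclideanHalfSpace]; rfl

/-- The `0`-th coordinate. -/
def coordZero (n : ℕ) [NeZero n] : Coord n →L[ℝ] ℝ := EuclideanSpace.proj 0

@[simp] lemma coordZero_apply {n : ℕ} [NeZero n] (y : Coord n) : coordZero n y = y 0 := rfl

/-- The inclusion of the boundary of the half space. -/
def boundaryIncl (d : ℕ) : Coord d →L[ℝ] Coord (d + 1) :=
  LinearMap.toContinuousLinearMap
    { toFun := fun s => WithLp.toLp 2 (Fin.cons 0 s.ofLp)
      map_add' := fun s t => by
        ext i; refine Fin.cases ?_ (fun j => ?_) i <;> simp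
      map_smul' := fun a s => by
        ext i; refine Fin.cases ?_ (fun j => ?_) i <;> simp }

@[simp] lemma boundaryIncl_zero (s : Coord d) : boundaryIncl d s 0 = 0 := rfl
@[simp] lemma boundaryIncl_succ (s : Coord d) (a : Fin d) : boundaryIncl d s a.succ = s a := rfl

/-- The tangential coordinates. -/
def tail (d : ℕ) : Coord (d + 1) →L[ℝ] Coord d :=
  LinearMap.toContinuousLinearMap
    { toFun := fun y => WithLp.toLp 2 fun a => y a.succ
      map_add' := fun s t => by ext i; simp
      map_smul' := fun a s => by ext i; simp }

@[simp] lemma tail_apply (y : Coord (d + 1)) (a : Fin d) : tail d y a = y a.succ := rfl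

@[simp] lemma tail_boundaryIncl (s : Coord d) : tail d (boundaryIncl d s) = s := by ext a; simp

/-- The point with coordinates `(t, s)`. -/
def consCoord (t : ℝ) (s : Coord d) : Coord (d + 1) := t • stdVec 0 + boundaryIncl d s

@[simp] lemma consCoord_zero (t : ℝ) (s : Coord d) : consCoord t s 0 = t := by
  simp [consCoord]

@[simp] lemma consCoord_succ (t : ℝ) (s : Coord d) (a : Fin d) : consCoord t s a.succ = s a := by
  simp [consCoord, Fin.succ_ne_zero]

@[simp] lemma tail_consCoord (t : ℝ) (s : Coord d) : tail d (consCoord t s) = s := by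
  ext a; simp

lemma consCoord_tail (y : Coord (d + 1)) : consCoord (y 0) (tail d y) = y := by
  ext i; refine Fin.cases ?_ (fun j => ?_) i <;> simp

lemma contDiff_consCoord : ContDiff ℝ ∞ (fun z : ℝ × Coord d => consCoord z.1 z.2) := by
  unfold consCoord; fun_prop

lemma stdVec_eq_sum {n : ℕ} (v : Coord n) : v = ∑ i, v i • stdVec i := by
  have := (EuclideanSpace.basisFun (Fin n) ℝ).sum_repr v
  simpa using this.symm

lemma boundaryIncl_stdVec (a : Fin d) : boundaryIncl d (stdVec a) = stdVec a.succ := by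
  ext i
  refine Fin.cases ?_ (fun j => ?_) i
  · simp [(Fin.succ_ne_zero a).symm]
  · simp

end HalfSpace

section Boundary

variable {n : ℕ} [NeZero n] {M : Type*} [TopologicalSpace M]
  [ChartedSpace (EuclideanHalfSpace n) M] [IsManifold (𝓡∂ n) ∞ M]

lemma range_mem_nhds {y : Coord n} (hy : 0 < y 0) : range (𝓡∂ n) ∈ 𝓝 y := by
  have h : IsOpen {z : Coord n | 0 < coordZero n z} := isOpen_lt continuous_const (coordZero n).continuous
  exact Filter.mem_of_superset (h.mem_nhds hy) fun z hz => mem_range_halfSpace.2 (le_of_lt hz)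

lemma target_mem_nhds {c : M} {y : Coord n} (hy : y ∈ (extChartAt (𝓡∂ n) c).target)
    (h0 : 0 < y 0) : (extChartAt (𝓡∂ n) c).target ∈ 𝓝 y := by
  have := target_mem_nhdsWithin c hy
  rwa [nhdsWithin_eq_nhds.2 (range_mem_nhds h0)] at this

lemma mem_interior_iff {c p : M} (hp : p ∈ (extChartAt (𝓡∂ n) c).source) :
    p ∈ (𝓡∂ n).interior M ↔ 0 < extChartAt (𝓡∂ n) c p 0 := by
  have hp' : p ∈ (chartAt (EuclideanHalfSpace n) c).source := by rwa [extChartAt_source] at hp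
  have h := (𝓡∂ n).isInteriorPoint_iff_of_mem_atlas (n := ∞) (by simp)
    (chart_mem_atlas (EuclideanHalfSpace n) c) hp'
  change (𝓡∂ n).IsInteriorPoint p ↔ _
  rw [h]
  constructor
  · intro h1
    have h2 := interior_mono (target_subset_range c) h1
    rw [interior_range_modelWithCornersEuclideanHalfSpace] at h2
    exact h2
  · intro h1
    exact mem_interior_iff_mem_nhds.2 (target_mem_nhds ((extChartAt (𝓡∂ n) c).map_source hp) h1)

lemma mem_boundary_iff {c p : M} (hp : p ∈ (extChartAt (𝓡∂ n) c).source) :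
    p ∈ (𝓡∂ n).boundary M ↔ extChartAt (𝓡∂ n) c p 0 = 0 := by
  have h0 : 0 ≤ extChartAt (𝓡∂ n) c p 0 :=
    mem_range_halfSpace.1 (target_subset_range c ((extChartAt (𝓡∂ n) c).map_source hp))
  rw [← (𝓡∂ n).compl_interior, mem_compl_iff, mem_interior_iff hp, not_lt]
  exact ⟨fun h => le_antisymm h h0, fun h => h.le⟩

end Boundary

/-! ### Immersions -/

/-- In adapted charts an immersion is a linear embedding onto a complemented subspace, so projecting
to the first factor inverts it. The left inverse will serve to show that differentials are
injective. -/
lemma exists_leftInverse_of_isImmersionAt {E E' H H' M N : Type*} [NormedAddCommGroup E]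
    [NormedSpace ℝ E] [NormedAddCommGroup E'] [NormedSpace ℝ E'] [TopologicalSpace H]
    [TopologicalSpace H'] {I : ModelWithCorners ℝ E H} [I.Boundaryless]
    {J : ModelWithCorners ℝ E' H'} [TopologicalSpace M] [ChartedSpace H M] [TopologicalSpace N]
    [ChartedSpace H' N] [IsManifold I ∞ M] [IsManifold J ∞ N] {f : M → N} {x : M}
    (h : Manifold.IsImmersionAt I J ∞ f x) :
    ∃ k : N → M, ContMDiffAt J I ∞ k (f x) ∧ ∀ᶠ z in 𝓝 x, k (f z) = z := by
  have hcod : ContMDiffAt J 𝓘(ℝ, E') ∞ (h.codChart.extend J) (f x) :=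
    (h.codChart.contMDiffOn_extend h.codChart_mem_maximalAtlas).contMDiffAt
      (h.codChart.open_source.mem_nhds h.mem_codChart_source)
  have hdom : ContMDiffOn 𝓘(ℝ, E) I ∞ (h.domChart.extend I).symm (h.domChart.extend I).target := by
    rw [OpenPartialHomeomorph.extend_target']
    exact contMDiffOn_extend_symm h.domChart_mem_maximalAtlas
  set P : E' → E := fun y => (h.equiv.symm y).1 with hP
  have hPs : ContMDiff 𝓘(ℝ, E') 𝓘(ℝ, E) ∞ P := by
    refine ContDiff.contMDiff ?_
    exact contDiff_fst.comp h.equiv.symm.contDiff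
  have hleft : ∀ z ∈ h.domChart.source, P (h.codChart.extend J (f z)) = h.domChart.extend I z := by
    intro z hz
    have hz' : z ∈ (h.domChart.extend I).source := by rwa [OpenPartialHomeomorph.extend_source]
    have h1 := h.writtenInCharts ((h.domChart.extend I).map_source hz')
    simp only [Function.comp_apply, (h.domChart.extend I).left_inv hz'] at h1
    simp only [hP, h1, ContinuousLinearEquiv.symm_apply_apply]
  have htgt : (h.domChart.extend I).target ∈ 𝓝 (h.domChart.extend I x) :=
    h.domChart.isOpen_extend_target.mem_nhds ((h.domChart.extend I).map_source
      (by rw [OpenPartialHomeomorph.extend_source]; exact h.mem_domChart_source))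
  refine ⟨fun y => (h.domChart.extend I).symm (P (h.codChart.extend J y)), ?_, ?_⟩
  · have h2 := hleft x h.mem_domChart_source
    have h3 : ContMDiffAt 𝓘(ℝ, E) I ∞ (h.domChart.extend I).symm
        (P (h.codChart.extend J (f x))) := by
      rw [h2]; exact hdom.contMDiffAt htgt
    exact h3.comp (f x) ((hPs _).comp (f x) hcod)
  · filter_upwards [h.domChart.open_source.mem_nhds h.mem_domChart_source] with z hz
    rw [hleft z hz]
    exact h.domChart.extend_left_inv hz

/-! ### Boundary charts -/

section BoundaryChart

variable {d : ℕ} {M : Type*} [TopologicalSpace M]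
  [ChartedSpace (EuclideanHalfSpace (d + 1)) M] [IsManifold (𝓡∂ (d + 1)) ∞ M]
  {N : Type*} [TopologicalSpace N] [ChartedSpace (Coord d) N] [IsManifold (𝓡 d) ∞ N]

lemma boundaryIncl_mem_range (s : Coord d) : boundaryIncl d s ∈ range (𝓡∂ (d + 1)) :=
  mem_range_halfSpace.2 (by simp)

lemma contMDiffAt_symm_boundaryIncl (c : M) {s : Coord d}
    (hs : boundaryIncl d s ∈ (extChartAt (𝓡∂ (d + 1)) c).target) :
    ContMDiffAt 𝓘(ℝ, Coord d) (𝓡∂ (d + 1)) ∞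
      (fun s => (extChartAt (𝓡∂ (d + 1)) c).symm (boundaryIncl d s)) s := by
  have h1 := (contMDiffOn_extChartAt_symm (n := ∞) c (boundaryIncl d s) hs).mono_of_mem_nhdsWithin
    (target_mem_nhdsWithin c hs)
  exact (h1.comp s ((boundaryIncl d).contDiff.contMDiff.contMDiffAt.contMDiffWithinAt (s := univ))
    fun t _ => boundaryIncl_mem_range t).contMDiffAt univ_mem

/-- The tangential coordinates of a chart of `M` are coordinates of a boundary hypersurface. -/
lemma exists_boundaryChart {ι : N → M} {q₀ : N}
    (hι : Manifold.IsImmersionAt (𝓡 d) (𝓡∂ (d + 1)) ∞ ι q₀) (hs : ContMDiff (𝓡 d) (𝓡∂ (d + 1)) ∞ ι)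
    (hb : ∀ q, ι q ∈ (𝓡∂ (d + 1)).boundary M) {c : M}
    (hc : ι q₀ ∈ (extChartAt (𝓡∂ (d + 1)) c).source) :
    ∃ S : OpenPartialHomeomorph N (Coord d), q₀ ∈ S.source ∧
      (∀ q ∈ S.source, ι q ∈ (extChartAt (𝓡∂ (d + 1)) c).source ∧
        extChartAt (𝓡∂ (d + 1)) c (ι q) = boundaryIncl d (S q)) ∧
      ContMDiffOn (𝓡 d) 𝓘(ℝ, Coord d) ∞ S S.source ∧
      ContMDiffOn 𝓘(ℝ, Coord d) (𝓡 d) ∞ S.symm S.target := by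
  obtain ⟨k, hk, hkι⟩ := exists_leftInverse_of_isImmersionAt hι
  set φ := extChartAt (𝓡∂ (d + 1)) c with hφ
  set χ := extChartAt (𝓡 d) q₀ with hχ
  set U : Set (Coord d) := χ.target ∩ χ.symm ⁻¹' (ι ⁻¹' φ.source) with hU
  have hιopen : IsOpen (ι ⁻¹' φ.source) := (isOpen_extChartAt_source c).preimage hs.continuous
  have hUo : IsOpen U := (continuousOn_extChartAt_symm q₀).isOpen_inter_preimage
    (isOpen_extChartAt_target q₀) hιopen
  have hq : χ.symm (χ q₀) = q₀ := extChartAt_to_inv q₀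
  have ha : χ q₀ ∈ U := ⟨mem_extChartAt_target q₀, by
    simp only [mem_preimage, hq]; exact hc⟩
  set f : Coord d → Coord d := fun x => tail d (φ (ι (χ.symm x))) with hf
  have hbd : ∀ q, ι q ∈ φ.source → φ (ι q) = boundaryIncl d (tail d (φ (ι q))) := by
    intro q hq
    have h1 := (mem_boundary_iff hq).1 (hb q)
    conv_lhs => rw [← consCoord_tail (φ (ι q)), h1]
    simp [consCoord]
  have hφs : ContMDiffOn (𝓡∂ (d + 1)) 𝓘(ℝ, Coord (d + 1)) ∞ φ φ.source := by
    rw [hφ, extChartAt_source]; exact contMDiffOn_extChartAt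
  have hχs : ContMDiffOn 𝓘(ℝ, Coord d) (𝓡 d) ∞ χ.symm χ.target := contMDiffOn_extChartAt_symm q₀
  have hfs : ContDiffOn ℝ ∞ f U := by
    refine contMDiffOn_iff_contDiffOn.1 ?_
    refine (tail d).contDiff.contMDiff.comp_contMDiffOn (hφs.comp
      (hs.comp_contMDiffOn (hχs.mono inter_subset_left)) fun x hx => hx.2)
  -- a left inverse of `f`
  set r : Coord d → Coord d := fun s => χ (k (φ.symm (boundaryIncl d s))) with hr
  have hfa : boundaryIncl d (f (χ q₀)) = φ (ι q₀) := by
    simp only [hf, hq]; exact (hbd q₀ hc).symm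
  have hsymm : φ.symm (boundaryIncl d (f (χ q₀))) = ι q₀ := by
    rw [hfa]; exact φ.left_inv hc
  have hkq : k (ι q₀) = q₀ := hkι.self_of_nhds
  have hrs : DifferentiableAt ℝ r (f (χ q₀)) := by
    have h1 := contMDiffAt_symm_boundaryIncl c (s := f (χ q₀)) (by rw [hfa]; exact φ.map_source hc)
    have h2 : ContMDiffAt (𝓡∂ (d + 1)) (𝓡 d) ∞ k (φ.symm (boundaryIncl d (f (χ q₀)))) := by
      rw [hsymm]; exact hk
    have h3 : ContMDiffAt (𝓡 d) 𝓘(ℝ, Coord d) ∞ χ (k (φ.symm (boundaryIncl d (f (χ q₀))))) := by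
      rw [hsymm, hkq]; exact contMDiffAt_extChartAt
    have h4 : ContMDiffAt 𝓘(ℝ, Coord d) 𝓘(ℝ, Coord d) ∞ r (f (χ q₀)) :=
      ContMDiffAt.comp (f (χ q₀)) (g := χ) (f := fun s => k (φ.symm (boundaryIncl d s))) h3
        (ContMDiffAt.comp (f (χ q₀)) (g := k) (f := fun s => φ.symm (boundaryIncl d s)) h2 h1)
    exact (contMDiffAt_iff_contDiffAt.1 h4).differentiableAt (by simp)
  have hrf : ∀ᶠ x in 𝓝 (χ q₀), r (f x) = x := by
    have hcont : ContinuousAt χ.symm (χ q₀) := continuousAt_extChartAt_symm q₀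
    have h4 : ∀ᶠ x in 𝓝 (χ q₀), k (ι (χ.symm x)) = χ.symm x := by
      have h5 : Tendsto χ.symm (𝓝 (χ q₀)) (𝓝 q₀) := by
        have := hcont.tendsto; rwa [hq] at this
      exact h5.eventually hkι
    filter_upwards [hUo.mem_nhds ha, h4] with x hx h4
    simp only [hr, hf]
    rw [← hbd _ hx.2, φ.left_inv hx.2, h4, χ.right_inv hx.1]
  have hfd : DifferentiableAt ℝ f (χ q₀) :=
    (hfs.contDiffAt (hUo.mem_nhds ha)).differentiableAt (by simp)
  have hcomp : (fderiv ℝ r (f (χ q₀))).comp (fderiv ℝ f (χ q₀)) = ContinuousLinearMap.id ℝ _ := by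
    rw [← fderiv_comp _ hrs hfd, Filter.EventuallyEq.fderiv_eq (f₁ := r ∘ f) (f := id) hrf, fderiv_id]
  have hinj : Function.Injective (fderiv ℝ f (χ q₀)) := by
    intro v w hvw
    have := fun v => congrArg (fun L : Coord d →L[ℝ] Coord d => L v) hcomp
    simp only [ContinuousLinearMap.comp_apply, ContinuousLinearMap.id_apply] at this
    rw [← this v, hvw, this w]
  -- Source and target of `f` have the same dimension, so the injectivity supplied by the left
  -- inverse `r` is invertibility.
  set L : Coord d ≃L[ℝ] Coord d := (LinearEquiv.ofInjectiveEndo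
    (fderiv ℝ f (χ q₀)).toLinearMap hinj).toContinuousLinearEquiv with hL
  have hL' : HasFDerivAt f (L : Coord d →L[ℝ] Coord d) (χ q₀) := by
    have : (L : Coord d →L[ℝ] Coord d) = fderiv ℝ f (χ q₀) := by ext v; rfl
    rw [this]; exact hfd.hasFDerivAt
  obtain ⟨e, hea, heU, hef, hes⟩ := exists_smooth_openPartialHomeomorph hUo ha hfs L hL'
  have hχc : ∀ q, chartAt (Coord d) q₀ q = χ q := fun q => by simp [hχ]
  have hχc' : ∀ x, (chartAt (Coord d) q₀).symm x = χ.symm x := fun x => by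
    simp [hχ]
  have hval : ∀ q ∈ ((chartAt (Coord d) q₀).trans e).source,
      q ∈ χ.source ∧ χ q ∈ e.source ∧ ι q ∈ φ.source ∧
        ((chartAt (Coord d) q₀).trans e) q = tail d (φ (ι q)) := by
    intro q hq
    rw [OpenPartialHomeomorph.trans_source] at hq
    have h1 : q ∈ χ.source := by rw [hχ, extChartAt_source]; exact hq.1
    have h2 : χ q ∈ e.source := by have := hq.2; rwa [mem_preimage, hχc] at this
    have h3 : χ.symm (χ q) = q := χ.left_inv h1
    have h4 := (heU h2).2
    rw [mem_preimage, h3] at h4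
    refine ⟨h1, h2, h4, ?_⟩
    rw [OpenPartialHomeomorph.coe_trans, Function.comp_apply, hχc, hef]
    simp only [hf, h3]
  refine ⟨(chartAt (Coord d) q₀).trans e, ?_, fun q hq => ?_, ?_, ?_⟩
  · rw [OpenPartialHomeomorph.trans_source]
    exact ⟨mem_chart_source _ q₀, by rw [mem_preimage, hχc]; exact hea⟩
  · obtain ⟨h1, h2, h3, h4⟩ := hval q hq
    exact ⟨h3, by rw [h4]; exact hbd q h3⟩
  · refine ContMDiffOn.congr (f := fun q => tail d (φ (ι q))) ?_ fun q hq => (hval q hq).2.2.2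
    exact (tail d).contDiff.contMDiff.comp_contMDiffOn (hφs.comp hs.contMDiffOn
      fun q hq => (hval q hq).2.2.1)
  · have h1 : ContMDiffOn 𝓘(ℝ, Coord d) (𝓡 d) ∞ (fun x => χ.symm (e.symm x))
        ((chartAt (Coord d) q₀).trans e).target := by
      rw [OpenPartialHomeomorph.trans_target]
      refine hχs.comp (contMDiffOn_iff_contDiffOn.2 (hes.mono inter_subset_left)) fun x hx => ?_
      exact (heU (e.map_target hx.1)).1
    refine h1.congr fun x hx => ?_
    rw [OpenPartialHomeomorph.coe_trans_symm, Function.comp_apply, hχc']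

end BoundaryChart

/-! ### The cometric `W² g⁻¹` and its extension across the boundary -/

section Cometric

variable {n : ℕ} [NeZero n] {M : Type*} [TopologicalSpace M]
  [ChartedSpace (EuclideanHalfSpace n) M] [IsManifold (𝓡∂ n) ∞ M]

/-- The linear map with matrix `a` from covectors to vectors. -/
def covectorMap (a : Fin n → Fin n → ℝ) : (Coord n →L[ℝ] ℝ) →L[ℝ] Coord n :=
  ∑ i, ∑ j, a i j • (ContinuousLinearMap.apply ℝ ℝ (stdVec j)).smulRight (stdVec i)

lemma covectorMap_apply (a : Fin n → Fin n → ℝ) (p : Coord n →L[ℝ] ℝ) :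
    covectorMap a p = ∑ i, (∑ j, a i j * p (stdVec j)) • stdVec i := by
  simp only [covectorMap, sum_apply, smul_apply, ContinuousLinearMap.smulRight_apply,
    ContinuousLinearMap.apply_apply, Finset.sum_smul, mul_smul]

lemma covectorMap_apply_apply (a : Fin n → Fin n → ℝ) (p : Coord n →L[ℝ] ℝ) (i : Fin n) :
    covectorMap a p i = ∑ j, a i j * p (stdVec j) := by
  rw [covectorMap_apply]
  simp [Finset.sum_apply, Pi.single_apply]

lemma apply_covectorMap (a : Fin n → Fin n → ℝ) (p q : Coord n →L[ℝ] ℝ) :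
    q (covectorMap a p) = ∑ i, ∑ j, a i j * p (stdVec j) * q (stdVec i) := by
  rw [covectorMap_apply, map_sum]
  refine Finset.sum_congr rfl fun i _ => ?_
  rw [map_smul, smul_eq_mul, Finset.sum_mul]

lemma contDiff_covectorMap {E : Type*} [NormedAddCommGroup E] [NormedSpace ℝ E]
    {a : E → Fin n → Fin n → ℝ} (ha : ∀ i j, ContDiff ℝ ∞ fun x => a x i j) :
    ContDiff ℝ ∞ fun x => covectorMap (a x) :=
  ContDiff.sum fun i _ => ContDiff.sum fun j _ => (ha i j).smul contDiff_const

/-- A smooth extension across the boundary of the metric `W² g⁻¹` on covectors. -/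
lemma exists_cometric_extension (g : SmoothMetric n M) {W : M → ℝ}
    (hW : ContMDiff (𝓡∂ n) 𝓘(ℝ, ℝ) ∞ W) (c : M) {y : Coord n}
    (hy : y ∈ (extChartAt (𝓡∂ n) c).target) (hWy : 0 < W ((extChartAt (𝓡∂ n) c).symm y)) :
    ∃ a : Coord n → Fin n → Fin n → ℝ, (∀ i j, ContDiff ℝ ∞ fun x => a x i j) ∧
      (∀ x i j, a x i j = a x j i) ∧ ∃ r > 0, ∀ x ∈ Metric.ball y r, 0 ≤ x 0 →
        x ∈ (extChartAt (𝓡∂ n) c).target ∧ 0 < W ((extChartAt (𝓡∂ n) c).symm x) ∧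
        ∀ i j, a x i j = W ((extChartAt (𝓡∂ n) c).symm x) ^ 2 * (coordMetric g c x)⁻¹ i j := by
  set φ := extChartAt (𝓡∂ n) c with hφ
  have hWs : ContDiffOn ℝ ∞ (fun x => W (φ.symm x)) φ.target :=
    contMDiffOn_iff_contDiffOn.1 (hW.comp_contMDiffOn (contMDiffOn_extChartAt_symm (n := ∞) c))
  have hU : {x | x ∈ φ.target ∧ 0 < W (φ.symm x)} ∈ 𝓝[range (𝓡∂ n)] y := by
    have h1 := (hWs.continuousOn y hy).mono_of_mem_nhdsWithin (target_mem_nhdsWithin c hy)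
    filter_upwards [target_mem_nhdsWithin c hy, h1.eventually (lt_mem_nhds hWy)] with x h1 h2
    exact ⟨h1, h2⟩
  obtain ⟨ρ, hρ, hball⟩ := Metric.mem_nhdsWithin_iff.1 hU
  -- The cut-off vanishes outside the ball of radius `ρ / 2`, so its product with the cometric is
  -- smooth on the whole half space and has bounded support. It is `1` on the ball of radius `ρ /
  -- 3`, where the extension has to agree with the cometric.
  let b : ContDiffBump y := ⟨ρ / 3, ρ / 2, by positivity, by linarith⟩
  set s : Coord n → Fin n → Fin n → ℝ := fun x i j => b x * (W (φ.symm x) ^ 2 * (coordMetric g c x)⁻¹ i j)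
    with hs
  have hsm : ∀ i j, ContDiffOn ℝ ∞ (fun x => s x i j) {x | 0 ≤ coordZero n x} := by
    intro i j x hx
    have hxR : x ∈ range (𝓡∂ n) := mem_range_halfSpace.2 hx
    have hRe : {x | 0 ≤ coordZero n x} = range (𝓡∂ n) := by
      ext z; exact mem_range_halfSpace.symm
    rw [hRe]
    by_cases hxb : x ∈ Metric.ball y ρ
    · have hxt : x ∈ φ.target := (hball ⟨hxb, hxR⟩).1
      have h1 : ContDiffWithinAt ℝ ∞ (fun x => W (φ.symm x) ^ 2 * (coordMetric g c x)⁻¹ i j)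
          φ.target x := ((hWs.pow 2).mul (contDiffOn_coordMetric_inv g c i j)) x hxt
      exact (b.contDiff.contDiffAt.contDiffWithinAt).mul
        (h1.mono_of_mem_nhdsWithin (target_mem_nhdsWithin c hxt))
    · have hne : ∀ᶠ z in 𝓝 x, b z = 0 := by
        have hopen : IsOpen (Metric.closedBall y (ρ / 2))ᶜ := Metric.isClosed_closedBall.isOpen_compl
        have hxm : x ∈ (Metric.closedBall y (ρ / 2))ᶜ := by
          intro h
          rw [Metric.mem_closedBall] at h
          exact hxb (Metric.mem_ball.2 (by linarith))
        filter_upwards [hopen.mem_nhds hxm] with z hz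
        refine b.zero_of_le_dist ?_
        rw [mem_compl_iff, Metric.mem_closedBall, not_le] at hz
        exact hz.le
      have : (fun x => s x i j) =ᶠ[𝓝 x] fun _ => 0 := by
        filter_upwards [hne] with z hz
        simp only [hs, hz, zero_mul]
      exact (contDiffAt_const.congr_of_eventuallyEq this).contDiffWithinAt
  have hext : ∀ i j, ∃ f : Coord n → ℝ, ContDiff ℝ ∞ f ∧ ∀ x, 0 ≤ coordZero n x → f x = s x i j := by
    intro i j
    refine exists_contDiff_extension (l := coordZero n) (e := stdVec 0) (by simp) (hsm i j)
      ⟨‖y‖ + ρ, fun x _ hx => ?_⟩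
    have : b x = 0 := by
      refine b.zero_of_le_dist ?_
      change ρ / 2 ≤ dist x y
      have := norm_le_norm_add_norm_sub' x y
      rw [dist_eq_norm]
      linarith
    simp only [hs, this, zero_mul]
  choose f hf hfs using hext
  -- The entries have been extended one by one, so the symmetry of the matrix has to be restored.
  refine ⟨fun x i j => (f i j x + f j i x) / 2, fun i j => ((hf i j).add (hf j i)).div_const 2,
    fun x i j => by ring, ρ / 3, by positivity, fun x hx hx0 => ?_⟩
  have hxb : x ∈ Metric.ball y ρ := Metric.ball_subset_ball (by linarith) hx
  obtain ⟨h1, h2⟩ := hball ⟨hxb, mem_range_halfSpace.2 hx0⟩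
  refine ⟨h1, h2, fun i j => ?_⟩
  have hb1 : b x = 1 := b.one_of_mem_closedBall (Metric.ball_subset_closedBall hx)
  simp only [hfs _ _ x hx0, hs, hb1, one_mul, coordMetric_inv_symm g c x j i]
  ring

end Cometric

section Charts

variable {n : ℕ} [NeZero n] {M : Type*} [TopologicalSpace M]
  [ChartedSpace (EuclideanHalfSpace n) M] [IsManifold (𝓡∂ n) ∞ M]

/-! ### Change of charts -/

/-- The derivative of a change of charts intertwines metrics and differentials; hence it maps
gradients to gradients. -/
lemma fderivWithin_transition_gradient (g : SmoothMetric n M) {c c' : M} {y : Coord n}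
    (hy : y ∈ (extChartAt (𝓡∂ n) c).target)
    (hy' : (extChartAt (𝓡∂ n) c).symm y ∈ (extChartAt (𝓡∂ n) c').source) {u : M → ℝ}
    (hu : MDifferentiableAt (𝓡∂ n) 𝓘(ℝ, ℝ) u ((extChartAt (𝓡∂ n) c).symm y)) :
    fderivWithin ℝ (fun z => extChartAt (𝓡∂ n) c' ((extChartAt (𝓡∂ n) c).symm z)) (range (𝓡∂ n)) y
        (WithLp.toLp 2 fun i => gradient g c u i y)
      = WithLp.toLp 2 fun i => gradient g c' u i (extChartAt (𝓡∂ n) c' ((extChartAt (𝓡∂ n) c).symm y)) := by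
  set φ := extChartAt (𝓡∂ n) c with hφ
  set φ' := extChartAt (𝓡∂ n) c' with hφ'
  set R := range (𝓡∂ n) with hR
  have hyR : y ∈ R := target_subset_range c hy
  have huR : UniqueMDiffWithinAt 𝓘(ℝ, Coord n) R y := (uniqueDiffOn_range y hyR).uniqueMDiffWithinAt
  set κ : Coord n → Coord n := fun z => φ' (φ.symm z) with hκ
  set y' := κ y with hy'def
  have hy't : y' ∈ φ'.target := φ'.map_source hy'
  have hy'R : y' ∈ R := target_subset_range c' hy't
  have hsymm : φ'.symm y' = φ.symm y := φ'.left_inv hy'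
  have hφd : MDifferentiableWithinAt 𝓘(ℝ, Coord n) (𝓡∂ n) φ.symm R y :=
    mdifferentiableWithinAt_extChartAt_symm hy
  have hφ'd : MDifferentiableWithinAt 𝓘(ℝ, Coord n) (𝓡∂ n) φ'.symm R y' :=
    mdifferentiableWithinAt_extChartAt_symm hy't
  have hφ'm : MDifferentiableAt (𝓡∂ n) 𝓘(ℝ, Coord n) φ' (φ.symm y) :=
    mdifferentiableAt_extChartAt (by rwa [extChartAt_source] at hy')
  have hκd : MDifferentiableWithinAt 𝓘(ℝ, Coord n) 𝓘(ℝ, Coord n) κ R y :=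
    hφ'm.comp_mdifferentiableWithinAt y hφd
  set T : Set (Coord n) := φ.target ∩ φ.symm ⁻¹' φ'.source with hT
  have hTreg : IsChartRegion c T := isChartRegion_preimage c (isOpen_extChartAt_source c')
  have hTy : T ∈ 𝓝[R] y := hTreg.mem_nhds y ⟨hy, hy'⟩
  have hTu : UniqueDiffWithinAt ℝ T y :=
    (uniqueDiffOn_range y hyR).mono_nhds (nhdsWithin_le_of_mem hTy)
  have hTR : T ⊆ R := hTreg.subset_range
  have hκT : MapsTo κ T R := fun z hz => target_subset_range c' (φ'.map_source hz.2)
  have hκT' : ∀ z ∈ T, φ'.symm (κ z) = φ.symm z := fun z hz => φ'.left_inv hz.2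
  set L : Coord n →L[ℝ] Coord n := fderivWithin ℝ κ R y with hL
  have hκf : HasFDerivWithinAt κ L R y := hκd.differentiableWithinAt.hasFDerivWithinAt
  have hA : ∀ v : Coord n, (mfderivWithin 𝓘(ℝ, Coord n) (𝓡∂ n) φ.symm R y v : Coord n)
      = mfderivWithin 𝓘(ℝ, Coord n) (𝓡∂ n) φ'.symm R y' (L v) := by
    have h1 : HasMFDerivWithinAt 𝓘(ℝ, Coord n) (𝓡∂ n) (φ'.symm ∘ κ) T y
        ((mfderivWithin 𝓘(ℝ, Coord n) (𝓡∂ n) φ'.symm R y').comp L) :=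
      HasMFDerivWithinAt.comp y hφ'd.hasMFDerivWithinAt (hκf.mono hTR).hasMFDerivWithinAt hκT
    have h2 : HasMFDerivWithinAt 𝓘(ℝ, Coord n) (𝓡∂ n) φ.symm T y
        ((mfderivWithin 𝓘(ℝ, Coord n) (𝓡∂ n) φ'.symm R y').comp L) :=
      h1.congr_of_eventuallyEq (Filter.eventually_of_mem self_mem_nhdsWithin
        fun z hz => (hκT' z hz).symm) (hκT' y ⟨hy, hy'⟩).symm
    have h3 : HasMFDerivWithinAt 𝓘(ℝ, Coord n) (𝓡∂ n) φ.symm T y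
        (mfderivWithin 𝓘(ℝ, Coord n) (𝓡∂ n) φ.symm R y) := hφd.hasMFDerivWithinAt.mono hTR
    intro v
    exact congrArg (fun D : Coord n →L[ℝ] Coord n => D v) (hTu.uniqueMDiffWithinAt.eq h3 h2)
  have hu' : MDifferentiableAt (𝓡∂ n) 𝓘(ℝ, ℝ) u (φ'.symm y') := by rw [hsymm]; exact hu
  have hud : HasFDerivWithinAt (fun z => u (φ'.symm z)) (fderivWithin ℝ (fun z => u (φ'.symm z)) R y')
      R y' :=
    (MDifferentiableAt.comp_mdifferentiableWithinAt y' hu' hφ'd).differentiableWithinAt.hasFDerivWithinAt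
  have hB : ∀ v : Coord n, fderivWithin ℝ (fun z => u (φ.symm z)) R y v
      = fderivWithin ℝ (fun z => u (φ'.symm z)) R y' (L v) := by
    have h1 : HasFDerivWithinAt (fun z => u (φ.symm z))
        ((fderivWithin ℝ (fun z => u (φ'.symm z)) R y').comp L) T y :=
      (hud.comp y (hκf.mono hTR) hκT).congr (fun z hz => by
        simp only [Function.comp_apply, hκT' z hz]) (by
        simp only [Function.comp_apply, hκT' y ⟨hy, hy'⟩])
    have h2 := (MDifferentiableAt.comp_mdifferentiableWithinAt y hu
      hφd).differentiableWithinAt.hasFDerivWithinAt.mono hTR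
    intro v
    exact congrArg (fun D : Coord n →L[ℝ] ℝ => D v) (hTu.eq h2 h1)
  have hC : ∀ v w : Coord n, ∑ i, ∑ j, coordMetric g c y i j * v i * w j
      = ∑ i, ∑ j, coordMetric g c' y' i j * L v i * L w j := by
    intro v w
    have hbase : ∀ (p p' : M) (_ : p' = p) (a b : Coord n),
        (show ℝ from g.inner p' a b) = g.inner p a b := by
      intro p p' h a b; subst h; rfl
    rw [← inner_sum_coordVec, ← inner_sum_coordVec]
    refine Eq.trans ?_ (hbase _ _ hsymm _ _).symm
    rw [← hA v, ← hA w]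
  -- the pairing of the gradient with a vector
  have hgrad : ∀ (c : M) (y : Coord n), y ∈ (extChartAt (𝓡∂ n) c).target → ∀ w : Coord n,
      ∑ i, ∑ j, coordMetric g c y i j * gradient g c u i y * w j
        = fderivWithin ℝ (fun z => u ((extChartAt (𝓡∂ n) c).symm z)) R y w := by
    intro c y hy w
    rw [Finset.sum_comm]
    conv_rhs => rw [stdVec_eq_sum w, map_sum]
    refine Finset.sum_congr rfl fun j _ => ?_
    rw [map_smul, smul_eq_mul, ← Finset.sum_mul, mul_comm]
    congr 1
    refine Eq.trans ?_ (sum_coordMetric_mul_gradient g hy j)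
    exact Finset.sum_congr rfl fun i _ => by rw [coordMetric_symm g c y i j]
  have hpos : ∀ (c : M) (y : Coord n), y ∈ (extChartAt (𝓡∂ n) c).target → ∀ v : Coord n,
      (∑ i, ∑ j, coordMetric g c y i j * v i * v j = 0) → v = 0 := by
    intro c y hy v hv
    by_contra hne
    have h1 := (coordMetric_posDef g c hy).dotProduct_mulVec_pos (x := v.ofLp)
      (fun h => hne (by ext i; exact congrFun h i))
    have h2 : star v.ofLp ⬝ᵥ (coordMetric g c y).mulVec v.ofLp
        = ∑ i, ∑ j, coordMetric g c y i j * v i * v j := by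
      simp only [star_trivial, dotProduct, Matrix.mulVec, Finset.mul_sum]
      exact Finset.sum_congr rfl fun i _ => Finset.sum_congr rfl fun j _ => by ring
    rw [h2, hv] at h1
    exact lt_irrefl _ h1
  have hinj : Function.Injective L := by
    refine (injective_iff_map_eq_zero L).2 fun v hv => hpos c y hy v ?_
    rw [hC, hv]
    simp
  have hsurj : Function.Surjective L := LinearMap.injective_iff_surjective.1 hinj
  set Z : Coord n := WithLp.toLp 2 fun i => gradient g c u i y with hZ
  set Z' : Coord n := WithLp.toLp 2 fun i => gradient g c' u i y' with hZ'
  -- Both vectors represent `du` through the metric of the second chart, and every test vector is of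
  -- the form `L v`; positivity of the metric then identifies them.
  have hpair : ∀ w : Coord n, ∑ i, ∑ j, coordMetric g c' y' i j * (L Z - Z') i * w j = 0 := by
    intro w
    obtain ⟨v, rfl⟩ := hsurj w
    have h1 := hC Z v
    rw [show ∑ i, ∑ j, coordMetric g c y i j * Z i * v j = _ from hgrad c y hy v, hB v,
      ← hgrad c' y' hy't (L v)] at h1
    have h2 : ∀ i j, coordMetric g c' y' i j * (L Z - Z') i * L v j
        = coordMetric g c' y' i j * L Z i * L v j - coordMetric g c' y' i j * Z' i * L v j := by
      intro i j
      rw [PiLp.sub_apply]; ring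
    simp_rw [h2, Finset.sum_sub_distrib]
    rw [← h1]
    exact sub_self _
  exact sub_eq_zero.1 (hpos c' y' hy't _ (hpair _))

end Charts

/-! ### Collars: moving the boundary with normal speed `W` -/

section Collar

variable {d : ℕ} {M : Type*} [TopologicalSpace M]
  [ChartedSpace (EuclideanHalfSpace (d + 1)) M] [IsManifold (𝓡∂ (d + 1)) ∞ M]
  {N : Type*} [TopologicalSpace N] [ChartedSpace (Coord d) N] [IsManifold (𝓡 d) ∞ N]

/-- The region covered by the curves `X · q`, `q ∈ N'`, at times `t ∈ [0, ε)`. -/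
def collarImage (N' : Set N) (ε : ℝ) (X : ℝ → N → M) : Set M :=
  (fun z : ℝ × N => X z.1 z.2) '' (Ico 0 ε ×ˢ N')

/-- A collar of the boundary hypersurface `ι` over `N'`: the flow `X` of `W² ∇u`, where `u` vanishes
on the boundary and `W |∇u| = 1`, together with the inverse `(u, π)` of `X`. -/
structure IsCollar (g : SmoothMetric (d + 1) M) (W : M → ℝ) (ι : N → M) (N' : Set N) (ε : ℝ)
    (X : ℝ → N → M) (u : M → ℝ) (π : M → N) : Prop where
  eps_pos : 0 < ε
  isOpen_base : IsOpen N'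
  smooth_X : ContMDiffOn (𝓘(ℝ, ℝ).prod (𝓡 d)) (𝓡∂ (d + 1)) ∞ (fun q : ℝ × N => X q.1 q.2)
    (Ico 0 ε ×ˢ N')
  isOpen_image : IsOpen (collarImage N' ε X)
  smooth_u : ContMDiffOn (𝓡∂ (d + 1)) 𝓘(ℝ, ℝ) ∞ u (collarImage N' ε X)
  smooth_π : ContMDiffOn (𝓡∂ (d + 1)) (𝓡 d) ∞ π (collarImage N' ε X)
  X_zero : ∀ q ∈ N', X 0 q = ι q
  u_X : ∀ t ∈ Ico 0 ε, ∀ q ∈ N', u (X t q) = t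
  π_X : ∀ t ∈ Ico 0 ε, ∀ q ∈ N', π (X t q) = q
  W_pos : ∀ p ∈ collarImage N' ε X, 0 < W p
  mem_interior : ∀ t ∈ Ioo 0 ε, ∀ q ∈ N', X t q ∈ (𝓡∂ (d + 1)).interior M
  flow : ∀ t ∈ Ioo 0 ε, ∀ q ∈ N', ∀ c : M, X t q ∈ (extChartAt (𝓡∂ (d + 1)) c).source →
    HasDerivAt (fun s => extChartAt (𝓡∂ (d + 1)) c (X s q))
      (W (X t q) ^ 2 • WithLp.toLp 2 fun i => gradient g c u i (extChartAt (𝓡∂ (d + 1)) c (X t q))) t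

/-- These are Fermi coordinates for the metric `W⁻² g`. In a chart of `M`, a Fermi chart `Ψ` of the
extended cometric gives the flow as `Ψ(t, s)`, with `s` the coordinates of the boundary point, and
`u` as the zeroth coordinate of `Ψ⁻¹`. As `Ψ` preserves the sign of the zeroth coordinate, only the
part of the extension that is the true cometric matters. -/
theorem exists_local_collar (g : SmoothMetric (d + 1) M) {W : M → ℝ}
    (hW : ContMDiff (𝓡∂ (d + 1)) 𝓘(ℝ, ℝ) ∞ W) {ι : N → M} {q₀ : N}
    (hι : Manifold.IsImmersionAt (𝓡 d) (𝓡∂ (d + 1)) ∞ ι q₀) (hs : ContMDiff (𝓡 d) (𝓡∂ (d + 1)) ∞ ι)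
    (hb : ∀ q, ι q ∈ (𝓡∂ (d + 1)).boundary M) (hWq : 0 < W (ι q₀)) :
    ∃ (N' : Set N) (ε : ℝ) (X : ℝ → N → M) (u : M → ℝ) (π : M → N), q₀ ∈ N' ∧
      IsCollar g W ι N' ε X u π := by
  set c : M := ι q₀ with hc
  set φ := extChartAt (𝓡∂ (d + 1)) c with hφ
  have hcs : ι q₀ ∈ φ.source := mem_extChartAt_source _
  obtain ⟨S, hqS, hSφ, hSs, hSs'⟩ := exists_boundaryChart hι hs hb hcs
  set y : Coord (d + 1) := φ (ι q₀) with hy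
  have hyt : y ∈ φ.target := φ.map_source hcs
  have hysymm : φ.symm y = ι q₀ := φ.left_inv hcs
  have hyS : y = boundaryIncl d (S q₀) := (hSφ q₀ hqS).2
  obtain ⟨a, has, hasym, r, hr, har⟩ := exists_cometric_extension g hW c hyt (by
    rw [hysymm]; exact hWq)
  set A : Coord (d + 1) → (Coord (d + 1) →L[ℝ] ℝ) →L[ℝ] Coord (d + 1) := fun x => covectorMap (a x)
    with hA
  have hy0 : coordZero (d + 1) y = 0 := by rw [hyS]; simp
  have hApos : 0 < coordZero (d + 1) (A y (coordZero (d + 1))) := by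
    have h1 : coordZero (d + 1) (A y (coordZero (d + 1))) = a y 0 0 := by
      rw [coordZero_apply, hA, covectorMap_apply_apply]
      rw [Finset.sum_eq_single 0]
      · simp
      · intro j _ hj; simp [hj.symm]
      · simp
    rw [h1, (har y (Metric.mem_ball_self hr) hy0.ge).2.2]
    have h2 := (coordMetric_posDef g c hyt).inv.diag_pos (i := 0)
    have h3 : 0 < W (φ.symm y) := by rw [hysymm]; exact hWq
    positivity
  obtain ⟨Ψ, hyΨ, hΨO, hΨs, hΨs', hΨ0, hΨpos, hΨneg, hΨd⟩ :=
    exists_fermi_chart (l := coordZero (d + 1)) (e := stdVec 0) (by simp) (A := A)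
      (contDiff_covectorMap has) (fun x p q => by
        rw [hA, apply_covectorMap, apply_covectorMap, Finset.sum_comm]
        refine Finset.sum_congr rfl fun i _ => Finset.sum_congr rfl fun j _ => ?_
        rw [hasym x j i]; ring) hy0 hApos Metric.isOpen_ball (Metric.mem_ball_self hr)
  -- a product neighbourhood
  have hcont : Continuous fun z : ℝ × Coord d => consCoord z.1 z.2 := contDiff_consCoord.continuous
  have hprod : {z : ℝ × Coord d | consCoord z.1 z.2 ∈ Ψ.source ∧ z.2 ∈ S.target}
      ∈ 𝓝 ((0 : ℝ), S q₀) := by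
    refine ((Ψ.open_source.preimage hcont).inter (S.open_target.preimage continuous_snd)).mem_nhds
      ⟨?_, S.map_source hqS⟩
    simp only [mem_preimage, consCoord, zero_smul, zero_add, ← hyS]
    exact hyΨ
  obtain ⟨ε, hε, hball⟩ := Metric.mem_nhds_iff.1 hprod
  have hbox : ∀ (t : ℝ) (s : Coord d), |t| < ε → s ∈ Metric.ball (S q₀) ε →
      consCoord t s ∈ Ψ.source ∧ s ∈ S.target := by
    intro t s ht hs
    refine hball (a := (t, s)) ?_
    rw [← ball_prod_same]
    exact ⟨by simpa using ht, hs⟩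
  set N' : Set N := S.source ∩ S ⁻¹' Metric.ball (S q₀) ε with hN'
  have hN'o : IsOpen N' := S.isOpen_inter_preimage Metric.isOpen_ball
  set X : ℝ → N → M := fun t q => φ.symm (Ψ (consCoord t (S q))) with hX
  set u : M → ℝ := fun p => Ψ.symm (φ p) 0 with hu
  set π : M → N := fun p => S.symm (tail d (Ψ.symm (φ p))) with hπ
  have habs : ∀ t ∈ Ico 0 ε, |t| < ε := fun t ht => by rw [abs_of_nonneg ht.1]; exact ht.2
  have hz : ∀ t ∈ Ico 0 ε, ∀ q ∈ N', consCoord t (S q) ∈ Ψ.source ∧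
      Ψ (consCoord t (S q)) ∈ Metric.ball y r ∧ 0 ≤ Ψ (consCoord t (S q)) 0 := by
    intro t ht q hq
    have h1 := (hbox t (S q) (habs t ht) hq.2).1
    refine ⟨h1, hΨO (Ψ.map_source h1), ?_⟩
    rcases ht.1.eq_or_lt with h0 | h0
    · have h2 : coordZero (d + 1) (consCoord t (S q)) = 0 := by simp [← h0]
      rw [hΨ0 _ h1 h2]
      exact h2.ge
    · exact (hΨpos _ h1 (by simpa using h0)).le
  have hzt : ∀ t ∈ Ico 0 ε, ∀ q ∈ N', Ψ (consCoord t (S q)) ∈ φ.target :=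
    fun t ht q hq => (har _ (hz t ht q hq).2.1 (hz t ht q hq).2.2).1
  have hφX : ∀ t ∈ Ico 0 ε, ∀ q ∈ N', φ (X t q) = Ψ (consCoord t (S q)) :=
    fun t ht q hq => φ.right_inv (hzt t ht q hq)
  have huX : ∀ t ∈ Ico 0 ε, ∀ q ∈ N', u (X t q) = t := by
    intro t ht q hq
    simp only [hu, hφX t ht q hq, Ψ.left_inv (hz t ht q hq).1, consCoord_zero]
  have hπX : ∀ t ∈ Ico 0 ε, ∀ q ∈ N', π (X t q) = q := by
    intro t ht q hq
    simp only [hπ, hφX t ht q hq, Ψ.left_inv (hz t ht q hq).1, tail_consCoord, S.left_inv hq.1]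
  -- the image
  set D : Set (Coord (d + 1)) := {z | |z 0| < ε ∧ tail d z ∈ Metric.ball (S q₀) ε} with hD
  have hDo : IsOpen D := by
    refine IsOpen.inter ?_ (Metric.isOpen_ball.preimage (tail d).continuous)
    exact isOpen_lt ((coordZero (d + 1)).continuous.abs) continuous_const
  -- The image is the preimage of an open set, hence open in `M` although `[0, ε)` is not open in
  -- `ℝ`: negative parameters would leave the half space.
  have himage : collarImage N' ε X = φ.source ∩ φ ⁻¹' (Ψ.target ∩ Ψ.symm ⁻¹' D) := by
    ext p
    constructor
    · rintro ⟨⟨t, q⟩, ⟨ht, hq⟩, rfl⟩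
      refine ⟨φ.map_target (hzt t ht q hq), ?_⟩
      simp only [mem_preimage, hφX t ht q hq]
      refine ⟨Ψ.map_source (hz t ht q hq).1, ?_⟩
      simp only [mem_preimage, Ψ.left_inv (hz t ht q hq).1, hD, mem_ofPred_eq, consCoord_zero,
        tail_consCoord]
      exact ⟨habs t ht, hq.2⟩
    · rintro ⟨hp, hpt, hpD⟩
      set z := Ψ.symm (φ p) with hzdef
      have hzs : z ∈ Ψ.source := Ψ.map_target hpt
      have hΨz : Ψ z = φ p := Ψ.right_inv hpt
      have h0 : 0 ≤ z 0 := by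
        by_contra h
        have h1 := hΨneg z hzs (not_le.1 h)
        rw [hΨz] at h1
        exact absurd (mem_range_halfSpace.1 (target_subset_range c (φ.map_source hp))) (not_le.2 h1)
      have hzt : tail d z ∈ S.target := (hbox (z 0) (tail d z) hpD.1 hpD.2).2
      refine ⟨(z 0, S.symm (tail d z)), ⟨⟨h0, (abs_lt.1 hpD.1).2⟩, S.map_target hzt, ?_⟩, ?_⟩
      · simp only [mem_preimage, S.right_inv hzt]; exact hpD.2
      · simp only [hX, S.right_inv hzt, consCoord_tail, hΨz]
        exact φ.left_inv hp
  have hφc : ContinuousOn φ φ.source := continuousOn_extChartAt c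
  have hopen : IsOpen (collarImage N' ε X) := by
    rw [himage]
    exact hφc.isOpen_inter_preimage (isOpen_extChartAt_source c) (Ψ.symm.isOpen_inter_preimage hDo)
  have hφs : ContMDiffOn (𝓡∂ (d + 1)) 𝓘(ℝ, Coord (d + 1)) ∞ φ φ.source := by
    rw [hφ, extChartAt_source]; exact contMDiffOn_extChartAt
  have hΨφ : ContMDiffOn (𝓡∂ (d + 1)) 𝓘(ℝ, Coord (d + 1)) ∞ (fun p => Ψ.symm (φ p))
      (collarImage N' ε X) := by
    rw [himage]
    exact (contMDiffOn_iff_contDiffOn.2 hΨs').comp (hφs.mono inter_subset_left) fun p hp => hp.2.1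
  have hus : ContMDiffOn (𝓡∂ (d + 1)) 𝓘(ℝ, ℝ) ∞ u (collarImage N' ε X) :=
    (coordZero (d + 1)).contDiff.contMDiff.comp_contMDiffOn hΨφ
  refine ⟨N', ε, X, u, π, ⟨hqS, Metric.mem_ball_self hε⟩, hε, hN'o, ?_, hopen, hus, ?_, ?_, huX, hπX,
    ?_, ?_, ?_⟩
  · have h1 : ContMDiffOn (𝓘(ℝ, ℝ).prod (𝓡 d)) 𝓘(ℝ, Coord (d + 1)) ∞
        (fun q : ℝ × N => consCoord q.1 (S q.2)) (Ico 0 ε ×ˢ N') := by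
      have h2 : ContMDiffOn (𝓘(ℝ, ℝ).prod (𝓡 d)) 𝓘(ℝ, ℝ × Coord d) ∞
          (fun q : ℝ × N => (q.1, S q.2)) (Ico 0 ε ×ˢ N') :=
        contMDiffOn_fst.prodMk_space (hSs.comp contMDiffOn_snd fun q hq => hq.2.1)
      exact contDiff_consCoord.contMDiff.comp_contMDiffOn h2
    have h3 : ContMDiffOn (𝓘(ℝ, ℝ).prod (𝓡 d)) 𝓘(ℝ, Coord (d + 1)) ∞
        (fun q : ℝ × N => Ψ (consCoord q.1 (S q.2))) (Ico 0 ε ×ˢ N') :=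
      (contMDiffOn_iff_contDiffOn.2 hΨs).comp h1 fun q hq => (hz q.1 hq.1 q.2 hq.2).1
    exact (contMDiffOn_extChartAt_symm (n := ∞) c).comp h3 fun q hq => hzt q.1 hq.1 q.2 hq.2
  · refine hSs'.comp ((tail d).contDiff.contMDiff.comp_contMDiffOn hΨφ) fun p hp => ?_
    rw [himage] at hp
    exact (hbox _ _ hp.2.2.1 hp.2.2.2).2
  · intro q hq
    have h1 := (hz 0 ⟨le_rfl, hε⟩ q hq).1
    simp only [hX]
    rw [hΨ0 _ h1 (by simp), ]
    simp only [consCoord, zero_smul, zero_add, ← (hSφ q hq.1).2]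
    exact φ.left_inv (hSφ q hq.1).1
  · rintro p ⟨⟨t, q⟩, ⟨ht, hq⟩, rfl⟩
    exact (har _ (hz t ht q hq).2.1 (hz t ht q hq).2.2).2.1
  · intro t ht q hq
    have ht' : t ∈ Ico 0 ε := ⟨ht.1.le, ht.2⟩
    rw [mem_interior_iff (c := c) (φ.map_target (hzt t ht' q hq))]
    rw [show extChartAt (𝓡∂ (d + 1)) c (X t q) = _ from hφX t ht' q hq]
    exact hΨpos _ (hz t ht' q hq).1 (by simpa using ht.1)
  · intro t ht q hq c' hc'
    have ht' : t ∈ Ico 0 ε := ⟨ht.1.le, ht.2⟩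
    obtain ⟨hzs, hzb, hz0⟩ := hz t ht' q hq
    set z := consCoord t (S q) with hzdef
    have hy1t : Ψ z ∈ φ.target := hzt t ht' q hq
    have hy1p : 0 < Ψ z 0 := hΨpos _ hzs (by simpa [hzdef] using ht.1)
    have hXt : X t q = φ.symm (Ψ z) := rfl
    obtain ⟨p, hp, hpA, -⟩ := hΨd z hzs (by simpa [hzdef] using ht.1.le)
    have hup : HasFDerivAt (fun x => u (φ.symm x)) p (Ψ z) := by
      refine hp.congr_of_eventuallyEq ?_
      filter_upwards [target_mem_nhds hy1t hy1p] with x hx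
      simp only [hu, φ.right_inv hx, coordZero_apply]
    have hpD : ∀ j, p (stdVec j) = coordD c u j (Ψ z) := by
      intro j
      simp only [coordD, partialD]
      rw [hup.hasFDerivWithinAt.fderivWithin (uniqueDiffOn_range _ (target_subset_range c hy1t))]
    have hΨdiff : HasFDerivAt Ψ (fderiv ℝ Ψ z) z :=
      ((hΨs.contDiffAt (Ψ.open_source.mem_nhds hzs)).differentiableAt (by simp)).hasFDerivAt
    have hcurve : HasDerivAt (fun s => consCoord s (S q)) (stdVec 0) t := by
      simpa [consCoord] using ((hasDerivAt_id t).smul_const (stdVec (n := d + 1) 0)).add_const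
        (boundaryIncl d (S q))
    have h1 : HasDerivAt (fun s => Ψ (consCoord s (S q))) (fderiv ℝ Ψ z (stdVec 0)) t :=
      hΨdiff.comp_hasDerivAt t hcurve
    -- The Fermi chart moves with velocity `A p`, where `p = du`, and this is `W² ∇u`.
    -- `fderivWithin_transition_gradient` then carries the formula to an arbitrary chart `c'`.
    have h2 : fderiv ℝ Ψ z (stdVec 0)
        = W (X t q) ^ 2 • WithLp.toLp 2 fun i => gradient g c u i (Ψ z) := by
      rw [hpA]
      ext i
      rw [hA, covectorMap_apply_apply, PiLp.smul_apply, smul_eq_mul]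
      simp only [gradient, Finset.mul_sum]
      refine Finset.sum_congr rfl fun j _ => ?_
      rw [(har _ hzb hz0).2.2, hpD, hXt, mul_assoc]
    have hmem : X t q ∈ collarImage N' ε X := ⟨(t, q), ⟨ht', hq⟩, rfl⟩
    have humd : MDifferentiableAt (𝓡∂ (d + 1)) 𝓘(ℝ, ℝ) u (φ.symm (Ψ z)) :=
      (hus.contMDiffAt (hopen.mem_nhds hmem)).mdifferentiableAt (by simp)
    have h3 := fderivWithin_transition_gradient g (c := c) (c' := c') hy1t hc' humd
    have hκ : HasFDerivAt (fun x => extChartAt (𝓡∂ (d + 1)) c' (φ.symm x))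
        (fderivWithin ℝ (fun x => extChartAt (𝓡∂ (d + 1)) c' (φ.symm x)) (range (𝓡∂ (d + 1))) (Ψ z))
        (Ψ z) := by
      have h4 : MDifferentiableWithinAt 𝓘(ℝ, Coord (d + 1)) 𝓘(ℝ, Coord (d + 1))
          (fun x => extChartAt (𝓡∂ (d + 1)) c' (φ.symm x)) (range (𝓡∂ (d + 1))) (Ψ z) :=
        (mdifferentiableAt_extChartAt (by rwa [extChartAt_source] at hc')).comp_mdifferentiableWithinAt
          (Ψ z) (mdifferentiableWithinAt_extChartAt_symm hy1t)
      exact h4.differentiableWithinAt.hasFDerivWithinAt.hasFDerivAt (range_mem_nhds hy1p)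
    have h5 := hκ.comp_hasDerivAt t h1
    rw [h2, map_smul, h3] at h5
    exact h5

end Collar

/-! ### The strong maximum principle -/

section Hopf

lemma eventually_lt_of_hasDerivAt {f : ℝ → ℝ} {f' : ℝ} (hf : HasDerivAt f f' 0) (h : f' < 0) :
    ∀ᶠ t in 𝓝[>] (0 : ℝ), f t < f 0 := by
  have h4 := ((hasDerivAt_iff_tendsto_slope.1 hf).mono_left
    (nhdsWithin_mono 0 fun x (hx : (0 : ℝ) < x) => hx.ne')).eventually (gt_mem_nhds h)
  filter_upwards [h4, self_mem_nhdsWithin] with τ h5 (h6 : 0 < τ)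
  rw [slope_def_field, sub_zero, div_neg_iff] at h5
  rcases h5 with h5 | h5
  · exact absurd h5.2 (not_lt.2 h6.le)
  · linarith [h5.1]

variable {d : ℕ}

lemma clm_apply_eq_sum (L : Coord d →L[ℝ] ℝ) (ξ : Coord d) : L ξ = ∑ b, ξ b * L (stdVec b) := by
  conv_lhs => rw [stdVec_eq_sum ξ]
  simp [map_sum]

/-- The second partial derivative `∂ₐ ∂ᵦ f`. -/
def partialD₂ (f : Coord d → ℝ) (a b : Fin d) (s : Coord d) : ℝ :=
  fderiv ℝ (fun s => fderiv ℝ f s (stdVec b)) s (stdVec a)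

/-- The necessary second order condition for a minimum. -/
lemma IsLocalMin.sum_partialD₂_nonneg {f : Coord d → ℝ} {s : Coord d} (hmin : IsLocalMin f s)
    (hf : ContDiffAt ℝ ∞ f s) (ξ : Coord d) : 0 ≤ ∑ a, ∑ b, ξ a * ξ b * partialD₂ f a b s := by
  set G : ℝ → ℝ := fun t => f (s + t • ξ) with hG
  have hl : ∀ t, HasDerivAt (fun t : ℝ => s + t • ξ) ξ t := fun t => by
    simpa using ((hasDerivAt_id t).smul_const ξ).const_add s
  have hl0 : Tendsto (fun t : ℝ => s + t • ξ) (𝓝 0) (𝓝 s) := Continuous.tendsto' (by fun_prop) _ _ (by simp)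
  have hd : ∀ᶠ z in 𝓝 s, DifferentiableAt ℝ f z := by
    have := hf.of_le (m := 1) (by simp)
    filter_upwards [this.eventually (by simp)] with z hz using hz.differentiableAt (by simp)
  have h1 : deriv G =ᶠ[𝓝 0] fun t => ∑ b, ξ b * fderiv ℝ f (s + t • ξ) (stdVec b) := by
    filter_upwards [hl0.eventually hd] with t ht
    have h0 : deriv G t = fderiv ℝ f (s + t • ξ) ξ := (ht.hasFDerivAt.comp_hasDerivAt t (hl t)).deriv
    rw [h0, clm_apply_eq_sum]
  have h2 : ∀ b, DifferentiableAt ℝ (fun z => fderiv ℝ f z (stdVec b)) s := fun b =>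
    ((hf.fderiv_right (m := ∞) (by simp)).differentiableAt (by simp)).clm_apply (differentiableAt_const _)
  have h3 : HasDerivAt (deriv G) (∑ a, ∑ b, ξ a * ξ b * partialD₂ f a b s) 0 := by
    refine HasDerivAt.congr_of_eventuallyEq ?_ h1
    have h4 : ∀ b, HasDerivAt (fun t : ℝ => ξ b * fderiv ℝ f (s + t • ξ) (stdVec b))
        (ξ b * ∑ a, ξ a * partialD₂ f a b s) 0 := by
      intro b
      refine HasDerivAt.const_mul _ ?_
      have h5 : HasFDerivAt (fun z => fderiv ℝ f z (stdVec b))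
          (fderiv ℝ (fun z => fderiv ℝ f z (stdVec b)) s) (s + (0 : ℝ) • ξ) := by
        simpa using (h2 b).hasFDerivAt
      refine (h5.comp_hasDerivAt (0 : ℝ) (hl 0)).congr_deriv ?_
      rw [clm_apply_eq_sum]
      rfl
    refine (HasDerivAt.fun_sum fun b _ => h4 b).congr_deriv ?_
    simp only [Finset.mul_sum]
    rw [Finset.sum_comm]
    exact Finset.sum_congr rfl fun a _ => Finset.sum_congr rfl fun b _ => by ring
  have hGmin : IsLocalMin G 0 := by
    have : ∀ᶠ z in 𝓝 s, f s ≤ f z := hmin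
    filter_upwards [hl0.eventually this] with t ht
    simpa [hG] using ht
  -- If the second derivative were negative, `0` would also be a local maximum, so `G` would be
  -- locally constant and its second derivative zero.
  by_contra hneg
  push Not at hneg
  have hGmax : IsLocalMax G 0 := by
    refine isLocalMax_of_deriv_deriv_neg (by rw [h3.deriv]; exact hneg) hGmin.deriv_eq_zero ?_
    exact (ContinuousAt.comp (f := fun t : ℝ => s + t • ξ) (g := f) (by simpa using hf.continuousAt)
      (hl 0).continuousAt)
  have hconst : G =ᶠ[𝓝 0] fun _ => G 0 := by
    filter_upwards [hGmin, hGmax] with t h5 h6 using le_antisymm h6 h5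
  have h7 : deriv G =ᶠ[𝓝 0] fun _ => 0 := by
    filter_upwards [hconst.eventuallyEq_nhds] with t ht
    rw [ht.deriv_eq]; simp
  have h8 := h3.unique ((hasDerivAt_const (0 : ℝ) (0 : ℝ)).congr_of_eventuallyEq h7)
  exact hneg.ne h8

/-- A positive semidefinite matrix is a sum of rank one terms `v vᵀ`, each of which contributes a
second directional derivative. -/
lemma IsLocalMin.elliptic_nonneg {f : Coord d → ℝ} {s : Coord d} (hmin : IsLocalMin f s)
    (hf : ContDiffAt ℝ ∞ f s) {H : Matrix (Fin d) (Fin d) ℝ} (hH : H.PosSemidef) :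
    0 ≤ ∑ a, ∑ b, H a b * partialD₂ f a b s := by
  obtain ⟨m, v, rfl⟩ := Matrix.posSemidef_iff_eq_sum_vecMulVec.1 hH
  have : ∑ a, ∑ b, (∑ k, Matrix.vecMulVec (v k) (star (v k))) a b * partialD₂ f a b s
      = ∑ k, ∑ a, ∑ b, v k a * v k b * partialD₂ f a b s := by
    simp only [Matrix.sum_apply, Matrix.vecMulVec_apply, star_trivial, Finset.sum_mul]
    rw [Finset.sum_comm' (s' := fun _ => Finset.univ) (t' := Finset.univ) (by simp)]
    calc _ = ∑ b, ∑ k, ∑ a, v k a * v k b * partialD₂ f a b s :=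
          Finset.sum_congr rfl fun b _ => Finset.sum_comm
      _ = ∑ k, ∑ b, ∑ a, v k a * v k b * partialD₂ f a b s := Finset.sum_comm
      _ = _ := Finset.sum_congr rfl fun k _ => Finset.sum_comm
  rw [this]
  exact Finset.sum_nonneg fun k _ => IsLocalMin.sum_partialD₂_nonneg hmin hf (WithLp.toLp 2 (v k))

/-- The barrier function. -/
def barrier (p : Coord d) (α R : ℝ) (s : Coord d) : ℝ :=
  Real.exp (-α * ‖s - p‖ ^ 2) - Real.exp (-α * R ^ 2)

lemma hasFDerivAt_exp_norm_sq (p : Coord d) (α : ℝ) (s : Coord d) :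
    HasFDerivAt (fun s => Real.exp (-α * ‖s - p‖ ^ 2))
      ((-2 * α * Real.exp (-α * ‖s - p‖ ^ 2)) • innerSL ℝ (s - p)) s := by
  have h1 := ((((hasFDerivAt_id s).sub_const p).norm_sq).const_mul (-α)).exp
  refine h1.congr_fderiv ?_
  ext ξ
  simp
  ring

lemma contDiff_barrier (p : Coord d) (α R : ℝ) : ContDiff ℝ ∞ (barrier p α R) := by
  unfold barrier
  exact (Real.contDiff_exp.comp (contDiff_const.mul ((contDiff_id.sub contDiff_const).norm_sq ℝ))).sub
    contDiff_const

lemma fderiv_barrier (p : Coord d) (α R : ℝ) (s ξ : Coord d) :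
    fderiv ℝ (barrier p α R) s ξ = -2 * α * Real.exp (-α * ‖s - p‖ ^ 2) * inner ℝ (s - p) ξ := by
  have h : fderiv ℝ (barrier p α R) s = _ :=
    ((hasFDerivAt_exp_norm_sq p α s).sub_const (Real.exp (-α * R ^ 2))).fderiv
  rw [h, smul_apply, smul_eq_mul, innerSL_apply_apply]

lemma fderiv_barrier_stdVec (p : Coord d) (α R : ℝ) (s : Coord d) (b : Fin d) :
    fderiv ℝ (barrier p α R) s (stdVec b) = -2 * α * Real.exp (-α * ‖s - p‖ ^ 2) * (s b - p b) := by
  rw [fderiv_barrier, stdVec, EuclideanSpace.inner_single_right]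
  simp

lemma partialD₂_barrier (p : Coord d) (α R : ℝ) (s : Coord d) (a b : Fin d) :
    partialD₂ (barrier p α R) a b s = Real.exp (-α * ‖s - p‖ ^ 2)
      * (4 * α ^ 2 * (s a - p a) * (s b - p b) - 2 * α * if a = b then 1 else 0) := by
  have h1 : (fun s => fderiv ℝ (barrier p α R) s (stdVec b))
      = fun s => (-2 * α) * (Real.exp (-α * ‖s - p‖ ^ 2) * (s b - p b)) := by
    funext s; rw [fderiv_barrier_stdVec]; ring
  have h2 : HasFDerivAt (fun s : Coord d => s b - p b) (EuclideanSpace.proj b : Coord d →L[ℝ] ℝ) s :=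
    (EuclideanSpace.proj (𝕜 := ℝ) b).hasFDerivAt.sub_const (p b)
  have h3 := (((hasFDerivAt_exp_norm_sq p α s).fun_mul h2).const_mul (-2 * α)).fderiv
  rw [partialD₂, h1, h3]
  have h4 : inner ℝ (s - p) (stdVec a) = s a - p a := by
    rw [stdVec, EuclideanSpace.inner_single_right]; simp
  simp only [smul_apply, add_apply, innerSL_apply_apply, smul_eq_mul, h4]
  have h5 : (EuclideanSpace.proj b : Coord d →L[ℝ] ℝ) (stdVec a) = if a = b then 1 else 0 := by
    simp [eq_comm]
  rw [h5]
  ring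

/-- The barrier is a strict subsolution on an annulus, if `α` is large. -/
lemma exists_barrier {A : Set (Coord d)} (hA : IsCompact A) {p : Coord d} (hp : p ∉ A) (R : ℝ)
    {H : Coord d → Matrix (Fin d) (Fin d) ℝ} (hH : ∀ a b, ContinuousOn (fun s => H s a b) A)
    (hpos : ∀ s ∈ A, (H s).PosDef) {B : Fin d → Coord d → ℝ} (hB : ∀ e, ContinuousOn (B e) A) (K : ℝ)
    (hK : 0 ≤ K) :
    ∃ α > 0, ∀ s ∈ A, K * barrier p α R s < ∑ a, ∑ b, H s a b * partialD₂ (barrier p α R) a b s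
      + ∑ e, B e s * fderiv ℝ (barrier p α R) s (stdVec e) := by
  set q : Coord d → ℝ := fun s => ∑ a, ∑ b, H s a b * (s a - p a) * (s b - p b) with hq
  set T : Coord d → ℝ := fun s => ∑ a, H s a a + ∑ e, B e s * (s e - p e) with hT
  have hcoord : ∀ a, ContinuousOn (fun s : Coord d => s a - p a) A := fun a =>
    ((EuclideanSpace.proj (𝕜 := ℝ) a).continuous.sub continuous_const).continuousOn
  have hqc : ContinuousOn q A := continuousOn_finsetSum _ fun a _ => continuousOn_finsetSum _ fun b _ =>
    ((hH a b).mul (hcoord a)).mul (hcoord b)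
  have hTc : ContinuousOn T A := (continuousOn_finsetSum _ fun a _ => hH a a).add
    (continuousOn_finsetSum _ fun e _ => (hB e).mul (hcoord e))
  have hqpos : ∀ s ∈ A, 0 < q s := by
    intro s hs
    have hne : (fun a => s a - p a) ≠ 0 := fun h => hp (by
      have : s = p := by ext a; exact sub_eq_zero.1 (congrFun h a)
      rwa [← this])
    have := (hpos s hs).dotProduct_mulVec_pos hne
    refine this.trans_eq ?_
    simp only [dotProduct, Matrix.mulVec, Finset.mul_sum, star_trivial, hq]
    exact Finset.sum_congr rfl fun i _ => Finset.sum_congr rfl fun j _ => by ring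
  obtain ⟨μ, hμ, hμq⟩ : ∃ μ > 0, ∀ s ∈ A, μ ≤ q s := by
    rcases A.eq_empty_or_nonempty with rfl | hne
    · exact ⟨1, one_pos, by simp⟩
    · obtain ⟨z, hz, hzm⟩ := hA.exists_isMinOn hne hqc
      exact ⟨q z, hqpos z hz, fun s hs => hzm hs⟩
  obtain ⟨t, ht⟩ := (hA.image_of_continuousOn hTc).bddAbove
  have htT : ∀ s ∈ A, T s ≤ |t| := fun s hs => (ht ⟨s, hs, rfl⟩).trans (le_abs_self t)
  -- The operator maps the exponential to itself times `4 α² q - 2 α T`, with `q ≥ μ` and `T ≤ |t|`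
  -- on `A`. This `α` gives `α ≥ 1` and `4 μ α - 2 |t| ≥ K + 1`, so the factor exceeds `K`.
  set α := (K + 1 + 2 * |t|) / (4 * μ) + 1 with hα
  have hα0 : 1 ≤ α := by
    rw [hα]
    have : 0 ≤ (K + 1 + 2 * |t|) / (4 * μ) := by positivity
    linarith
  have hα1 : K + 1 + 2 * |t| ≤ 4 * μ * α := by
    rw [hα, mul_add, mul_div_cancel₀ _ (by positivity)]
    linarith
  refine ⟨α, by linarith, fun s hs => ?_⟩
  set E := Real.exp (-α * ‖s - p‖ ^ 2) with hE
  have hE0 : 0 < E := Real.exp_pos _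
  have h1 : ∑ a, ∑ b, H s a b * partialD₂ (barrier p α R) a b s
      + ∑ e, B e s * fderiv ℝ (barrier p α R) s (stdVec e)
      = E * (4 * α ^ 2 * q s - 2 * α * T s) := by
    simp only [partialD₂_barrier, fderiv_barrier_stdVec, ← hE]
    have e1 : ∀ a, ∑ b, H s a b * (E * (4 * α ^ 2 * (s a - p a) * (s b - p b) - 2 * α * if a = b then 1 else 0))
        = E * (4 * α ^ 2) * ∑ b, H s a b * (s a - p a) * (s b - p b) - E * (2 * α) * H s a a := by
      intro a
      have : ∀ b, H s a b * (E * (4 * α ^ 2 * (s a - p a) * (s b - p b) - 2 * α * if a = b then 1 else 0))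
          = E * (4 * α ^ 2) * (H s a b * (s a - p a) * (s b - p b))
            - E * (2 * α) * (if a = b then H s a b else 0) := fun b => by split_ifs <;> ring
      simp only [this, Finset.sum_sub_distrib, ← Finset.mul_sum, Finset.sum_ite_eq, Finset.mem_univ, if_true]
    have e2 : ∑ e, B e s * (-2 * α * E * (s e - p e)) = - (E * (2 * α)) * ∑ e, B e s * (s e - p e) := by
      rw [Finset.mul_sum]; exact Finset.sum_congr rfl fun e _ => by ring
    rw [Finset.sum_congr rfl fun a _ => e1 a, e2, Finset.sum_sub_distrib, ← Finset.mul_sum, ← Finset.mul_sum]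
    simp only [hq, hT]
    ring
  rw [h1]
  have h2 : barrier p α R s ≤ E := by
    rw [barrier, ← hE]; linarith [Real.exp_pos (-α * R ^ 2)]
  calc K * barrier p α R s ≤ K * E := mul_le_mul_of_nonneg_left h2 hK
    _ < E * (4 * α ^ 2 * q s - 2 * α * T s) := by
        rw [mul_comm]
        refine mul_lt_mul_of_pos_left ?_ hE0
        have h3 : 4 * α ^ 2 * μ ≤ 4 * α ^ 2 * q s := mul_le_mul_of_nonneg_left (hμq s hs) (by positivity)
        have h4 : 2 * α * T s ≤ 2 * α * |t| := mul_le_mul_of_nonneg_left (htT s hs) (by linarith)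
        have h5 : (K + 1) * 1 ≤ (4 * μ * α - 2 * |t|) * α := by
          refine mul_le_mul (by linarith) hα0 zero_le_one (by linarith)
        nlinarith

/-- The strong maximum principle: a non-negative solution that vanishes at a point vanishes near it. -/
theorem eventually_eq_zero_of_elliptic {Ω : Set (Coord d)} (hΩ : IsOpen Ω) {v : Coord d → ℝ}
    (hv : ContDiffOn ℝ ∞ v Ω) (hv0 : ∀ s ∈ Ω, 0 ≤ v s) {H : Coord d → Matrix (Fin d) (Fin d) ℝ}
    (hH : ∀ a b, ContinuousOn (fun s => H s a b) Ω) (hpos : ∀ s ∈ Ω, (H s).PosDef)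
    {B : Fin d → Coord d → ℝ} (hB : ∀ e, ContinuousOn (B e) Ω) {κ : Coord d → ℝ} (hκ : ContinuousOn κ Ω)
    (heq : ∀ s ∈ Ω, 0 < v s → ∑ a, ∑ b, H s a b * partialD₂ v a b s
      + ∑ e, B e s * fderiv ℝ v s (stdVec e) + κ s * v s = 0)
    {s₀ : Coord d} (hs₀ : s₀ ∈ Ω) (hvs₀ : v s₀ = 0) : ∀ᶠ s in 𝓝 s₀, v s = 0 := by
  by_contra hcon
  obtain ⟨ρ, hρ, hρΩ⟩ := Metric.nhds_basis_closedBall.mem_iff.1 (hΩ.mem_nhds hs₀)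
  -- `p` will be within `ρ / 3` of `s₀` and its nearest zero within `ρ / 3` of `p`; so the ball used
  -- below stays inside the ball of radius `ρ`.
  set r := ρ / 3 with hr
  have hr0 : 0 < r := by positivity
  have hcon' : ∃ᶠ s in 𝓝 s₀, v s ≠ 0 := Filter.not_eventually.1 hcon
  obtain ⟨p, hvp, hpr⟩ := (hcon'.and_eventually (Metric.ball_mem_nhds s₀ hr0)).exists
  have hvc : ContinuousOn v Ω := hv.continuousOn
  set Z := Metric.closedBall s₀ ρ ∩ v ⁻¹' {0} with hZ
  have hZc : IsCompact Z := by
    refine (isCompact_closedBall s₀ ρ).of_isClosed_subset ?_ inter_subset_left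
    exact (hvc.mono hρΩ).preimage_isClosed_of_isClosed Metric.isClosed_closedBall isClosed_singleton
  have hs₀Z : s₀ ∈ Z := ⟨Metric.mem_closedBall_self hρ.le, hvs₀⟩
  -- A zero of `v` nearest to `p`: then `v` is positive in the open ball around `p` through `z`,
  -- which touches the zero set at `z`.
  obtain ⟨z, hzZ, hz⟩ := hZc.exists_infDist_eq_dist ⟨s₀, hs₀Z⟩ p
  set R := dist p z with hR
  have hpz : p ≠ z := fun h => hvp (by rw [h]; exact hzZ.2)
  have hR0 : 0 < R := dist_pos.2 hpz
  have hRr : R < r := by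
    rw [← hz]
    exact (Metric.infDist_le_dist_of_mem hs₀Z).trans_lt hpr
  have hballρ : ∀ s, dist s p ≤ R → dist s s₀ < ρ := fun s hs => by
    calc dist s s₀ ≤ dist s p + dist p s₀ := dist_triangle _ _ _
      _ < r + r := add_lt_add_of_le_of_lt (hs.trans hRr.le) hpr
      _ < ρ := by rw [hr]; linarith
  have hballΩ : ∀ s, dist s p ≤ R → s ∈ Ω := fun s hs => hρΩ (hballρ s hs).le
  have hvpos : ∀ s, dist s p < R → 0 < v s := fun s hs => by
    refine lt_of_le_of_ne (hv0 s (hballΩ s hs.le)) fun h => ?_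
    have : s ∈ Z := ⟨(hballρ s hs.le).le, h.symm⟩
    have h2 := Metric.infDist_le_dist_of_mem (x := p) this
    rw [hz, dist_comm p s] at h2
    exact absurd hs (not_lt.2 h2)
  have hzR : dist z p = R := dist_comm z p
  have hzΩ : z ∈ Ω := hballΩ z hzR.le
  -- `z` is an interior minimum of `v`, so its gradient vanishes. The contradiction will be Hopf's
  -- boundary lemma, which makes the normal derivative at `z` nonzero.
  have hvz : fderiv ℝ v z = 0 := by
    refine IsLocalMin.fderiv_eq_zero ?_
    filter_upwards [hΩ.mem_nhds hzΩ] with s hs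
    rw [show v z = 0 from hzZ.2]
    exact hv0 s hs
  -- the annulus
  set A := Metric.closedBall p R \ Metric.ball p (R / 2) with hA
  have hAc : IsCompact A := (isCompact_closedBall p R).diff Metric.isOpen_ball
  have hAΩ : A ⊆ Ω := fun s hs => hballΩ s hs.1
  have hpA : p ∉ A := fun h => h.2 (Metric.mem_ball_self (by positivity))
  obtain ⟨K, hK⟩ := (hAc.image_of_continuousOn ((hκ.mono hAΩ).norm)).bddAbove
  have hKκ : ∀ s ∈ A, |κ s| ≤ |K| := fun s hs => (hK ⟨s, hs, rfl⟩).trans (le_abs_self K)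
  obtain ⟨α, hα, hbar⟩ := exists_barrier hAc hpA R (fun a b => (hH a b).mono hAΩ)
    (fun s hs => hpos s (hAΩ hs)) (fun e => (hB e).mono hAΩ) |K| (abs_nonneg K)
  set w := barrier p α R with hw
  obtain ⟨τ, hτ, hτm⟩ : ∃ τ > 0, ∀ s, dist s p = R / 2 → τ ≤ v s := by
    rcases (Metric.sphere p (R / 2)).eq_empty_or_nonempty with h | hne
    · exact ⟨1, one_pos, fun s hs => absurd (show s ∈ Metric.sphere p (R / 2) from hs) (by rw [h]; simp)⟩
    · have hsub : Metric.sphere p (R / 2) ⊆ Ω := fun s hs => hballΩ s (by rw [Metric.mem_sphere.1 hs]; linarith)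
      obtain ⟨z', hz', hzm⟩ := (isCompact_sphere p (R / 2)).exists_isMinOn hne (hvc.mono hsub)
      exact ⟨v z', hvpos z' (by rw [Metric.mem_sphere.1 hz']; linarith), fun s hs => hzm hs⟩
  have hw1 : ∀ s, w s ≤ 1 := fun s => by
    have h1 : Real.exp (-α * ‖s - p‖ ^ 2) ≤ 1 := Real.exp_le_one_iff.2 (by
      have : 0 ≤ α * ‖s - p‖ ^ 2 := by positivity
      linarith)
    rw [hw, barrier]; linarith [Real.exp_pos (-α * R ^ 2)]
  have hwR : ∀ s, dist s p = R → w s = 0 := fun s hs => by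
    rw [hw, barrier, ← dist_eq_norm, hs, sub_self]
  have hws : ContDiff ℝ ∞ w := contDiff_barrier p α R
  set f : Coord d → ℝ := fun s => v s - τ * w s with hf
  -- Comparison on the annulus: on the inner sphere `v ≥ τ ≥ τ w`, on the outer one `w = 0`. At an
  -- interior negative minimum the gradients of `v` and `τ w` agree and the barrier inequality
  -- contradicts the equation for `v`, which is available because `v > 0` inside the ball.
  have hfnonneg : ∀ s ∈ A, 0 ≤ f s := by
    have hzA : z ∈ A := ⟨hzR.le, by
      rw [Metric.mem_ball, hzR, not_lt]; linarith⟩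
    have hfc : ContinuousOn f A := (hvc.mono hAΩ).sub (continuousOn_const.mul hws.continuous.continuousOn)
    obtain ⟨s, hsA, hsm⟩ := hAc.exists_isMinOn ⟨z, hzA⟩ hfc
    suffices 0 ≤ f s from fun s' hs' => this.trans (hsm hs')
    by_contra hneg
    push Not at hneg
    have h1 : dist s p ≠ R / 2 := fun h => by
      have := mul_le_mul_of_nonneg_left (hw1 s) hτ.le
      have h2 := hτm s h
      simp only [hf] at hneg
      linarith
    have h2 : dist s p ≠ R := fun h => by
      simp only [hf, hwR s h] at hneg
      linarith [hv0 s (hAΩ hsA)]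
    have h3 : dist s p < R := lt_of_le_of_ne hsA.1 h2
    have h4 : R / 2 < dist s p := lt_of_le_of_ne (not_lt.1 hsA.2) h1.symm
    have hsΩ := hAΩ hsA
    have hloc : IsLocalMin f s := by
      have h5 : A ∈ 𝓝 s := by
        filter_upwards [Metric.isOpen_ball.mem_nhds (Metric.mem_ball.2 h3),
          Metric.isClosed_closedBall.isOpen_compl.mem_nhds (show s ∈ (Metric.closedBall p (R / 2))ᶜ from
            fun h => absurd h4 (not_lt.2 h))] with s' h6 h7
        exact ⟨(Metric.mem_ball.1 h6).le, fun h8 => h7 (Metric.ball_subset_closedBall h8)⟩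
      filter_upwards [h5] with s' hs' using hsm hs'
    have hvs : ContDiffAt ℝ ∞ v s := hv.contDiffAt (hΩ.mem_nhds hsΩ)
    have hτw : ContDiff ℝ ∞ fun s => τ * w s := contDiff_const.mul hws
    have hfs : ContDiffAt ℝ ∞ f s := hvs.sub hτw.contDiffAt
    have hgrad : ∀ e, fderiv ℝ v s (stdVec e) = τ * fderiv ℝ w s (stdVec e) := fun e => by
      have h5 := hloc.fderiv_eq_zero
      have h6 : fderiv ℝ f s = fderiv ℝ v s - τ • fderiv ℝ w s :=
        ((hvs.differentiableAt (by simp)).hasFDerivAt.sub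
          ((hws.differentiable (by simp) s).hasFDerivAt.const_mul τ)).fderiv
      rw [h6] at h5
      have h7 := congrArg (fun L : Coord d →L[ℝ] ℝ => L (stdVec e)) h5
      simp only [sub_apply, smul_apply, smul_eq_mul, zero_apply] at h7
      linarith
    have hsecond : ∀ a b, partialD₂ f a b s = partialD₂ v a b s - τ * partialD₂ w a b s := by
      intro a b
      have h5 : (fun s => fderiv ℝ f s (stdVec b)) =ᶠ[𝓝 s]
          fun s => fderiv ℝ v s (stdVec b) - τ * fderiv ℝ w s (stdVec b) := by
        filter_upwards [hΩ.mem_nhds hsΩ] with s' hs'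
        have h6 : fderiv ℝ f s' = fderiv ℝ v s' - τ • fderiv ℝ w s' :=
          (((hv.contDiffAt (hΩ.mem_nhds hs')).differentiableAt (by simp)).hasFDerivAt.sub
            ((hws.differentiable (by simp) s').hasFDerivAt.const_mul τ)).fderiv
        rw [h6]; rfl
      have h7 : ∀ {k : Coord d → ℝ}, ContDiffAt ℝ ∞ k s →
          DifferentiableAt ℝ (fun s => fderiv ℝ k s (stdVec b)) s := fun hk =>
        ((hk.fderiv_right (m := ∞) (by simp)).differentiableAt (by simp)).clm_apply (differentiableAt_const _)
      have h8 := ((h7 hvs).hasFDerivAt.fun_sub ((h7 hws.contDiffAt).hasFDerivAt.const_mul τ)).fderiv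
      rw [partialD₂, h5.fderiv_eq, h8]
      rfl
    have hell := IsLocalMin.elliptic_nonneg hloc hfs (hpos s hsΩ).posSemidef
    have h5 := heq s hsΩ (hvpos s h3)
    have h6 := hbar s hsA
    simp only [hsecond, mul_sub, Finset.sum_sub_distrib] at hell
    have h7 : ∑ a, ∑ b, H s a b * (τ * partialD₂ w a b s) = τ * ∑ a, ∑ b, H s a b * partialD₂ w a b s := by
      simp only [Finset.mul_sum]
      exact Finset.sum_congr rfl fun a _ => Finset.sum_congr rfl fun b _ => by ring
    have h8 : ∑ e, B e s * fderiv ℝ v s (stdVec e) = τ * ∑ e, B e s * fderiv ℝ w s (stdVec e) := by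
      rw [Finset.mul_sum]
      exact Finset.sum_congr rfl fun e _ => by rw [hgrad]; ring
    rw [h7] at hell
    rw [h8] at h5
    have h9 : τ * (|K| * w s) < τ * (∑ a, ∑ b, H s a b * partialD₂ w a b s
      + ∑ e, B e s * fderiv ℝ w s (stdVec e)) := mul_lt_mul_of_pos_left h6 hτ
    have h10 : -|K| * v s ≤ κ s * v s :=
      mul_le_mul_of_nonneg_right (by linarith [neg_abs_le (κ s), hKκ s hsA]) (hvpos s h3).le
    have h11 : |K| * f s ≤ 0 := mul_nonpos_of_nonneg_of_nonpos (abs_nonneg K) hneg.le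
    simp only [hf, mul_sub] at h11
    linarith
  -- the derivative at `z`
  set G : ℝ → ℝ := fun t => f (z + t • (p - z)) with hG
  have hGd : HasDerivAt G (-(τ * (2 * α * Real.exp (-α * R ^ 2) * R ^ 2))) 0 := by
    have hl : HasDerivAt (fun t : ℝ => z + t • (p - z)) (p - z) 0 := by
      simpa using ((hasDerivAt_id (0 : ℝ)).smul_const (p - z)).const_add z
    have h1 : HasFDerivAt f (fderiv ℝ v z - τ • fderiv ℝ w z) (z + (0 : ℝ) • (p - z)) := by
      rw [zero_smul, add_zero]
      exact ((hv.contDiffAt (hΩ.mem_nhds hzΩ)).differentiableAt (by simp)).hasFDerivAt.sub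
          ((hws.differentiable (by simp) z).hasFDerivAt.const_mul τ)
    refine (h1.comp_hasDerivAt (0 : ℝ) hl).congr_deriv ?_
    rw [hvz, zero_sub, neg_apply, smul_apply, smul_eq_mul, hw, fderiv_barrier, ← dist_eq_norm, hzR,
      ← neg_sub z p, inner_neg_right, real_inner_self_eq_norm_sq, ← dist_eq_norm, hzR]
    ring
  have hG0 : G 0 = 0 := by
    simp only [hG, hf, zero_smul, add_zero, hwR z hzR]
    rw [show v z = 0 from hzZ.2]; ring
  have hneg : -(τ * (2 * α * Real.exp (-α * R ^ 2) * R ^ 2)) < 0 := by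
    rw [neg_lt_zero]; positivity
  -- Moving from `z` towards `p`, `f` becomes negative at once, while `t < 1/2` keeps the point in
  -- the annulus.
  obtain ⟨t, ht, ht'⟩ := ((eventually_lt_of_hasDerivAt hGd hneg).and
    (Ioo_mem_nhdsGT (show (0 : ℝ) < 1 / 2 by norm_num))).exists
  have htA : z + t • (p - z) ∈ A := by
    have h1 : dist (z + t • (p - z)) p = (1 - t) * R := by
      rw [dist_eq_norm, show z + t • (p - z) - p = (1 - t) • (z - p) by module, norm_smul,
        Real.norm_of_nonneg (by linarith [ht'.2]), ← dist_eq_norm z p, hzR]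
    refine ⟨?_, ?_⟩
    · rw [Metric.mem_closedBall, h1]; nlinarith [ht'.1]
    · rw [Metric.mem_ball, h1, not_lt]; nlinarith [ht'.2]
  have := hfnonneg _ htA
  rw [hG0] at ht
  exact absurd ht (not_lt.2 this)

end Hopf

section Collar

variable {d : ℕ} {M : Type*} [TopologicalSpace M]
  [ChartedSpace (EuclideanHalfSpace (d + 1)) M] [IsManifold (𝓡∂ (d + 1)) ∞ M]
  {N : Type*} [TopologicalSpace N] [ChartedSpace (Coord d) N] [IsManifold (𝓡 d) ∞ N]
  {g : SmoothMetric (d + 1) M} {W : M → ℝ} {ι : N → M} {N' : Set N} {ε : ℝ}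
  {X : ℝ → N → M} {u : M → ℝ} {π : M → N}

/-! ### Basic properties of collars -/

lemma IsCollar.mem_image (h : IsCollar g W ι N' ε X u π) {t : ℝ} (ht : t ∈ Ico 0 ε) {q : N}
    (hq : q ∈ N') : X t q ∈ collarImage N' ε X := ⟨(t, q), ⟨ht, hq⟩, rfl⟩

lemma IsCollar.ι_mem_image (h : IsCollar g W ι N' ε X u π) {q : N} (hq : q ∈ N') :
    ι q ∈ collarImage N' ε X := by
  rw [← h.X_zero q hq]
  exact h.mem_image ⟨le_rfl, h.eps_pos⟩ hq

lemma IsCollar.X_u_π (h : IsCollar g W ι N' ε X u π) {p : M} (hp : p ∈ collarImage N' ε X) :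
    u p ∈ Ico 0 ε ∧ π p ∈ N' ∧ X (u p) (π p) = p := by
  obtain ⟨⟨t, q⟩, ⟨ht, hq⟩, rfl⟩ := hp
  have h1 := h.u_X t ht q hq
  have h2 := h.π_X t ht q hq
  refine ⟨by simpa only [h1] using ht, by simpa only [h2] using hq, ?_⟩
  simp only [h1, h2]

lemma IsCollar.restrict (h : IsCollar g W ι N' ε X u π) {N'' : Set N} {ε' : ℝ} (hε' : 0 < ε')
    (hεε' : ε' ≤ ε) (hN : IsOpen N'') (hNN : N'' ⊆ N') : IsCollar g W ι N'' ε' X u π := by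
  have hI : Ico (0 : ℝ) ε' ⊆ Ico 0 ε := Ico_subset_Ico_right hεε'
  have hIo : Ioo (0 : ℝ) ε' ⊆ Ioo 0 ε := Ioo_subset_Ioo_right hεε'
  have hsub : collarImage N'' ε' X ⊆ collarImage N' ε X := image_mono (prod_mono hI hNN)
  have heq : collarImage N'' ε' X = collarImage N' ε X ∩ (u ⁻¹' Iio ε' ∩ π ⁻¹' N'') := by
    ext p
    constructor
    · rintro ⟨⟨t, q⟩, ⟨ht, hq⟩, rfl⟩
      refine ⟨h.mem_image (hI ht) (hNN hq), ?_, ?_⟩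
      · simp only [mem_preimage, h.u_X t (hI ht) q (hNN hq)]; exact ht.2
      · simp only [mem_preimage, h.π_X t (hI ht) q (hNN hq)]; exact hq
    · rintro ⟨hp, h1, h2⟩
      obtain ⟨h3, h4, h5⟩ := h.X_u_π hp
      exact ⟨(u p, π p), ⟨⟨h3.1, h1⟩, h2⟩, h5⟩
  refine ⟨hε', hN, h.smooth_X.mono (prod_mono hI hNN), ?_, h.smooth_u.mono hsub, h.smooth_π.mono hsub,
    fun q hq => h.X_zero q (hNN hq), fun t ht q hq => h.u_X t (hI ht) q (hNN hq),
    fun t ht q hq => h.π_X t (hI ht) q (hNN hq), fun p hp => h.W_pos p (hsub hp),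
    fun t ht q hq => h.mem_interior t (hIo ht) q (hNN hq),
    fun t ht q hq => h.flow t (hIo ht) q (hNN hq)⟩
  rw [heq, inter_inter_distrib_left]
  exact (h.smooth_u.continuousOn.isOpen_inter_preimage h.isOpen_image isOpen_Iio).inter
    (h.smooth_π.continuousOn.isOpen_inter_preimage h.isOpen_image hN)

lemma IsCollar.continuousAt_curve (h : IsCollar g W ι N' ε X u π) {t : ℝ} (ht : t ∈ Ioo 0 ε) {q : N}
    (hq : q ∈ N') : ContinuousAt (fun s => X s q) t := by
  have h1 : ContinuousOn (fun s : ℝ => X s q) (Ico 0 ε) :=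
    h.smooth_X.continuousOn.comp (by fun_prop : ContinuousOn (fun s : ℝ => (s, q)) (Ico 0 ε))
      fun s hs => ⟨hs, hq⟩
  exact h1.continuousAt (Ico_mem_nhds ht.1 ht.2)

/-- A box around `(0, q)` that `X` maps into a given neighbourhood of `ι q`. -/
lemma IsCollar.exists_box (h : IsCollar g W ι N' ε X u π) {q : N} (hq : q ∈ N') {O : Set M}
    (hO : O ∈ 𝓝 (ι q)) : ∃ (B : Set N) (δ : ℝ), IsOpen B ∧ q ∈ B ∧ B ⊆ N' ∧ 0 < δ ∧ δ ≤ ε ∧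
      ∀ t ∈ Ico 0 δ, ∀ q' ∈ B, X t q' ∈ O := by
  have h1 : Tendsto (fun z : ℝ × N => X z.1 z.2) (𝓝[Ico 0 ε ×ˢ N'] (0, q)) (𝓝 (ι q)) := by
    have := h.smooth_X.continuousOn (0, q) ⟨⟨le_rfl, h.eps_pos⟩, hq⟩
    rw [ContinuousWithinAt, h.X_zero q hq] at this
    exact this
  have h2 := h1 hO
  rw [mem_map, nhdsWithin_prod_eq, (h.isOpen_base.nhdsWithin_eq hq)] at h2
  obtain ⟨I, hI, B, hB, hIB⟩ := Filter.mem_prod_iff.1 h2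
  obtain ⟨ρ, hρ, hball⟩ := Metric.mem_nhdsWithin_iff.1 hI
  obtain ⟨B', hB', hB'o, hqB'⟩ := mem_nhds_iff.1 (inter_mem hB (h.isOpen_base.mem_nhds hq))
  refine ⟨B', min ρ ε, hB'o, hqB', fun x hx => (hB' hx).2, lt_min hρ h.eps_pos, min_le_right _ _,
    fun t ht q' hq' => ?_⟩
  have ht1 : t ∈ I := hball ⟨by
    rw [Metric.mem_ball, Real.dist_eq, sub_zero, abs_of_nonneg ht.1]
    exact ht.2.trans_le (min_le_left _ _), ht.1, ht.2.trans_le (min_le_right _ _)⟩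
  exact hIB (show (t, q') ∈ I ×ˢ B from ⟨ht1, (hB' hq').1⟩)

/-- The derivative of a function along the curves of the collar. -/
lemma IsCollar.hasDerivAt_comp (h : IsCollar g W ι N' ε X u π) {t : ℝ} (ht : t ∈ Ioo 0 ε) {q : N}
    (hq : q ∈ N') {c : M} (hc : X t q ∈ (extChartAt (𝓡∂ (d + 1)) c).source) {G : Type*}
    [NormedAddCommGroup G] [NormedSpace ℝ G] {F : M → G}
    (hF : MDifferentiableAt (𝓡∂ (d + 1)) 𝓘(ℝ, G) F (X t q)) :
    HasDerivAt (fun s => F (X s q))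
      (fderivWithin ℝ (fun z => F ((extChartAt (𝓡∂ (d + 1)) c).symm z)) (range (𝓡∂ (d + 1)))
        (extChartAt (𝓡∂ (d + 1)) c (X t q))
        (W (X t q) ^ 2 • WithLp.toLp 2
          fun i => gradient g c u i (extChartAt (𝓡∂ (d + 1)) c (X t q)))) t := by
  set φ := extChartAt (𝓡∂ (d + 1)) c with hφ
  have hyt : φ (X t q) ∈ φ.target := φ.map_source hc
  have hpos : 0 < φ (X t q) 0 := (mem_interior_iff hc).1 (h.mem_interior t ht q hq)
  have h1 : MDifferentiableWithinAt 𝓘(ℝ, Coord (d + 1)) 𝓘(ℝ, G) (F ∘ φ.symm) (range (𝓡∂ (d + 1)))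
      (φ (X t q)) := by
    refine MDifferentiableAt.comp_mdifferentiableWithinAt (φ (X t q)) ?_
      (mdifferentiableWithinAt_extChartAt_symm hyt)
    rw [φ.left_inv hc]; exact hF
  have h2 := h1.differentiableWithinAt.hasFDerivWithinAt.hasFDerivAt (range_mem_nhds hpos)
  have h3 := h2.comp_hasDerivAt t (h.flow t ht q hq c hc)
  refine h3.congr_of_eventuallyEq ?_
  filter_upwards [(h.continuousAt_curve ht hq).eventually
    ((isOpen_extChartAt_source c).mem_nhds hc)] with s hs
  simp only [Function.comp_apply]
  rw [φ.left_inv hs]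

lemma sum_gradient_mul_coordD (c : M) (f k : M → ℝ) (y : Coord (d + 1)) (a : ℝ) :
    fderivWithin ℝ (fun z => f ((extChartAt (𝓡∂ (d + 1)) c).symm z)) (range (𝓡∂ (d + 1))) y
      (a • WithLp.toLp 2 fun i => gradient g c k i y) = a * ∑ i, gradient g c k i y * coordD c f i y := by
  rw [map_smul, smul_eq_mul, stdVec_eq_sum (WithLp.toLp 2 fun i => gradient g c k i y), map_sum]
  congr 1
  refine Finset.sum_congr rfl fun i _ => ?_
  rw [map_smul, smul_eq_mul]
  rfl

lemma IsCollar.mdifferentiableAt_u (h : IsCollar g W ι N' ε X u π) {p : M}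
    (hp : p ∈ collarImage N' ε X) : MDifferentiableAt (𝓡∂ (d + 1)) 𝓘(ℝ, ℝ) u p :=
  (h.smooth_u.contMDiffAt (h.isOpen_image.mem_nhds hp)).mdifferentiableAt (by simp)

/-- Differentiate `u (X t q) = t` along the flow line, whose velocity is `W² ∇u`. -/
lemma IsCollar.eq_one_of_pos (h : IsCollar g W ι N' ε X u π) {t : ℝ} (ht : t ∈ Ioo 0 ε) {q : N}
    (hq : q ∈ N') {c : M} (hc : X t q ∈ (extChartAt (𝓡∂ (d + 1)) c).source) :
    W (X t q) ^ 2 * gradNormSq g c u (extChartAt (𝓡∂ (d + 1)) c (X t q)) = 1 := by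
  have h1 := h.hasDerivAt_comp ht hq hc (h.mdifferentiableAt_u (h.mem_image ⟨ht.1.le, ht.2⟩ hq))
  rw [sum_gradient_mul_coordD] at h1
  have h2 : HasDerivAt (fun s => u (X s q)) 1 t := by
    refine (hasDerivAt_id t).congr_of_eventuallyEq ?_
    filter_upwards [Ioo_mem_nhds ht.1 ht.2] with s hs
    exact h.u_X s ⟨hs.1.le, hs.2⟩ q hq
  exact h1.unique h2

/-- The region of a chart that is covered by a collar. -/
def collarRegion (N' : Set N) (ε : ℝ) (X : ℝ → N → M) (c : M) : Set (Coord (d + 1)) :=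
  (extChartAt (𝓡∂ (d + 1)) c).target ∩ (extChartAt (𝓡∂ (d + 1)) c).symm ⁻¹' collarImage N' ε X

/-- The function `u` of a collar solves the eikonal equation in each chart. -/
theorem IsCollar.isEikonal (h : IsCollar g W ι N' ε X u π) (hW : ContMDiff (𝓡∂ (d + 1)) 𝓘(ℝ, ℝ) ∞ W)
    (hb : ∀ q, ι q ∈ (𝓡∂ (d + 1)).boundary M) (c : M) : IsEikonal g W u c (collarRegion (d := d) N' ε X c) := by
  have hreg : IsChartRegion c (collarRegion (d := d) N' ε X c) := isChartRegion_preimage c h.isOpen_image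
  have hu : ContDiffOn ℝ ∞ (fun z => u ((extChartAt (𝓡∂ (d + 1)) c).symm z))
      (collarRegion (d := d) N' ε X c) := contDiffOn_comp_extChartAt_symm h.isOpen_image h.smooth_u c
  have hWs : ContDiffOn ℝ ∞ (fun z => W ((extChartAt (𝓡∂ (d + 1)) c).symm z))
      (collarRegion (d := d) N' ε X c) := contDiffOn_comp_extChartAt_symm h.isOpen_image hW.contMDiffOn c
  refine ⟨hreg, hu, hWs, fun y hy => h.W_pos _ hy.2, fun y hy => ?_⟩
  set T := collarRegion (d := d) N' ε X c with hT
  -- interior points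
  have hint : ∀ z ∈ T, 0 < z 0 →
      W ((extChartAt (𝓡∂ (d + 1)) c).symm z) ^ 2 * gradNormSq g c u z = 1 := by
    intro z hz hz0
    obtain ⟨hu1, hπ1, hXe⟩ := h.X_u_π hz.2
    set p := (extChartAt (𝓡∂ (d + 1)) c).symm z with hp
    have hps : p ∈ (extChartAt (𝓡∂ (d + 1)) c).source := (extChartAt (𝓡∂ (d + 1)) c).map_target hz.1
    have hpz : extChartAt (𝓡∂ (d + 1)) c p = z := (extChartAt (𝓡∂ (d + 1)) c).right_inv hz.1
    have hpi : p ∈ (𝓡∂ (d + 1)).interior M := (mem_interior_iff hps).2 (by rw [hpz]; exact hz0)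
    have hu0 : 0 < u p := by
      refine lt_of_le_of_ne hu1.1 fun h0 => ?_
      rw [← h0, h.X_zero _ hπ1] at hXe
      have := hb (π p)
      rw [hXe, ← (𝓡∂ (d + 1)).compl_interior] at this
      exact this hpi
    have h1 := h.eq_one_of_pos ⟨hu0, hu1.2⟩ hπ1 (c := c) (by rw [hXe]; exact hps)
    rw [hXe, hpz] at h1
    exact h1
  -- the boundary
  have hcl : y ∈ closure (interior (range (𝓡∂ (d + 1)))) :=
    mem_closure_interior_range (hreg.subset_range hy)
  have hcont : ContinuousWithinAt (fun z => W ((extChartAt (𝓡∂ (d + 1)) c).symm z) ^ 2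
      * gradNormSq g c u z) T y :=
    (((hWs.pow 2).mul (hreg.contDiffOn_gradNormSq g hu)).continuousOn) y hy
  have hcl' : y ∈ closure (interior (range (𝓡∂ (d + 1))) ∩ T) := by
    rw [mem_closure_iff_nhdsWithin_neBot] at hcl ⊢
    have h1 : T ∈ 𝓝[interior (range (𝓡∂ (d + 1)))] y :=
      nhdsWithin_mono y interior_subset (hreg.mem_nhds y hy)
    rw [inter_comm, nhdsWithin_inter_of_mem h1]
    exact hcl
  rw [mem_closure_iff_nhdsWithin_neBot] at hcl'
  have hlim := (hcont.mono (inter_subset_right (s := interior (range (𝓡∂ (d + 1)))))).tendsto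
  refine tendsto_nhds_unique hlim (tendsto_const_nhds.congr' ?_)
  filter_upwards [self_mem_nhdsWithin] with z hz
  refine (hint z hz.2 ?_).symm
  have := hz.1
  rw [interior_range_modelWithCornersEuclideanHalfSpace] at this
  exact this

end Collar

/-! ### Uniqueness of collars and gluing over a closed hypersurface -/

section Glue

variable {d : ℕ} {M : Type*} [TopologicalSpace M]
  [ChartedSpace (EuclideanHalfSpace (d + 1)) M] [IsManifold (𝓡∂ (d + 1)) ∞ M]
  {N : Type*} [TopologicalSpace N] [ChartedSpace (Coord d) N] [IsManifold (𝓡 d) ∞ N]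
  {g : SmoothMetric (d + 1) M} {W : M → ℝ} {ι : N → M}

/-- The flow equation of a collar is known at positive times only, so the left endpoint is reached
by continuity. -/
lemma eq_of_hasDerivAt_zero {E : Type*} [NormedAddCommGroup E] [NormedSpace ℝ E] {f : ℝ → E}
    {a b : ℝ} (hab : a < b) (hc : ContinuousOn f (Icc a b)) (hd : ∀ x ∈ Ioo a b, HasDerivAt f 0 x) :
    f b = f a := by
  have hconst : ∀ x ∈ Ioo a b, f b = f x := fun x hx =>
    constant_of_has_deriv_right_zero (hc.mono (Icc_subset_Icc_left hx.1.le))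
      (fun y hy => (hd y ⟨hx.1.trans_le hy.1, hy.2⟩).hasDerivWithinAt) b ⟨hx.2.le, le_rfl⟩
  have h1 : Tendsto f (𝓝[Ioo a b] a) (𝓝 (f a)) :=
    (hc a ⟨le_rfl, hab.le⟩).mono Ioo_subset_Icc_self
  have : (𝓝[Ioo a b] a).NeBot := by
    rw [← mem_closure_iff_nhdsWithin_neBot, closure_Ioo hab.ne]
    exact ⟨le_rfl, hab.le⟩
  refine tendsto_nhds_unique (tendsto_const_nhds.congr' ?_) h1
  filter_upwards [self_mem_nhdsWithin] with x hx using hconst x hx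

/-- Cauchy–Schwarz for gradients. -/
lemma abs_inner_gradient_le {c : M} {y : Coord (d + 1)}
    (hy : y ∈ (extChartAt (𝓡∂ (d + 1)) c).target) {f k : M → ℝ} {a : ℝ}
    (hf : a * gradNormSq g c f y = 1) (hk : a * gradNormSq g c k y = 1) :
    a * ∑ i, gradient g c k i y * coordD c f i y ≤ 1 := by
  have hps := (coordMetric_posDef g c hy).inv.posSemidef
  set P := (coordMetric g c y)⁻¹ with hP
  have hnn : 0 ≤ gradNormSq g c (fun p => f p) y := by
    have := hps.dotProduct_mulVec_nonneg (fun i => coordD c f i y)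
    rw [star_trivial, dotProduct_comm] at this
    exact this
  have ha : 0 < a := by
    by_contra h
    have := mul_nonpos_of_nonpos_of_nonneg (not_lt.1 h) hnn
    linarith [hf]
  -- Expand `0 ≤ a |∇f - ∇k|² = 2 - 2a ⟨∇f, ∇k⟩`.
  have h1 := hps.dotProduct_mulVec_nonneg (fun i => coordD c f i y - coordD c k i y)
  have h2 : star (fun i => coordD c f i y - coordD c k i y) ⬝ᵥ
      P.mulVec (fun i => coordD c f i y - coordD c k i y)
      = gradNormSq g c f y + gradNormSq g c k y - 2 * ∑ i, gradient g c k i y * coordD c f i y := by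
    have e1 : ∑ i, gradient g c f i y * coordD c k i y = ∑ i, gradient g c k i y * coordD c f i y := by
      simp only [gradient, Finset.sum_mul]
      rw [Finset.sum_comm]
      refine Finset.sum_congr rfl fun i _ => Finset.sum_congr rfl fun j _ => ?_
      rw [coordMetric_inv_symm g c y i j]; ring
    rw [show gradNormSq g c f y + gradNormSq g c k y - 2 * ∑ i, gradient g c k i y * coordD c f i y
      = gradNormSq g c f y + gradNormSq g c k y - ∑ i, gradient g c k i y * coordD c f i y
        - ∑ i, gradient g c f i y * coordD c k i y by rw [e1]; ring]
    unfold gradNormSq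
    rw [← Finset.sum_add_distrib, ← Finset.sum_sub_distrib, ← Finset.sum_sub_distrib]
    simp only [star_trivial, dotProduct, Matrix.mulVec]
    refine Finset.sum_congr rfl fun i _ => ?_
    have e2 : ∑ j, P i j * (coordD c f j y - coordD c k j y) = gradient g c f i y - gradient g c k i y := by
      simp only [gradient, mul_sub, Finset.sum_sub_distrib, hP]
    rw [e2]; ring
  rw [h2] at h1
  nlinarith

/-- Both functions are distances to the boundary for `W⁻² g`. Along a flow line of the first collar
`u₁` has derivative `1`, while `u₂` has derivative `W² ⟨∇u₁, ∇u₂⟩ ≤ 1` by Cauchy–Schwarz, and both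
start at zero. -/
lemma IsCollar.u_le (hb : ∀ q, ι q ∈ (𝓡∂ (d + 1)).boundary M)
    (hW : ContMDiff (𝓡∂ (d + 1)) 𝓘(ℝ, ℝ) ∞ W)
    {N₁ N₂ : Set N} {ε₁ ε₂ : ℝ} {X₁ X₂ : ℝ → N → M} {u₁ u₂ : M → ℝ} {π₁ π₂ : M → N}
    (h₁ : IsCollar g W ι N₁ ε₁ X₁ u₁ π₁) (h₂ : IsCollar g W ι N₂ ε₂ X₂ u₂ π₂) {q : N} (hq₁ : q ∈ N₁)
    (hq₂ : q ∈ N₂) : ∀ᶠ p in 𝓝 (ι q), u₂ p ≤ u₁ p := by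
  obtain ⟨B, δ, hBo, hqB, hBN, hδ, hδε, hbox⟩ := h₁.exists_box hq₁
    (h₂.isOpen_image.mem_nhds (h₂.ι_mem_image hq₂))
  have h₁' := h₁.restrict hδ hδε (hBo.inter h₂.isOpen_base) (fun x hx => hBN hx.1)
  refine Filter.mem_of_superset (h₁'.isOpen_image.mem_nhds (h₁'.ι_mem_image ⟨hqB, hq₂⟩)) ?_
  rintro p ⟨⟨t, q'⟩, ⟨ht, hq'⟩, rfl⟩
  change u₂ (X₁ t q') ≤ u₁ (X₁ t q')
  rw [h₁'.u_X t ht q' hq']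
  set f : ℝ → ℝ := fun s => u₂ (X₁ s q') with hf
  have hcurve : ContinuousOn (fun s : ℝ => X₁ s q') (Ico 0 δ) :=
    h₁'.smooth_X.continuousOn.comp (by fun_prop : ContinuousOn (fun s : ℝ => (s, q')) (Ico 0 δ))
      fun s hs => ⟨hs, hq'⟩
  have hfc : ContinuousOn f (Ico 0 δ) :=
    h₂.smooth_u.continuousOn.comp hcurve fun s hs => hbox s hs q' hq'.1
  have hfd : ∀ s ∈ Ioo 0 δ, ∃ f', HasDerivAt f f' s ∧ f' ≤ 1 := by
    intro s hs
    have hmem := hbox s ⟨hs.1.le, hs.2⟩ q' hq'.1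
    have hsrc := mem_extChartAt_source (I := 𝓡∂ (d + 1)) (X₁ s q')
    refine ⟨_, h₁'.hasDerivAt_comp hs hq' hsrc (h₂.mdifferentiableAt_u hmem), ?_⟩
    rw [sum_gradient_mul_coordD]
    refine abs_inner_gradient_le ((extChartAt (𝓡∂ (d + 1)) _).map_source hsrc) ?_
      (h₁'.eq_one_of_pos hs hq' hsrc)
    have h3 := (h₂.isEikonal hW hb (X₁ s q')).eq_one (extChartAt (𝓡∂ (d + 1)) (X₁ s q') (X₁ s q'))
      ⟨(extChartAt (𝓡∂ (d + 1)) _).map_source hsrc, by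
        rw [mem_preimage, (extChartAt (𝓡∂ (d + 1)) _).left_inv hsrc]; exact hmem⟩
    rwa [(extChartAt (𝓡∂ (d + 1)) _).left_inv hsrc] at h3
  have hf0 : f 0 = 0 := by
    simp only [hf]
    rw [h₁'.X_zero q' hq', ← h₂.X_zero q' hq'.2]
    exact h₂.u_X 0 ⟨le_rfl, h₂.eps_pos⟩ q' hq'.2
  have key : ∀ s ∈ Icc 0 t, f s ≤ s := by
    intro s hs
    have hsub : Icc 0 s ⊆ Ico 0 δ := fun x hx => ⟨hx.1, (hx.2.trans hs.2).trans_lt ht.2⟩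
    rcases hs.1.eq_or_lt with h0 | h0
    · rw [← h0, hf0]
    · obtain ⟨x, hx, hxe⟩ := exists_deriv_eq_slope f h0 (hfc.mono hsub) fun x hx => by
        obtain ⟨f', hf', -⟩ := hfd x ⟨hx.1, (hsub ⟨hx.1.le, hx.2.le⟩).2⟩
        exact hf'.differentiableAt.differentiableWithinAt
      obtain ⟨f', hf', hle⟩ := hfd x ⟨hx.1, (hsub ⟨hx.1.le, hx.2.le⟩).2⟩
      rw [hf'.deriv, hf0, sub_zero, sub_zero] at hxe
      rw [hxe, div_le_one h0] at hle
      exact hle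
  exact key t ⟨ht.1, le_rfl⟩

/-- Two collars agree near their common base. -/
lemma IsCollar.eventually_eq [T2Space N] (hb : ∀ q, ι q ∈ (𝓡∂ (d + 1)).boundary M)
    (hW : ContMDiff (𝓡∂ (d + 1)) 𝓘(ℝ, ℝ) ∞ W)
    {N₁ N₂ : Set N} {ε₁ ε₂ : ℝ} {X₁ X₂ : ℝ → N → M} {u₁ u₂ : M → ℝ} {π₁ π₂ : M → N}
    (h₁ : IsCollar g W ι N₁ ε₁ X₁ u₁ π₁) (h₂ : IsCollar g W ι N₂ ε₂ X₂ u₂ π₂) {q : N} (hq₁ : q ∈ N₁)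
    (hq₂ : q ∈ N₂) :
    ∃ (B : Set N) (δ : ℝ), IsOpen B ∧ q ∈ B ∧ B ⊆ N₁ ∧ 0 < δ ∧ δ ≤ ε₁ ∧
      ∀ t ∈ Ico 0 δ, ∀ q' ∈ B, X₁ t q' = X₂ t q' := by
  have hu : ∀ᶠ p in 𝓝 (ι q), u₁ p = u₂ p := by
    filter_upwards [h₁.u_le hb hW h₂ hq₁ hq₂, h₂.u_le hb hW h₁ hq₂ hq₁] with p hp1 hp2
    exact le_antisymm hp2 hp1
  obtain ⟨O, hO, hOo, hqO⟩ := mem_nhds_iff.1 hu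
  set ψ := extChartAt (𝓡 d) q with hψ
  have hπ₂q : π₂ (ι q) = q := by
    have := h₂.π_X 0 ⟨le_rfl, h₂.eps_pos⟩ q hq₂
    rwa [h₂.X_zero q hq₂] at this
  have hP : O ∩ (collarImage N₂ ε₂ X₂ ∩ π₂ ⁻¹' ψ.source) ∈ 𝓝 (ι q) := by
    refine inter_mem (hOo.mem_nhds hqO) (IsOpen.mem_nhds ?_ ⟨h₂.ι_mem_image hq₂, ?_⟩)
    · exact h₂.smooth_π.continuousOn.isOpen_inter_preimage h₂.isOpen_image (isOpen_extChartAt_source q)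
    · rw [mem_preimage, hπ₂q]; exact mem_extChartAt_source q
  obtain ⟨B, δ, hBo, hqB, hBN, hδ, hδε, hbox⟩ := h₁.exists_box hq₁ hP
  refine ⟨B ∩ (N₂ ∩ ψ.source), δ, hBo.inter (h₂.isOpen_base.inter (isOpen_extChartAt_source q)),
    ⟨hqB, hq₂, mem_extChartAt_source q⟩, fun x hx => hBN hx.1, hδ, hδε, fun t ht q' hq' => ?_⟩
  have h₁' := h₁.restrict hδ hδε hBo hBN
  set F : M → Coord d := fun p => ψ (π₂ p) with hF
  have hFm : ∀ s ∈ Ico 0 δ, MDifferentiableAt (𝓡∂ (d + 1)) 𝓘(ℝ, Coord d) F (X₁ s q') := by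
    intro s hs
    obtain ⟨-, h3, h4⟩ := hbox s hs q' hq'.1
    have h5 : MDifferentiableAt (𝓡∂ (d + 1)) (𝓡 d) π₂ (X₁ s q') :=
      (h₂.smooth_π.contMDiffAt (h₂.isOpen_image.mem_nhds h3)).mdifferentiableAt (by simp)
    exact (mdifferentiableAt_extChartAt (by rwa [mem_preimage, hψ, extChartAt_source] at h4)).comp _ h5
  -- the curves of the first collar are contained in the fibres of `π₂`
  have hder : ∀ s ∈ Ioo 0 δ, HasDerivAt (fun s => F (X₁ s q')) 0 s := by
    intro s hs
    have hs' : s ∈ Ico 0 δ := ⟨hs.1.le, hs.2⟩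
    obtain ⟨hpO, hpI, hpψ⟩ := hbox s hs' q' hq'.1
    set p := X₁ s q' with hp
    have hsrc := mem_extChartAt_source (I := 𝓡∂ (d + 1)) p
    have e1 := h₁'.hasDerivAt_comp hs hq'.1 (c := p) hsrc (hFm s hs')
    obtain ⟨hu2, hπ2, hX2⟩ := h₂.X_u_π hpI
    have hus : u₂ p = s := by
      have h6 : u₁ p = u₂ p := hO hpO
      rw [← h6]; exact h₁'.u_X s hs' q' hq'.1
    rw [hus] at hu2 hX2
    have e2 := h₂.hasDerivAt_comp (t := s) ⟨hs.1, hu2.2⟩ hπ2 (c := p) (by rw [hX2]; exact hsrc)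
      (F := F) (by rw [hX2]; exact hFm s hs')
    rw [hX2] at e2
    have e3 : HasDerivAt (fun s => F (X₂ s (π₂ p))) 0 s := by
      refine (hasDerivAt_const s (ψ (π₂ p))).congr_of_eventuallyEq ?_
      filter_upwards [Ioo_mem_nhds hs.1 hu2.2] with r hr
      simp only [hF]
      rw [h₂.π_X r ⟨hr.1.le, hr.2⟩ _ hπ2]
    have e4 : ∀ i, gradient g p u₁ i (extChartAt (𝓡∂ (d + 1)) p p)
        = gradient g p u₂ i (extChartAt (𝓡∂ (d + 1)) p p) := by
      intro i
      have hreg := isChartRegion_preimage (n := d + 1) p hOo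
      have hmem : extChartAt (𝓡∂ (d + 1)) p p ∈ (extChartAt (𝓡∂ (d + 1)) p).target ∩
          (extChartAt (𝓡∂ (d + 1)) p).symm ⁻¹' O :=
        ⟨(extChartAt (𝓡∂ (d + 1)) p).map_source hsrc, by
          rw [mem_preimage, (extChartAt (𝓡∂ (d + 1)) p).left_inv hsrc]; exact hpO⟩
      simp only [gradient, coordD]
      refine Finset.sum_congr rfl fun j _ => ?_
      rw [hreg.partialD_congr (f := fun z => u₁ ((extChartAt (𝓡∂ (d + 1)) p).symm z))
        (h := fun z => u₂ ((extChartAt (𝓡∂ (d + 1)) p).symm z)) (fun z hz => hO hz.2) hmem]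
    have e5 := e2.unique e3
    rw [← funext e4] at e5
    exact e5 ▸ e1
  have hcurve : ContinuousOn (fun s : ℝ => X₁ s q') (Ico 0 δ) :=
    h₁'.smooth_X.continuousOn.comp (by fun_prop : ContinuousOn (fun s : ℝ => (s, q')) (Ico 0 δ))
      fun s hs => ⟨hs, hq'.1⟩
  have hFc : ContinuousOn (fun s => F (X₁ s q')) (Icc 0 t) := fun s hs =>
    ((hFm s ⟨hs.1, hs.2.trans_lt ht.2⟩).continuousAt.comp_continuousWithinAt
      (f := fun s => X₁ s q') (hcurve s ⟨hs.1, hs.2.trans_lt ht.2⟩)).mono fun x hx => ⟨hx.1, hx.2.trans_lt ht.2⟩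
  have hconst : F (X₁ t q') = F (X₁ 0 q') := by
    rcases ht.1.eq_or_lt with h0 | h0
    · rw [← h0]
    · exact eq_of_hasDerivAt_zero h0 hFc fun x hx => hder x ⟨hx.1, hx.2.trans ht.2⟩
  obtain ⟨hpO, hpI, hpψ⟩ := hbox t ht q' hq'.1
  have hπ0 : π₂ (X₁ 0 q') = q' := by
    rw [h₁.X_zero q' (hBN hq'.1), ← h₂.X_zero q' hq'.2.1]
    exact h₂.π_X 0 ⟨le_rfl, h₂.eps_pos⟩ q' hq'.2.1
  have hπt : π₂ (X₁ t q') = q' := by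
    simp only [hF, hπ0] at hconst
    exact ψ.injOn hpψ hq'.2.2 hconst
  obtain ⟨-, -, hX2⟩ := h₂.X_u_π hpI
  have h6 : u₁ (X₁ t q') = u₂ (X₁ t q') := hO hpO
  rw [hπt, ← h6, h₁'.u_X t ht q' hq'.1] at hX2
  exact hX2.symm

lemma IsCollar.congr {N' : Set N} {ε : ℝ} {X X' : ℝ → N → M} {u : M → ℝ} {π : M → N}
    (h : IsCollar g W ι N' ε X u π) (hX : ∀ t ∈ Ico 0 ε, ∀ q ∈ N', X' t q = X t q) :
    IsCollar g W ι N' ε X' u π := by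
  have him : collarImage N' ε X' = collarImage N' ε X :=
    image_congr fun z hz => hX z.1 hz.1 z.2 hz.2
  have hI : ∀ t ∈ Ioo 0 ε, t ∈ Ico 0 ε := fun t ht => ⟨ht.1.le, ht.2⟩
  refine ⟨h.eps_pos, h.isOpen_base, h.smooth_X.congr fun z hz => hX z.1 hz.1 z.2 hz.2, ?_, ?_, ?_,
    fun q hq => ?_, fun t ht q hq => ?_, fun t ht q hq => ?_, ?_, fun t ht q hq => ?_,
    fun t ht q hq c hc => ?_⟩
  · rw [him]; exact h.isOpen_image
  · rw [him]; exact h.smooth_u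
  · rw [him]; exact h.smooth_π
  · rw [hX 0 ⟨le_rfl, h.eps_pos⟩ q hq]; exact h.X_zero q hq
  · rw [hX t ht q hq]; exact h.u_X t ht q hq
  · rw [hX t ht q hq]; exact h.π_X t ht q hq
  · rw [him]; exact h.W_pos
  · rw [hX t (hI t ht) q hq]; exact h.mem_interior t ht q hq
  · rw [hX t (hI t ht) q hq] at hc ⊢
    refine (h.flow t ht q hq c hc).congr_of_eventuallyEq ?_
    filter_upwards [Ioo_mem_nhds ht.1 ht.2] with s hs
    rw [hX s (hI s hs) q hq]

/-- Existence of a collar of a closed boundary hypersurface. -/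
theorem exists_collar [T2Space M] [T2Space N] [CompactSpace N] [Nonempty N] (g : SmoothMetric (d + 1) M)
    (hW : ContMDiff (𝓡∂ (d + 1)) 𝓘(ℝ, ℝ) ∞ W)
    (hι : IsSmoothEmbedding (𝓡 d) (𝓡∂ (d + 1)) ∞ ι)
    (hb : ∀ q, ι q ∈ (𝓡∂ (d + 1)).boundary M) (hWpos : ∀ q, 0 < W (ι q)) :
    ∃ (ε : ℝ) (X : ℝ → N → M) (u : M → ℝ) (π : M → N), IsCollar g W ι univ ε X u π := by
  have hs : ContMDiff (𝓡 d) (𝓡∂ (d + 1)) ∞ ι := hι.contMDiff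
  choose N₀ ε₀ X₀ u₀ π₀ hmem hcol using fun q => exists_local_collar g hW
    (hι.isImmersion.isImmersionAt q) hs hb (hWpos q)
  -- a shrunken finite cover
  have hshrink : ∀ q, ∃ B : Set N, IsOpen B ∧ q ∈ B ∧ closure B ⊆ N₀ q := by
    intro q
    obtain ⟨K, hK, hKc, hKN⟩ := exists_mem_nhds_isClosed_subset ((hcol q).isOpen_base.mem_nhds (hmem q))
    exact ⟨interior K, isOpen_interior, mem_interior_iff_mem_nhds.2 hK,
      (closure_minimal interior_subset hKc).trans hKN⟩
  choose B hBo hqB hBN using hshrink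
  obtain ⟨F, hF⟩ := isCompact_univ.elim_finite_subcover B hBo
    fun q _ => mem_iUnion.2 ⟨q, hqB q⟩
  have hcov : ∀ q, ∃ i ∈ F, q ∈ B i := fun q => by
    have := hF (mem_univ q)
    simpa using this
  choose i hiF hqi using hcov
  -- The index `i q` is chosen without any continuity; uniqueness of collars makes `X` smooth for
  -- short times all the same.
  set X : ℝ → N → M := fun t q => X₀ (i q) t q with hX
  -- `X` is locally one of the local collars
  have hloc : ∀ q, ∃ (B' : Set N) (δ : ℝ) (u : M → ℝ) (π : M → N), q ∈ B' ∧
      IsCollar g W ι B' δ X u π := by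
    intro q
    have h1 : ∀ j ∈ F, ∃ (C : Set N) (δ : ℝ), IsOpen C ∧ q ∈ C ∧ C ⊆ N₀ (i q) ∧ 0 < δ ∧
        δ ≤ ε₀ (i q) ∧ ∀ t ∈ Ico 0 δ, ∀ q' ∈ C, q' ∈ B j → X₀ (i q) t q' = X₀ j t q' := by
      intro j hj
      -- This is why the cover was shrunk. A point of the closure still lies in the base of the
      -- `j`-th collar, where the two collars agree; any other point has a neighbourhood that misses
      -- `B j`.
      by_cases hqj : q ∈ closure (B j)
      · obtain ⟨C, δ, hC, hqC, hCN, hδ, hδε, hCX⟩ := (hcol (i q)).eventually_eq hb hW (hcol j)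
          (hBN _ (subset_closure (hqi q))) (hBN _ hqj)
        exact ⟨C, δ, hC, hqC, hCN, hδ, hδε, fun t ht q' hq' _ => hCX t ht q' hq'⟩
      · exact ⟨(closure (B j))ᶜ ∩ N₀ (i q), ε₀ (i q), isClosed_closure.isOpen_compl.inter
          (hcol (i q)).isOpen_base, ⟨hqj, hBN _ (subset_closure (hqi q))⟩, inter_subset_right,
          (hcol (i q)).eps_pos, le_rfl, fun t _ q' hq' hB' => absurd (subset_closure hB') hq'.1⟩
    choose! C δ hC hqC hCN hδ hδε hCX using h1
    have hFne : F.Nonempty := ⟨i q, hiF q⟩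
    set δ' := F.inf' hFne δ with hδ'
    have hδ'pos : 0 < δ' := (Finset.lt_inf'_iff hFne).2 fun j hj => hδ j hj
    have hCo : IsOpen (⋂ j ∈ F, C j) := isOpen_biInter_finset fun j hj => hC j hj
    refine ⟨⋂ j ∈ F, C j, δ', u₀ (i q), π₀ (i q), mem_iInter₂.2 fun j hj => hqC j hj, ?_⟩
    have hδle : δ' ≤ ε₀ (i q) := (Finset.inf'_le δ (hiF q)).trans (hδε _ (hiF q))
    refine ((hcol (i q)).restrict hδ'pos hδle hCo fun x hx =>
      hCN _ (hiF q) (mem_iInter₂.1 hx _ (hiF q))).congr fun t ht q' hq' => ?_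
    exact (hCX (i q') (hiF q') t ⟨ht.1, ht.2.trans_le (Finset.inf'_le δ (hiF q'))⟩ q'
      (mem_iInter₂.1 hq' _ (hiF q')) (hqi q')).symm
  choose B' δ u' π' hqB' hcol' using hloc
  -- uniform time and injectivity
  have hunif : ∀ᶠ τ in 𝓝 (0 : ℝ), ∀ q ∈ (univ : Set N), 0 < τ →
      ∃ (C : Set N) (u : M → ℝ) (π : M → N), q ∈ C ∧ IsCollar g W ι C τ X u π := by
    refine isCompact_univ.eventually_forall_of_forall_eventually fun q _ => ?_
    have h1 : {z : ℝ × N | z.1 < δ q ∧ z.2 ∈ B' q} ∈ 𝓝 ((0 : ℝ), q) :=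
      ((isOpen_Iio.preimage continuous_fst).inter
        ((hcol' q).isOpen_base.preimage continuous_snd)).mem_nhds ⟨(hcol' q).eps_pos, hqB' q⟩
    filter_upwards [h1] with z hz hz0
    exact ⟨B' q, u' q, π' q, hz.2, (hcol' q).restrict hz0 hz.1.le (hcol' q).isOpen_base subset_rfl⟩
  -- Injectivity for a uniform time, by compactness of `N × N`: near the diagonal a single local
  -- collar is injective, and away from it the images stay in disjoint neighbourhoods of two
  -- distinct boundary points.
  have hinj : ∀ᶠ τ in 𝓝 (0 : ℝ), ∀ z ∈ (univ : Set (N × N)), ∀ t ∈ Ico 0 τ, ∀ t' ∈ Ico 0 τ,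
      X t z.1 = X t' z.2 → t = t' ∧ z.1 = z.2 := by
    refine isCompact_univ.eventually_forall_of_forall_eventually fun z _ => ?_
    by_cases hz : z.1 = z.2
    · have h1 : {w : ℝ × N × N | w.1 < δ z.1 ∧ w.2.1 ∈ B' z.1 ∧ w.2.2 ∈ B' z.1}
          ∈ 𝓝 ((0 : ℝ), z) := by
        refine (IsOpen.inter (isOpen_Iio.preimage continuous_fst) (IsOpen.inter
          ((hcol' z.1).isOpen_base.preimage (continuous_fst.comp continuous_snd))
          ((hcol' z.1).isOpen_base.preimage (continuous_snd.comp continuous_snd)))).mem_nhds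
          ⟨(hcol' z.1).eps_pos, hqB' z.1, ?_⟩
        change z.2 ∈ B' z.1
        rw [← hz]; exact hqB' z.1
      filter_upwards [h1] with w hw t ht t' ht' heq
      have ht1 : t ∈ Ico 0 (δ z.1) := ⟨ht.1, ht.2.trans hw.1⟩
      have ht2 : t' ∈ Ico 0 (δ z.1) := ⟨ht'.1, ht'.2.trans hw.1⟩
      constructor
      · rw [← (hcol' z.1).u_X t ht1 _ hw.2.1, heq, (hcol' z.1).u_X t' ht2 _ hw.2.2]
      · rw [← (hcol' z.1).π_X t ht1 _ hw.2.1, heq, (hcol' z.1).π_X t' ht2 _ hw.2.2]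
    · obtain ⟨O₁, O₂, hO₁, hO₂, h1, h2, hdisj⟩ := t2_separation (hι.isEmbedding.injective.ne hz)
      obtain ⟨C₁, δ₁, hC₁, hq₁, -, hδ₁, -, hX₁⟩ := (hcol' z.1).exists_box (hqB' z.1) (hO₁.mem_nhds h1)
      obtain ⟨C₂, δ₂, hC₂, hq₂, -, hδ₂, -, hX₂⟩ := (hcol' z.2).exists_box (hqB' z.2) (hO₂.mem_nhds h2)
      have h3 : {w : ℝ × N × N | w.1 < min δ₁ δ₂ ∧ w.2.1 ∈ C₁ ∧ w.2.2 ∈ C₂} ∈ 𝓝 ((0 : ℝ), z) :=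
        (IsOpen.inter (isOpen_Iio.preimage continuous_fst) (IsOpen.inter
          (hC₁.preimage (continuous_fst.comp continuous_snd))
          (hC₂.preimage (continuous_snd.comp continuous_snd)))).mem_nhds
          ⟨lt_min hδ₁ hδ₂, hq₁, hq₂⟩
      filter_upwards [h3] with w hw t ht t' ht' heq
      exfalso
      have e1 := hX₁ t ⟨ht.1, ht.2.trans (hw.1.trans_le (min_le_left _ _))⟩ _ hw.2.1
      have e2 := hX₂ t' ⟨ht'.1, ht'.2.trans (hw.1.trans_le (min_le_right _ _))⟩ _ hw.2.2
      rw [heq] at e1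
      exact disjoint_left.1 hdisj e1 e2
  obtain ⟨τ, ⟨h1, h2⟩, hτ⟩ := (((hunif.and hinj).filter_mono nhdsWithin_le_nhds).and
    (self_mem_nhdsWithin (s := Ioi (0 : ℝ)))).exists
  choose C uC πC hqC hcolC using fun q => h1 q (mem_univ q) hτ
  have hXinj : InjOn (fun z : ℝ × N => X z.1 z.2) (Ico 0 τ ×ˢ univ) := by
    rintro ⟨t, q⟩ ht ⟨t', q'⟩ ht' heq
    obtain ⟨e1, e2⟩ := h2 (q, q') (mem_univ _) t ht.1 t' ht'.1 heq
    exact Prod.ext e1 e2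
  -- The global inverse coincides locally with the pair `(u, π)` of a local collar, from which it
  -- inherits smoothness.
  set Θ : M → ℝ × N := Function.invFunOn (fun z : ℝ × N => X z.1 z.2) (Ico 0 τ ×ˢ univ) with hΘ
  have hΘX : ∀ t ∈ Ico 0 τ, ∀ q, Θ (X t q) = (t, q) := fun t ht q =>
    hXinj.leftInvOn_invFunOn (show (t, q) ∈ Ico 0 τ ×ˢ (univ : Set N) from ⟨ht, mem_univ q⟩)
  have hsub : ∀ q, collarImage (C q) τ X ⊆ collarImage univ τ X := fun q =>
    image_mono (prod_mono subset_rfl (subset_univ _))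
  have hmemC : ∀ p ∈ collarImage (univ : Set N) τ X, ∃ q, p ∈ collarImage (C q) τ X := by
    rintro p ⟨⟨t, q⟩, ⟨ht, -⟩, rfl⟩
    exact ⟨q, (t, q), ⟨ht, hqC q⟩, rfl⟩
  have hagree : ∀ q, ∀ p ∈ collarImage (C q) τ X, (Θ p).1 = uC q p ∧ (Θ p).2 = πC q p := by
    rintro q p ⟨⟨t, q'⟩, ⟨ht, hq'⟩, rfl⟩
    simp only [hΘX t ht q']
    exact ⟨((hcolC q).u_X t ht q' hq').symm, ((hcolC q).π_X t ht q' hq').symm⟩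
  refine ⟨τ, X, fun p => (Θ p).1, fun p => (Θ p).2, hτ, isOpen_univ, ?_, ?_, ?_, ?_, ?_, ?_, ?_, ?_, ?_, ?_⟩
  · rintro ⟨t, q⟩ ⟨ht, -⟩
    refine ((hcolC q).smooth_X (t, q) ⟨ht, hqC q⟩).mono_of_mem_nhdsWithin ?_
    have : (univ : Set ℝ) ×ˢ C q ∈ 𝓝 (t, q) := prod_mem_nhds univ_mem ((hcolC q).isOpen_base.mem_nhds (hqC q))
    filter_upwards [self_mem_nhdsWithin, mem_nhdsWithin_of_mem_nhds this] with z hz1 hz2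
    exact ⟨hz1.1, hz2.2⟩
  · have : collarImage (univ : Set N) τ X = ⋃ q, collarImage (C q) τ X := by
      refine subset_antisymm (fun p hp => mem_iUnion.2 (hmemC p hp)) (iUnion_subset hsub)
    rw [this]
    exact isOpen_iUnion fun q => (hcolC q).isOpen_image
  · intro p hp
    obtain ⟨q, hq⟩ := hmemC p hp
    have h3 := (hcolC q).smooth_u.contMDiffAt ((hcolC q).isOpen_image.mem_nhds hq)
    refine (h3.congr_of_eventuallyEq ?_).contMDiffWithinAt
    filter_upwards [(hcolC q).isOpen_image.mem_nhds hq] with x hx using (hagree q x hx).1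
  · intro p hp
    obtain ⟨q, hq⟩ := hmemC p hp
    have h3 := (hcolC q).smooth_π.contMDiffAt ((hcolC q).isOpen_image.mem_nhds hq)
    refine (h3.congr_of_eventuallyEq ?_).contMDiffWithinAt
    filter_upwards [(hcolC q).isOpen_image.mem_nhds hq] with x hx using (hagree q x hx).2
  · exact fun q _ => (hcolC q).X_zero q (hqC q)
  · exact fun t ht q _ => by rw [hΘX t ht q]
  · exact fun t ht q _ => by rw [hΘX t ht q]
  · intro p hp
    obtain ⟨q, hq⟩ := hmemC p hp
    exact (hcolC q).W_pos p hq
  · exact fun t ht q _ => (hcolC q).mem_interior t ht q (hqC q)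
  · intro t ht q _ c hc
    have h3 := (hcolC q).flow t ht q (hqC q) c hc
    have hmem : X t q ∈ collarImage (C q) τ X := ⟨(t, q), ⟨⟨ht.1.le, ht.2⟩, hqC q⟩, rfl⟩
    have hreg := isChartRegion_preimage (n := d + 1) c (hcolC q).isOpen_image
    have e4 : ∀ i, gradient g c (fun p => (Θ p).1) i (extChartAt (𝓡∂ (d + 1)) c (X t q))
        = gradient g c (uC q) i (extChartAt (𝓡∂ (d + 1)) c (X t q)) := by
      intro i
      simp only [gradient, coordD]
      refine Finset.sum_congr rfl fun j _ => ?_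
      rw [hreg.partialD_congr (f := fun z => (Θ ((extChartAt (𝓡∂ (d + 1)) c).symm z)).1)
        (h := fun z => uC q ((extChartAt (𝓡∂ (d + 1)) c).symm z)) (fun z hz => (hagree q _ hz.2).1)
        ⟨(extChartAt (𝓡∂ (d + 1)) c).map_source hc, by
          rw [mem_preimage, (extChartAt (𝓡∂ (d + 1)) c).left_inv hc]; exact hmem⟩]
    simp_rw [e4]
    exact h3

end Glue

/-! ### Densities on a manifold -/

section Density

variable {d : ℕ} {N : Type*} [TopologicalSpace N] [ChartedSpace (Coord d) N] [IsManifold (𝓡 d) ∞ N]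

/-- The change of coordinates from the chart at `c` to the chart at `c'`. -/
def transition (c c' : N) (y : Coord d) : Coord d :=
  extChartAt (𝓡 d) c' ((extChartAt (𝓡 d) c).symm y)

/-- The points of the chart at `c` that lie in `E`. -/
def chartPart (c : N) (E : Set N) : Set (Coord d) :=
  (extChartAt (𝓡 d) c).target ∩ (extChartAt (𝓡 d) c).symm ⁻¹' E

lemma isOpen_chartPart (c : N) {E : Set N} (hE : IsOpen E) : IsOpen (chartPart (d := d) c E) :=
  (continuousOn_extChartAt_symm c).isOpen_inter_preimage (isOpen_extChartAt_target c) hE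

lemma contDiffOn_transition (c c' : N) : ContDiffOn ℝ ∞ (transition (d := d) c c')
    (chartPart c (extChartAt (𝓡 d) c').source) := by
  refine contMDiffOn_iff_contDiffOn.1 ?_
  have h1 : ContMDiffOn (𝓡 d) 𝓘(ℝ, Coord d) ∞ (extChartAt (𝓡 d) c') (extChartAt (𝓡 d) c').source := by
    rw [extChartAt_source]; exact contMDiffOn_extChartAt
  exact h1.comp ((contMDiffOn_extChartAt_symm c).mono inter_subset_left) fun y hy => hy.2

lemma injOn_transition (c c' : N) :
    InjOn (transition (d := d) c c') (chartPart c (extChartAt (𝓡 d) c').source) := by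
  intro y hy z hz h
  exact (extChartAt (𝓡 d) c).symm.injOn hy.1 hz.1 ((extChartAt (𝓡 d) c').injOn hy.2 hz.2 h)

/-- A family of densities, one for each chart, that transforms like the density of a measure. -/
def IsDensity (D : N → Coord d → ℝ≥0∞) : Prop :=
  ∀ c c' : N, ∀ y ∈ chartPart c (extChartAt (𝓡 d) c').source,
    D c y = ENNReal.ofReal |(fderiv ℝ (transition c c') y).det| * D c' (transition c c' y)

lemma IsDensity.lintegral_image {D : N → Coord d → ℝ≥0∞} (hD : IsDensity D) (c c' : N)
    {S : Set (Coord d)} (hS : MeasurableSet S)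
    (hSc : S ⊆ chartPart c (extChartAt (𝓡 d) c').source) :
    ∫⁻ y in S, D c y = ∫⁻ y in transition c c' '' S, D c' y := by
  rw [lintegral_image_eq_lintegral_abs_det_fderiv_mul volume hS
    (f' := fun y => fderiv ℝ (transition c c') y) (fun y hy => ?_) ((injOn_transition c c').mono hSc)]
  · exact setLIntegral_congr_fun hS fun y hy => hD c c' y (hSc hy)
  · have h1 := (contDiffOn_transition c c').contDiffAt
      ((isOpen_chartPart c (isOpen_extChartAt_source c')).mem_nhds (hSc hy))
    exact (h1.differentiableAt (by simp)).hasFDerivAt.hasFDerivWithinAt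

lemma measurableSet_image_transition (c c' : N) {S : Set (Coord d)} (hS : MeasurableSet S)
    (hSc : S ⊆ chartPart c (extChartAt (𝓡 d) c').source) :
    MeasurableSet (transition c c' '' S) := by
  refine hS.image_of_continuousOn_injOn ?_ ((injOn_transition c c').mono hSc)
  exact (contDiffOn_transition c c').continuousOn.mono hSc

/-- A finite measurable partition of `N` into pieces of chart domains. -/
structure IsChartPartition (F : Finset N) (B : N → Set (Coord d)) : Prop where
  measurable : ∀ c ∈ F, MeasurableSet (B c)
  subset : ∀ c ∈ F, B c ⊆ (extChartAt (𝓡 d) c).target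
  disjoint : (F : Set N).PairwiseDisjoint fun c => (extChartAt (𝓡 d) c).symm '' B c
  cover : ∀ q : N, ∃ c ∈ F, ∃ y ∈ B c, (extChartAt (𝓡 d) c).symm y = q
  bounded : ∀ c ∈ F, ∃ K, IsCompact K ∧ B c ⊆ K ∧ K ⊆ (extChartAt (𝓡 d) c).target

variable (d N) in
lemma exists_isChartPartition [CompactSpace N] :
    ∃ (F : Finset N) (B : N → Set (Coord d)), IsChartPartition F B := by
  have hball : ∀ q : N, ∃ r > 0, Metric.closedBall (extChartAt (𝓡 d) q q) r
      ⊆ (extChartAt (𝓡 d) q).target := fun q =>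
    Metric.nhds_basis_closedBall.mem_iff.1
      ((isOpen_extChartAt_target q).mem_nhds (mem_extChartAt_target q))
  choose r hr hrt using hball
  set A : N → Set N := fun q => (extChartAt (𝓡 d) q).source ∩
    extChartAt (𝓡 d) q ⁻¹' Metric.ball (extChartAt (𝓡 d) q q) (r q) with hA
  have hAo : ∀ q, IsOpen (A q) := fun q =>
    (continuousOn_extChartAt q).isOpen_inter_preimage (isOpen_extChartAt_source q) Metric.isOpen_ball
  have hqA : ∀ q, q ∈ A q := fun q => ⟨mem_extChartAt_source q, Metric.mem_ball_self (hr q)⟩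
  obtain ⟨F, hF⟩ := isCompact_univ.elim_finite_subcover A hAo fun q _ => mem_iUnion.2 ⟨q, hqA q⟩
  -- Points that lie in no earlier ball: removing the earlier balls along a well-order turns the
  -- finite cover into a partition.
  set P : N → Set N := fun c => {q | ∀ j ∈ F, WellOrderingRel j c → q ∉ A j} with hP
  set B : N → Set (Coord d) := fun c => Metric.ball (extChartAt (𝓡 d) c c) (r c) ∩
    (extChartAt (𝓡 d) c).symm ⁻¹' P c with hB
  have hBt : ∀ c, B c ⊆ (extChartAt (𝓡 d) c).target := fun c y hy =>
    hrt c (Metric.ball_subset_closedBall hy.1)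
  have hBA : ∀ c, ∀ y ∈ B c, (extChartAt (𝓡 d) c).symm y ∈ A c := by
    intro c y hy
    refine ⟨(extChartAt (𝓡 d) c).map_target (hBt c hy), ?_⟩
    rw [mem_preimage, (extChartAt (𝓡 d) c).right_inv (hBt c hy)]
    exact hy.1
  refine ⟨F, B, fun c hc => ?_, fun c _ => hBt c, ?_, fun q => ?_, fun c hc =>
    ⟨_, isCompact_closedBall _ (r c), fun y hy => Metric.ball_subset_closedBall hy.1, hrt c⟩⟩
  · have : B c = Metric.ball (extChartAt (𝓡 d) c c) (r c) \
        ⋃ j ∈ F, ⋃ (_ : WellOrderingRel j c), chartPart c (A j) := by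
      ext y
      simp only [hB, hP, mem_inter_iff, mem_preimage, mem_ofPred_eq, Set.mem_sdiff, mem_iUnion, not_exists,
        chartPart, not_and]
      refine and_congr_right fun hy => ?_
      constructor
      · intro h j hj hjc _; exact h j hj hjc
      · intro h j hj hjc; exact h j hj hjc (hrt c (Metric.ball_subset_closedBall hy))
    rw [this]
    refine Metric.isOpen_ball.measurableSet.diff (IsOpen.measurableSet ?_)
    exact isOpen_biUnion fun j _ => isOpen_iUnion fun _ => isOpen_chartPart c (hAo j)
  · intro c hc c' hc' hne
    refine disjoint_left.2 ?_
    rintro q ⟨y, hy, rfl⟩ ⟨z, hz, hzy⟩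
    rcases trichotomous_of WellOrderingRel c c' with h | h | h
    · have h1 := hz.2 c hc h
      rw [hzy] at h1
      exact h1 (hBA c y hy)
    · exact hne h
    · have h1 := hy.2 c' hc' h
      rw [← hzy] at h1
      exact h1 (hBA c' z hz)
  · have hex : ∃ c, c ∈ F ∧ q ∈ A c := by
      have := hF (mem_univ q)
      simpa using this
    obtain ⟨c, ⟨hcF, hqc⟩, hmin⟩ := (IsWellFounded.wf (r := (WellOrderingRel : N → N → Prop))).has_min
      {c | c ∈ F ∧ q ∈ A c} hex
    have hleft := (extChartAt (𝓡 d) c).left_inv hqc.1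
    refine ⟨c, hcF, extChartAt (𝓡 d) c q, ⟨hqc.2, ?_⟩, hleft⟩
    rw [mem_preimage, hleft]
    exact fun j hj hjc hqj => hmin j ⟨hj, hqj⟩ hjc

/-- The integral of a density over `E`, computed with a partition. -/
def densityMass (F : Finset N) (B : N → Set (Coord d)) (D : N → Coord d → ℝ≥0∞) (E : Set N) : ℝ≥0∞ :=
  ∑ c ∈ F, ∫⁻ y in B c ∩ (extChartAt (𝓡 d) c).symm ⁻¹' E, D c y

variable {F : Finset N} {B : N → Set (Coord d)} {D D' : N → Coord d → ℝ≥0∞}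

lemma IsChartPartition.measurableSet_inter (hP : IsChartPartition F B) {c : N} (hc : c ∈ F) {E : Set N}
    (hE : IsOpen E) : MeasurableSet (B c ∩ (extChartAt (𝓡 d) c).symm ⁻¹' E) := by
  have : B c ∩ (extChartAt (𝓡 d) c).symm ⁻¹' E = B c ∩ chartPart c E := by
    ext y
    exact ⟨fun h => ⟨h.1, hP.subset c hc h.1, h.2⟩, fun h => ⟨h.1, h.2.2⟩⟩
  rw [this]
  exact (hP.measurable c hc).inter (isOpen_chartPart c hE).measurableSet

/-- The sum over a disjoint family of pieces is at most the integral. -/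
lemma IsDensity.sum_le_densityMass (hD : IsDensity D) (hP : IsChartPartition F B) {E : Set N}
    {s : Finset N} {C : N → Set (Coord d)} (hC : ∀ c ∈ s, MeasurableSet (C c))
    (hCt : ∀ c ∈ s, C c ⊆ (extChartAt (𝓡 d) c).target)
    (hdisj : (s : Set N).PairwiseDisjoint fun c => (extChartAt (𝓡 d) c).symm '' C c)
    (hCE : ∀ c ∈ s, (extChartAt (𝓡 d) c).symm '' C c ⊆ E) :
    ∑ c ∈ s, ∫⁻ y in C c, D c y ≤ densityMass F B D E := by
  -- the part of `C c` in the `i`-th piece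
  set R : N → N → Set (Coord d) := fun c i => C c ∩ (extChartAt (𝓡 d) c).symm ⁻¹'
    ((extChartAt (𝓡 d) i).symm '' B i) with hR
  have hRsub : ∀ c ∈ s, ∀ i ∈ F, R c i ⊆ chartPart c (extChartAt (𝓡 d) i).source := by
    rintro c hc i hi y ⟨hy, z, hz, hzy⟩
    refine ⟨hCt c hc hy, ?_⟩
    rw [mem_preimage, ← hzy]
    exact (extChartAt (𝓡 d) i).map_target (hP.subset i hi hz)
  have hRm : ∀ c ∈ s, ∀ i ∈ F, MeasurableSet (R c i) := by
    intro c hc i hi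
    have h1 : R c i = C c ∩ transition i c '' (B i ∩ chartPart i (extChartAt (𝓡 d) c).source) := by
      ext y
      constructor
      · rintro ⟨hy, z, hz, hzy⟩
        refine ⟨hy, z, ⟨hz, hP.subset i hi hz, ?_⟩, ?_⟩
        · rw [mem_preimage, hzy]; exact (extChartAt (𝓡 d) c).map_target (hCt c hc hy)
        · rw [transition, hzy]; exact (extChartAt (𝓡 d) c).right_inv (hCt c hc hy)
      · rintro ⟨hy, z, ⟨hz, hz'⟩, rfl⟩
        refine ⟨hy, z, hz, ?_⟩
        exact ((extChartAt (𝓡 d) c).left_inv hz'.2).symm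
    rw [h1]
    exact (hC c hc).inter (measurableSet_image_transition i c ((hP.measurable i hi).inter
      (isOpen_chartPart i (isOpen_extChartAt_source c)).measurableSet) inter_subset_right)
  have h1 : ∀ c ∈ s, ∫⁻ y in C c, D c y = ∑ i ∈ F, ∫⁻ y in R c i, D c y := by
    intro c hc
    have hU : C c = ⋃ i ∈ F, R c i := by
      ext y
      simp only [mem_iUnion]
      constructor
      · intro hy
        obtain ⟨i, hi, z, hz, hzy⟩ := hP.cover ((extChartAt (𝓡 d) c).symm y)
        exact ⟨i, hi, hy, z, hz, hzy⟩
      · rintro ⟨i, hi, hy⟩; exact hy.1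
    conv_lhs => rw [hU]
    refine lintegral_biUnion_finset (fun i hi j hj hij => ?_) (fun i hi => hRm c hc i hi) _
    exact disjoint_left.2 fun y hy hy' => disjoint_left.1 (hP.disjoint hi hj hij) hy.2 hy'.2
  rw [Finset.sum_congr rfl h1, Finset.sum_comm]
  refine Finset.sum_le_sum fun i hi => ?_
  -- Change of variables moves the pieces inside the `i`-th cell into the chart at `i`, where they
  -- are disjoint subsets of `B i`.
  have h2 : ∀ c ∈ s, ∫⁻ y in R c i, D c y = ∫⁻ y in transition c i '' R c i, D i y := fun c hc =>
    hD.lintegral_image c i (hRm c hc i hi) (hRsub c hc i hi)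
  have hdis : (s : Set N).PairwiseDisjoint fun c => transition c i '' R c i := by
    intro c hc c' hc' hne
    refine disjoint_left.2 ?_
    rintro _ ⟨y, hy, rfl⟩ ⟨z, hz, hzy⟩
    have h3 : (extChartAt (𝓡 d) c').symm z = (extChartAt (𝓡 d) c).symm y :=
      (extChartAt (𝓡 d) i).injOn (hRsub c' hc' i hi hz).2 (hRsub c hc i hi hy).2 hzy
    exact disjoint_left.1 (hdisj hc hc' hne) ⟨y, hy.1, rfl⟩ ⟨z, hz.1, h3⟩
  rw [Finset.sum_congr rfl h2, ← lintegral_biUnion_finset hdis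
    (fun c hc => measurableSet_image_transition c i (hRm c hc i hi) (hRsub c hc i hi))]
  refine lintegral_mono_set ?_
  intro w hw
  simp only [mem_iUnion] at hw
  obtain ⟨c, hc, y, hy, rfl⟩ := hw
  obtain ⟨z, hz, hzy⟩ := hy.2
  have h4 : transition c i y = z := by
    rw [transition, ← hzy]; exact (extChartAt (𝓡 d) i).right_inv (hP.subset i hi hz)
  refine ⟨by rw [h4]; exact hz, ?_⟩
  rw [h4, mem_preimage, hzy]
  exact hCE c hc ⟨y, hy.1, rfl⟩

lemma densityMass_univ : densityMass F B D univ = ∑ c ∈ F, ∫⁻ y in B c, D c y := by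
  simp [densityMass]

lemma IsChartPartition.densityMass_add_compl (hP : IsChartPartition F B) {E : Set N} (hE : IsOpen E) :
    densityMass F B D E + densityMass F B D Eᶜ = densityMass F B D univ := by
  rw [densityMass_univ, densityMass, densityMass, ← Finset.sum_add_distrib]
  refine Finset.sum_congr rfl fun c hc => ?_
  have h1 : B c ∩ (extChartAt (𝓡 d) c).symm ⁻¹' Eᶜ
      = B c \ (B c ∩ (extChartAt (𝓡 d) c).symm ⁻¹' E) := by
    ext y; simp
  have h2 := lintegral_inter_add_sdiff (μ := volume) (D c) (B c) (hP.measurableSet_inter hc hE)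
  rw [h1]
  rw [show B c ∩ (B c ∩ (extChartAt (𝓡 d) c).symm ⁻¹' E) = B c ∩ (extChartAt (𝓡 d) c).symm ⁻¹' E by
    rw [← inter_assoc, inter_self]] at h2
  exact h2

lemma IsChartPartition.densityMass_le (hP : IsChartPartition F B) {E : Set N} {k : ℝ≥0∞} (hk : k ≠ ⊤)
    (h : ∀ c ∈ F, ∀ y ∈ B c, (extChartAt (𝓡 d) c).symm y ∈ E → D' c y ≤ k * D c y)
    (hE : ∀ c ∈ F, MeasurableSet (B c ∩ (extChartAt (𝓡 d) c).symm ⁻¹' E)) :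
    densityMass F B D' E ≤ k * densityMass F B D E := by
  rw [densityMass, densityMass, Finset.mul_sum]
  refine Finset.sum_le_sum fun c hc => ?_
  rw [← lintegral_const_mul' _ _ hk]
  exact setLIntegral_mono' (hE c hc) fun y hy => h c hc y hy.1 hy.2

lemma IsChartPartition.densityMass_lt_top (hP : IsChartPartition F B)
    (hD : ∀ c ∈ F, ∃ f : Coord d → ℝ, ContinuousOn f (extChartAt (𝓡 d) c).target ∧
      ∀ y, D c y = ENNReal.ofReal (f y)) : densityMass F B D univ < ⊤ := by
  rw [densityMass_univ]
  refine ENNReal.sum_lt_top.2 fun c hc => ?_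
  obtain ⟨K, hK, hBK, hKt⟩ := hP.bounded c hc
  obtain ⟨f, hf, hfD⟩ := hD c hc
  obtain ⟨b, hb⟩ := (hK.image_of_continuousOn (hf.mono hKt)).bddAbove
  calc ∫⁻ y in B c, D c y ≤ ∫⁻ _ in B c, ENNReal.ofReal b :=
        setLIntegral_mono' (hP.measurable c hc) fun y hy => by
          rw [hfD]; exact ENNReal.ofReal_le_ofReal (hb ⟨y, hBK hy, rfl⟩)
    _ ≤ ENNReal.ofReal b * volume K := by
        rw [lintegral_const, Measure.restrict_apply_univ]
        gcongr
    _ < ⊤ := ENNReal.mul_lt_top ENNReal.ofReal_lt_top hK.measure_lt_top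

lemma IsDensity.densityMass_pos (hD : IsDensity D) (hP : IsChartPartition F B) {E : Set N}
    (hE : IsOpen E) {q : N} (hq : q ∈ E) (hpos : ∀ c : N, ∀ y ∈ (extChartAt (𝓡 d) c).target, D c y ≠ 0)
    (hm : ∀ c, AEMeasurable (D c) (volume.restrict (extChartAt (𝓡 d) c).target)) :
    0 < densityMass F B D E := by
  have h1 := hD.sum_le_densityMass hP (E := E) (s := {q}) (C := fun c => chartPart c E)
    (fun c _ => (isOpen_chartPart c hE).measurableSet) (fun c _ => inter_subset_left)
    (by rw [Finset.coe_singleton]; exact pairwiseDisjoint_singleton _ _)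
    (by rintro c - _ ⟨y, hy, rfl⟩; exact hy.2)
  rw [Finset.sum_singleton] at h1
  refine lt_of_lt_of_le ?_ h1
  rw [pos_iff_ne_zero]
  intro h0
  have hsub : chartPart q E ⊆ (extChartAt (𝓡 d) q).target := inter_subset_left
  rw [lintegral_eq_zero_iff' ((hm q).mono_measure (Measure.restrict_mono hsub le_rfl))] at h0
  have h2 := (ae_restrict_iff' (isOpen_chartPart q hE).measurableSet).1 h0
  have h3 : volume (chartPart q E : Set (Coord d)) = 0 := by
    refine measure_mono_null (fun y hy => ?_) h2
    intro h4
    exact hpos q y (hsub hy) (h4 hy)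
  exact ((isOpen_chartPart q hE).measure_pos volume ⟨extChartAt (𝓡 d) q q,
    mem_extChartAt_target q, by rw [mem_preimage, extChartAt_to_inv]; exact hq⟩).ne' h3

end Density

/-! ### The area density in coordinates -/

section Gram

/-- The Jacobian matrix of a map between coordinate spaces. -/
def jac {d n : ℕ} (f : Coord d → Coord n) (y : Coord d) : Matrix (Fin n) (Fin d) ℝ :=
  Matrix.of fun i a => fderiv ℝ f y (stdVec a) i

lemma fderiv_apply_eq_jac_mulVec {d n : ℕ} (f : Coord d → Coord n) (y v : Coord d) (i : Fin n) :
    fderiv ℝ f y v i = (jac f y).mulVec v i := by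
  conv_lhs => rw [stdVec_eq_sum v]
  simp [Matrix.mulVec, dotProduct, jac, mul_comm]

lemma jac_comp {d k n : ℕ} {f : Coord k → Coord n} {τ : Coord d → Coord k} {y : Coord d}
    (hf : DifferentiableAt ℝ f (τ y)) (hτ : DifferentiableAt ℝ τ y) :
    jac (f ∘ τ) y = jac f (τ y) * jac τ y := by
  ext i a
  rw [jac, Matrix.of_apply, fderiv_comp y hf hτ, ContinuousLinearMap.comp_apply,
    fderiv_apply_eq_jac_mulVec]
  simp [Matrix.mulVec, dotProduct, Matrix.mul_apply, jac]

lemma det_fderiv_eq_det_jac {d : ℕ} (τ : Coord d → Coord d) (y : Coord d) :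
    (fderiv ℝ τ y).det = (jac τ y).det := by
  rw [ContinuousLinearMap.det, ← LinearMap.det_toMatrix (EuclideanSpace.basisFun (Fin d) ℝ).toBasis]
  congr 1

variable {n : ℕ} [NeZero n] {M : Type*} [TopologicalSpace M]
  [ChartedSpace (EuclideanHalfSpace n) M] [IsManifold (𝓡∂ n) ∞ M]

/-- The Gram matrix of the pullback of the metric by a map, expressed in the chart at `c`. -/
def gram {d : ℕ} (g : SmoothMetric n M) (c : M) (f : Coord d → Coord n) (y : Coord d) :
    Matrix (Fin d) (Fin d) ℝ :=
  (jac f y).transpose * coordMetric g c (f y) * jac f y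

lemma gram_apply {d : ℕ} (g : SmoothMetric n M) (c : M) (f : Coord d → Coord n) (y : Coord d)
    (a b : Fin d) : gram g c f y a b = ∑ i, ∑ j, coordMetric g c (f y) i j
      * (fderiv ℝ f y (stdVec a) i) * (fderiv ℝ f y (stdVec b) j) := by
  simp only [gram, Matrix.mul_apply, Matrix.transpose_apply, jac, Matrix.of_apply, Finset.sum_mul]
  rw [Finset.sum_comm]
  refine Finset.sum_congr rfl fun i _ => Finset.sum_congr rfl fun j _ => ?_
  ring

lemma gram_comp {d k : ℕ} (g : SmoothMetric n M) (c : M) {f : Coord k → Coord n}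
    {τ : Coord d → Coord k} {y : Coord d} (hf : DifferentiableAt ℝ f (τ y))
    (hτ : DifferentiableAt ℝ τ y) :
    gram g c (f ∘ τ) y = (jac τ y).transpose * gram g c f (τ y) * jac τ y := by
  simp only [gram, jac_comp hf hτ, Matrix.transpose_mul, Function.comp_apply, Matrix.mul_assoc]

lemma gram_posSemidef {d : ℕ} (g : SmoothMetric n M) {c : M} {f : Coord d → Coord n} {y : Coord d}
    (hy : f y ∈ (extChartAt (𝓡∂ n) c).target) : (gram g c f y).PosSemidef := by
  have := (coordMetric_posDef g c hy).posSemidef.conjTranspose_mul_mul_same (jac f y)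
  rwa [Matrix.conjTranspose_eq_transpose_of_trivial] at this

lemma gram_posDef {d : ℕ} (g : SmoothMetric n M) {c : M} {f : Coord d → Coord n} {y : Coord d}
    (hy : f y ∈ (extChartAt (𝓡∂ n) c).target) (hinj : Function.Injective (fderiv ℝ f y)) :
    (gram g c f y).PosDef := by
  have h1 : Function.Injective (jac f y).mulVec := by
    intro v w h
    have : WithLp.toLp 2 v = WithLp.toLp 2 w := hinj (by
      ext i
      rw [fderiv_apply_eq_jac_mulVec, fderiv_apply_eq_jac_mulVec]
      exact congrFun h i)
    exact congrArg WithLp.ofLp this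
  have := (coordMetric_posDef g c hy).conjTranspose_mul_mul_same h1
  rwa [Matrix.conjTranspose_eq_transpose_of_trivial] at this

/-- The inner product of two image vectors, computed in a chart. -/
lemma inner_mfderiv {d : ℕ} (g : SmoothMetric n M) {c : M} {k : Coord d → M} {y : Coord d}
    (hk : MDifferentiableAt 𝓘(ℝ, Coord d) (𝓡∂ n) k y) (hc : k y ∈ (extChartAt (𝓡∂ n) c).source)
    (v w : Coord d) :
    DifferentiableAt ℝ (extChartAt (𝓡∂ n) c ∘ k) y ∧
    g.inner (k y) (mfderiv 𝓘(ℝ, Coord d) (𝓡∂ n) k y v) (mfderiv 𝓘(ℝ, Coord d) (𝓡∂ n) k y w)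
      = ∑ i, ∑ j, coordMetric g c (extChartAt (𝓡∂ n) c (k y)) i j
        * (fderiv ℝ (extChartAt (𝓡∂ n) c ∘ k) y v i)
        * (fderiv ℝ (extChartAt (𝓡∂ n) c ∘ k) y w j) := by
  have hcs : k y ∈ (chartAt (EuclideanHalfSpace n) c).source := by rwa [extChartAt_source] at hc
  have h1 : MDifferentiableAt 𝓘(ℝ, Coord d) 𝓘(ℝ, Coord n) (extChartAt (𝓡∂ n) c ∘ k) y :=
    (mdifferentiableAt_extChartAt hcs).comp y hk
  have h1' := mdifferentiableAt_iff_differentiableAt.1 h1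
  refine ⟨h1', ?_⟩
  set φ := extChartAt (𝓡∂ n) c with hφ
  have hyt : φ (k y) ∈ φ.target := φ.map_source hc
  have h2 : MDifferentiableWithinAt 𝓘(ℝ, Coord n) (𝓡∂ n) φ.symm (range (𝓡∂ n)) (φ (k y)) :=
    mdifferentiableWithinAt_extChartAt_symm hyt
  have h3 : HasMFDerivAt 𝓘(ℝ, Coord d) (𝓡∂ n) k y
      ((mfderivWithin 𝓘(ℝ, Coord n) (𝓡∂ n) φ.symm (range (𝓡∂ n)) (φ (k y))).comp
        (mfderiv 𝓘(ℝ, Coord d) 𝓘(ℝ, Coord n) (φ ∘ k) y)) := by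
    have h4 := HasMFDerivWithinAt.comp (s := univ) y (f := φ ∘ k) h2.hasMFDerivWithinAt
      h1.hasMFDerivAt.hasMFDerivWithinAt (fun z _ => by
        simp only [mem_preimage, Function.comp, hφ, extChartAt, mfld_simps])
    rw [hasMFDerivWithinAt_univ] at h4
    refine h4.congr_of_eventuallyEq ?_
    filter_upwards [hk.continuousAt.preimage_mem_nhds ((isOpen_extChartAt_source c).mem_nhds hc)]
      with z hz
    exact (φ.left_inv hz).symm
  let A : M → Coord n →L[ℝ] Coord n →L[ℝ] ℝ := fun p => g.inner p
  let L : Coord n →L[ℝ] Coord n :=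
    mfderivWithin 𝓘(ℝ, Coord n) (𝓡∂ n) φ.symm (range (𝓡∂ n)) (φ (k y))
  have h6 : A (φ.symm (φ (k y))) (L (fderiv ℝ (φ ∘ k) y v)) (L (fderiv ℝ (φ ∘ k) y w)) = _ :=
    inner_sum_coordVec g c (φ (k y)) (fderiv ℝ (φ ∘ k) y v) (fderiv ℝ (φ ∘ k) y w)
  rw [φ.left_inv hc] at h6
  rw [← h6, h3.mfderiv, mfderiv_eq_fderiv]
  rfl

/-- The area density, computed in a chart. -/
lemma areaDensity_eq {d : ℕ} {N : Type*} [TopologicalSpace N] [ChartedSpace (Coord d) N]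
    (g : SmoothMetric n M) {c : M} {b : N} {F : N → M} {y : Coord d}
    (hF : MDifferentiableAt 𝓘(ℝ, Coord d) (𝓡∂ n) (F ∘ (extChartAt (𝓡 d) b).symm) y)
    (hc : F ((extChartAt (𝓡 d) b).symm y) ∈ (extChartAt (𝓡∂ n) c).source) :
    areaDensity g F b y
      = √(gram g c (extChartAt (𝓡∂ n) c ∘ F ∘ (extChartAt (𝓡 d) b).symm) y).det := by
  rw [areaDensity]
  congr 2
  ext a a'
  rw [Matrix.of_apply, gram_apply]
  exact (inner_mfderiv g hF hc (stdVec a) (stdVec a')).2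

variable {d : ℕ} {N : Type*} [TopologicalSpace N] [ChartedSpace (Coord d) N] [IsManifold (𝓡 d) ∞ N]

lemma contMDiffAt_comp_extChartAt_symm {F : N → M} (hF : ContMDiff (𝓡 d) (𝓡∂ n) ∞ F) {b : N}
    {y : Coord d} (hy : y ∈ (extChartAt (𝓡 d) b).target) :
    ContMDiffAt 𝓘(ℝ, Coord d) (𝓡∂ n) ∞ (F ∘ (extChartAt (𝓡 d) b).symm) y :=
  hF.contMDiffAt.comp y (((contMDiffOn_extChartAt_symm b) y hy).contMDiffAt
    ((isOpen_extChartAt_target b).mem_nhds hy))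

/-- Under a change of charts the Gram determinant is multiplied by the square of the Jacobian
determinant. -/
lemma isDensity_areaDensity (g : SmoothMetric n M) {F : N → M}
    (hF : ContMDiff (𝓡 d) (𝓡∂ n) ∞ F) :
    IsDensity (d := d) (N := N) fun b y => ENNReal.ofReal (areaDensity g F b y) := by
  intro b b' y hy
  set p := (extChartAt (𝓡 d) b).symm y with hp
  have hτ : DifferentiableAt ℝ (transition b b') y :=
    ((contDiffOn_transition b b').contDiffAt
      ((isOpen_chartPart b (isOpen_extChartAt_source b')).mem_nhds hy)).differentiableAt (by simp)
  have hτt : transition b b' y ∈ (extChartAt (𝓡 d) b').target := (extChartAt (𝓡 d) b').map_source hy.2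
  have hsymm : ∀ z ∈ chartPart b (extChartAt (𝓡 d) b').source,
      (extChartAt (𝓡 d) b').symm (transition b b' z) = (extChartAt (𝓡 d) b).symm z := fun z hz =>
    (extChartAt (𝓡 d) b').left_inv hz.2
  have hc := mem_extChartAt_source (I := 𝓡∂ n) (F p)
  have hd1 := (contMDiffAt_comp_extChartAt_symm hF hy.1).mdifferentiableAt (by simp)
  have hd2 := (contMDiffAt_comp_extChartAt_symm hF hτt).mdifferentiableAt (by simp)
  have hc' : F ((extChartAt (𝓡 d) b').symm (transition b b' y)) ∈ (extChartAt (𝓡∂ n) (F p)).source := by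
    rw [hsymm y hy]; exact hc
  beta_reduce
  rw [areaDensity_eq g hd1 hc, areaDensity_eq g hd2 hc',
    ← ENNReal.ofReal_mul (abs_nonneg _)]
  congr 1
  have h1 : extChartAt (𝓡∂ n) (F p) ∘ F ∘ (extChartAt (𝓡 d) b).symm =ᶠ[𝓝 y]
      (extChartAt (𝓡∂ n) (F p) ∘ F ∘ (extChartAt (𝓡 d) b').symm) ∘ transition b b' := by
    filter_upwards [(isOpen_chartPart b (isOpen_extChartAt_source b')).mem_nhds hy] with z hz
    simp only [Function.comp_apply, hsymm z hz]
  have h2 : gram g (F p) (extChartAt (𝓡∂ n) (F p) ∘ F ∘ (extChartAt (𝓡 d) b).symm) y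
      = gram g (F p) ((extChartAt (𝓡∂ n) (F p) ∘ F ∘ (extChartAt (𝓡 d) b').symm) ∘ transition b b') y := by
    simp only [gram, jac, h1.fderiv_eq, h1.eq_of_nhds]
  rw [h2, gram_comp g (F p) (inner_mfderiv g hd2 hc' 0 0).1 hτ, Matrix.det_mul, Matrix.det_mul,
    Matrix.det_transpose, det_fderiv_eq_det_jac]
  rw [show ∀ a b : ℝ, a * b * a = a ^ 2 * b from fun a b => by ring, Real.sqrt_mul (sq_nonneg _),
    Real.sqrt_sq_eq_abs]

/-- The area of a smooth map is the integral of the area density over a partition. -/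
lemma area_eq_densityMass (g : SmoothMetric n M) {F : N → M} (hF : ContMDiff (𝓡 d) (𝓡∂ n) ∞ F)
    {s : Finset N} {B : N → Set (Coord d)} (hP : IsChartPartition s B) :
    area d g F = densityMass s B (fun b y => ENNReal.ofReal (areaDensity g F b y)) univ := by
  refine le_antisymm ?_ ?_
  · refine iSup_le fun s' => iSup_le fun B' => iSup_le fun h => iSup_le fun h' => ?_
    exact (isDensity_areaDensity g hF).sum_le_densityMass hP (fun c hc => (h c hc).1)
      (fun c hc => (h c hc).2) h' fun c hc => subset_univ _
  · rw [densityMass_univ]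
    exact le_iSup_of_le s (le_iSup_of_le B (le_iSup_of_le
      (fun c hc => ⟨hP.measurable c hc, hP.subset c hc⟩) (le_iSup_of_le hP.disjoint le_rfl)))

/-- A local left inverse of the immersion makes its differential injective, so the Gram matrix is
positive definite. -/
lemma areaDensity_pos (g : SmoothMetric n M) {F : N → M} (hF : IsSmoothEmbedding (𝓡 d) (𝓡∂ n) ∞ F)
    (b : N) {y : Coord d} (hy : y ∈ (extChartAt (𝓡 d) b).target) : 0 < areaDensity g F b y := by
  have hs : ContMDiff (𝓡 d) (𝓡∂ n) ∞ F := hF.isImmersion.contMDiff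
  set χ := extChartAt (𝓡 d) b with hχ
  set p := χ.symm y with hp
  set φ := extChartAt (𝓡∂ n) (F p) with hφ
  have hc := mem_extChartAt_source (I := 𝓡∂ n) (F p)
  have hd := (contMDiffAt_comp_extChartAt_symm hs hy).mdifferentiableAt (by simp)
  rw [areaDensity_eq g hd hc]
  refine Real.sqrt_pos.2 (gram_posDef g (φ.map_source hc) ?_).det_pos
  obtain ⟨k, hk, hkF⟩ := exists_leftInverse_of_isImmersionAt (hF.isImmersion.isImmersionAt p)
  have hkp : k (F p) = p := hkF.self_of_nhds
  have hps : p ∈ χ.source := χ.map_target hy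
  set f : Coord d → Coord n := φ ∘ F ∘ χ.symm with hf
  have hfd : DifferentiableAt ℝ f y := (inner_mfderiv g hd hc 0 0).1
  have hfy : φ.symm (f y) = F p := φ.left_inv hc
  have hr : DifferentiableWithinAt ℝ (χ ∘ k ∘ φ.symm) (range (𝓡∂ n)) (f y) := by
    refine mdifferentiableWithinAt_iff_differentiableWithinAt.1 ?_
    have h1 : MDifferentiableWithinAt 𝓘(ℝ, Coord n) (𝓡∂ n) φ.symm (range (𝓡∂ n)) (f y) :=
      mdifferentiableWithinAt_extChartAt_symm (φ.map_source hc)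
    have h2 : MDifferentiableAt (𝓡∂ n) (𝓡 d) k (φ.symm (f y)) := by
      rw [hfy]; exact hk.mdifferentiableAt (by simp)
    have h3 : MDifferentiableAt (𝓡 d) 𝓘(ℝ, Coord d) χ (k (φ.symm (f y))) := by
      rw [hfy, hkp]
      exact mdifferentiableAt_extChartAt (by rwa [hχ, extChartAt_source] at hps)
    exact h3.comp_mdifferentiableWithinAt (f y) (h2.comp_mdifferentiableWithinAt (f y) h1)
  have h4 : HasFDerivAt ((χ ∘ k ∘ φ.symm) ∘ f) ((fderivWithin ℝ (χ ∘ k ∘ φ.symm) (range (𝓡∂ n)) (f y)).comp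
      (fderiv ℝ f y)) y :=
    hr.hasFDerivWithinAt.comp_hasFDerivAt y hfd.hasFDerivAt
      (Eventually.of_forall fun z => by simp only [hf, hφ, Function.comp, extChartAt, mfld_simps])
  have hχc : ContinuousAt χ.symm y := (continuousOn_extChartAt_symm b).continuousAt
    ((isOpen_extChartAt_target b).mem_nhds hy)
  have h5 : (χ ∘ k ∘ φ.symm) ∘ f =ᶠ[𝓝 y] id := by
    have h6 : ∀ᶠ z in 𝓝 y, F (χ.symm z) ∈ φ.source :=
      (hs.continuous.continuousAt.comp hχc).preimage_mem_nhds ((isOpen_extChartAt_source _).mem_nhds hc)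
    filter_upwards [hχc.eventually hkF, h6, (isOpen_extChartAt_target b).mem_nhds hy] with z h7 h8 h9
    simp only [Function.comp_apply, hf, φ.left_inv h8, h7, id, χ.right_inv h9]
  have h6 := h4.unique ((hasFDerivAt_id y).congr_of_eventuallyEq h5)
  intro v w hvw
  have h7 := fun v => congrArg (fun L : Coord d →L[ℝ] Coord d => L v) h6
  simp only [ContinuousLinearMap.comp_apply, ContinuousLinearMap.id_apply] at h7
  rw [← h7 v, hvw, h7 w]

end Gram

/-! ### Evolution of the area density along a collar -/

section Evolution

/-- Liouville's formula. -/
lemma hasDerivAt_det {m : ℕ} {A : ℝ → Matrix (Fin m) (Fin m) ℝ} {K : Matrix (Fin m) (Fin m) ℝ} {t : ℝ}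
    (h : ∀ i j, HasDerivAt (fun s => A s i j) ((K * A t) i j) t) :
    HasDerivAt (fun s => (A s).det) (K.trace * (A t).det) t := by
  have hdet : ∀ B : Matrix (Fin m) (Fin m) ℝ, B.det
      = ∑ σ : Equiv.Perm (Fin m), (Equiv.Perm.sign σ : ℝ) * ∏ i, B i (σ i) := fun B => by
    rw [← Matrix.det_transpose, Matrix.det_apply']
    rfl
  -- Row `k` of `K A` is a combination of the rows of `A`; when it replaces row `k` only the
  -- coefficient `K k k` survives in the determinant.
  have h1 : K.trace * (A t).det
      = ∑ k, ((A t).updateRow k ((K * A t) k)).det := by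
    rw [Matrix.trace, Finset.sum_mul]
    refine Finset.sum_congr rfl fun k _ => ?_
    have : (K * A t) k = ∑ l, K k l • A t l := by
      ext j; simp [Matrix.mul_apply, Finset.sum_apply]
    rw [this, Matrix.det_updateRow_sum, smul_eq_mul, Matrix.diag_apply]
  have h2 : ∀ k, ((A t).updateRow k ((K * A t) k)).det = ∑ σ : Equiv.Perm (Fin m),
      (Equiv.Perm.sign σ : ℝ) * ((∏ i ∈ Finset.univ.erase k, A t i (σ i)) * (K * A t) k (σ k)) := by
    intro k
    rw [hdet]
    refine Finset.sum_congr rfl fun σ _ => ?_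
    rw [← Finset.prod_erase_mul _ _ (Finset.mem_univ k), Matrix.updateRow_self]
    congr 2
    refine Finset.prod_congr rfl fun i hi => ?_
    rw [Matrix.updateRow_ne (Finset.ne_of_mem_erase hi)]
  rw [h1, Finset.sum_congr rfl fun k _ => h2 k, Finset.sum_comm]
  simp only [hdet]
  refine HasDerivAt.fun_sum fun σ _ => ?_
  rw [← Finset.mul_sum]
  refine HasDerivAt.const_mul _ ?_
  have := HasDerivAt.fun_finsetProd (u := Finset.univ) (f := fun i s => A s i (σ i))
    (f' := fun i => (K * A t) i (σ i)) (x := t) fun i _ => h i (σ i)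
  simpa only [smul_eq_mul] using this

variable {d : ℕ}

lemma hasDerivAt_consCoord (y : Coord d) (t : ℝ) :
    HasDerivAt (fun s => consCoord s y) (stdVec 0) t := by
  unfold consCoord
  simpa using ((hasDerivAt_id t).smul_const (stdVec (0 : Fin (d + 1)))).add_const (boundaryIncl d y)

/-- Differentiate the flow equation `∂₀ f = Y ∘ f` in a spatial or time direction and exchange the
derivatives: the Jacobian matrix solves the linearised equation `J' = DY · J`. -/
lemma hasDerivAt_jac {m : ℕ} {f : Coord (d + 1) → Coord m} {Y : Coord m → Coord m} {t : ℝ} {y : Coord d}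
    (hf : ContDiffAt ℝ ∞ f (consCoord t y)) (hY : DifferentiableAt ℝ Y (f (consCoord t y)))
    (hflow : ∀ᶠ z in 𝓝 (consCoord t y), fderiv ℝ f z (stdVec 0) = Y (f z)) (i : Fin m)
    (b : Fin (d + 1)) :
    HasDerivAt (fun s => jac f (consCoord s y) i b)
      ((jac Y (f (consCoord t y)) * jac f (consCoord t y)) i b) t := by
  set z := consCoord t y with hz
  have h1 : DifferentiableAt ℝ (fderiv ℝ f) z :=
    (hf.fderiv_right (m := ∞) (by simp)).differentiableAt (by simp)
  have h2 : HasDerivAt (fun s => fderiv ℝ f (consCoord s y)) (fderiv ℝ (fderiv ℝ f) z (stdVec 0)) t :=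
    h1.hasFDerivAt.comp_hasDerivAt t (hasDerivAt_consCoord y t)
  have h3 : HasDerivAt (fun s => fderiv ℝ f (consCoord s y) (stdVec b))
      (fderiv ℝ (fderiv ℝ f) z (stdVec 0) (stdVec b)) t := by
    simpa using h2.clm_apply (hasDerivAt_const t (stdVec b))
  have hsymm : fderiv ℝ (fderiv ℝ f) z (stdVec 0) (stdVec b)
      = fderiv ℝ (fderiv ℝ f) z (stdVec b) (stdVec 0) :=
    (hf.isSymmSndFDerivAt (by simp only [minSmoothness_of_isRCLikeNormedField]; exact WithTop.coe_le_coe.2 le_top)).eq _ _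
  have h4 : fderiv ℝ (fderiv ℝ f) z (stdVec b) (stdVec 0) = fderiv ℝ Y (f z) (fderiv ℝ f z (stdVec b)) := by
    have h5 : HasFDerivAt (fun w => fderiv ℝ f w (stdVec 0))
        ((ContinuousLinearMap.apply ℝ (Coord m) (stdVec 0)).comp (fderiv ℝ (fderiv ℝ f) z)) z :=
      (ContinuousLinearMap.apply ℝ (Coord m) (stdVec (0 : Fin (d + 1)))).hasFDerivAt.comp z h1.hasFDerivAt
    have h6 : HasFDerivAt (fun w => Y (f w)) ((fderiv ℝ Y (f z)).comp (fderiv ℝ f z)) z :=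
      hY.hasFDerivAt.comp z (hf.differentiableAt (by simp)).hasFDerivAt
    have h7 := h5.unique (h6.congr_of_eventuallyEq hflow)
    exact congrArg (fun L : Coord (d + 1) →L[ℝ] Coord m => L (stdVec b)) h7
  have h8 := (EuclideanSpace.proj (𝕜 := ℝ) i).hasFDerivAt.comp_hasDerivAt t h3
  rw [hsymm, h4] at h8
  have h9 : (jac Y (f z) * jac f z) i b = fderiv ℝ Y (f z) (fderiv ℝ f z (stdVec b)) i := by
    rw [fderiv_apply_eq_jac_mulVec]
    simp [Matrix.mulVec, dotProduct, Matrix.mul_apply, jac]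
  rw [h9]
  exact h8

variable {M : Type*} [TopologicalSpace M]
  [ChartedSpace (EuclideanHalfSpace (d + 1)) M] [IsManifold (𝓡∂ (d + 1)) ∞ M]

/-- The determinant of the metric pulled back by a flow changes by twice the divergence. -/
lemma hasDerivAt_det_gram (g : SmoothMetric (d + 1) M) {c : M} {f : Coord (d + 1) → Coord (d + 1)}
    {Y : Coord (d + 1) → Coord (d + 1)} {t : ℝ} {y : Coord d}
    (hf : ContDiffAt ℝ ∞ f (consCoord t y)) (hY : DifferentiableAt ℝ Y (f (consCoord t y)))
    (hflow : ∀ᶠ z in 𝓝 (consCoord t y), fderiv ℝ f z (stdVec 0) = Y (f z))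
    (hfc : f (consCoord t y) ∈ (extChartAt (𝓡∂ (d + 1)) c).target) (hf0 : 0 < f (consCoord t y) 0) :
    HasDerivAt (fun s => (gram g c f (consCoord s y)).det)
      (2 * (∑ k, (partialD (fun z => Y z k) k (f (consCoord t y))
        + ∑ i, christoffel g c i i k (f (consCoord t y)) * Y (f (consCoord t y)) k))
        * (gram g c f (consCoord t y)).det) t := by
  set z := consCoord t y with hz
  set p := f z with hp
  have hrange : range (𝓡∂ (d + 1)) ∈ 𝓝 p := range_mem_nhds hf0
  have hfl : HasDerivAt (fun s => f (consCoord s y)) (Y p) t := by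
    have := (hf.differentiableAt (by simp)).hasFDerivAt.comp_hasDerivAt t (hasDerivAt_consCoord y t)
    rwa [hflow.self_of_nhds] at this
  set G' : Matrix (Fin (d + 1)) (Fin (d + 1)) ℝ :=
    Matrix.of fun i j => ∑ k, Y p k * partialD (fun w => coordMetric g c w i j) k p with hG'
  have hGd : ∀ i j, HasDerivAt (fun s => coordMetric g c (f (consCoord s y)) i j)
      (G' i j) t := by
    intro i j
    have h1 : DifferentiableAt ℝ (fun w => coordMetric g c w i j) p :=
      (((contDiffOn_coordMetric g c i j).contDiffAt (target_mem_nhds hfc hf0)).differentiableAt (by simp))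
    have h2 := h1.hasFDerivAt.comp_hasDerivAt t hfl
    have h3 : G' i j = fderiv ℝ (fun w => coordMetric g c w i j) p (Y p) := by
      conv_rhs => rw [stdVec_eq_sum (Y p)]
      rw [map_sum, hG', Matrix.of_apply]
      refine Finset.sum_congr rfl fun k _ => ?_
      rw [map_smul, smul_eq_mul, partialD, fderivWithin_of_mem_nhds hrange]
    rw [h3]; exact h2
  have hu : IsUnit (coordMetric g c p).det := isUnit_det_coordMetric g c hfc
  have hGdet : HasDerivAt (fun s => (coordMetric g c (f (consCoord s y))).det)
      ((G' * (coordMetric g c p)⁻¹).trace * (coordMetric g c p).det) t := by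
    refine hasDerivAt_det fun i j => ?_
    rw [← hz, ← hp, Matrix.mul_assoc, Matrix.nonsing_inv_mul _ hu, Matrix.mul_one]
    exact hGd i j
  -- The Gram matrix is `Jᵀ G J` with a square `J`. Here `det J` grows with the trace of `DY`,
  -- counted twice, and `det G` with `2 Γⁱᵢₖ Yᵏ`; together they give twice the divergence.
  have hJdet : HasDerivAt (fun s => (jac f (consCoord s y)).det)
      ((jac Y p).trace * (jac f z).det) t :=
    hasDerivAt_det fun i b => hasDerivAt_jac hf hY hflow i b
  have htr : (G' * (coordMetric g c p)⁻¹).trace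
      = 2 * ∑ k, ∑ i, christoffel g c i i k p * Y p k := by
    have h1 : ∀ k, ∑ i, christoffel g c i i k p * Y p k = Y p k * ∑ i, christoffel g c i i k p := fun k => by
      rw [← Finset.sum_mul, mul_comm]
    simp only [h1, Finset.mul_sum (s := Finset.univ (α := Fin (d + 1))) (a := (2 : ℝ))]
    simp only [mul_left_comm (2 : ℝ)]
    simp only [← sum_inv_mul_partialD_coordMetric g hfc]
    simp only [Finset.mul_sum]
    have h2 : (G' * (coordMetric g c p)⁻¹).trace = ∑ i, ∑ j, ∑ k, Y p k *
        ((coordMetric g c p)⁻¹ i j * partialD (fun w => coordMetric g c w i j) k p) := by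
      simp only [Matrix.trace, Matrix.diag_apply, Matrix.mul_apply, hG', Matrix.of_apply, Finset.sum_mul]
      refine Finset.sum_congr rfl fun i _ => Finset.sum_congr rfl fun j _ =>
        Finset.sum_congr rfl fun k _ => ?_
      rw [coordMetric_inv_symm g c p j i]
      ring
    rw [h2, Finset.sum_comm' (s' := fun _ => Finset.univ) (t' := Finset.univ) (by simp)]
    calc _ = ∑ j, ∑ k, ∑ i, Y p k *
        ((coordMetric g c p)⁻¹ i j * partialD (fun w => coordMetric g c w i j) k p) :=
          Finset.sum_congr rfl fun j _ => Finset.sum_comm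
      _ = ∑ k, ∑ j, ∑ i, Y p k *
        ((coordMetric g c p)⁻¹ i j * partialD (fun w => coordMetric g c w i j) k p) := Finset.sum_comm
      _ = _ := Finset.sum_congr rfl fun k _ => Finset.sum_comm
  have hY' : (jac Y p).trace = ∑ k, partialD (fun w => Y w k) k p := by
    rw [Matrix.trace]
    refine Finset.sum_congr rfl fun k _ => ?_
    rw [Matrix.diag_apply, jac, Matrix.of_apply, partialD, fderivWithin_of_mem_nhds hrange]
    have := ((EuclideanSpace.proj (𝕜 := ℝ) k).hasFDerivAt.comp p hY.hasFDerivAt).fderiv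
    exact (congrArg (fun L : Coord (d + 1) →L[ℝ] ℝ => L (stdVec k)) this).symm
  have hdet : ∀ s, (gram g c f (consCoord s y)).det
      = (jac f (consCoord s y)).det ^ 2 * (coordMetric g c (f (consCoord s y))).det := fun s => by
    rw [gram, Matrix.det_mul, Matrix.det_mul, Matrix.det_transpose]; ring
  simp only [hdet]
  refine ((hJdet.fun_pow 2).fun_mul hGdet).congr_deriv ?_
  rw [Finset.sum_add_distrib, ← hY', htr, hdet t, ← hz, ← hp]
  push_cast
  ring

end Evolution

/-! ### The collar flow in coordinates -/

section CollarEvolution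

variable {d : ℕ} {M : Type*} [TopologicalSpace M]
  [ChartedSpace (EuclideanHalfSpace (d + 1)) M] [IsManifold (𝓡∂ (d + 1)) ∞ M]
  {N : Type*} [TopologicalSpace N] [ChartedSpace (Coord d) N] [IsManifold (𝓡 d) ∞ N]
  {g : SmoothMetric (d + 1) M} {W : M → ℝ} {ι : N → M} {N' : Set N} {ε : ℝ} {X : ℝ → N → M}
  {u : M → ℝ} {π : M → N}

/-- The flow `X` in charts of `N` and `M`. -/
def flowCoord (b : N) (c : M) (X : ℝ → N → M) (z : Coord (d + 1)) : Coord (d + 1) :=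
  extChartAt (𝓡∂ (d + 1)) c (X (z 0) ((extChartAt (𝓡 d) b).symm (tail d z)))

/-- The points where `flowCoord` is smooth. -/
def flowDomain (b : N) (c : M) (N' : Set N) (ε : ℝ) (X : ℝ → N → M) : Set (Coord (d + 1)) :=
  {z | z 0 ∈ Ioo 0 ε ∧ tail d z ∈ (extChartAt (𝓡 d) b).target ∧
    (extChartAt (𝓡 d) b).symm (tail d z) ∈ N' ∧
    X (z 0) ((extChartAt (𝓡 d) b).symm (tail d z)) ∈ (extChartAt (𝓡∂ (d + 1)) c).source}

lemma IsCollar.contMDiffAt_X (h : IsCollar g W ι N' ε X u π) {b : N} {z : Coord (d + 1)}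
    (h0 : z 0 ∈ Ioo 0 ε) (hz : tail d z ∈ (extChartAt (𝓡 d) b).target)
    (hN : (extChartAt (𝓡 d) b).symm (tail d z) ∈ N') :
    ContMDiffAt 𝓘(ℝ, Coord (d + 1)) (𝓡∂ (d + 1)) ∞
      (fun z : Coord (d + 1) => X (z 0) ((extChartAt (𝓡 d) b).symm (tail d z))) z := by
  have h1 : ContMDiffAt (𝓘(ℝ, ℝ).prod (𝓡 d)) (𝓡∂ (d + 1)) ∞ (fun q : ℝ × N => X q.1 q.2)
      (z 0, (extChartAt (𝓡 d) b).symm (tail d z)) :=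
    h.smooth_X.contMDiffAt (prod_mem_nhds (Ico_mem_nhds h0.1 h0.2) (h.isOpen_base.mem_nhds hN))
  have h2 : ContMDiffAt 𝓘(ℝ, Coord (d + 1)) 𝓘(ℝ, ℝ) ∞ (fun z : Coord (d + 1) => z 0) z :=
    (coordZero (d + 1)).contDiff.contMDiff.contMDiffAt
  have h3 : ContMDiffAt 𝓘(ℝ, Coord (d + 1)) (𝓡 d) ∞
      (fun z : Coord (d + 1) => (extChartAt (𝓡 d) b).symm (tail d z)) z :=
    ContMDiffAt.comp z (g := (extChartAt (𝓡 d) b).symm) (f := tail d)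
      (((contMDiffOn_extChartAt_symm b) _ hz).contMDiffAt ((isOpen_extChartAt_target b).mem_nhds hz))
      (tail d).contDiff.contMDiff.contMDiffAt
  exact ContMDiffAt.comp z (g := fun q : ℝ × N => X q.1 q.2) h1 (h2.prodMk h3)

lemma IsCollar.flowDomain_mem_nhds (h : IsCollar g W ι N' ε X u π) {b : N} {c : M} {z : Coord (d + 1)}
    (hz : z ∈ flowDomain b c N' ε X) : flowDomain b c N' ε X ∈ 𝓝 z := by
  obtain ⟨h0, h1, h2, h3⟩ := hz
  have c0 : ContinuousAt (fun z : Coord (d + 1) => z 0) z := (coordZero (d + 1)).continuous.continuousAt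
  have c1 : ContinuousAt (fun z : Coord (d + 1) => tail d z) z := (tail d).continuous.continuousAt
  have c2 : ContinuousAt (fun z : Coord (d + 1) => (extChartAt (𝓡 d) b).symm (tail d z)) z :=
    ContinuousAt.comp (f := tail d) ((continuousOn_extChartAt_symm b).continuousAt
      ((isOpen_extChartAt_target b).mem_nhds h1)) c1
  filter_upwards [c0.preimage_mem_nhds (isOpen_Ioo.mem_nhds h0),
    c1.preimage_mem_nhds ((isOpen_extChartAt_target b).mem_nhds h1),
    c2.preimage_mem_nhds (h.isOpen_base.mem_nhds h2),
    (h.contMDiffAt_X h0 h1 h2).continuousAt.preimage_mem_nhds ((isOpen_extChartAt_source c).mem_nhds h3)]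
    with w w0 w1 w2 w3
  exact ⟨w0, w1, w2, w3⟩

lemma IsCollar.contDiffAt_flowCoord (h : IsCollar g W ι N' ε X u π) {b : N} {c : M} {z : Coord (d + 1)}
    (hz : z ∈ flowDomain b c N' ε X) : ContDiffAt ℝ ∞ (flowCoord b c X) z := by
  obtain ⟨h0, h1, h2, h3⟩ := hz
  refine contMDiffAt_iff_contDiffAt.1 ?_
  have h4 : ContMDiffAt (𝓡∂ (d + 1)) 𝓘(ℝ, Coord (d + 1)) ∞ (extChartAt (𝓡∂ (d + 1)) c)
      (X (z 0) ((extChartAt (𝓡 d) b).symm (tail d z))) :=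
    contMDiffAt_extChartAt' (by rwa [extChartAt_source] at h3)
  exact ContMDiffAt.comp z (g := extChartAt (𝓡∂ (d + 1)) c)
    (f := fun z : Coord (d + 1) => X (z 0) ((extChartAt (𝓡 d) b).symm (tail d z))) h4
    (h.contMDiffAt_X h0 h1 h2)

/-- The velocity of the collar in a chart. -/
def velocity (g : SmoothMetric (d + 1) M) (W u : M → ℝ) (c : M) (y : Coord (d + 1)) : Coord (d + 1) :=
  W ((extChartAt (𝓡∂ (d + 1)) c).symm y) ^ 2 • WithLp.toLp 2 fun i => gradient g c u i y

lemma IsCollar.fderiv_flowCoord (h : IsCollar g W ι N' ε X u π) {b : N} {c : M} {z : Coord (d + 1)}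
    (hz : z ∈ flowDomain b c N' ε X) :
    fderiv ℝ (flowCoord b c X) z (stdVec 0) = velocity g W u c (flowCoord b c X z) := by
  have h1 := ((h.contDiffAt_flowCoord hz).differentiableAt (by simp)).hasFDerivAt
  have h2 : HasDerivAt (fun s => flowCoord b c X (consCoord s (tail d z)))
      (fderiv ℝ (flowCoord b c X) z (stdVec 0)) (z 0) := by
    rw [← consCoord_tail z] at h1
    have := h1.comp_hasDerivAt (z 0) (hasDerivAt_consCoord (tail d z) (z 0))
    rwa [consCoord_tail] at this
  have h3 := h.flow (z 0) hz.1 _ hz.2.2.1 c hz.2.2.2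
  have h4 : (fun s => flowCoord b c X (consCoord s (tail d z))) = fun s =>
      extChartAt (𝓡∂ (d + 1)) c (X s ((extChartAt (𝓡 d) b).symm (tail d z))) := by
    funext s; simp [flowCoord]
  rw [h4] at h2
  rw [h2.unique h3, velocity, flowCoord, (extChartAt (𝓡∂ (d + 1)) c).left_inv hz.2.2.2]

/-- The Gram matrix of the flow is a block matrix. -/
lemma IsCollar.gram_flowCoord (h : IsCollar g W ι N' ε X u π) {b : N} {c : M} {z : Coord (d + 1)}
    (hz : z ∈ flowDomain b c N' ε X) (v : Coord (d + 1)) :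
    ∑ i, ∑ j, coordMetric g c (flowCoord b c X z) i j * (fderiv ℝ (flowCoord b c X) z v i)
      * (fderiv ℝ (flowCoord b c X) z (stdVec 0) j)
      = W (X (z 0) ((extChartAt (𝓡 d) b).symm (tail d z))) ^ 2 * v 0 := by
  set φ := extChartAt (𝓡∂ (d + 1)) c with hφ
  set f := flowCoord (d := d) b c X with hf
  have hsymm : ∀ w ∈ flowDomain (d := d) b c N' ε X,
      φ.symm (f w) = X (w 0) ((extChartAt (𝓡 d) b).symm (tail d w)) := fun w hw => φ.left_inv hw.2.2.2
  have hft : f z ∈ φ.target := φ.map_source hz.2.2.2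
  have h0 : 0 < f z 0 := (mem_interior_iff hz.2.2.2).1 (h.mem_interior _ hz.1 _ hz.2.2.1)
  have hd : DifferentiableAt ℝ (fun y => u (φ.symm y)) (f z) := by
    have hm : f z ∈ collarRegion (d := d) N' ε X c := ⟨hft, by
      rw [mem_preimage, hsymm z hz]
      exact h.mem_image ⟨hz.1.1.le, hz.1.2⟩ hz.2.2.1⟩
    have h1 := contDiffOn_comp_extChartAt_symm h.isOpen_image h.smooth_u c
    have h2 := (isChartRegion_preimage (n := d + 1) c h.isOpen_image).mem_nhds _ hm
    rw [nhdsWithin_eq_nhds.2 (range_mem_nhds h0)] at h2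
    exact (h1.contDiffAt h2).differentiableAt (by simp)
  have hfd := ((h.contDiffAt_flowCoord hz).differentiableAt (by simp)).hasFDerivAt
  -- `u` is the time coordinate of the flow, so pairing an image vector with `∇u` reads off the time
  -- component of `v`.
  have h1 : HasFDerivAt (fun w : Coord (d + 1) => w 0) ((fderiv ℝ (fun y => u (φ.symm y)) (f z)).comp
      (fderiv ℝ f z)) z := by
    refine (hd.hasFDerivAt.comp z hfd).congr_of_eventuallyEq ?_
    filter_upwards [h.flowDomain_mem_nhds hz] with w hw
    simp only [Function.comp_apply, hsymm w hw]
    exact (h.u_X _ ⟨hw.1.1.le, hw.1.2⟩ _ hw.2.2.1).symm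
  have h2 : fderiv ℝ (fun y => u (φ.symm y)) (f z) (fderiv ℝ f z v) = v 0 := by
    have := congrArg (fun L : Coord (d + 1) →L[ℝ] ℝ => L v) (h1.unique (coordZero (d + 1)).hasFDerivAt)
    simpa using this
  have h3 : fderiv ℝ (fun y => u (φ.symm y)) (f z) (fderiv ℝ f z v)
      = ∑ i, fderiv ℝ f z v i * coordD c u i (f z) := by
    conv_lhs => rw [stdVec_eq_sum (fderiv ℝ f z v)]
    rw [map_sum]
    refine Finset.sum_congr rfl fun i _ => ?_
    rw [map_smul, smul_eq_mul, coordD, partialD, fderivWithin_of_mem_nhds (range_mem_nhds h0)]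
  rw [h.fderiv_flowCoord hz, velocity, hsymm z hz, ← h2, h3, Finset.mul_sum]
  refine Finset.sum_congr rfl fun i _ => ?_
  rw [← sum_coordMetric_mul_gradient g hft i, Finset.mul_sum, Finset.mul_sum]
  refine Finset.sum_congr rfl fun j _ => ?_
  simp only [PiLp.smul_apply, smul_eq_mul]
  ring

/-- The flow is orthogonal to its slices and has length `W`. Expanding along column `0` leaves `W²`
times the Gram determinant of the slice. -/
lemma IsCollar.det_gram_flowCoord (h : IsCollar g W ι N' ε X u π) {b : N} {c : M} {z : Coord (d + 1)}
    (hz : z ∈ flowDomain b c N' ε X) :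
    (gram g c (flowCoord b c X) z).det
      = W (X (z 0) ((extChartAt (𝓡 d) b).symm (tail d z))) ^ 2
        * areaDensity g (X (z 0)) b (tail d z) ^ 2 := by
  have hX : ContMDiffAt 𝓘(ℝ, Coord d) (𝓡∂ (d + 1)) ∞ (X (z 0) ∘ (extChartAt (𝓡 d) b).symm) (tail d z) := by
    have h1 : ContMDiffAt 𝓘(ℝ, Coord (d + 1)) (𝓡∂ (d + 1)) ∞
        (fun z : Coord (d + 1) => X (z 0) ((extChartAt (𝓡 d) b).symm (tail d z)))
        (consCoord (z 0) (tail d z)) := by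
      rw [consCoord_tail]; exact h.contMDiffAt_X hz.1 hz.2.1 hz.2.2.1
    have h2 : ContMDiffAt 𝓘(ℝ, Coord d) 𝓘(ℝ, Coord (d + 1)) ∞ (fun s => consCoord (z 0) s) (tail d z) := by
      refine (ContDiff.contMDiff ?_).contMDiffAt
      exact contDiff_consCoord.comp (contDiff_const.prodMk contDiff_id)
    have h3 := ContMDiffAt.comp (tail d z) h1 h2
    refine h3.congr_of_eventuallyEq (Eventually.of_forall fun s => ?_)
    simp
  have hd := hX.mdifferentiableAt (by simp)
  have hft := (extChartAt (𝓡∂ (d + 1)) c).map_source hz.2.2.2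
  rw [areaDensity_eq g hd hz.2.2.2, Real.sq_sqrt (gram_posSemidef g hft).det_nonneg,
    Matrix.det_succ_column_zero, Fin.sum_univ_succ]
  have e0 : ∀ a, gram g c (flowCoord b c X) z a 0
      = W (X (z 0) ((extChartAt (𝓡 d) b).symm (tail d z))) ^ 2 * (stdVec a : Coord (d + 1)) 0 := fun a => by
    rw [gram_apply]; exact h.gram_flowCoord hz (stdVec a)
  have e1 : ∀ a : Fin d, gram g c (flowCoord b c X) z a.succ 0 = 0 := fun a => by
    rw [e0]; simp
  rw [e0]
  simp only [e1, mul_zero, zero_mul, Finset.sum_const_zero, add_zero]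
  have e2 : (gram g c (flowCoord b c X) z).submatrix (Fin.succAbove 0) Fin.succ
      = gram g c (extChartAt (𝓡∂ (d + 1)) c ∘ X (z 0) ∘ (extChartAt (𝓡 d) b).symm) (tail d z) := by
    ext a a'
    have hc1 : HasFDerivAt (fun s : Coord d => consCoord (z 0) s) (boundaryIncl d) (tail d z) := by
      unfold consCoord
      simpa using (boundaryIncl d).hasFDerivAt.const_add ((z 0) • stdVec (0 : Fin (d + 1)))
    have hc2 : HasFDerivAt (extChartAt (𝓡∂ (d + 1)) c ∘ X (z 0) ∘ (extChartAt (𝓡 d) b).symm)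
        ((fderiv ℝ (flowCoord b c X) z).comp (boundaryIncl d)) (tail d z) := by
      have h1 := ((h.contDiffAt_flowCoord hz).differentiableAt (by simp)).hasFDerivAt
      have h1' : HasFDerivAt (flowCoord b c X) (fderiv ℝ (flowCoord b c X) z) (consCoord (z 0) (tail d z)) := by
        rw [consCoord_tail]; exact h1
      refine (h1'.comp (tail d z) hc1).congr_of_eventuallyEq (Eventually.of_forall fun s => ?_)
      simp [flowCoord]
    simp only [Matrix.submatrix_apply, Fin.zero_succAbove, gram_apply]
    rw [hc2.fderiv]
    simp only [ContinuousLinearMap.comp_apply, boundaryIncl_stdVec]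
    rfl
  rw [e2]
  simp

/-- The evolution of the area density along a collar. -/
theorem IsCollar.hasDerivAt_areaDensity_sq (h : IsCollar g W ι N' ε X u π)
    (hW : ContMDiff (𝓡∂ (d + 1)) 𝓘(ℝ, ℝ) ∞ W) (hb : ∀ q, ι q ∈ (𝓡∂ (d + 1)).boundary M)
    {b : N} {c : M} {t : ℝ} (ht : t ∈ Ioo 0 ε) {y : Coord d} (hy : y ∈ (extChartAt (𝓡 d) b).target)
    (hyN : (extChartAt (𝓡 d) b).symm y ∈ N')
    (hc : X t ((extChartAt (𝓡 d) b).symm y) ∈ (extChartAt (𝓡∂ (d + 1)) c).source) :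
    HasDerivAt (fun s => areaDensity g (X s) b y ^ 2)
      (2 * W (X t ((extChartAt (𝓡 d) b).symm y)) ^ 2 * eikonalMean g W u c
        (extChartAt (𝓡∂ (d + 1)) c (X t ((extChartAt (𝓡 d) b).symm y)))
        * areaDensity g (X t) b y ^ 2) t := by
  set q := (extChartAt (𝓡 d) b).symm y with hq
  set φ := extChartAt (𝓡∂ (d + 1)) c with hφ
  have hz : consCoord t y ∈ flowDomain b c N' ε X := by
    simp only [flowDomain, mem_ofPred_eq, consCoord_zero, tail_consCoord]
    exact ⟨ht, hy, hyN, hc⟩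
  have hE := h.isEikonal hW hb c
  have hfz : flowCoord b c X (consCoord t y) = φ (X t q) := by simp [flowCoord, hφ, hq]
  have hft : φ (X t q) ∈ φ.target := φ.map_source hc
  have hsymm : φ.symm (φ (X t q)) = X t q := φ.left_inv hc
  have h0 : 0 < φ (X t q) 0 := (mem_interior_iff hc).1 (h.mem_interior _ ht _ hyN)
  have hm : φ (X t q) ∈ collarRegion (d := d) N' ε X c := ⟨hft, by
    rw [mem_preimage, hsymm]; exact h.mem_image ⟨ht.1.le, ht.2⟩ hyN⟩
  have hreg := hE.region.mem_nhds _ hm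
  rw [nhdsWithin_eq_nhds.2 (range_mem_nhds h0)] at hreg
  have hYs : ContDiffOn ℝ ∞ (velocity g W u c) (collarRegion (d := d) N' ε X c) := by
    refine (contDiffOn_piLp 2).2 fun i => ?_
    exact (hE.smooth_W.pow 2).mul (hE.region.contDiffOn_gradient g hE.smooth_u i)
  have hY : DifferentiableAt ℝ (velocity g W u c) (φ (X t q)) :=
    (hYs.contDiffAt hreg).differentiableAt (by simp)
  have h1 := hasDerivAt_det_gram g (c := c) (h.contDiffAt_flowCoord hz) (Y := velocity g W u c)
    (by rw [hfz]; exact hY)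
    (by filter_upwards [h.flowDomain_mem_nhds hz] with w hw using h.fderiv_flowCoord hw)
    (by rw [hfz]; exact hft) (by rw [hfz]; exact h0)
  rw [hfz, h.det_gram_flowCoord hz, consCoord_zero, tail_consCoord] at h1
  have hdiv := hE.divergence hm
  simp only [velocity, PiLp.smul_apply, smul_eq_mul] at h1
  rw [hdiv, hsymm] at h1
  have hWp : W (X t q) ≠ 0 := (h.W_pos _ (h.mem_image ⟨ht.1.le, ht.2⟩ hyN)).ne'
  have h2 := h.hasDerivAt_comp ht hyN hc (hW.mdifferentiable (by simp) (X t q))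
  rw [sum_gradient_mul_coordD] at h2
  -- The squared density is the full Gram determinant divided by `W²`. The divergence of the
  -- velocity is `W² E + W ⟨∇u, ∇W⟩`, and the growth of `W²` cancels the second term.
  have h3 := h1.div (h2.fun_pow 2) (pow_ne_zero 2 hWp)
  have h4 : (fun s => areaDensity g (X s) b y ^ 2) =ᶠ[𝓝 t]
      fun s => (gram g c (flowCoord b c X) (consCoord s y)).det / W (X s q) ^ 2 := by
    have h5 : ∀ᶠ s in 𝓝 t, consCoord s y ∈ flowDomain b c N' ε X :=
      (hasDerivAt_consCoord y t).continuousAt.preimage_mem_nhds (h.flowDomain_mem_nhds hz)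
    filter_upwards [h5] with s hs
    have h6 := h.det_gram_flowCoord hs
    rw [consCoord_zero, tail_consCoord] at h6
    have hs' := hs.1
    rw [consCoord_zero] at hs'
    have h7 : W (X s q) ≠ 0 := (h.W_pos _ (h.mem_image ⟨hs'.1.le, hs'.2⟩ hyN)).ne'
    rw [h6, mul_div_cancel_left₀ _ (pow_ne_zero 2 h7)]
  refine (h3.congr_of_eventuallyEq h4).congr_deriv ?_
  rw [h.det_gram_flowCoord hz, consCoord_zero, tail_consCoord]
  push_cast
  field_simp
  ring

end CollarEvolution

/-! ### The second fundamental form of the boundary -/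

section BoundaryForm

variable {d : ℕ} {M : Type*} [TopologicalSpace M]
  [ChartedSpace (EuclideanHalfSpace (d + 1)) M] [IsManifold (𝓡∂ (d + 1)) ∞ M]

lemma hasFDerivAt_comp_boundaryIncl {f : Coord (d + 1) → ℝ} {s : Coord d}
    (hf : DifferentiableWithinAt ℝ f (range (𝓡∂ (d + 1))) (boundaryIncl d s)) :
    HasFDerivAt (fun s => f (boundaryIncl d s))
      ((fderivWithin ℝ f (range (𝓡∂ (d + 1))) (boundaryIncl d s)).comp (boundaryIncl d)) s :=
  hf.hasFDerivWithinAt.comp_hasFDerivAt s (boundaryIncl d).hasFDerivAt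
    (Eventually.of_forall boundaryIncl_mem_range)

lemma partialD_boundaryIncl {f : Coord (d + 1) → ℝ} {s : Coord d}
    (hf : DifferentiableWithinAt ℝ f (range (𝓡∂ (d + 1))) (boundaryIncl d s)) (a : Fin d) :
    partialD f a.succ (boundaryIncl d s) = fderiv ℝ (fun s => f (boundaryIncl d s)) s (stdVec a) := by
  rw [(hasFDerivAt_comp_boundaryIncl hf).fderiv, ContinuousLinearMap.comp_apply, boundaryIncl_stdVec]
  rfl

/-- The restriction of a function on `M` to the boundary, in the chart at `c`. -/
def boundaryTrace (c : M) (f : M → ℝ) (s : Coord d) : ℝ :=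
  f ((extChartAt (𝓡∂ (d + 1)) c).symm (boundaryIncl d s))

/-- The inverse of the metric of the boundary. -/
def tangentialInv (g : SmoothMetric (d + 1) M) (c : M) (y : Coord (d + 1)) (a b : Fin d) : ℝ :=
  (coordMetric g c y)⁻¹ a.succ b.succ
    - (coordMetric g c y)⁻¹ a.succ 0 * (coordMetric g c y)⁻¹ b.succ 0 / (coordMetric g c y)⁻¹ 0 0

/-- The mean curvature of the boundary, up to a nonzero factor. -/
def boundaryMean (g : SmoothMetric (d + 1) M) (c : M) (y : Coord (d + 1)) : ℝ :=
  ∑ a : Fin d, ∑ b : Fin d, tangentialInv g c y a b * christoffel g c 0 a.succ b.succ y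

variable {g : SmoothMetric (d + 1) M} {c : M} {y : Coord (d + 1)}

lemma inv_coordMetric_zero_pos (hy : y ∈ (extChartAt (𝓡∂ (d + 1)) c).target) :
    0 < (coordMetric g c y)⁻¹ 0 0 :=
  (coordMetric_posDef g c hy).inv.diag_pos

/-- The matrix `gⁱʲ - gⁱ⁰ gʲ⁰ / g⁰⁰` has zero row and column `0`. So the trace over the boundary is
the full trace minus the value on the unit normal `gⁱ⁰ / √g⁰⁰`. -/
lemma sum_tangentialInv (hy : y ∈ (extChartAt (𝓡∂ (d + 1)) c).target)
    (S : Fin (d + 1) → Fin (d + 1) → ℝ) :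
    ∑ a : Fin d, ∑ b : Fin d, tangentialInv g c y a b * S a.succ b.succ
      = ∑ i, ∑ j, (coordMetric g c y)⁻¹ i j * S i j
        - (∑ i, ∑ j, S i j * (coordMetric g c y)⁻¹ i 0 * (coordMetric g c y)⁻¹ j 0)
          / (coordMetric g c y)⁻¹ 0 0 := by
  have h0 := (inv_coordMetric_zero_pos (g := g) hy).ne'
  have h1 : ∑ i, ∑ j, (coordMetric g c y)⁻¹ i j * S i j
        - (∑ i, ∑ j, S i j * (coordMetric g c y)⁻¹ i 0 * (coordMetric g c y)⁻¹ j 0)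
          / (coordMetric g c y)⁻¹ 0 0
      = ∑ i, ∑ j, ((coordMetric g c y)⁻¹ i j
        - (coordMetric g c y)⁻¹ i 0 * (coordMetric g c y)⁻¹ j 0 / (coordMetric g c y)⁻¹ 0 0) * S i j := by
    rw [Finset.sum_div, ← Finset.sum_sub_distrib]
    refine Finset.sum_congr rfl fun i _ => ?_
    rw [Finset.sum_div, ← Finset.sum_sub_distrib]
    refine Finset.sum_congr rfl fun j _ => by ring
  rw [h1, Fin.sum_univ_succ]
  have h2 : ∀ j, ((coordMetric g c y)⁻¹ 0 j
        - (coordMetric g c y)⁻¹ 0 0 * (coordMetric g c y)⁻¹ j 0 / (coordMetric g c y)⁻¹ 0 0) = 0 := fun j => by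
    rw [mul_div_cancel_left₀ _ h0, coordMetric_inv_symm g c y 0 j, sub_self]
  simp only [h2, zero_mul, Finset.sum_const_zero, zero_add]
  refine Finset.sum_congr rfl fun a _ => ?_
  rw [Fin.sum_univ_succ, mul_div_assoc, div_self h0, mul_one, sub_self, zero_mul, zero_add]
  rfl

/-- Complete `ξ` by the zeroth entry that makes it orthogonal to `dx⁰`; on such covectors the
correction term vanishes and the form is the inverse metric. -/
lemma tangentialInv_pos (hy : y ∈ (extChartAt (𝓡∂ (d + 1)) c).target) {ξ : Fin d → ℝ} (hξ : ξ ≠ 0) :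
    0 < ∑ a, ∑ b, tangentialInv g c y a b * ξ a * ξ b := by
  have h0 := (inv_coordMetric_zero_pos (g := g) hy)
  set A := (coordMetric g c y)⁻¹ with hA
  set η : Fin (d + 1) → ℝ := Fin.cons (-(∑ a, A a.succ 0 * ξ a) / A 0 0) ξ with hη
  have hηne : η ≠ 0 := fun h => hξ (by
    ext a; have := congrFun h a.succ; simpa [hη] using this)
  have h1 := (coordMetric_posDef g c hy).inv.dotProduct_mulVec_pos hηne
  have h2 : ∑ i, A i 0 * η i = 0 := by
    rw [Fin.sum_univ_succ]
    simp only [hη, Fin.cons_zero, Fin.cons_succ]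
    field_simp
    ring
  have h3 := sum_tangentialInv (g := g) hy fun i j => η i * η j
  have h4 : ∑ i, ∑ j, η i * η j * A i 0 * A j 0 = 0 := by
    have : ∑ i, ∑ j, η i * η j * A i 0 * A j 0 = (∑ i, A i 0 * η i) * ∑ j, A j 0 * η j := by
      rw [Finset.sum_mul_sum]
      exact Finset.sum_congr rfl fun i _ => Finset.sum_congr rfl fun j _ => by ring
    rw [this, h2, zero_mul]
  rw [← hA, h4, zero_div, sub_zero] at h3
  have h5 : star η ⬝ᵥ A.mulVec η = ∑ i, ∑ j, A i j * (η i * η j) := by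
    simp only [dotProduct, Matrix.mulVec, Finset.mul_sum, star_trivial]
    exact Finset.sum_congr rfl fun i _ => Finset.sum_congr rfl fun j _ => by ring
  rw [← hA, h5, ← h3] at h1
  refine h1.trans_eq (Finset.sum_congr rfl fun a _ => Finset.sum_congr rfl fun b _ => ?_)
  simp only [hη, Fin.cons_succ]
  ring

variable {T : Set (Coord (d + 1))} {f : M → ℝ} {s : Coord d}

lemma IsChartRegion.preimage_boundaryIncl (hT : IsChartRegion c T) (hs : boundaryIncl d s ∈ T) :
    ∀ᶠ s' in 𝓝 s, boundaryIncl d s' ∈ T := by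
  have h1 : Tendsto (boundaryIncl d) (𝓝 s) (𝓝[range (𝓡∂ (d + 1))] (boundaryIncl d s)) :=
    tendsto_nhdsWithin_iff.2 ⟨(boundaryIncl d).continuous.continuousAt,
      Eventually.of_forall boundaryIncl_mem_range⟩
  exact h1.eventually (hT.mem_nhds _ hs)

lemma coordD_boundaryIncl (hT : IsChartRegion c T)
    (hf : ContDiffOn ℝ ∞ (fun z => f ((extChartAt (𝓡∂ (d + 1)) c).symm z)) T)
    (hs : boundaryIncl d s ∈ T) (a : Fin d) :
    coordD c f a.succ (boundaryIncl d s) = fderiv ℝ (boundaryTrace c f) s (stdVec a) :=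
  partialD_boundaryIncl (hT.differentiableWithinAt hf hs) a

/-- The tangential part of the Hessian at the boundary. -/
lemma hessian_boundaryIncl (hT : IsChartRegion c T)
    (hf : ContDiffOn ℝ ∞ (fun z => f ((extChartAt (𝓡∂ (d + 1)) c).symm z)) T)
    (hs : boundaryIncl d s ∈ T) (a b : Fin d) :
    hessian g c f a.succ b.succ (boundaryIncl d s)
      = fderiv ℝ (fun s => fderiv ℝ (boundaryTrace c f) s (stdVec b)) s (stdVec a)
        - ∑ e : Fin d, christoffel g c e.succ a.succ b.succ (boundaryIncl d s)
          * fderiv ℝ (boundaryTrace c f) s (stdVec e)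
        - christoffel g c 0 a.succ b.succ (boundaryIncl d s) * coordD c f 0 (boundaryIncl d s) := by
  rw [hessian, Fin.sum_univ_succ, partialD_boundaryIncl
    (hT.differentiableWithinAt (hT.contDiffOn_coordD hf b.succ) hs)]
  have h1 : (fun s => coordD c f b.succ (boundaryIncl d s)) =ᶠ[𝓝 s]
      fun s => fderiv ℝ (boundaryTrace c f) s (stdVec b) := by
    filter_upwards [hT.preimage_boundaryIncl hs] with s' hs' using coordD_boundaryIncl hT hf hs' b
  rw [h1.fderiv_eq]
  simp only [coordD_boundaryIncl hT hf hs]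
  ring

/-- If `f` vanishes on the boundary, its tangential Hessian is `-Γ⁰ ∂₀f` and its gradient is normal;
so the mean curvature is `-∂₀f / |∇f|` times `boundaryMean`. As the latter does not involve `f`,
minimality passes from one defining function to another. -/
lemma boundaryTrace_eq_zero_iff_meanCurvature (hT : IsChartRegion c T)
    (hf : ContDiffOn ℝ ∞ (fun z => f ((extChartAt (𝓡∂ (d + 1)) c).symm z)) T)
    (hs : boundaryIncl d s ∈ T) (h0 : boundaryTrace c f =ᶠ[𝓝 s] fun _ => 0)
    (h1 : coordD c f 0 (boundaryIncl d s) ≠ 0) :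
    meanCurvature g f c (boundaryIncl d s) = 0 ↔ boundaryMean g c (boundaryIncl d s) = 0 := by
  set y := boundaryIncl d s with hy
  have hyt := hT.subset hs
  have hA := inv_coordMetric_zero_pos (g := g) hyt
  have hd : fderiv ℝ (boundaryTrace c f) =ᶠ[𝓝 s] fun _ => 0 := by
    filter_upwards [h0.eventuallyEq_nhds] with s' hs'
    rw [hs'.fderiv_eq]; simp
  have hD : ∀ a : Fin d, coordD c f a.succ y = 0 := fun a => by
    rw [hy, coordD_boundaryIncl hT hf hs, hd.eq_of_nhds]; rfl
  have hZ : ∀ i, gradient g c f i y = (coordMetric g c y)⁻¹ i 0 * coordD c f 0 y := fun i => by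
    rw [gradient, Fin.sum_univ_succ]
    simp [hD]
  have hN : gradNormSq g c f y = (coordMetric g c y)⁻¹ 0 0 * coordD c f 0 y ^ 2 := by
    rw [gradNormSq, Fin.sum_univ_succ]
    simp only [hD, mul_zero, Finset.sum_const_zero, add_zero, hZ]
    ring
  have hNpos : 0 < gradNormSq g c f y := by rw [hN]; positivity
  have hH : ∀ a b : Fin d, hessian g c f a.succ b.succ y
      = - coordD c f 0 y * christoffel g c 0 a.succ b.succ y := fun a b => by
    rw [hy, hessian_boundaryIncl hT hf hs]
    have h2 : (fun s => fderiv ℝ (boundaryTrace c f) s (stdVec b)) =ᶠ[𝓝 s] fun _ => (0 : ℝ) := by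
      filter_upwards [hd] with s' hs'
      rw [hs']; rfl
    rw [h2.fderiv_eq, hd.eq_of_nhds]
    simp
    ring
  have key := sum_tangentialInv (g := g) hyt fun i j => hessian g c f i j y
  have hq : (∑ i, ∑ j, hessian g c f i j y * gradient g c f i y * gradient g c f j y)
      / gradNormSq g c f y
      = (∑ i, ∑ j, hessian g c f i j y * (coordMetric g c y)⁻¹ i 0 * (coordMetric g c y)⁻¹ j 0)
          / (coordMetric g c y)⁻¹ 0 0 := by
    have : ∑ i, ∑ j, hessian g c f i j y * gradient g c f i y * gradient g c f j y
        = (∑ i, ∑ j, hessian g c f i j y * (coordMetric g c y)⁻¹ i 0 * (coordMetric g c y)⁻¹ j 0)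
          * coordD c f 0 y ^ 2 := by
      simp only [Finset.sum_mul, hZ]
      exact Finset.sum_congr rfl fun i _ => Finset.sum_congr rfl fun j _ => by ring
    rw [this, hN, mul_div_mul_right _ _ (pow_ne_zero 2 h1)]
  rw [meanCurvature, hq, laplacian, ← key]
  simp only [hH]
  have h3 : ∑ a : Fin d, ∑ b : Fin d, tangentialInv g c y a b
      * (- coordD c f 0 y * christoffel g c 0 a.succ b.succ y) = - coordD c f 0 y * boundaryMean g c y := by
    rw [boundaryMean, Finset.mul_sum]
    refine Finset.sum_congr rfl fun a _ => ?_
    rw [Finset.mul_sum]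
    exact Finset.sum_congr rfl fun b _ => by ring
  rw [h3, div_eq_zero_iff, mul_eq_zero, neg_eq_zero]
  simp [h1, (Real.sqrt_pos.2 hNpos).ne']

variable {N : Type*} [TopologicalSpace N] [ChartedSpace (Coord d) N] [IsManifold (𝓡 d) ∞ N] {ι : N → M}

/-- Near a point of the boundary hypersurface, the boundary in a chart consists of points of it. -/
lemma eventually_mem_range (hι : IsSmoothEmbedding (𝓡 d) (𝓡∂ (d + 1)) ∞ ι)
    (hb : ∀ q, ι q ∈ (𝓡∂ (d + 1)).boundary M) {q : N}
    (hc : ι q ∈ (extChartAt (𝓡∂ (d + 1)) c).source)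
    (hs : boundaryIncl d s = extChartAt (𝓡∂ (d + 1)) c (ι q)) :
    ∀ᶠ s' in 𝓝 s, (extChartAt (𝓡∂ (d + 1)) c).symm (boundaryIncl d s') ∈ range ι := by
  obtain ⟨S, hqS, hS, -, -⟩ := exists_boundaryChart (hι.isImmersion.isImmersionAt q)
    hι.isImmersion.contMDiff hb hc
  have hsS : S q = s := by
    have := (hS q hqS).2
    rw [← hs] at this
    have h2 := congrArg (tail d) this
    simpa using h2.symm
  filter_upwards [S.open_target.mem_nhds (by rw [← hsS]; exact S.map_source hqS)] with s' hs'
  have h1 := hS _ (S.map_target hs')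
  refine ⟨S.symm s', ?_⟩
  rw [← S.right_inv hs', ← h1.2, (extChartAt (𝓡∂ (d + 1)) c).left_inv h1.1, S.right_inv hs']

lemma exists_boundaryIncl_eq {p : M} (hp : p ∈ (extChartAt (𝓡∂ (d + 1)) c).source)
    (hb : p ∈ (𝓡∂ (d + 1)).boundary M) : ∃ s : Coord d, boundaryIncl d s = extChartAt (𝓡∂ (d + 1)) c p := by
  refine ⟨tail d (extChartAt (𝓡∂ (d + 1)) c p), ?_⟩
  conv_rhs => rw [← consCoord_tail (extChartAt (𝓡∂ (d + 1)) c p), (mem_boundary_iff hp).1 hb]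
  simp [consCoord]

lemma mfderiv_eq_zero_of_coordD {p : M} (hp : p ∈ (extChartAt (𝓡∂ (d + 1)) c).source)
    (hf : MDifferentiableAt (𝓡∂ (d + 1)) 𝓘(ℝ, ℝ) f p)
    (h : ∀ i, coordD c f i (extChartAt (𝓡∂ (d + 1)) c p) = 0) :
    mfderiv (𝓡∂ (d + 1)) 𝓘(ℝ, ℝ) f p = 0 := by
  set φ := extChartAt (𝓡∂ (d + 1)) c with hφ
  have hps : p ∈ (chartAt (EuclideanHalfSpace (d + 1)) c).source := by rwa [hφ, extChartAt_source] at hp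
  have h1 : MDifferentiableWithinAt 𝓘(ℝ, Coord (d + 1)) 𝓘(ℝ, ℝ) (f ∘ φ.symm) (range (𝓡∂ (d + 1))) (φ p) := by
    refine MDifferentiableAt.comp_mdifferentiableWithinAt (φ p) ?_
      (mdifferentiableWithinAt_extChartAt_symm (φ.map_source hp))
    rw [φ.left_inv hp]; exact hf
  have h2 := HasMFDerivWithinAt.comp (s := univ) p (f := φ) h1.hasMFDerivWithinAt
    (mdifferentiableAt_extChartAt hps).hasMFDerivAt.hasMFDerivWithinAt (fun z _ => by
        simp only [mem_preimage, hφ, extChartAt, mfld_simps])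
  rw [hasMFDerivWithinAt_univ] at h2
  have h3 : f =ᶠ[𝓝 p] (f ∘ φ.symm) ∘ φ := by
    filter_upwards [(isOpen_extChartAt_source c).mem_nhds hp] with z hz
    simp only [Function.comp_apply, φ.left_inv hz]
  rw [(h2.congr_of_eventuallyEq h3).mfderiv, mfderivWithin_eq_fderivWithin]
  have h4 : fderivWithin ℝ (f ∘ φ.symm) (range (𝓡∂ (d + 1))) (φ p) = 0 := by
    ext v
    rw [stdVec_eq_sum v, map_sum]
    refine Finset.sum_eq_zero fun i _ => ?_
    rw [map_smul]
    have : fderivWithin ℝ (f ∘ φ.symm) (range (𝓡∂ (d + 1))) (φ p) (stdVec i) = 0 := h i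
    rw [this, smul_zero]
  rw [h4]
  exact ContinuousLinearMap.zero_comp _

lemma IsMinimalHypersurface.boundaryMean_eq_zero (hmin : IsMinimalHypersurface g (range ι))
    (hι : IsSmoothEmbedding (𝓡 d) (𝓡∂ (d + 1)) ∞ ι)
    (hb : ∀ q, ι q ∈ (𝓡∂ (d + 1)).boundary M) {q : N}
    (hc : ι q ∈ (extChartAt (𝓡∂ (d + 1)) c).source) :
    boundaryMean g c (extChartAt (𝓡∂ (d + 1)) c (ι q)) = 0 := by
  obtain ⟨U, hU, hpU, f, hf, hfS, hfd⟩ := hmin (ι q) (mem_range_self q)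
  obtain ⟨s, hs⟩ := exists_boundaryIncl_eq hc (hb q)
  set φ := extChartAt (𝓡∂ (d + 1)) c with hφ
  have hsT : boundaryIncl d s ∈ φ.target ∩ φ.symm ⁻¹' U := by
    rw [hs]
    exact ⟨φ.map_source hc, by rw [mem_preimage, φ.left_inv hc]; exact hpU⟩
  have hreg := isChartRegion_preimage (n := d + 1) c hU
  have hfs := contDiffOn_comp_extChartAt_symm hU hf c
  have h0 : boundaryTrace c f =ᶠ[𝓝 s] fun _ => 0 := by
    filter_upwards [eventually_mem_range hι hb hc hs, hreg.preimage_boundaryIncl hsT] with s' h1 h2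
    exact (hfS _ h2.2).1 h1
  obtain ⟨hne, hH⟩ := hfd (ι q) hpU (mem_range_self q)
  have h1 : coordD c f 0 (boundaryIncl d s) ≠ 0 := by
    intro h1
    refine hne (mfderiv_eq_zero_of_coordD hc
      ((hf.contMDiffAt (hU.mem_nhds hpU)).mdifferentiableAt (by simp)) fun i => ?_)
    rw [← hφ, ← hs]
    refine Fin.cases h1 (fun a => ?_) i
    rw [coordD_boundaryIncl hreg hfs hsT, h0.fderiv_eq]
    simp
  rw [← hs]
  refine (boundaryTrace_eq_zero_iff_meanCurvature hreg hfs hsT h0 h1).1 ?_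
  rw [hs]
  exact hH c hc

variable {W : M → ℝ} {N' : Set N} {ε : ℝ} {X : ℝ → N → M} {u : M → ℝ} {π : M → N}

lemma IsCollar.mem_collarRegion (h : IsCollar g W ι N' ε X u π) {q : N} (hq : q ∈ N')
    (hc : ι q ∈ (extChartAt (𝓡∂ (d + 1)) c).source) :
    extChartAt (𝓡∂ (d + 1)) c (ι q) ∈ collarRegion (d := d) N' ε X c :=
  ⟨(extChartAt (𝓡∂ (d + 1)) c).map_source hc, by
    rw [mem_preimage, (extChartAt (𝓡∂ (d + 1)) c).left_inv hc]; exact h.ι_mem_image hq⟩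

lemma IsCollar.boundaryTrace_eq_zero (h : IsCollar g W ι N' ε X u π)
    (hι : IsSmoothEmbedding (𝓡 d) (𝓡∂ (d + 1)) ∞ ι)
    (hb : ∀ q, ι q ∈ (𝓡∂ (d + 1)).boundary M) {q : N} (hq : q ∈ N')
    (hc : ι q ∈ (extChartAt (𝓡∂ (d + 1)) c).source)
    (hs : boundaryIncl d s = extChartAt (𝓡∂ (d + 1)) c (ι q)) : boundaryTrace c u =ᶠ[𝓝 s] fun _ => 0 := by
  have hreg := isChartRegion_preimage (n := d + 1) c h.isOpen_image
  have hsT := h.mem_collarRegion hq hc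
  rw [← hs] at hsT
  filter_upwards [eventually_mem_range hι hb hc hs, hreg.preimage_boundaryIncl hsT] with s' h1 h2
  obtain ⟨q', hq'⟩ := h1
  obtain ⟨h3, h4, h5⟩ := h.X_u_π h2.2
  rw [boundaryTrace]
  rcases h3.1.eq_or_lt with h6 | h6
  · exact h6.symm
  · have h7 := h.mem_interior _ ⟨h6, h3.2⟩ _ h4
    rw [h5, ← hq'] at h7
    exact absurd (hb q') (by rw [← (𝓡∂ (d + 1)).compl_interior]; exact fun h => h h7)

lemma IsCollar.coordD_succ_eq_zero (h : IsCollar g W ι N' ε X u π)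
    (hι : IsSmoothEmbedding (𝓡 d) (𝓡∂ (d + 1)) ∞ ι)
    (hb : ∀ q, ι q ∈ (𝓡∂ (d + 1)).boundary M) {q : N} (hq : q ∈ N')
    (hc : ι q ∈ (extChartAt (𝓡∂ (d + 1)) c).source) (a : Fin d) :
    coordD c u a.succ (extChartAt (𝓡∂ (d + 1)) c (ι q)) = 0 := by
  obtain ⟨s, hs⟩ := exists_boundaryIncl_eq hc (hb q)
  have hsT := h.mem_collarRegion hq hc
  rw [← hs] at hsT ⊢
  rw [coordD_boundaryIncl (isChartRegion_preimage (n := d + 1) c h.isOpen_image)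
    (contDiffOn_comp_extChartAt_symm h.isOpen_image h.smooth_u c) hsT,
    (h.boundaryTrace_eq_zero hι hb hq hc hs).fderiv_eq]
  simp

/-- The arrival time `u` and the function in the definition of minimality both cut out the boundary,
so minimality is the initial condition for `eikonalMean`. -/
lemma IsCollar.eikonalMean_eq_zero (h : IsCollar g W ι N' ε X u π)
    (hW : ContMDiff (𝓡∂ (d + 1)) 𝓘(ℝ, ℝ) ∞ W) (hmin : IsMinimalHypersurface g (range ι))
    (hι : IsSmoothEmbedding (𝓡 d) (𝓡∂ (d + 1)) ∞ ι)
    (hb : ∀ q, ι q ∈ (𝓡∂ (d + 1)).boundary M) {q : N} (hq : q ∈ N')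
    (hc : ι q ∈ (extChartAt (𝓡∂ (d + 1)) c).source) :
    eikonalMean g W u c (extChartAt (𝓡∂ (d + 1)) c (ι q)) = 0 := by
  have hE := h.isEikonal hW hb c
  obtain ⟨s, hs⟩ := exists_boundaryIncl_eq hc (hb q)
  have hB := hmin.boundaryMean_eq_zero hι hb hc
  have hD := h.coordD_succ_eq_zero hι hb hq hc
  have hsT := h.mem_collarRegion hq hc
  have h0 := h.boundaryTrace_eq_zero hι hb hq hc hs
  rw [← hs] at hsT hD hB ⊢
  have h1 : coordD c u 0 (boundaryIncl d s) ≠ 0 := by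
    intro h1
    have h3 := hE.eq_one _ hsT
    rw [gradNormSq, Fin.sum_univ_succ] at h3
    simp [h1, hD] at h3
  have h2 := (boundaryTrace_eq_zero_iff_meanCurvature (g := g) hE.region hE.smooth_u hsT h0 h1).2 hB
  rw [hE.meanCurvature_eq hsT] at h2
  exact (mul_eq_zero.1 h2).resolve_right (hE.pos _ hsT).ne'

end BoundaryForm

/-! ### Differential inequalities for the area along a collar -/

section Comparison

variable {d : ℕ} {M : Type*} [TopologicalSpace M]
  [ChartedSpace (EuclideanHalfSpace (d + 1)) M] [IsManifold (𝓡∂ (d + 1)) ∞ M]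
  {N : Type*} [TopologicalSpace N] [ChartedSpace (Coord d) N] [IsManifold (𝓡 d) ∞ N]
  {g : SmoothMetric (d + 1) M} {W : M → ℝ} {ι : N → M} {N' : Set N} {ε : ℝ} {X : ℝ → N → M}
  {u : M → ℝ} {π : M → N}

/-- The area density of a smooth family is continuous. -/
lemma continuousOn_areaDensity (hN' : IsOpen N')
    (hX : ContMDiffOn (𝓘(ℝ, ℝ).prod (𝓡 d)) (𝓡∂ (d + 1)) ∞ (fun q : ℝ × N => X q.1 q.2)
      (Ico 0 ε ×ˢ N')) (b : N) :
    ContinuousOn (fun z : ℝ × Coord d => areaDensity g (X z.1) b z.2)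
      (Ico 0 ε ×ˢ chartPart b N') := by
  set χ := extChartAt (𝓡 d) b with hχ
  set A : Set (Coord d) := chartPart b N' with hA
  have hAo : IsOpen A := isOpen_chartPart b hN'
  set D : Set (ℝ × Coord d) := Ico 0 ε ×ˢ A with hD
  have hXs : ContMDiffOn 𝓘(ℝ, ℝ × Coord d) (𝓡∂ (d + 1)) ∞
      (fun z : ℝ × Coord d => X z.1 (χ.symm z.2)) D := by
    have h1 : ContMDiffOn 𝓘(ℝ, ℝ × Coord d) (𝓘(ℝ, ℝ).prod (𝓡 d)) ∞
        (fun z : ℝ × Coord d => (z.1, χ.symm z.2)) D := by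
      refine contDiff_fst.contMDiff.contMDiffOn.prodMk ?_
      exact (contMDiffOn_extChartAt_symm b).comp contDiff_snd.contMDiff.contMDiffOn fun z hz => hz.2.1
    exact hX.comp h1 fun z hz => ⟨hz.1, hz.2.2⟩
  rintro ⟨t, y⟩ hty
  set c : M := X t (χ.symm y) with hc
  set φ := extChartAt (𝓡∂ (d + 1)) c with hφ
  obtain ⟨O, hO, hOD⟩ := continuousOn_iff'.1 hXs.continuousOn φ.source (isOpen_extChartAt_source c)
  set R : Set (ℝ × Coord d) := O ∩ D with hR
  have hRc : ∀ z ∈ R, X z.1 (χ.symm z.2) ∈ φ.source := fun z hz => by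
    have : z ∈ (fun z : ℝ × Coord d => X z.1 (χ.symm z.2)) ⁻¹' φ.source ∩ D := by rw [hOD]; exact hz
    exact this.1
  have htyR : (t, y) ∈ R := by
    have : (t, y) ∈ (fun z : ℝ × Coord d => X z.1 (χ.symm z.2)) ⁻¹' φ.source ∩ D :=
      ⟨mem_extChartAt_source c, hty⟩
    rwa [hOD] at this
  have hRu : UniqueDiffOn ℝ R := by
    rw [hR, inter_comm]
    exact ((uniqueDiffOn_Ico 0 ε).prod hAo.uniqueDiffOn).inter hO
  set f : ℝ × Coord d → Coord (d + 1) := fun z => φ (X z.1 (χ.symm z.2)) with hf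
  have hfs : ContDiffOn ℝ ∞ f R := by
    refine contMDiffOn_iff_contDiffOn.1 ?_
    have h1 : ContMDiffOn (𝓡∂ (d + 1)) 𝓘(ℝ, Coord (d + 1)) ∞ φ φ.source := by
      rw [hφ, extChartAt_source]; exact contMDiffOn_extChartAt
    exact h1.comp (hXs.mono inter_subset_right) hRc
  -- Time `0` is an endpoint of the domain, so the joint derivative is taken within `R`; restricted
  -- to directions of `N` it is the ordinary derivative of the slice.
  have hG : ContinuousOn (fderivWithin ℝ f R) R := hfs.continuousOn_fderivWithin hRu (by simp)
  have hslice : ∀ z ∈ R, HasFDerivAt (fun s => f (z.1, s))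
      ((fderivWithin ℝ f R z).comp (ContinuousLinearMap.inr ℝ ℝ (Coord d))) z.2 := by
    rintro ⟨r, s⟩ hz
    have h1 := ((hfs.differentiableOn (by simp)) _ hz).hasFDerivWithinAt
    refine h1.comp_hasFDerivAt s (hasFDerivAt_prodMk_right r s) ?_
    have h2 : ContinuousAt (fun s : Coord d => (r, s)) s := by fun_prop
    filter_upwards [h2.preimage_mem_nhds (hO.mem_nhds hz.1), hAo.mem_nhds hz.2.2] with s' h3 h4
    exact ⟨h3, hz.2.1, h4⟩
  have hgram : ContinuousOn (fun z : ℝ × Coord d => √(gram g c (φ ∘ X z.1 ∘ χ.symm) z.2).det) R := by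
    refine Continuous.comp_continuousOn Real.continuous_sqrt ?_
    have h1 : ContinuousOn (fun z : ℝ × Coord d => gram g c (φ ∘ X z.1 ∘ χ.symm) z.2) R := by
      refine continuousOn_pi.2 fun a => continuousOn_pi.2 fun a' => ?_
      simp only [gram_apply]
      refine continuousOn_finsetSum _ fun i _ => continuousOn_finsetSum _ fun j _ => ?_
      have h2 : ContinuousOn (fun z : ℝ × Coord d => coordMetric g c (f z) i j) R :=
        (contDiffOn_coordMetric g c i j).continuousOn.comp hfs.continuousOn
          fun z hz => φ.map_source (hRc z hz)
      have h3 : ∀ (a : Fin d) (i : Fin (d + 1)), ContinuousOn (fun z : ℝ × Coord d =>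
          fderiv ℝ (φ ∘ X z.1 ∘ χ.symm) z.2 (stdVec a) i) R := by
        intro a i
        have h4 : ContinuousOn (fun z => fderivWithin ℝ f R z (0, stdVec a) i) R :=
          (EuclideanSpace.proj (𝕜 := ℝ) i).continuous.comp_continuousOn
            (hG.clm_apply continuousOn_const)
        refine h4.congr fun z hz => ?_
        have h5 : fderiv ℝ (φ ∘ X z.1 ∘ χ.symm) z.2 = _ := (hslice z hz).fderiv
        rw [h5]
        simp
      exact (h2.mul (h3 a i)).mul (h3 a' j)
    exact (continuous_id.matrix_det).comp_continuousOn h1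
  have hRD : R ∈ 𝓝[D] (t, y) := by
    rw [hR]; exact inter_mem (mem_nhdsWithin_of_mem_nhds (hO.mem_nhds htyR.1)) self_mem_nhdsWithin
  have heq : ∀ z ∈ R, areaDensity g (X z.1) b z.2 = √(gram g c (φ ∘ X z.1 ∘ χ.symm) z.2).det := by
    rintro ⟨r, s⟩ hz
    refine areaDensity_eq g ?_ (hRc _ hz)
    have h1 : ContMDiffOn 𝓘(ℝ, Coord d) (𝓡∂ (d + 1)) ∞ (X r ∘ χ.symm) A :=
      hXs.comp (f := fun s : Coord d => (r, s)) (contDiff_prodMk_right r).contMDiff.contMDiffOn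
        fun s' hs' => ⟨hz.2.1, hs'⟩
    exact (h1.contMDiffAt (hAo.mem_nhds hz.2.2)).mdifferentiableAt (by simp)
  exact ((hgram _ htyR).congr heq (heq _ htyR)).mono_of_mem_nhdsWithin hRD

lemma IsCollar.contMDiff_X (h : IsCollar g W ι univ ε X u π) {t : ℝ} (ht : t ∈ Ico 0 ε) :
    ContMDiff (𝓡 d) (𝓡∂ (d + 1)) ∞ (X t) := by
  refine contMDiffOn_univ.1 ?_
  exact h.smooth_X.comp (contMDiffOn_const.prodMk contMDiffOn_id) fun q hq => ⟨ht, hq⟩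

lemma IsCollar.tendsto_X (h : IsCollar g W ι N' ε X u π) {q : N} (hq : q ∈ N') :
    Tendsto (fun s => X s q) (𝓝[>] 0) (𝓝 (ι q)) := by
  have h1 := h.smooth_X.continuousOn (0, q) ⟨⟨le_rfl, h.eps_pos⟩, hq⟩
  rw [ContinuousWithinAt, h.X_zero q hq] at h1
  refine Tendsto.comp (g := fun q : ℝ × N => X q.1 q.2) (f := fun s => (s, q)) h1
    (tendsto_nhdsWithin_iff.2 ⟨?_, ?_⟩)
  · exact (Continuous.tendsto' (by fun_prop) _ _ rfl).mono_left nhdsWithin_le_nhds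
  · filter_upwards [Ioo_mem_nhdsGT h.eps_pos] with s hs using ⟨⟨hs.1.le, hs.2⟩, hq⟩

lemma IsCollar.hasDerivAt_eikonalMean (h : IsCollar g W ι N' ε X u π)
    (hW : ContMDiff (𝓡∂ (d + 1)) 𝓘(ℝ, ℝ) ∞ W) (hb : ∀ q, ι q ∈ (𝓡∂ (d + 1)).boundary M)
    {c : M} {t : ℝ} (ht : t ∈ Ioo 0 ε) {q : N} (hq : q ∈ N')
    (hc : X t q ∈ (extChartAt (𝓡∂ (d + 1)) c).source) :
    HasDerivAt (fun s => eikonalMean g W u c (extChartAt (𝓡∂ (d + 1)) c (X s q)))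
      (W (X t q) ^ 2 * ∑ i, gradient g c u i (extChartAt (𝓡∂ (d + 1)) c (X t q))
        * partialD (eikonalMean g W u c) i (extChartAt (𝓡∂ (d + 1)) c (X t q))) t := by
  have hE := h.isEikonal hW hb c
  set φ := extChartAt (𝓡∂ (d + 1)) c with hφ
  have hm : φ (X t q) ∈ collarRegion (d := d) N' ε X c := ⟨φ.map_source hc, by
    rw [mem_preimage, φ.left_inv hc]; exact h.mem_image ⟨ht.1.le, ht.2⟩ hq⟩
  have h0 : 0 < φ (X t q) 0 := (mem_interior_iff hc).1 (h.mem_interior _ ht _ hq)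
  have h1 := hE.region.differentiableWithinAt hE.contDiffOn_eikonalMean hm
  have h2 := h1.hasFDerivWithinAt.hasFDerivAt (range_mem_nhds h0)
  have h3 := h2.comp_hasDerivAt t (h.flow t ht q hq c hc)
  refine h3.congr_deriv ?_
  rw [map_smul, smul_eq_mul, stdVec_eq_sum (WithLp.toLp 2 fun i => gradient g c u i (φ (X t q))), map_sum]
  congr 1
  refine Finset.sum_congr rfl fun i _ => ?_
  rw [map_smul, smul_eq_mul]
  rfl

/-- The evolution equation holds at positive times only, so the initial value zero enters as a
limit. -/
lemma IsCollar.tendsto_eikonalMean (h : IsCollar g W ι N' ε X u π)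
    (hW : ContMDiff (𝓡∂ (d + 1)) 𝓘(ℝ, ℝ) ∞ W) (hmin : IsMinimalHypersurface g (range ι))
    (hι : IsSmoothEmbedding (𝓡 d) (𝓡∂ (d + 1)) ∞ ι)
    (hb : ∀ q, ι q ∈ (𝓡∂ (d + 1)).boundary M) {c : M} {q : N} (hq : q ∈ N')
    (hc : ι q ∈ (extChartAt (𝓡∂ (d + 1)) c).source) :
    Tendsto (fun s => eikonalMean g W u c (extChartAt (𝓡∂ (d + 1)) c (X s q))) (𝓝[>] 0) (𝓝 0) := by
  have hE := h.isEikonal hW hb c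
  have h0 := h.eikonalMean_eq_zero hW hmin hι hb hq hc
  set φ := extChartAt (𝓡∂ (d + 1)) c with hφ
  have hm : φ (ι q) ∈ collarRegion (d := d) N' ε X c := ⟨φ.map_source hc, by
    rw [mem_preimage, φ.left_inv hc]; exact h.ι_mem_image hq⟩
  have h1 := (hE.contDiffOn_eikonalMean.continuousOn _ hm).mono_of_mem_nhdsWithin
    (hE.region.mem_nhds _ hm)
  rw [ContinuousWithinAt, h0] at h1
  refine h1.comp (tendsto_nhdsWithin_iff.2 ⟨?_, Eventually.of_forall fun s => ?_⟩)
  · exact (continuousAt_extChartAt' hc).tendsto.comp (h.tendsto_X hq)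
  · simp only [hφ, extChartAt, mfld_simps]

/-- The source term in the evolution of `eikonalMean`, for `W = V + η`. -/
lemma IsEikonal.source_eq {V : M → ℝ} {η : ℝ} (hWV : ∀ p, W p = V p + η) {c : M}
    {T : Set (Coord (d + 1))} (h : IsEikonal g W u c T) {y : Coord (d + 1)} (hy : y ∈ T) :
    laplacian g c W y - W ((extChartAt (𝓡∂ (d + 1)) c).symm y) ^ 2
          * ∑ i, ∑ j, hessian g c W i j y * gradient g c u i y * gradient g c u j y
        + W ((extChartAt (𝓡∂ (d + 1)) c).symm y) ^ 3
          * ∑ i, ∑ j, ricci g c i j y * gradient g c u i y * gradient g c u j y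
      = W ((extChartAt (𝓡∂ (d + 1)) c).symm y) ^ 2
          * ∑ i, ∑ j, tensorP g V c y i j * gradient g c u i y * gradient g c u j y
        + η * W ((extChartAt (𝓡∂ (d + 1)) c).symm y) ^ 2
          * ∑ i, ∑ j, ricci g c i j y * gradient g c u i y * gradient g c u j y := by
  -- `W` and `V` differ by a constant, so `η` survives only in front of the Ricci term; `W² |∇u|² =
  -- 1` turns `ΔV` into the trace part of `P(∇u, ∇u)`.
  have hD : ∀ i : Fin (d + 1), coordD c W i = coordD c V i := fun i => by
    funext z
    unfold coordD partialD
    simp only [hWV, fderivWithin_add_const]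
  have hH : ∀ i j, hessian g c W i j y = hessian g c V i j y := fun i j => by
    simp only [hessian, hD]
  have hL : laplacian g c W y = laplacian g c V y := by simp only [laplacian, hH]
  have h1 := h.eq_one y hy
  have h2 : ∑ i, ∑ j, coordMetric g c y i j * gradient g c u i y * gradient g c u j y
      = gradNormSq g c u y := by
    rw [gradNormSq]
    refine Finset.sum_congr rfl fun i _ => ?_
    rw [← sum_coordMetric_mul_gradient g (h.region.subset hy) i, Finset.mul_sum]
    exact Finset.sum_congr rfl fun j _ => by ring
  have h3 : ∑ i, ∑ j, tensorP g V c y i j * gradient g c u i y * gradient g c u j y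
      = V ((extChartAt (𝓡∂ (d + 1)) c).symm y)
          * ∑ i, ∑ j, ricci g c i j y * gradient g c u i y * gradient g c u j y
        - ∑ i, ∑ j, hessian g c V i j y * gradient g c u i y * gradient g c u j y
        + laplacian g c V y * gradNormSq g c u y := by
    rw [← h2]
    simp only [Finset.mul_sum, ← Finset.sum_sub_distrib, ← Finset.sum_add_distrib, tensorP, Matrix.of_apply]
    exact Finset.sum_congr rfl fun i _ => Finset.sum_congr rfl fun j _ => by ring
  rw [h3, hL]
  simp only [hH]
  have hV : V ((extChartAt (𝓡∂ (d + 1)) c).symm y) = W ((extChartAt (𝓡∂ (d + 1)) c).symm y) - η := by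
    rw [hWV]; ring
  rw [hV]
  linear_combination (-laplacian g c V y) * h1

/-- A differential inequality of Gronwall type. -/
lemma le_exp_mul_of_hasDerivAt {m e : ℝ → ℝ} {γ δ t : ℝ} (hm0 : ∀ s, 0 ≤ m s)
    (hc : ContinuousOn m (Ico 0 δ)) (hm : ∀ s ∈ Ioo 0 δ, HasDerivAt m (2 * e s * m s) s)
    (he : ∀ s ∈ Ioo 0 δ, e s ≤ γ * s) (ht : t ∈ Ico 0 δ) : m t ≤ Real.exp (γ * t ^ 2) * m 0 := by
  -- The integrating factor for `m' ≤ 2 γ s m`.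
  have hanti : AntitoneOn (fun s => Real.exp (-γ * s ^ 2) * m s) (Ico 0 δ) := by
    refine antitoneOn_of_hasDerivWithinAt_nonpos (f' := fun s => Real.exp (-γ * s ^ 2) *
      (2 * (e s - γ * s) * m s)) (convex_Ico 0 δ) (ContinuousOn.mul (by fun_prop) hc) ?_ ?_
    · intro s hs
      rw [interior_Ico] at hs
      have h2 : HasDerivAt (fun s => Real.exp (-γ * s ^ 2)) (Real.exp (-γ * s ^ 2) * (-γ * (2 * s))) s := by
        have := ((hasDerivAt_pow 2 s).const_mul (-γ)).exp
        simpa using this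
      refine ((h2.fun_mul (hm s hs)).congr_deriv ?_).hasDerivWithinAt
      ring
    · intro s hs
      rw [interior_Ico] at hs
      refine mul_nonpos_of_nonneg_of_nonpos (Real.exp_pos _).le
        (mul_nonpos_of_nonpos_of_nonneg ?_ (hm0 s))
      linarith [he s hs]
  have h1 := hanti ⟨le_rfl, ht.1.trans_lt ht.2⟩ ht ht.1
  norm_num at h1
  have h4 : Real.exp (γ * t ^ 2) * Real.exp (-(γ * t ^ 2)) = 1 := by rw [← Real.exp_add]; simp
  calc m t = Real.exp (γ * t ^ 2) * (Real.exp (-(γ * t ^ 2)) * m t) := by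
        rw [← mul_assoc, h4, one_mul]
    _ ≤ _ := mul_le_mul_of_nonneg_left h1 (Real.exp_pos _).le

/-- A differential inequality for the area density along a collar. -/
lemma IsCollar.areaDensity_le_of_eikonalMean_le (h : IsCollar g W ι univ ε X u π)
    (hW : ContMDiff (𝓡∂ (d + 1)) 𝓘(ℝ, ℝ) ∞ W)
    (hb : ∀ q, ι q ∈ (𝓡∂ (d + 1)).boundary M) {b : N} {y : Coord d} (hy : y ∈ (extChartAt (𝓡 d) b).target)
    {c : M} {δ γ : ℝ} (hδ : δ ≤ ε)
    (hc : ∀ t ∈ Ioo 0 δ, X t ((extChartAt (𝓡 d) b).symm y) ∈ (extChartAt (𝓡∂ (d + 1)) c).source)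
    (hE : ∀ t ∈ Ioo 0 δ, W (X t ((extChartAt (𝓡 d) b).symm y)) ^ 2 * eikonalMean g W u c
      (extChartAt (𝓡∂ (d + 1)) c (X t ((extChartAt (𝓡 d) b).symm y))) ≤ γ * t)
    {t : ℝ} (ht : t ∈ Ico 0 δ) :
    areaDensity g (X t) b y ≤ Real.exp (γ * t ^ 2 / 2) * areaDensity g ι b y := by
  have hX0 : X 0 = ι := funext fun q => h.X_zero q (mem_univ q)
  have hcont : ContinuousOn (fun s => areaDensity g (X s) b y) (Ico 0 ε) :=
    ContinuousOn.comp (g := fun z : ℝ × Coord d => areaDensity g (X z.1) b z.2)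
      (f := fun s : ℝ => (s, y)) (continuousOn_areaDensity (g := g) isOpen_univ h.smooth_X b)
      (by fun_prop) fun s hs => ⟨hs, hy, mem_univ _⟩
  -- The inequality is integrated for the squared density, whose derivative is known; taking the
  -- root halves the exponent.
  have h1 := le_exp_mul_of_hasDerivAt (m := fun s => areaDensity g (X s) b y ^ 2)
    (e := fun t => W (X t ((extChartAt (𝓡 d) b).symm y)) ^ 2 * eikonalMean g W u c
      (extChartAt (𝓡∂ (d + 1)) c (X t ((extChartAt (𝓡 d) b).symm y)))) (fun s => sq_nonneg _)
    ((hcont.mono (Ico_subset_Ico_right hδ)).pow 2) (fun s hs => by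
      refine (h.hasDerivAt_areaDensity_sq hW hb (b := b) (c := c) ⟨hs.1, hs.2.trans_le hδ⟩ hy
        (mem_univ _) (hc s hs)).congr_deriv ?_
      simp only [mul_assoc]) hE ht
  simp only [hX0] at h1
  have h2 : areaDensity g (X t) b y ^ 2
      ≤ (Real.exp (γ * t ^ 2 / 2) * areaDensity g ι b y) ^ 2 := by
    have h3 : Real.exp (γ * t ^ 2 / 2) ^ 2 = Real.exp (γ * t ^ 2) := by
      rw [← Real.exp_nat_mul]; congr 1; push_cast; ring
    rwa [mul_pow, h3]
  exact le_of_sq_le_sq h2 (mul_nonneg (Real.exp_pos _).le (Real.sqrt_nonneg _))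

end Comparison

/-! ### Local bounds for the mean curvature and the area density -/

section LocalComparison

variable {d : ℕ} {M : Type*} [TopologicalSpace M]
  [ChartedSpace (EuclideanHalfSpace (d + 1)) M] [IsManifold (𝓡∂ (d + 1)) ∞ M]
  {N : Type*} [TopologicalSpace N] [ChartedSpace (Coord d) N] [IsManifold (𝓡 d) ∞ N]
  {g : SmoothMetric (d + 1) M} {W : M → ℝ} {ι : N → M} {ε : ℝ} {X : ℝ → N → M}
  {u : M → ℝ} {π : M → N}

/-- The source term in the evolution of the mean curvature of the level sets of `u`. -/
def sourceTerm (g : SmoothMetric (d + 1) M) (W u : M → ℝ) (c : M) (y : Coord (d + 1)) : ℝ :=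
  laplacian g c W y - W ((extChartAt (𝓡∂ (d + 1)) c).symm y) ^ 2
      * ∑ i, ∑ j, hessian g c W i j y * gradient g c u i y * gradient g c u j y
    + W ((extChartAt (𝓡∂ (d + 1)) c).symm y) ^ 3
      * ∑ i, ∑ j, ricci g c i j y * gradient g c u i y * gradient g c u j y

/-- Along a flow line the Bochner inequality bounds the derivative of `eikonalMean` by `-sourceTerm
/ W`, hence by `β`, and its limit at time zero is `0`. -/
lemma IsCollar.eikonalMean_le (h : IsCollar g W ι univ ε X u π)
    (hW : ContMDiff (𝓡∂ (d + 1)) 𝓘(ℝ, ℝ) ∞ W) (hmin : IsMinimalHypersurface g (range ι))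
    (hι : IsSmoothEmbedding (𝓡 d) (𝓡∂ (d + 1)) ∞ ι)
    (hb : ∀ q, ι q ∈ (𝓡∂ (d + 1)).boundary M) {c : M} {q : N} {δ β : ℝ} (hδ : δ ≤ ε)
    (hι0 : ι q ∈ (extChartAt (𝓡∂ (d + 1)) c).source)
    (hc : ∀ t ∈ Ioo 0 δ, X t q ∈ (extChartAt (𝓡∂ (d + 1)) c).source)
    (hβ : ∀ t ∈ Ioo 0 δ, -sourceTerm g W u c (extChartAt (𝓡∂ (d + 1)) c (X t q)) ≤ β * W (X t q))
    {t : ℝ} (ht : t ∈ Ioo 0 δ) :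
    eikonalMean g W u c (extChartAt (𝓡∂ (d + 1)) c (X t q)) ≤ β * t := by
  set φ := extChartAt (𝓡∂ (d + 1)) c with hφ
  set e : ℝ → ℝ := fun s => eikonalMean g W u c (φ (X s q)) with he
  have hder : ∀ s ∈ Ioo 0 δ, HasDerivAt e (W (X s q) ^ 2 * ∑ i, gradient g c u i (φ (X s q))
        * partialD (eikonalMean g W u c) i (φ (X s q))) s := fun s hs =>
    h.hasDerivAt_eikonalMean hW hb ⟨hs.1, hs.2.trans_le hδ⟩ (mem_univ q) (hc s hs)
  have hbound : ∀ s ∈ Ioo 0 δ, W (X s q) ^ 2 * ∑ i, gradient g c u i (φ (X s q))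
        * partialD (eikonalMean g W u c) i (φ (X s q)) ≤ β := by
    intro s hs
    have hm : X s q ∈ collarImage univ ε X := h.mem_image ⟨hs.1.le, hs.2.trans_le hδ⟩ (mem_univ q)
    have hsymm : φ.symm (φ (X s q)) = X s q := φ.left_inv (hc s hs)
    have h1 := (h.isEikonal hW hb c).bochner (y := φ (X s q)) ⟨φ.map_source (hc s hs), by
      rw [mem_preimage, hsymm]; exact hm⟩
    have h2 := hβ s hs
    rw [sourceTerm] at h2
    have h3 := h1.trans h2
    rw [hsymm] at h3
    have hw := h.W_pos _ hm
    rw [pow_succ, mul_right_comm] at h3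
    exact le_of_mul_le_mul_right h3 hw
  have hanti : AntitoneOn (fun s => e s - β * s) (Ioo 0 δ) := by
    have hd : ∀ s ∈ Ioo 0 δ, HasDerivAt (fun s => e s - β * s) (W (X s q) ^ 2 * ∑ i,
        gradient g c u i (φ (X s q)) * partialD (eikonalMean g W u c) i (φ (X s q)) - β) s := fun s hs => by
      have h1 := (hder s hs).fun_sub ((hasDerivAt_id s).const_mul β)
      rwa [mul_one] at h1
    refine antitoneOn_of_deriv_nonpos (convex_Ioo 0 δ) (fun s hs => (hd s hs).continuousAt.continuousWithinAt)
      (fun s hs => ?_) fun s hs => ?_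
    · rw [interior_Ioo] at hs; exact (hd s hs).differentiableAt.differentiableWithinAt
    · rw [interior_Ioo] at hs; rw [(hd s hs).deriv]; linarith [hbound s hs]
  have hlim : Tendsto (fun s => e s - β * s) (𝓝[>] 0) (𝓝 0) := by
    have h1 := h.tendsto_eikonalMean hW hmin hι hb (mem_univ q) hι0
    have h2 : Tendsto (fun s : ℝ => β * s) (𝓝[>] 0) (𝓝 0) :=
      (Continuous.tendsto' (by fun_prop) _ _ (mul_zero β)).mono_left nhdsWithin_le_nhds
    have h3 := h1.sub h2
    rwa [sub_zero] at h3
  have := ge_of_tendsto hlim (by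
    filter_upwards [Ioo_mem_nhdsGT ht.1] with s hs
    exact hanti ⟨hs.1, hs.2.trans ht.2⟩ ht hs.2.le)
  linarith [this]

/-- The area density is at most `exp (γ t² / 2)` times its initial value over `S`, for `t < δ`. -/
def DensityBound (g : SmoothMetric (d + 1) M) (ι : N → M) (X : ℝ → N → M) (γ δ : ℝ) (S : Set N) : Prop :=
  ∀ q ∈ S, ∀ b : N, q ∈ (extChartAt (𝓡 d) b).source → ∀ t ∈ Ico 0 δ,
    areaDensity g (X t) b (extChartAt (𝓡 d) b q)
      ≤ Real.exp (γ * t ^ 2 / 2) * areaDensity g ι b (extChartAt (𝓡 d) b q)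

/-- A lower bound `k` for the source makes `eikonalMean` grow at most linearly in time, and `W²`
times it is the growth rate of the area density. The two alternatives for `γ` absorb the oscillation
of `W` near `q₀`, which acts in opposite directions for the two signs of `k`. -/
lemma IsCollar.exists_densityBound_nhds (h : IsCollar g W ι univ ε X u π)
    (hW : ContMDiff (𝓡∂ (d + 1)) 𝓘(ℝ, ℝ) ∞ W) (hmin : IsMinimalHypersurface g (range ι))
    (hι : IsSmoothEmbedding (𝓡 d) (𝓡∂ (d + 1)) ∞ ι)
    (hb : ∀ q, ι q ∈ (𝓡∂ (d + 1)).boundary M) {c : M} {q₀ : N} {k γ : ℝ}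
    (hc : ι q₀ ∈ (extChartAt (𝓡∂ (d + 1)) c).source)
    (hk : ∀ᶠ y in 𝓝[range (𝓡∂ (d + 1))] (extChartAt (𝓡∂ (d + 1)) c (ι q₀)), k ≤ sourceTerm g W u c y)
    (hγ : (k ≤ 0 ∧ -4 * k * W (ι q₀) ≤ γ) ∨ (0 ≤ k ∧ -k * W (ι q₀) / 3 ≤ γ)) :
    ∃ B ∈ 𝓝 q₀, ∃ δ > 0, DensityBound g ι X γ δ B := by
  set φ := extChartAt (𝓡∂ (d + 1)) c with hφ
  have hw : 0 < W (ι q₀) := h.W_pos _ (h.ι_mem_image (mem_univ q₀))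
  -- With this `w` the value `W (ι q₀)` lies strictly between `w` and `2 w`. For `k ≤ 0` the rate is
  -- at most `(2w)² · (-k/w) = -4 k w`, for `k ≥ 0` at most `w² · (-k/(2w)) = -k W (ι q₀) / 3`.
  set w := 2 / 3 * W (ι q₀) with hwdef
  have hw0 : 0 < w := by positivity
  have hO : {p | p ∈ φ.source ∧ k ≤ sourceTerm g W u c (φ p) ∧ w < W p ∧ W p < 2 * w} ∈ 𝓝 (ι q₀) := by
    have h1 : Tendsto φ (𝓝 (ι q₀)) (𝓝[range (𝓡∂ (d + 1))] (φ (ι q₀))) :=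
      tendsto_nhdsWithin_iff.2 ⟨continuousAt_extChartAt' hc, Eventually.of_forall fun p => by
        simp only [hφ, extChartAt, mfld_simps]⟩
    have hWc : ContinuousAt W (ι q₀) := hW.continuous.continuousAt
    filter_upwards [(isOpen_extChartAt_source c).mem_nhds hc, h1.eventually hk,
      hWc.eventually (lt_mem_nhds (show w < W (ι q₀) by linarith)),
      hWc.eventually (gt_mem_nhds (show W (ι q₀) < 2 * w by linarith))] with p h2 h3 h4 h5
    exact ⟨h2, h3, h4, h5⟩
  obtain ⟨B, δ, hBo, hqB, -, hδ, hδε, hBX⟩ := h.exists_box (mem_univ q₀) hO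
  refine ⟨B, hBo.mem_nhds hqB, δ, hδ, fun q hq b hqb t ht => ?_⟩
  have hι0 : ι q ∈ φ.source := by
    have := (hBX 0 ⟨le_rfl, hδ⟩ q hq).1
    rwa [h.X_zero q (mem_univ q)] at this
  have hleft := (extChartAt (𝓡 d) b).left_inv hqb
  have hIco : ∀ s ∈ Ioo 0 δ, s ∈ Ico 0 δ := fun s hs => ⟨hs.1.le, hs.2⟩
  refine h.areaDensity_le_of_eikonalMean_le hW hb (c := c) ((extChartAt (𝓡 d) b).map_source hqb) hδε
    (fun s hs => ?_) (fun s hs => ?_) ht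
  · rw [hleft]; exact (hBX s (hIco s hs) q hq).1
  · rw [hleft]
    obtain ⟨h1, h2, h3, h4⟩ := hBX s (hIco s hs) q hq
    have hs0 := hs.1
    rcases hγ with ⟨hk0, hγ⟩ | ⟨hk0, hγ⟩
    · have h5 := h.eikonalMean_le hW hmin hι hb (q := q) (β := -k / w) hδε hι0
        (fun s hs => (hBX s (hIco s hs) q hq).1) (fun r hr => by
          obtain ⟨-, h6, h7, h8⟩ := hBX r (hIco r hr) q hq
          have h9 : -k ≤ -k / w * W (X r q) := by
            rw [div_mul_eq_mul_div, le_div_iff₀ hw0]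
            exact mul_le_mul_of_nonneg_left h7.le (by linarith)
          linarith) hs
      have h6 : 0 ≤ -k / w * s := mul_nonneg (div_nonneg (by linarith) hw0.le) hs0.le
      calc W (X s q) ^ 2 * eikonalMean g W u c (φ (X s q))
          ≤ W (X s q) ^ 2 * (-k / w * s) := mul_le_mul_of_nonneg_left h5 (sq_nonneg _)
        _ ≤ (2 * w) ^ 2 * (-k / w * s) := mul_le_mul_of_nonneg_right
            (pow_le_pow_left₀ (hw0.trans h3).le h4.le 2) h6
        _ = (-k * (4 * w)) * s := by field_simp; ring
        _ ≤ γ * s := by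
            refine mul_le_mul_of_nonneg_right (le_trans ?_ hγ) hs0.le
            nlinarith
    · have h5 := h.eikonalMean_le hW hmin hι hb (q := q) (β := -k / (2 * w)) hδε hι0
        (fun s hs => (hBX s (hIco s hs) q hq).1) (fun r hr => by
          obtain ⟨-, h6, h7, h8⟩ := hBX r (hIco r hr) q hq
          have h9 : -k ≤ -k / (2 * w) * W (X r q) := by
            rw [div_mul_eq_mul_div, le_div_iff₀ (by positivity)]
            nlinarith
          linarith) hs
      have h6 : 0 ≤ k / (2 * w) * s := mul_nonneg (div_nonneg hk0 (by positivity)) hs0.le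
      calc W (X s q) ^ 2 * eikonalMean g W u c (φ (X s q))
          ≤ W (X s q) ^ 2 * (-k / (2 * w) * s) := mul_le_mul_of_nonneg_left h5 (sq_nonneg _)
        _ = -(W (X s q) ^ 2 * (k / (2 * w) * s)) := by ring
        _ ≤ -(w ^ 2 * (k / (2 * w) * s)) := neg_le_neg (mul_le_mul_of_nonneg_right
            (pow_le_pow_left₀ hw0.le h3.le 2) h6)
        _ = (-k * w / 2) * s := by field_simp
        _ ≤ γ * s := by
            refine mul_le_mul_of_nonneg_right (le_trans (le_of_eq ?_) hγ) hs0.le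
            rw [hwdef]; ring

lemma exists_densityBound_of_isCompact {γ : ℝ} {K : Set N} (hK : IsCompact K)
    (h : ∀ q ∈ K, ∃ B ∈ 𝓝 q, ∃ δ > 0, DensityBound g ι X γ δ B) :
    ∃ δ > 0, DensityBound g ι X γ δ K := by
  refine hK.induction_on (p := fun S => ∃ δ > 0, DensityBound g ι X γ δ S) ⟨1, one_pos, by simp [DensityBound]⟩
    ?_ ?_ ?_
  · rintro s t hst ⟨δ, hδ, h⟩
    exact ⟨δ, hδ, fun q hq => h q (hst hq)⟩
  · rintro s t ⟨δ, hδ, h⟩ ⟨δ', hδ', h'⟩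
    refine ⟨min δ δ', lt_min hδ hδ', fun q hq b hqb r hr => ?_⟩
    rcases hq with hq | hq
    · exact h q hq b hqb r ⟨hr.1, hr.2.trans_le (min_le_left _ _)⟩
    · exact h' q hq b hqb r ⟨hr.1, hr.2.trans_le (min_le_right _ _)⟩
  · intro q hq
    obtain ⟨B, hB, δ, hδ, h⟩ := h q hq
    exact ⟨B, mem_nhdsWithin_of_mem_nhds hB, δ, hδ, h⟩

/-- The value of a bilinear form on the unit normal of the boundary. -/
def normalForm (g : SmoothMetric (d + 1) M) (c : M) (S : Fin (d + 1) → Fin (d + 1) → Coord (d + 1) → ℝ)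
    (y : Coord (d + 1)) : ℝ :=
  (∑ i, ∑ j, S i j y * (coordMetric g c y)⁻¹ i 0 * (coordMetric g c y)⁻¹ j 0) / (coordMetric g c y)⁻¹ 0 0

lemma continuousOn_normalForm (c : M) {S : Fin (d + 1) → Fin (d + 1) → Coord (d + 1) → ℝ}
    (hS : ∀ i j, ContinuousOn (S i j) (extChartAt (𝓡∂ (d + 1)) c).target) :
    ContinuousOn (normalForm g c S) (extChartAt (𝓡∂ (d + 1)) c).target := by
  have hA := fun i j => ((isChartRegion_target (n := d + 1) c).contDiffOn_coordMetric_inv g i j).continuousOn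
  unfold normalForm
  refine ContinuousOn.div (continuousOn_finsetSum _ fun i _ => continuousOn_finsetSum _ fun j _ =>
    ((hS i j).mul (hA i 0)).mul (hA j 0)) (hA 0 0) fun y hy => (inv_coordMetric_zero_pos hy).ne'

lemma continuousOn_ricci (c : M) (i j : Fin (d + 1)) :
    ContinuousOn (ricci g c i j) (extChartAt (𝓡∂ (d + 1)) c).target := by
  have hT := isChartRegion_target (n := d + 1) c
  have h1 := fun k i j => (hT.contDiffOn_christoffel g k i j)
  unfold ricci
  exact continuousOn_finsetSum _ fun k _ =>
    (((hT.contDiffOn_partialD (h1 k i j) k).continuousOn.sub (hT.contDiffOn_partialD (h1 k i k) j).continuousOn).add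
      (continuousOn_finsetSum _ fun l _ => ((h1 k k l).continuousOn.mul (h1 l i j).continuousOn).sub
        ((h1 k j l).continuousOn.mul (h1 l i k).continuousOn)))

lemma continuousOn_tensorP {V : M → ℝ} (hV : ContMDiff (𝓡∂ (d + 1)) 𝓘(ℝ, ℝ) ∞ V) (c : M) (i j : Fin (d + 1)) :
    ContinuousOn (fun y => tensorP g V c y i j) (extChartAt (𝓡∂ (d + 1)) c).target := by
  have hT := isChartRegion_target (n := d + 1) c
  have hVs : ContDiffOn ℝ ∞ (fun z => V ((extChartAt (𝓡∂ (d + 1)) c).symm z))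
      (extChartAt (𝓡∂ (d + 1)) c).target := by
    simpa using contDiffOn_comp_extChartAt_symm isOpen_univ hV.contMDiffOn c
  exact ((hVs.continuousOn.mul (continuousOn_ricci c i j)).sub (hT.contDiffOn_hessian g hVs i j).continuousOn).add
    ((hT.contDiffOn_laplacian g hVs).continuousOn.mul (contDiffOn_coordMetric g c i j).continuousOn)

/-- The unit normal of the boundary is the gradient direction of a collar. -/
lemma IsCollar.gradient_boundary (h : IsCollar g W ι univ ε X u π)
    (hW : ContMDiff (𝓡∂ (d + 1)) 𝓘(ℝ, ℝ) ∞ W)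
    (hι : IsSmoothEmbedding (𝓡 d) (𝓡∂ (d + 1)) ∞ ι)
    (hb : ∀ q, ι q ∈ (𝓡∂ (d + 1)).boundary M) {c : M} {q : N}
    (hc : ι q ∈ (extChartAt (𝓡∂ (d + 1)) c).source) (S : Fin (d + 1) → Fin (d + 1) → Coord (d + 1) → ℝ) :
    W (ι q) ^ 2 * ∑ i, ∑ j, S i j (extChartAt (𝓡∂ (d + 1)) c (ι q))
        * gradient g c u i (extChartAt (𝓡∂ (d + 1)) c (ι q))
        * gradient g c u j (extChartAt (𝓡∂ (d + 1)) c (ι q))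
      = normalForm g c S (extChartAt (𝓡∂ (d + 1)) c (ι q)) := by
  have hD := h.coordD_succ_eq_zero hι hb (mem_univ q) hc
  have hm := h.mem_collarRegion (mem_univ q) hc
  have h1 := (h.isEikonal hW hb c).eq_one _ hm
  rw [(extChartAt (𝓡∂ (d + 1)) c).left_inv hc] at h1
  set y := extChartAt (𝓡∂ (d + 1)) c (ι q) with hy
  have hA := (inv_coordMetric_zero_pos (g := g) hm.1).ne'
  have hZ : ∀ i, gradient g c u i y = (coordMetric g c y)⁻¹ i 0 * coordD c u 0 y := fun i => by
    rw [gradient, Fin.sum_univ_succ]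
    simp [hD]
  rw [gradNormSq, Fin.sum_univ_succ] at h1
  simp only [hD, mul_zero, Finset.sum_const_zero, add_zero, hZ] at h1
  rw [normalForm, eq_div_iff hA]
  simp only [hZ, Finset.mul_sum, Finset.sum_mul]
  refine Finset.sum_congr rfl fun i _ => Finset.sum_congr rfl fun j _ => ?_
  linear_combination (S i j y * (coordMetric g c y)⁻¹ i 0 * (coordMetric g c y)⁻¹ j 0) * h1

end LocalComparison

/-! ### Comparison of areas and a criterion for instability -/

section AreaComparison

variable {d : ℕ} {M : Type*} [TopologicalSpace M]
  [ChartedSpace (EuclideanHalfSpace (d + 1)) M] [IsManifold (𝓡∂ (d + 1)) ∞ M]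
  {N : Type*} [TopologicalSpace N] [ChartedSpace (Coord d) N] [IsManifold (𝓡 d) ∞ N]
  {g : SmoothMetric (d + 1) M} {ι : N → M}

lemma continuousOn_areaDensity_of_contMDiff {F : N → M} (hF : ContMDiff (𝓡 d) (𝓡∂ (d + 1)) ∞ F) (b : N) :
    ContinuousOn (areaDensity g F b) (extChartAt (𝓡 d) b).target := by
  have h1 := continuousOn_areaDensity (g := g) (ε := 1) (X := fun _ => F) isOpen_univ
    (hF.comp contMDiff_snd).contMDiffOn b
  exact ContinuousOn.comp (g := fun z : ℝ × Coord d => areaDensity g F b z.2) (f := fun y => ((0 : ℝ), y)) h1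
    (by fun_prop) fun y hy => ⟨⟨le_rfl, one_pos⟩, hy, mem_univ _⟩

/-- The area density of `F` is at most `a` times the area density of `F'` over `S`. -/
def DensityLE (g : SmoothMetric (d + 1) M) (F F' : N → M) (a : ℝ) (S : Set N) : Prop :=
  ∀ q ∈ S, ∀ b : N, q ∈ (extChartAt (𝓡 d) b).source →
    areaDensity g F b (extChartAt (𝓡 d) b q) ≤ a * areaDensity g F' b (extChartAt (𝓡 d) b q)

/-- Comparison of areas: better control of the density over an open set `E` is visible in the area. -/
lemma exists_area_le [T2Space N] [CompactSpace N] (hι : IsSmoothEmbedding (𝓡 d) (𝓡∂ (d + 1)) ∞ ι)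
    {E : Set N} (hE : IsOpen E) {q : N} (hq : q ∈ E) :
    ∃ A A' : ℝ, 0 < A ∧ 0 ≤ A' ∧ area d g ι = ENNReal.ofReal (A + A') ∧
      ∀ (F : N → M) (a a' : ℝ), ContMDiff (𝓡 d) (𝓡∂ (d + 1)) ∞ F → 0 ≤ a → 0 ≤ a' →
        DensityLE g F ι a E → DensityLE g F ι a' univ → area d g F ≤ ENNReal.ofReal (a * A + a' * A') := by
  have hs : ContMDiff (𝓡 d) (𝓡∂ (d + 1)) ∞ ι := hι.contMDiff
  obtain ⟨S, B, hP⟩ := exists_isChartPartition d N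
  set D : N → Coord d → ℝ≥0∞ := fun b y => ENNReal.ofReal (areaDensity g ι b y) with hD
  have hDd : IsDensity D := isDensity_areaDensity g hs
  have hadd := hP.densityMass_add_compl (D := D) hE
  have htop : densityMass S B D univ < ⊤ := hP.densityMass_lt_top fun c _ =>
    ⟨areaDensity g ι c, continuousOn_areaDensity_of_contMDiff hs c, fun y => rfl⟩
  have hpos : 0 < densityMass S B D E := hDd.densityMass_pos hP hE hq
    (fun c y hy => (ENNReal.ofReal_pos.2 (areaDensity_pos g hι c hy)).ne') fun c =>
      ENNReal.measurable_ofReal.comp_aemeasurable ((continuousOn_areaDensity_of_contMDiff hs c).aemeasurable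
        (isOpen_extChartAt_target c).measurableSet)
  have h1 : densityMass S B D E ≠ ⊤ := ne_top_of_le_ne_top htop.ne (hadd ▸ le_self_add)
  have h2 : densityMass S B D Eᶜ ≠ ⊤ := ne_top_of_le_ne_top htop.ne (hadd ▸ le_add_self)
  -- `A` and `A'` are the areas of `E` and of its complement.
  refine ⟨(densityMass S B D E).toReal, (densityMass S B D Eᶜ).toReal, ENNReal.toReal_pos hpos.ne' h1,
    ENNReal.toReal_nonneg, ?_, fun F a a' hF ha ha' hFE hFu => ?_⟩
  · rw [ENNReal.ofReal_add ENNReal.toReal_nonneg ENNReal.toReal_nonneg, ENNReal.ofReal_toReal h1,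
      ENNReal.ofReal_toReal h2, hadd, area_eq_densityMass g hs hP]
  · rw [area_eq_densityMass g hF hP, ← hP.densityMass_add_compl hE,
      ENNReal.ofReal_add (mul_nonneg ha ENNReal.toReal_nonneg) (mul_nonneg ha' ENNReal.toReal_nonneg),
      ENNReal.ofReal_mul ha, ENNReal.ofReal_mul ha', ENNReal.ofReal_toReal h1, ENNReal.ofReal_toReal h2]
    have key : ∀ (e : ℝ) (G : Set N), 0 ≤ e → DensityLE g F ι e G → ∀ c ∈ S, ∀ y ∈ B c,
        (extChartAt (𝓡 d) c).symm y ∈ G →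
        ENNReal.ofReal (areaDensity g F c y) ≤ ENNReal.ofReal e * D c y := by
      intro e G he h c hc y hy hyG
      have hyt := hP.subset c hc hy
      have := h _ hyG c ((extChartAt (𝓡 d) c).map_target hyt)
      rw [(extChartAt (𝓡 d) c).right_inv hyt] at this
      rw [hD, ← ENNReal.ofReal_mul he]
      exact ENNReal.ofReal_le_ofReal this
    refine add_le_add (hP.densityMass_le ENNReal.ofReal_ne_top (key a E ha hFE)
      fun c hc => hP.measurableSet_inter hc hE) (hP.densityMass_le ENNReal.ofReal_ne_top
      (key a' Eᶜ ha' fun q _ => hFu q (mem_univ q)) fun c hc => ?_)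
    rw [preimage_compl, ← sdiff_eq, ← sdiff_self_inter]
    exact (hP.measurable c hc).diff (hP.measurableSet_inter hc hE)

lemma DensityBound.densityLE {X : ℝ → N → M} {γ δ t : ℝ} {S : Set N} (h : DensityBound g ι X γ δ S)
    (ht : t ∈ Ico 0 δ) : DensityLE g (X t) ι (Real.exp (γ * t ^ 2 / 2)) S :=
  fun q hq b hb => h q hq b hb t ht

/-- A collar is a variation. -/
lemma IsCollar.isVariation {W : M → ℝ} {ε : ℝ} {X : ℝ → N → M} {u : M → ℝ} {π : M → N}
    (h : IsCollar g W ι univ ε X u π) : IsVariation (n := d + 1) d ι ε X :=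
  ⟨h.smooth_X, funext fun q => h.X_zero q (mem_univ q)⟩

/-- If the area density decreases fast enough on an open set, then the hypersurface is unstable. -/
lemma not_isStable_of_densityBound [T2Space N] [CompactSpace N] {W : M → ℝ} {ε : ℝ} {X : ℝ → N → M} {u : M → ℝ}
    {π : M → N} (h : IsCollar g W ι univ ε X u π)
    {A A' : ℝ} (hA : 0 < A) (hA' : 0 ≤ A') (hareaι : area d g ι = ENNReal.ofReal (A + A')) {E : Set N}
    (harea : ∀ (F : N → M) (a a' : ℝ), ContMDiff (𝓡 d) (𝓡∂ (d + 1)) ∞ F → 0 ≤ a → 0 ≤ a' →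
        DensityLE g F ι a E → DensityLE g F ι a' univ → area d g F ≤ ENNReal.ofReal (a * A + a' * A'))
    {γ γ' δ δ' : ℝ} (hδ : 0 < δ) (hδ' : 0 < δ') (h1 : DensityBound g ι X γ δ E)
    (h2 : DensityBound g ι X γ' δ' univ) (hlt : γ * A + γ' * A' < 0) : ¬ IsStable d g ι := by
  intro hst
  have hev := hst ε X h.eps_pos h.isVariation
  -- In the variable `τ = t² / 2` the area is bounded by `f τ`, which starts at the initial area
  -- with slope `γ A + γ' A' < 0`.
  set f : ℝ → ℝ := fun τ => Real.exp (γ * τ) * A + Real.exp (γ' * τ) * A' with hf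
  have hd : HasDerivAt f (γ * A + γ' * A') 0 := by
    have e1 : ∀ κ : ℝ, HasDerivAt (fun τ => Real.exp (κ * τ)) κ 0 := fun κ => by
      have := ((hasDerivAt_id (0 : ℝ)).const_mul κ).exp
      simpa using this
    exact ((e1 γ).mul_const A).fun_add ((e1 γ').mul_const A')
  have hslope := eventually_lt_of_hasDerivAt hd hlt
  rw [show f 0 = A + A' by simp [hf]] at hslope
  have hsq : Tendsto (fun t : ℝ => t ^ 2 / 2) (𝓝[>] 0) (𝓝[>] 0) := by
    refine tendsto_nhdsWithin_iff.2 ⟨(Continuous.tendsto' (by fun_prop) _ _ (by simp)).mono_left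
      nhdsWithin_le_nhds, ?_⟩
    filter_upwards [self_mem_nhdsWithin] with t (ht : 0 < t)
    exact mem_Ioi.2 (by positivity)
  obtain ⟨t, h3, h4, h5⟩ := (hev.and ((hsq.eventually hslope).and
    (Ioo_mem_nhdsGT (lt_min (lt_min hδ hδ') h.eps_pos)))).exists
  have ht1 : t < δ := h5.2.trans_le ((min_le_left _ _).trans (min_le_left _ _))
  have ht2 : t < δ' := h5.2.trans_le ((min_le_left _ _).trans (min_le_right _ _))
  have ht3 : t < ε := h5.2.trans_le (min_le_right _ _)
  have h6 := harea (X t) _ _ (h.contMDiff_X ⟨h5.1.le, ht3⟩) (Real.exp_pos _).le (Real.exp_pos _).le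
    (h1.densityLE ⟨h5.1.le, ht1⟩) (h2.densityLE ⟨h5.1.le, ht2⟩)
  have h7 := h3.trans h6
  rw [hareaι] at h7
  have h8 : f (t ^ 2 / 2) = Real.exp (γ * t ^ 2 / 2) * A + Real.exp (γ' * t ^ 2 / 2) * A' := by
    simp only [hf, mul_div_assoc]
  rw [← h8] at h7
  have hf0 : 0 ≤ f (t ^ 2 / 2) := by rw [h8]; positivity
  have := (ENNReal.ofReal_le_ofReal_iff hf0).1 h7
  linarith

/-- Every point is a limit of interior points, approached along the direction of the zeroth
coordinate. -/
lemma IsLapse.nonneg {V : M → ℝ} (hV : IsLapse (n := d + 1) V) (p : M) : 0 ≤ V p := by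
  set φ := extChartAt (𝓡∂ (d + 1)) p with hφ
  have hpt : φ p ∈ φ.target := mem_extChartAt_target p
  have hp0 : 0 ≤ φ p 0 := mem_range_halfSpace.1 (target_subset_range p hpt)
  have h1 : Tendsto (fun t : ℝ => φ p + t • stdVec 0) (𝓝[>] 0) (𝓝[range (𝓡∂ (d + 1))] (φ p)) := by
    refine tendsto_nhdsWithin_iff.2 ⟨(Continuous.tendsto' (by fun_prop) _ _ (by simp)).mono_left
      nhdsWithin_le_nhds, ?_⟩
    filter_upwards [self_mem_nhdsWithin] with t (ht : 0 < t)
    refine mem_range_halfSpace.2 ?_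
    simp
    linarith
  have h2 : ContinuousWithinAt (fun y => V (φ.symm y)) (range (𝓡∂ (d + 1))) (φ p) :=
    hV.smooth.continuous.continuousAt.comp_continuousWithinAt
      (continuousOn_extChartAt_symm p _ hpt |>.mono_of_mem_nhdsWithin (target_mem_nhdsWithin p hpt))
  have h3 := h2.tendsto.comp h1
  rw [extChartAt_to_inv] at h3
  refine ge_of_tendsto h3 ?_
  filter_upwards [h1.eventually (target_mem_nhdsWithin p hpt), self_mem_nhdsWithin] with t h4 (h5 : 0 < t)
  refine (hV.pos _ ((mem_interior_iff (c := p) (φ.map_target h4)).2 ?_)).le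
  rw [← hφ, φ.right_inv h4]
  simp
  linarith

end AreaComparison

/-! ### Stability and the value of `P` on the unit normal -/

section Stability

variable {d : ℕ} {M : Type*} [TopologicalSpace M]
  [ChartedSpace (EuclideanHalfSpace (d + 1)) M] [IsManifold (𝓡∂ (d + 1)) ∞ M]
  {N : Type*} [TopologicalSpace N] [ChartedSpace (Coord d) N] [IsManifold (𝓡 d) ∞ N]
  {g : SmoothMetric (d + 1) M} {V : M → ℝ} {ι : N → M}

lemma continuousAt_normalForm (hι : ContMDiff (𝓡 d) (𝓡∂ (d + 1)) ∞ ι) {c : M} {q : N}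
    (hc : ι q ∈ (extChartAt (𝓡∂ (d + 1)) c).source)
    {S : Fin (d + 1) → Fin (d + 1) → Coord (d + 1) → ℝ}
    (hS : ∀ i j, ContinuousOn (S i j) (extChartAt (𝓡∂ (d + 1)) c).target) :
    ContinuousAt (fun q => normalForm g c S (extChartAt (𝓡∂ (d + 1)) c (ι q))) q := by
  have h1 : ContinuousOn (fun p => normalForm g c S (extChartAt (𝓡∂ (d + 1)) c p))
      (extChartAt (𝓡∂ (d + 1)) c).source :=
    (continuousOn_normalForm c hS).comp (continuousOn_extChartAt c) fun p hp =>
      (extChartAt (𝓡∂ (d + 1)) c).map_source hp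
  exact ContinuousAt.comp (f := ι) (h1.continuousAt ((isOpen_extChartAt_source c).mem_nhds hc))
    hι.continuous.continuousAt

/-- Compactness, with a chart that depends on the point; so `normalForm` need not be compared
between charts. -/
lemma exists_normalForm_ricci_le [CompactSpace N] (hι : ContMDiff (𝓡 d) (𝓡∂ (d + 1)) ∞ ι) :
    ∃ C : ℝ, 0 ≤ C ∧ ∀ q, ∃ c : M, ι q ∈ (extChartAt (𝓡∂ (d + 1)) c).source ∧
      |normalForm g c (ricci g c) (extChartAt (𝓡∂ (d + 1)) c (ι q))| ≤ C := by
  have key : ∃ C : ℝ, ∀ q ∈ (univ : Set N), ∃ c : M, ι q ∈ (extChartAt (𝓡∂ (d + 1)) c).source ∧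
      |normalForm g c (ricci g c) (extChartAt (𝓡∂ (d + 1)) c (ι q))| ≤ C := by
    refine isCompact_univ.induction_on (p := fun S => ∃ C : ℝ, ∀ q ∈ S, ∃ c : M,
      ι q ∈ (extChartAt (𝓡∂ (d + 1)) c).source ∧
      |normalForm g c (ricci g c) (extChartAt (𝓡∂ (d + 1)) c (ι q))| ≤ C) ⟨0, by simp⟩
      (fun s t hst ⟨C, hC⟩ => ⟨C, fun q hq => hC q (hst hq)⟩) ?_ ?_
    · rintro s t ⟨C, hC⟩ ⟨C', hC'⟩
      refine ⟨max C C', fun q hq => ?_⟩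
      rcases hq with hq | hq
      · exact (hC q hq).imp fun c h => ⟨h.1, h.2.trans (le_max_left _ _)⟩
      · exact (hC' q hq).imp fun c h => ⟨h.1, h.2.trans (le_max_right _ _)⟩
    · intro q _
      have hc := mem_extChartAt_source (I := 𝓡∂ (d + 1)) (ι q)
      have h1 := (continuousAt_normalForm (g := g) hι hc (continuousOn_ricci (g := g) (ι q))).abs
      have h2 := h1.eventually (gt_mem_nhds (lt_add_one _))
      have h3 := hι.continuous.continuousAt.preimage_mem_nhds ((isOpen_extChartAt_source (ι q)).mem_nhds hc)
      exact ⟨_, mem_nhdsWithin_of_mem_nhds (inter_mem h3 h2), _, fun q' hq' => ⟨ι q, hq'.1, le_of_lt hq'.2⟩⟩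
  obtain ⟨C, hC⟩ := key
  exact ⟨|C|, abs_nonneg C, fun q => (hC q (mem_univ q)).imp fun c h => ⟨h.1, h.2.trans (le_abs_self C)⟩⟩

lemma NonnegP.normalForm_nonneg (hP : NonnegP g V) {c : M} {y : Coord (d + 1)}
    (hy : y ∈ (extChartAt (𝓡∂ (d + 1)) c).target) :
    0 ≤ normalForm g c (fun i j y => tensorP g V c y i j) y :=
  div_nonneg (hP c y hy _) (inv_coordMetric_zero_pos hy).le

/-- The source term at the boundary. -/
lemma IsCollar.eventually_le_sourceTerm {W : M → ℝ} {ε : ℝ} {X : ℝ → N → M} {u : M → ℝ} {π : M → N} {η k : ℝ}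
    (h : IsCollar g W ι univ ε X u π) (hW : ContMDiff (𝓡∂ (d + 1)) 𝓘(ℝ, ℝ) ∞ W)
    (hWV : ∀ p, W p = V p + η)
    (hι : IsSmoothEmbedding (𝓡 d) (𝓡∂ (d + 1)) ∞ ι)
    (hb : ∀ q, ι q ∈ (𝓡∂ (d + 1)).boundary M) {c : M} {q : N}
    (hc : ι q ∈ (extChartAt (𝓡∂ (d + 1)) c).source)
    (hk : k < normalForm g c (fun i j y => tensorP g V c y i j) (extChartAt (𝓡∂ (d + 1)) c (ι q))
      + η * normalForm g c (ricci g c) (extChartAt (𝓡∂ (d + 1)) c (ι q))) :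
    ∀ᶠ y in 𝓝[range (𝓡∂ (d + 1))] (extChartAt (𝓡∂ (d + 1)) c (ι q)), k ≤ sourceTerm g W u c y := by
  have hE := h.isEikonal hW hb c
  have hm := h.mem_collarRegion (mem_univ q) hc
  -- On the boundary `W ∇u` is the unit normal, so the source there is `P(ν,ν) + η Ric(ν,ν)`;
  -- continuity spreads the strict bound to a neighbourhood.
  have h1 := hE.source_eq hWV hm
  rw [(extChartAt (𝓡∂ (d + 1)) c).left_inv hc, h.gradient_boundary hW hι hb hc
    (fun i j y => tensorP g V c y i j), mul_assoc η, h.gradient_boundary hW hι hb hc (ricci g c)] at h1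
  have hT := hE.region
  have hR := fun i j => (continuousOn_ricci (g := g) c i j).mono hT.subset
  have hcont : ContinuousOn (sourceTerm g W u c) (collarRegion (d := d) univ ε X c) := by
    have hZ := fun i => (hT.contDiffOn_gradient g hE.smooth_u i).continuousOn
    unfold sourceTerm
    refine ((hT.contDiffOn_laplacian g hE.smooth_W).continuousOn.sub ((hE.smooth_W.continuousOn.pow 2).mul
      (continuousOn_finsetSum _ fun i _ => continuousOn_finsetSum _ fun j _ =>
        (((hT.contDiffOn_hessian g hE.smooth_W i j).continuousOn.mul (hZ i)).mul (hZ j))))).add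
      ((hE.smooth_W.continuousOn.pow 3).mul (continuousOn_finsetSum _ fun i _ =>
        continuousOn_finsetSum _ fun j _ => ((hR i j).mul (hZ i)).mul (hZ j)))
  have h2 := (hcont _ hm).mono_of_mem_nhdsWithin (hT.mem_nhds _ hm)
  have h3 : k < sourceTerm g W u c (extChartAt (𝓡∂ (d + 1)) c (ι q)) := by
    rw [sourceTerm, (extChartAt (𝓡∂ (d + 1)) c).left_inv hc, h1]; exact hk
  exact (h2.tendsto.eventually (lt_mem_nhds h3)).mono fun y hy => le_of_lt hy

/-- Stability forces `P(ν, ν)` to vanish on the boundary hypersurface where `V` does not. -/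
theorem normalForm_tensorP_eq_zero [T2Space M] [T2Space N] [CompactSpace N] (hV : IsLapse (n := d + 1) V)
    (hP : NonnegP g V) (hι : IsSmoothEmbedding (𝓡 d) (𝓡∂ (d + 1)) ∞ ι)
    (hb : ∀ q, ι q ∈ (𝓡∂ (d + 1)).boundary M) (hmin : IsMinimalHypersurface g (range ι))
    (hst : IsStable d g ι) {q₁ : N} (hVq : 0 < V (ι q₁)) {c₁ : M}
    (hc₁ : ι q₁ ∈ (extChartAt (𝓡∂ (d + 1)) c₁).source) :
    normalForm g c₁ (fun i j y => tensorP g V c₁ y i j) (extChartAt (𝓡∂ (d + 1)) c₁ (ι q₁)) = 0 := by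
  have hs : ContMDiff (𝓡 d) (𝓡∂ (d + 1)) ∞ ι := hι.contMDiff
  have : Nonempty N := ⟨q₁⟩
  by_contra hne
  set φ := extChartAt (𝓡∂ (d + 1)) c₁ with hφ
  set F : N → ℝ := fun q => normalForm g c₁ (fun i j y => tensorP g V c₁ y i j) (φ (ι q)) with hF
  set R : N → ℝ := fun q => normalForm g c₁ (ricci g c₁) (φ (ι q)) with hR
  have hp : 0 < F q₁ := lt_of_le_of_ne (hP.normalForm_nonneg (φ.map_source hc₁)) (Ne.symm hne)
  obtain ⟨C, hC0, hC⟩ := exists_normalForm_ricci_le (g := g) hs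
  have hVι : Continuous fun q => V (ι q) := hV.smooth.continuous.comp hs.continuous
  obtain ⟨b, hbd⟩ := (isCompact_univ.image hVι).bddAbove
  have hVb : ∀ q, V (ι q) ≤ b := fun q => hbd ⟨q, mem_univ q, rfl⟩
  have hb0 : 0 < b := hVq.trans_le (hVb q₁)
  have hFc : ContinuousAt F q₁ := continuousAt_normalForm hs hc₁ (continuousOn_tensorP hV.smooth c₁)
  have hRc : ContinuousAt R q₁ := continuousAt_normalForm hs hc₁ (continuousOn_ricci c₁)
  have hnear : {q | F q₁ / 2 < F q ∧ |R q| < |R q₁| + 1 ∧ V (ι q₁) / 2 < V (ι q) ∧ ι q ∈ φ.source} ∈ 𝓝 q₁ := by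
    filter_upwards [hFc.eventually (lt_mem_nhds (half_lt_self hp)),
      hRc.abs.eventually (gt_mem_nhds (lt_add_one _)),
      hVι.continuousAt.eventually (lt_mem_nhds (half_lt_self hVq)),
      hs.continuous.continuousAt.preimage_mem_nhds ((isOpen_extChartAt_source c₁).mem_nhds hc₁)]
      with q h1 h2 h3 h4
    exact ⟨h1, h2, h3, h4⟩
  obtain ⟨K, hKn, hKsub, hK⟩ := local_compact_nhds hnear
  obtain ⟨A, A', hA, hA', hareaι, harea⟩ := exists_area_le (g := g) hι isOpen_interior
    (mem_interior_iff_mem_nhds.2 hKn)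
  -- On `K` one has `P(ν,ν) > F q₁ / 2`, and the Ricci term will be smaller than `F q₁ / 4`, so the
  -- source exceeds `k₁`. As `W ≥ V > V (ι q₁) / 2` there, `γ` is an admissible rate of decrease,
  -- and it does not depend on `η`.
  set k₁ := F q₁ / 4 with hk₁
  set γ := -(k₁ * (V (ι q₁) / 2) / 3) with hγ
  have hγ0 : γ < 0 := by rw [hγ, neg_lt_zero]; positivity
  -- the choice of `η`
  have hchoice : ∀ᶠ η : ℝ in 𝓝[>] 0, η < 1 ∧ η * (|R q₁| + 1) < F q₁ / 4 ∧
      γ * A + (4 * η * (C + 1) * (b + 1)) * A' < 0 := by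
    have h1 : Tendsto (fun η : ℝ => η * (|R q₁| + 1)) (𝓝[>] 0) (𝓝 0) :=
      (Continuous.tendsto' (by fun_prop) _ _ (by simp)).mono_left nhdsWithin_le_nhds
    have h2 : Tendsto (fun η : ℝ => γ * A + (4 * η * (C + 1) * (b + 1)) * A') (𝓝[>] 0) (𝓝 (γ * A)) :=
      (Continuous.tendsto' (by fun_prop) _ _ (by simp)).mono_left nhdsWithin_le_nhds
    filter_upwards [Ioo_mem_nhdsGT one_pos, h1.eventually (gt_mem_nhds (show (0 : ℝ) < F q₁ / 4 by positivity)),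
      h2.eventually (gt_mem_nhds (mul_neg_of_neg_of_pos hγ0 hA))] with η h3 h4 h5
    exact ⟨h3.2, h4, h5⟩
  obtain ⟨η, ⟨hη1, hη2, hη3⟩, hη0⟩ := (hchoice.and self_mem_nhdsWithin).exists
  replace hη0 : 0 < η := hη0
  -- `V` may have zeros on the boundary; adding `η` makes the speed positive, as a collar requires.
  have hW : ContMDiff (𝓡∂ (d + 1)) 𝓘(ℝ, ℝ) ∞ fun p => V p + η := hV.smooth.add contMDiff_const
  obtain ⟨ε, X, u, π, h⟩ := exists_collar g hW hι hb fun q => add_pos_of_nonneg_of_pos (hV.nonneg _) hη0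
  obtain ⟨δ, hδ, hδK⟩ := exists_densityBound_of_isCompact (g := g) (ι := ι) (X := X) (γ := γ) hK fun q hq => by
    obtain ⟨h1, h2, h3, h4⟩ := hKsub hq
    refine h.exists_densityBound_nhds hW hmin hι hb (c := c₁) (k := k₁) h4
      (h.eventually_le_sourceTerm hW (fun _ => rfl) hι hb h4 ?_) (Or.inr ⟨by positivity, ?_⟩)
    · have h5 : -(η * (|R q₁| + 1)) ≤ η * R q := by
        rw [← mul_neg]
        exact mul_le_mul_of_nonneg_left (by linarith [neg_abs_le (R q)]) hη0.le
      have h6 : k₁ < F q + η * R q := by linarith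
      exact h6
    · have h5 : k₁ * (V (ι q₁) / 2) ≤ k₁ * (V (ι q) + η) :=
        mul_le_mul_of_nonneg_left (by linarith) (by positivity)
      rw [hγ]; linarith
  -- On all of `N` only `P ≥ 0` and `|Ric(ν,ν)| ≤ C` are available; the area density grows at a rate
  -- `O(η)`.
  obtain ⟨δ', hδ', hδN⟩ := exists_densityBound_of_isCompact (g := g) (ι := ι) (X := X)
      (γ := 4 * η * (C + 1) * (b + 1)) isCompact_univ fun q _ => by
    obtain ⟨c, hc, hcC⟩ := hC q
    refine h.exists_densityBound_nhds hW hmin hι hb (c := c) (k := -(η * (C + 1))) hc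
      (h.eventually_le_sourceTerm hW (fun _ => rfl) hι hb hc ?_) (Or.inl ⟨?_, ?_⟩)
    · have h1 := hP.normalForm_nonneg ((extChartAt (𝓡∂ (d + 1)) c).map_source hc)
      have h2 : -C ≤ normalForm g c (ricci g c) (extChartAt (𝓡∂ (d + 1)) c (ι q)) := (abs_le.1 hcC).1
      nlinarith
    · have : 0 ≤ η * (C + 1) := by positivity
      linarith
    · have h1 : 0 ≤ η * (C + 1) := by positivity
      have h2 : V (ι q) + η ≤ b + 1 := add_le_add (hVb q) hη1.le
      nlinarith
  exact not_isStable_of_densityBound h hA hA' hareaι harea hδ hδ'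
    (fun q hq => hδK q (interior_subset hq)) hδN hη3 hst

end Stability

/-! ### The strong maximum principle for the lapse on the boundary -/

section MaximumPrinciple

variable {d : ℕ} {M : Type*} [TopologicalSpace M]
  [ChartedSpace (EuclideanHalfSpace (d + 1)) M] [IsManifold (𝓡∂ (d + 1)) ∞ M]
  {g : SmoothMetric (d + 1) M} {V : M → ℝ} {c : M}

lemma tangentialInv_posDef {y : Coord (d + 1)} (hy : y ∈ (extChartAt (𝓡∂ (d + 1)) c).target) :
    (Matrix.of (tangentialInv g c y)).PosDef := by
  refine Matrix.PosDef.of_dotProduct_mulVec_pos ?_ fun x hx => ?_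
  · ext a b
    simp only [Matrix.conjTranspose_apply, Matrix.of_apply, star_trivial, tangentialInv,
      coordMetric_inv_symm g c y b.succ a.succ]
    ring
  · refine (tangentialInv_pos (g := g) hy hx).trans_eq ?_
    simp only [dotProduct, Matrix.mulVec, Finset.mul_sum, Matrix.of_apply, star_trivial]
    exact Finset.sum_congr rfl fun a _ => Finset.sum_congr rfl fun b _ => by ring

lemma normalForm_coordMetric {y : Coord (d + 1)} (hy : y ∈ (extChartAt (𝓡∂ (d + 1)) c).target) :
    normalForm g c (fun i j y => coordMetric g c y i j) y = 1 := by
  have h0 := (inv_coordMetric_zero_pos (g := g) hy).ne'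
  have h1 : ∀ i, ∑ j, coordMetric g c y i j * (coordMetric g c y)⁻¹ i 0 * (coordMetric g c y)⁻¹ j 0
      = (coordMetric g c y)⁻¹ i 0 * if i = 0 then 1 else 0 := fun i => by
    rw [← sum_coordMetric_mul_inv g c hy i 0, Finset.mul_sum]
    exact Finset.sum_congr rfl fun j _ => by ring
  simp only [normalForm, h1]
  simpa using div_self h0

/-- The normal is a unit vector, and `ΔV - ∇²V(ν,ν)` is the tangential trace of the Hessian. On a
minimal boundary this trace is the intrinsic Laplacian of the restriction of `V`. -/
lemma normalForm_tensorP {y : Coord (d + 1)} (hy : y ∈ (extChartAt (𝓡∂ (d + 1)) c).target) :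
    normalForm g c (fun i j y => tensorP g V c y i j) y
      = ∑ a : Fin d, ∑ b : Fin d, tangentialInv g c y a b * hessian g c V a.succ b.succ y
        + normalForm g c (ricci g c) y * V ((extChartAt (𝓡∂ (d + 1)) c).symm y) := by
  rw [sum_tangentialInv hy fun i j => hessian g c V i j y]
  have h1 := normalForm_coordMetric (g := g) hy
  have h2 : normalForm g c (fun i j y => tensorP g V c y i j) y
      = V ((extChartAt (𝓡∂ (d + 1)) c).symm y) * normalForm g c (ricci g c) y
        - normalForm g c (hessian g c V) y
        + laplacian g c V y * normalForm g c (fun i j y => coordMetric g c y i j) y := by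
    simp only [normalForm, mul_div_assoc', ← sub_div, ← add_div, Finset.mul_sum,
      ← Finset.sum_sub_distrib, ← Finset.sum_add_distrib, tensorP, Matrix.of_apply]
    exact congrArg (· / _) (Finset.sum_congr rfl fun i _ => Finset.sum_congr rfl fun j _ => by ring)
  rw [h2, h1]
  simp only [normalForm, laplacian]
  ring

variable {N : Type*} [TopologicalSpace N] [ChartedSpace (Coord d) N] [IsManifold (𝓡 d) ∞ N] {ι : N → M}

/-- Where `V > 0` on the boundary, stability gives `P(ν,ν) = 0`; by minimality this is the linear
elliptic equation `Δ_Σ V + Ric(ν,ν) V = 0` in the tangential coordinates. The strong maximum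
principle needs the equation only at such points. -/
theorem eventually_lapse_eq_zero [T2Space M] [T2Space N] [CompactSpace N] (hV : IsLapse (n := d + 1) V)
    (hP : NonnegP g V) (hι : IsSmoothEmbedding (𝓡 d) (𝓡∂ (d + 1)) ∞ ι)
    (hb : ∀ q, ι q ∈ (𝓡∂ (d + 1)).boundary M) (hmin : IsMinimalHypersurface g (range ι))
    (hst : IsStable d g ι) {q : N} (hq : V (ι q) = 0) : ∀ᶠ q' in 𝓝 q, V (ι q') = 0 := by
  set c := ι q with hcdef
  have hc : ι q ∈ (extChartAt (𝓡∂ (d + 1)) c).source := mem_extChartAt_source c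
  obtain ⟨s₀, hs₀⟩ := exists_boundaryIncl_eq hc (hb q)
  set φ := extChartAt (𝓡∂ (d + 1)) c with hφ
  have hreg := isChartRegion_preimage (n := d + 1) c isOpen_univ
  have hVs := contDiffOn_comp_extChartAt_symm isOpen_univ hV.smooth.contMDiffOn c
  rw [preimage_univ, inter_univ] at hreg hVs
  set Ω := interior {s : Coord d | boundaryIncl d s ∈ φ.target ∧ φ.symm (boundaryIncl d s) ∈ range ι}
    with hΩ
  have hΩs : ∀ s ∈ Ω, boundaryIncl d s ∈ φ.target ∧ φ.symm (boundaryIncl d s) ∈ range ι :=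
    fun s hs => (interior_subset hs : s ∈ {s : Coord d | _ ∧ _})
  have hmaps : MapsTo (boundaryIncl d) Ω φ.target := fun s hs => (hΩs s hs).1
  have hs₀Ω : s₀ ∈ Ω := by
    rw [hΩ, mem_interior_iff_mem_nhds]
    filter_upwards [eventually_mem_range hι hb hc hs₀,
      hreg.preimage_boundaryIncl (by rw [hs₀]; exact φ.map_source hc)] with s' h1 h2 using ⟨h2, h1⟩
  have hh : ∀ a b, ContinuousOn (fun s => tangentialInv g c (boundaryIncl d s) a b) Ω := fun a b => by
    have hA : ∀ i j, ContinuousOn (fun s => (coordMetric g c (boundaryIncl d s))⁻¹ i j) Ω := fun i j =>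
      ContinuousOn.comp (g := fun y => (coordMetric g c y)⁻¹ i j)
        (hreg.contDiffOn_coordMetric_inv g i j).continuousOn (boundaryIncl d).continuous.continuousOn hmaps
    exact (hA _ _).sub (((hA _ _).mul (hA _ _)).div (hA _ _) fun s hs =>
      (inv_coordMetric_zero_pos (g := g) (hmaps hs)).ne')
  have hΓ : ∀ k i j, ContinuousOn (fun s => christoffel g c k i j (boundaryIncl d s)) Ω := fun k i j =>
    ContinuousOn.comp (g := christoffel g c k i j)
      (hreg.contDiffOn_christoffel g k i j).continuousOn (boundaryIncl d).continuous.continuousOn hmaps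
  have key := eventually_eq_zero_of_elliptic (v := boundaryTrace c V) isOpen_interior
    (H := fun s => Matrix.of (tangentialInv g c (boundaryIncl d s)))
    (B := fun e s => -∑ a : Fin d, ∑ b : Fin d, tangentialInv g c (boundaryIncl d s) a b
      * christoffel g c e.succ a.succ b.succ (boundaryIncl d s))
    (κ := fun s => normalForm g c (ricci g c) (boundaryIncl d s))
    (hVs.comp (boundaryIncl d).contDiff.contDiffOn hmaps) (fun s _ => hV.nonneg _) hh
    (fun s hs => tangentialInv_posDef (hmaps hs))
    (fun e => (continuousOn_finsetSum _ fun a _ => continuousOn_finsetSum _ fun b _ =>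
      (hh a b).mul (hΓ _ _ _)).neg)
    (ContinuousOn.comp (g := normalForm g c (ricci g c))
      (continuousOn_normalForm c (continuousOn_ricci c)) (boundaryIncl d).continuous.continuousOn hmaps)
    (fun s hs hvs => ?_) hs₀Ω (by rw [boundaryTrace, hs₀, φ.left_inv hc]; exact hq)
  · have h1 : ContinuousAt (fun q' => tail d (φ (ι q'))) q :=
      (tail d).continuous.continuousAt.comp
        (ContinuousAt.comp (continuousAt_extChartAt' hc) hι.contMDiff.continuous.continuousAt)
    have h2 : tail d (φ (ι q)) = s₀ := by rw [← hs₀]; simp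
    have h3 := hι.contMDiff.continuous.continuousAt.preimage_mem_nhds
      ((isOpen_extChartAt_source c).mem_nhds hc)
    rw [← h2] at key
    filter_upwards [h1.eventually key, h3] with q' hq' hq's
    obtain ⟨s, hs⟩ := exists_boundaryIncl_eq hq's (hb q')
    rwa [← hs, tail_boundaryIncl, boundaryTrace, hs, φ.left_inv hq's] at hq'
  · obtain ⟨hst', q', hq'⟩ := hΩs s hs
    have hq's : ι q' ∈ φ.source := by rw [hq']; exact φ.map_target hst'
    have hy : φ (ι q') = boundaryIncl d s := by rw [hq', φ.right_inv hst']
    have hz := normalForm_tensorP_eq_zero hV hP hι hb hmin hst (q₁ := q') (by rw [hq']; exact hvs) hq's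
    have hH := hmin.boundaryMean_eq_zero hι hb hq's
    rw [← hφ, hy] at hz hH
    rw [normalForm_tensorP hst'] at hz
    rw [← hz]
    simp only [hessian_boundaryIncl hreg hVs hst', Matrix.of_apply, partialD₂, neg_mul, boundaryTrace]
    -- The normal derivative of `V` enters the tangential Hessian only with the mean curvature as
    -- its coefficient, which is zero.
    have h4 : ∑ a : Fin d, ∑ b : Fin d, tangentialInv g c (boundaryIncl d s) a b
        * (christoffel g c 0 a.succ b.succ (boundaryIncl d s) * coordD c V 0 (boundaryIncl d s)) = 0 := by
      rw [← zero_mul (coordD c V 0 (boundaryIncl d s)), ← hH, boundaryMean]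
      simp only [Finset.sum_mul, mul_assoc]
    have h5 : ∀ D : Fin d → ℝ, ∑ e : Fin d, (∑ a : Fin d, ∑ b : Fin d, tangentialInv g c (boundaryIncl d s) a b
        * christoffel g c e.succ a.succ b.succ (boundaryIncl d s)) * D e
        = ∑ a : Fin d, ∑ b : Fin d, tangentialInv g c (boundaryIncl d s) a b
          * ∑ e : Fin d, christoffel g c e.succ a.succ b.succ (boundaryIncl d s) * D e := fun D => by
      simp only [Finset.sum_mul, Finset.mul_sum]
      rw [Finset.sum_comm]
      refine Finset.sum_congr rfl fun a _ => ?_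
      rw [Finset.sum_comm]
      exact Finset.sum_congr rfl fun b _ => Finset.sum_congr rfl fun e _ => by ring
    simp only [mul_sub, Finset.sum_sub_distrib, h4, Finset.sum_neg_distrib, h5]
    ring

/-- The zero set of the lapse on the connected hypersurface is closed by continuity and open by the
maximum principle. -/
theorem lapse_eq_zero_or_pos [T2Space M] [T2Space N] [CompactSpace N] (hV : IsLapse (n := d + 1) V)
    (hP : NonnegP g V) (hι : IsSmoothEmbedding (𝓡 d) (𝓡∂ (d + 1)) ∞ ι)
    (hcomp : IsBoundaryComponent (n := d + 1) (range ι)) (hmin : IsMinimalHypersurface g (range ι))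
    (hst : IsStable d g ι) : (∀ q, V (ι q) = 0) ∨ ∀ q, 0 < V (ι q) := by
  obtain ⟨p, hp, hT⟩ := hcomp
  have hb : ∀ q, ι q ∈ (𝓡∂ (d + 1)).boundary M := fun q =>
    connectedComponentIn_subset _ _ (hT ▸ mem_range_self q)
  have hpre : IsPreconnected (range ι) := hT ▸ isPreconnected_connectedComponentIn
  have : PreconnectedSpace N := ⟨by
    rw [← hι.isEmbedding.isInducing.isPreconnected_image, image_univ]; exact hpre⟩
  have hcl : IsClopen {q | V (ι q) = 0} :=
    ⟨isClosed_eq (hV.smooth.continuous.comp hι.contMDiff.continuous) continuous_const,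
      isOpen_iff_mem_nhds.2 fun q hq => eventually_lapse_eq_zero hV hP hι hb hmin hst hq⟩
  rcases isClopen_iff.1 hcl with h | h
  · exact Or.inr fun q => (hV.nonneg _).lt_of_ne' fun h0 => (h ▸ h0 : q ∈ (∅ : Set N))
  · exact Or.inl fun q => (h.symm ▸ mem_univ q : q ∈ {q | V (ι q) = 0})

end MaximumPrinciple

/-! ### Foliation by minimal hypersurfaces -/

section Rigidity

variable {d : ℕ} {M : Type*} [TopologicalSpace M]
  [ChartedSpace (EuclideanHalfSpace (d + 1)) M] [IsManifold (𝓡∂ (d + 1)) ∞ M]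
  {N : Type*} [TopologicalSpace N] [ChartedSpace (Coord d) N] [IsManifold (𝓡 d) ∞ N]
  {g : SmoothMetric (d + 1) M} {ι : N → M} {ε : ℝ} {X : ℝ → N → M} {u : M → ℝ} {π : M → N}

/-- The Jacobian factor does not depend on `F`, so two area densities can be compared at a point in
a single chart. -/
lemma areaDensity_transition (g : SmoothMetric (d + 1) M) {F : N → M}
    (hF : ContMDiff (𝓡 d) (𝓡∂ (d + 1)) ∞ F) {q b b' : N}
    (hb : q ∈ (extChartAt (𝓡 d) b).source) (hb' : q ∈ (extChartAt (𝓡 d) b').source) :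
    areaDensity g F b' (extChartAt (𝓡 d) b' q)
      = |(fderiv ℝ (transition b' b) (extChartAt (𝓡 d) b' q)).det|
        * areaDensity g F b (extChartAt (𝓡 d) b q) := by
  have h := isDensity_areaDensity g hF b' b (extChartAt (𝓡 d) b' q)
    ⟨(extChartAt (𝓡 d) b').map_source hb', by
      rw [mem_preimage, (extChartAt (𝓡 d) b').left_inv hb']; exact hb⟩
  have h1 : transition b' b (extChartAt (𝓡 d) b' q) = extChartAt (𝓡 d) b q :=
    congrArg (extChartAt (𝓡 d) b) ((extChartAt (𝓡 d) b').left_inv hb')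
  rw [h1, ← ENNReal.ofReal_mul (abs_nonneg _)] at h
  exact (ENNReal.ofReal_eq_ofReal_iff (Real.sqrt_nonneg _)
    (mul_nonneg (abs_nonneg _) (Real.sqrt_nonneg _))).1 h

/-- A hypersurface with pointwise smaller density and no smaller area has the same density. -/
lemma DensityLE.areaDensity_eq_of_area_le [T2Space N] [CompactSpace N]
    (hι : IsSmoothEmbedding (𝓡 d) (𝓡∂ (d + 1)) ∞ ι) {F : N → M}
    (hF : ContMDiff (𝓡 d) (𝓡∂ (d + 1)) ∞ F) (h : DensityLE g F ι 1 univ) (harea : area d g ι ≤ area d g F)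
    {q b : N} (hq : q ∈ (extChartAt (𝓡 d) b).source) :
    areaDensity g F b (extChartAt (𝓡 d) b q) = areaDensity g ι b (extChartAt (𝓡 d) b q) := by
  set χ := extChartAt (𝓡 d) b with hχ
  have hle := h q (mem_univ q) b hq
  rw [one_mul] at hle
  refine hle.antisymm (not_lt.1 fun hlt => ?_)
  have hpos := areaDensity_pos g hι b (χ.map_source hq)
  -- If the density were smaller at `q`, then by continuity a factor `k < 1` would be gained on an
  -- open set of positive area, and the total area would drop.
  obtain ⟨k, hk, hk1⟩ := exists_between ((div_lt_one hpos).2 hlt)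
  have hk0 : 0 ≤ k := (div_nonneg (Real.sqrt_nonneg _) hpos.le).trans hk.le
  have hcont : ContinuousOn (fun q' => k * areaDensity g ι b (χ q') - areaDensity g F b (χ q')) χ.source :=
    (((continuousOn_areaDensity_of_contMDiff hι.contMDiff b).comp (continuousOn_extChartAt b)
      χ.mapsTo).const_mul k).sub ((continuousOn_areaDensity_of_contMDiff hF b).comp
      (continuousOn_extChartAt b) χ.mapsTo)
  have hE := hcont.isOpen_inter_preimage (isOpen_extChartAt_source b) (isOpen_Ioi (a := (0 : ℝ)))
  obtain ⟨A, A', hA, hA', hareaι, hle'⟩ := exists_area_le (g := g) hι hE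
    (show q ∈ _ from ⟨hq, sub_pos.2 ((div_lt_iff₀ hpos).1 hk)⟩)
  have h1 := hle' F k 1 hF hk0 zero_le_one (fun q' hq' b' hb' => by
    rw [areaDensity_transition g hF hq'.1 hb', areaDensity_transition g hι.contMDiff hq'.1 hb', mul_left_comm]
    exact mul_le_mul_of_nonneg_left (sub_pos.1 hq'.2).le (abs_nonneg _)) h
  have h2 := harea.trans h1
  rw [hareaι, ENNReal.ofReal_le_ofReal_iff (by positivity)] at h2
  nlinarith

variable {V : M → ℝ}

/-- With speed `V` the source is `P(ν,ν) ≥ 0`, so the rate `γ = 0` is admissible and no area density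
increases. Stability forbids a loss of area, hence the densities stay equal. -/
lemma IsCollar.exists_areaDensity_eq [T2Space N] [CompactSpace N] (h : IsCollar g V ι univ ε X u π)
    (hV : ContMDiff (𝓡∂ (d + 1)) 𝓘(ℝ, ℝ) ∞ V) (hP : NonnegP g V) (hmin : IsMinimalHypersurface g (range ι))
    (hι : IsSmoothEmbedding (𝓡 d) (𝓡∂ (d + 1)) ∞ ι)
    (hb : ∀ q, ι q ∈ (𝓡∂ (d + 1)).boundary M) (hst : IsStable d g ι) :
    ∃ δ > 0, δ ≤ ε ∧ ∀ t ∈ Ioo 0 δ, ∀ q b : N, q ∈ (extChartAt (𝓡 d) b).source →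
      areaDensity g (X t) b (extChartAt (𝓡 d) b q) = areaDensity g ι b (extChartAt (𝓡 d) b q) := by
  obtain ⟨δ, hδ, hB⟩ := exists_densityBound_of_isCompact (γ := 0) isCompact_univ fun q _ => by
    refine h.exists_densityBound_nhds hV hmin hι hb (mem_extChartAt_source (ι q)) (k := 0) ?_
      (Or.inl ⟨le_rfl, by simp⟩)
    have hE := h.isEikonal hV hb (ι q)
    filter_upwards [hE.region.mem_nhds _ (h.mem_collarRegion (mem_univ q) (mem_extChartAt_source _))] with y hy
    rw [sourceTerm, hE.source_eq (η := 0) (fun p => (add_zero _).symm) hy, zero_mul, zero_mul, add_zero]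
    refine mul_nonneg (sq_nonneg _) ((hP (ι q) y hy.1 fun i => gradient g (ι q) u i y).trans_eq ?_)
    rfl
  obtain ⟨δ', hδ', hst'⟩ := mem_nhdsGT_iff_exists_Ioo_subset.1 (hst ε X h.eps_pos h.isVariation)
  refine ⟨min (min δ δ') ε, lt_min (lt_min hδ hδ') h.eps_pos, min_le_right _ _, fun t ht q b hq => ?_⟩
  have h1 : t < δ ∧ t < δ' ∧ t < ε := by simpa [and_assoc] using ht.2
  have h2 := hB.densityLE ⟨ht.1.le, h1.1⟩
  rw [zero_mul, zero_div, Real.exp_zero] at h2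
  exact h2.areaDensity_eq_of_area_le hι (h.contMDiff_X ⟨ht.1.le, h1.2.2⟩) (hst' ⟨ht.1, h1.2.1⟩) hq

/-- The squared density has derivative `2 W² E` times itself; if it is constant, then `E = 0`, as
`W` and the density are nonzero. -/
lemma IsCollar.eikonalMean_eq_zero_of_areaDensity_eq {W : M → ℝ} (h : IsCollar g W ι univ ε X u π)
    (hW : ContMDiff (𝓡∂ (d + 1)) 𝓘(ℝ, ℝ) ∞ W)
    (hι : IsSmoothEmbedding (𝓡 d) (𝓡∂ (d + 1)) ∞ ι)
    (hb : ∀ q, ι q ∈ (𝓡∂ (d + 1)).boundary M) {δ : ℝ} (hδ : δ ≤ ε) {q : N}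
    (heq : ∀ t ∈ Ioo 0 δ, areaDensity g (X t) q (extChartAt (𝓡 d) q q)
      = areaDensity g ι q (extChartAt (𝓡 d) q q)) {t : ℝ} (ht : t ∈ Ioo 0 δ) {c : M}
    (hc : X t q ∈ (extChartAt (𝓡∂ (d + 1)) c).source) :
    eikonalMean g W u c (extChartAt (𝓡∂ (d + 1)) c (X t q)) = 0 := by
  have hq := mem_extChartAt_source (I := 𝓡 d) q
  have hleft := (extChartAt (𝓡 d) q).left_inv hq
  have hte : t ∈ Ioo 0 ε := ⟨ht.1, ht.2.trans_le hδ⟩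
  have h1 := h.hasDerivAt_areaDensity_sq hW hb (b := q) (c := c) hte ((extChartAt (𝓡 d) q).map_source hq)
    (mem_univ _) (by rw [hleft]; exact hc)
  rw [hleft, heq t ht] at h1
  have h2 := h1.unique ((hasDerivAt_const t (areaDensity g ι q (extChartAt (𝓡 d) q q) ^ 2)).congr_of_eventuallyEq
    (by filter_upwards [Ioo_mem_nhds ht.1 ht.2] with s hs; rw [heq s hs]))
  have h3 := (areaDensity_pos g hι q ((extChartAt (𝓡 d) q).map_source hq)).ne'
  have h4 := (h.W_pos _ (h.mem_image ⟨hte.1.le, hte.2⟩ (mem_univ q))).ne'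
  simp only [mul_eq_zero, pow_eq_zero_iff two_ne_zero, two_ne_zero, h3, h4, or_false, false_or] at h2
  exact h2

/-- A slice of a collar is minimal if `eikonalMean` vanishes on it. -/
lemma IsCollar.isMinimalHypersurface_slice {W : M → ℝ} (h : IsCollar g W ι univ ε X u π)
    (hW : ContMDiff (𝓡∂ (d + 1)) 𝓘(ℝ, ℝ) ∞ W) (hb : ∀ q, ι q ∈ (𝓡∂ (d + 1)).boundary M) {t : ℝ}
    (ht : t ∈ Ioo 0 ε) (hE : ∀ (q : N) (c : M), X t q ∈ (extChartAt (𝓡∂ (d + 1)) c).source →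
      eikonalMean g W u c (extChartAt (𝓡∂ (d + 1)) c (X t q)) = 0) :
    IsMinimalHypersurface g (range (X t)) := by
  have htc : t ∈ Ico 0 ε := ⟨ht.1.le, ht.2⟩
  rintro p ⟨q₀, rfl⟩
  have hsm : ContMDiffOn (𝓡∂ (d + 1)) 𝓘(ℝ, ℝ) ∞ (fun p => u p - t) (collarImage univ ε X) :=
    h.smooth_u.sub contMDiffOn_const
  refine ⟨collarImage univ ε X, h.isOpen_image, h.mem_image htc (mem_univ q₀), fun p => u p - t, hsm,
    fun p hp => ⟨?_, fun h0 => ?_⟩, ?_⟩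
  · rintro ⟨q, rfl⟩
    exact sub_eq_zero.2 (h.u_X t htc q (mem_univ q))
  · refine ⟨π p, ?_⟩
    rw [← sub_eq_zero.1 h0]
    exact (h.X_u_π hp).2.2
  · rintro p hp ⟨q, rfl⟩
    refine ⟨fun h0 => ?_, fun c hc => ?_⟩
    -- `u - t` has derivative `1` along the flow line through the point, so its differential cannot
    -- vanish.
    · have hcurve : MDifferentiableAt 𝓘(ℝ, ℝ) (𝓡∂ (d + 1)) (fun s => X s q) t := by
        have h1 := h.smooth_X.contMDiffAt (x := (t, q))
          (prod_mem_nhds (Ico_mem_nhds ht.1 ht.2) univ_mem)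
        exact (ContMDiffAt.comp (g := fun z : ℝ × N => X z.1 z.2) (f := fun s : ℝ => (s, q)) t h1
          (contMDiffAt_id.prodMk contMDiffAt_const)).mdifferentiableAt (by simp)
      have h1 := mfderiv_comp (g := fun p => u p - t) t
        ((hsm.contMDiffAt (h.isOpen_image.mem_nhds hp)).mdifferentiableAt (by simp)) hcurve
      rw [h0] at h1
      have h2 : (fun p => u p - t) ∘ (fun s => X s q) =ᶠ[𝓝 t] fun s => s - t := by
        filter_upwards [Ioo_mem_nhds ht.1 ht.2] with s hs
        simp only [Function.comp_apply, h.u_X s ⟨hs.1.le, hs.2⟩ q (mem_univ q)]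
      rw [h2.mfderiv_eq, mfderiv_eq_fderiv] at h1
      have h3 := ((hasDerivAt_id t).sub_const t).hasFDerivAt.fderiv
      have h4 := congrArg (fun L : ℝ →L[ℝ] ℝ => L 1) (h3.symm.trans h1)
      rw [ContinuousLinearMap.toSpanSingleton_apply, one_smul] at h4
      exact absurd (show (1 : ℝ) = 0 from h4) one_ne_zero
    · have hD : ∀ i, coordD (n := d + 1) c (fun p => u p - t) i = coordD c u i := fun i => by
        funext z
        exact congrArg (fun L : Coord (d + 1) →L[ℝ] ℝ => L (stdVec i)) (fderivWithin_sub_const _)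
      have h1 : meanCurvature g (fun p => u p - t) c (extChartAt (𝓡∂ (d + 1)) c (X t q))
          = meanCurvature g u c (extChartAt (𝓡∂ (d + 1)) c (X t q)) := by
        simp only [meanCurvature, laplacian, hessian, gradNormSq, gradient, hD]
      rw [h1, (h.isEikonal hW hb c).meanCurvature_eq ⟨(extChartAt (𝓡∂ (d + 1)) c).map_source hc, by
        rw [mem_preimage, (extChartAt (𝓡∂ (d + 1)) c).left_inv hc]; exact hp⟩, hE q c hc, zero_mul]

/-- The collar up to time `t` is an open set whose closure lies in the compact image of `[0, t] ×
N`. Points at time `t` are limits of earlier points of their flow lines but have `u = t`, so they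
form the frontier. -/
lemma IsCollar.encloses_slice [T2Space M] [CompactSpace N] {W : M → ℝ} (h : IsCollar g W ι univ ε X u π)
    {t : ℝ} (ht : t ∈ Ioo 0 ε) : Encloses (range (X t)) (range ι) := by
  have h' := h.restrict ht.1 ht.2.le isOpen_univ subset_rfl
  have hcomp : IsCompact ((fun z : ℝ × N => X z.1 z.2) '' (Icc 0 t ×ˢ univ)) :=
    (isCompact_Icc.prod isCompact_univ).image_of_continuousOn
      (h.smooth_X.continuousOn.mono (prod_mono (fun s hs => ⟨hs.1, hs.2.trans_lt ht.2⟩) subset_rfl))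
  have hsub : collarImage univ t X ⊆ (fun z : ℝ × N => X z.1 z.2) '' (Icc 0 t ×ˢ univ) :=
    image_mono (prod_mono Ico_subset_Icc_self subset_rfl)
  have hcl := closure_minimal hsub hcomp.isClosed
  refine ⟨collarImage univ t X, h'.isOpen_image, hcomp.of_isClosed_subset isClosed_closure hcl, ?_, ?_⟩
  · rintro p ⟨q, rfl⟩
    exact h'.ι_mem_image (mem_univ q)
  · rw [h'.isOpen_image.frontier_eq]
    ext p
    constructor
    · rintro ⟨hp, hpn⟩
      obtain ⟨⟨s, q⟩, ⟨hs, -⟩, rfl⟩ := hcl hp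
      rcases hs.2.eq_or_lt with h1 | h1
      · exact ⟨q, congrArg (X · q) h1.symm⟩
      · exact absurd (h'.mem_image ⟨hs.1, h1⟩ (mem_univ q)) hpn
    · rintro ⟨q, rfl⟩
      refine ⟨mem_closure_of_tendsto ((h.continuousAt_curve ht (mem_univ q)).tendsto.mono_left
        (nhdsWithin_le_nhds (s := Iio t))) ?_, fun hmem => ?_⟩
      · filter_upwards [Ioo_mem_nhdsLT ht.1] with s hs using h'.mem_image ⟨hs.1.le, hs.2⟩ (mem_univ q)
      · have := (h'.X_u_π hmem).1.2
        rw [h.u_X t ⟨ht.1.le, ht.2⟩ q (mem_univ q)] at this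
        exact lt_irrefl t this

/-- An outermost stable minimal boundary component is not disjoint from the zero set of the lapse. -/
theorem exists_lapse_nonpos [T2Space M] [T2Space N] [CompactSpace N] [Nonempty N]
    (hV : ContMDiff (𝓡∂ (d + 1)) 𝓘(ℝ, ℝ) ∞ V) (hP : NonnegP g V)
    (hι : IsSmoothEmbedding (𝓡 d) (𝓡∂ (d + 1)) ∞ ι)
    (hb : ∀ q, ι q ∈ (𝓡∂ (d + 1)).boundary M) (hmin : IsMinimalHypersurface g (range ι))
    (hst : IsStable d g ι) (hout : IsOutermost g (range ι)) : ∃ q, V (ι q) ≤ 0 := by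
  by_contra! hpos
  obtain ⟨ε, X, u, π, h⟩ := exists_collar g hV hι hb hpos
  obtain ⟨δ, hδ, hδε, heq⟩ := h.exists_areaDensity_eq hV hP hmin hι hb hst
  -- Any time in `(0, δ)` would do: every such slice is a closed minimal hypersurface in the
  -- interior.
  have ht : δ / 2 ∈ Ioo 0 δ := ⟨half_pos hδ, half_lt_self hδ⟩
  have htε : δ / 2 ∈ Ioo 0 ε := ⟨ht.1, ht.2.trans_le hδε⟩
  refine hout ⟨range (X (δ / 2)), range_nonempty _,
    isCompact_range (h.contMDiff_X ⟨htε.1.le, htε.2⟩).continuous, ?_,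
    h.isMinimalHypersurface_slice hV hb htε fun q c hc => h.eikonalMean_eq_zero_of_areaDensity_eq hV hι hb hδε
      (fun t ht => heq t ht q q (mem_extChartAt_source q)) ht hc, h.encloses_slice htε⟩
  rintro p ⟨q, rfl⟩
  exact h.mem_interior _ htε q (mem_univ q)

end Rigidity

end StaticTriple

end

theorem mainTheorem5 (d : ℕ) (hd : 2 ≤ d)
    -- the manifold with boundary `M` of dimension `n = d + 1 ≥ 3`
    {M : Type*} [TopologicalSpace M] [T2Space M] [SecondCountableTopology M]
    [ChartedSpace (EuclideanHalfSpace (d + 1)) M] [IsManifold (𝓡∂ (d + 1)) ∞ M]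
    -- the asymptotically flat static triple `(M, g, V)` with non-negative definite `P`
    (g : StaticTriple.SmoothMetric (d + 1) M) (V : M → ℝ) (m : ℝ)
    (hV : StaticTriple.IsLapse (n := d + 1) V)
    (hAF : StaticTriple.IsAsymptoticallyFlat g V m)
    (hP : StaticTriple.NonnegP g V)
    -- the boundary component, parametrized by an embedding `ι` of the closed manifold `N`
    {N : Type*} [TopologicalSpace N] [T2Space N] [SecondCountableTopology N] [CompactSpace N]
    [ChartedSpace (EuclideanSpace ℝ (Fin d)) N] [IsManifold (𝓡 d) ∞ N]
    (ι : N → M) (hι : Manifold.IsSmoothEmbedding (𝓡 d) (𝓡∂ (d + 1)) ∞ ι)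
    (hcomp : StaticTriple.IsBoundaryComponent (n := d + 1) (range ι))
    -- it is minimal, stable and outermost
    (hmin : StaticTriple.IsMinimalHypersurface g (range ι))
    (hstable : StaticTriple.IsStable d g ι)
    (hout : StaticTriple.IsOutermost g (range ι)) :
    ∀ p ∈ range ι, V p = 0 := by
  rcases StaticTriple.lapse_eq_zero_or_pos hV hP hι hcomp hmin hstable with h | h
  · rintro p ⟨q, rfl⟩
    exact h q
  · obtain ⟨p, hp, hT⟩ := hcomp
    obtain ⟨q, -⟩ : p ∈ range ι := hT ▸ mem_connectedComponentIn hp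
    have : Nonempty N := ⟨q⟩
    obtain ⟨q', hq'⟩ := StaticTriple.exists_lapse_nonpos hV.smooth hP hι
      (fun q => connectedComponentIn_subset _ _ (hT ▸ mem_range_self q)) hmin hstable hout
    exact absurd (h q') (not_lt.2 hq')
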